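/- **Conventions.** Legendrian graphs in $(\mathbb{R}^3,\ker(dz-y\,dx))$ are given by regular front projections: there are no triple points, cusps and vertices are not double points, and all cusps, vertices and double points have pairwise different $x$-coordinates. Every vertex has positive even valency. A bordered graph of type $(\ell,r)$ has $\ell$ left and $r$ right boundary strands. Isotopy is generated by the Reidemeister moves (0)–(V) of fronts. Let $\mathfrak R=\mathbb{Z}$ or $\mathbb{Z}/m$. A Maslov potential $\mu$ is an $\mathfrak R$-valued function on the components of the complement of cusps and vertices which at each cusp is larger by $1$ on the upper branch than on the lower one. A crossing of strands $\alpha,\alpha'$ has degree $\pm(\mu(\alpha)-\mu(\alpha'))$. Let $\rho\in\mathbb{Z}$. **Matchings and resolutions.** Let $\mathsf v$ be a vertex of type $(\ell,r)$. Label its half-edges $1,\dots,r$ on the right and $r+1,\dots,r+\ell$ on the left, each from top to bottom. A perfect matching $\phi$ of its half-edges is $\rho$-graded if, in $\mathfrak R/\rho\mathfrak R$, $\mu(\text{upper})-\mu(\text{lower})=1$ for matched half-edges on the same side and $\mu(e)=\mu(e')$ for matched half-edges on different sides. The resolution of $\mathsf v$ along $\phi$ replaces $\mathsf v$, from left to right,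 by: right cusps joining the pairs on the left, all the crossings needed for this being marked; the braid $\beta\cdot\beta^c\cdot\overline{\beta^c}$, where $\beta$ is the permutation braid of the pairs that go across, $\beta\beta^c$ is a half-twist, $\overline{\beta^c}$ is the reverse of $\beta^c$, the crossings of $\beta$ are regular and those of $\beta^c$ and $\overline{\beta^c}$ are marked; and left cusps joining the pairs on the right, again with marked crossings. Perfect matchings of the strands at a border are $\rho$-graded under the same condition for pairs on one side. **Normal rulings.** A $\rho$-graded normal ruling of type $(\phi,\psi)$ of a bordered Legendrian graph is a choice of a $\rho$-graded perfect matching at every vertex together with a set $\mathfrak r$ of regular (unmarked) crossings of the resulting resolution, of degree in $\rho\mathfrak R$, such that the $0$-resolution at $\mathfrak r$ is decomposed into eyes, half-eyes and parallels, the non-interlacing condition holds at every crossing of $\mathfrak r$, and the decomposition induces the $\rho$-graded perfect matchings $\phi$ and $\psi$ at the left and right borders. **Links in $\#^k(S^1\times S^2)$.** A Gompf standard form of a Legendrian link in $\#^k(S^1\times S^2)$ is a bordered Legendrian link of type $(n,n)$, $n=n_1+\dots+n_k$ with all $n_i$ positive and even, whose $i$-th blocks of $n_i$ consecutive strands on the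 left and on the right are the two feet of the $i$-th $1$-handle. It has a $\rho$-graded normal ruling in Leverson's sense if its bordered link has a $\rho$-graded normal ruling of type $(\phi,\phi)$ for some perfect matching $\phi$ that matches strands of the same handle only. **The double.** Let $\mathbf L=(\mathsf L,\mu)$ be a Legendrian graph (without borders) with Maslov potential and without markings, with vertices $\mathsf v_1,\dots,\mathsf v_k$ of valencies $n_1,\dots,n_k$. By Reidemeister moves pull all vertices of one copy of $\mathbf L$ to the far left and all vertices of a second copy (whose potential may be shifted by a constant) to the far right, so that on both sides the vertices, and the half-edges of each vertex, appear in the same order from top to bottom. Removing the vertices gives bordered links $\tilde{\mathbf L}_1$ of type $(n,0)$ and $\tilde{\mathbf L}_2$ of type $(0,n)$. The concatenation $\tilde{\mathbf L}_1\cdot\tilde{\mathbf L}_2$ with $(n_1,\dots,n_k)$ is a Gompf standard form of the Legendrian link $[D(\mathbf L)]$ in $\#^k(S^1\times S^2)$. **Corollary.** $\mathbf L$ has a $\rho$-graded normal ruling if and only if $[D(\mathbf L)]$, in any Gompf standard form obtained in this way, has a $\rho$-graded normal ruling in the sense of Leverson. -/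

import Mathlib

/-!
Fronts of bordered Legendrian graphs with Maslov potential, their Reidemeister moves, vertex
resolutions, normal rulings, and the doubling construction.

A regular front has no triple points, and its cusps, double points and vertices have pairwise
different `x`-coordinates. Reading it from left to right it is a word of elementary events. Between
two events the front is a stack of strands, numbered `0, 1, 2, …` from top to bottom. A Maslov
potential is recorded by the list of its values on the strands of each such stack. The crossings of
the resolved fronts may be marked; a front without markings has only unmarked crossings.
-/

namespace LegendrianFront

/-- The shape of an event of a front with a Maslov potential valued in `A`.
* `leftCusp c`: a left cusp; its upper strand has potential `c + 1`, its lower strand `c`.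
* `rightCusp`: a right cusp.
* `crossing marked`: a double point of the front, marked or regular.
* `vertex lefts rights`: a vertex with `lefts.length` half-edges going to the left and
  `rights.length` half-edges going to the right, each listed from top to bottom. Every half-edge
  carries a name (a natural number), used only to follow it through Reidemeister moves. The right
  half-edges also carry the Maslov potential of the strand that starts there. -/
inductive Core (A : Type) where
  | leftCusp (c : A) : Core A
  | rightCusp : Core A
  | crossing (marked : Bool) : Core A
  | vertex (lefts : List ℕ) (rights : List (ℕ × A)) : Core A

namespace Core

variable {A B : Type}

/-- The number of strands that enter from the left. -/
def ins : Core A → ℕ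
  | leftCusp _ => 0
  | rightCusp => 2
  | crossing _ => 2
  | vertex lefts _ => lefts.length

/-- The number of strands that leave to the right. -/
def outs : Core A → ℕ
  | leftCusp _ => 2
  | rightCusp => 0
  | crossing _ => 2
  | vertex _ rights => rights.length

/-- The half-edge names at an event, in the (clockwise) order of the half-edges around a vertex:
right half-edges from top to bottom, then left half-edges from top to bottom. -/
def names : Core A → List ℕ
  | vertex lefts rights => rights.map Prod.fst ++ lefts
  | _ => []

/-- Apply a map to all Maslov potentials. -/
def map (f : A → B) : Core A → Core B
  | leftCusp c => leftCusp (f c)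
  | rightCusp => rightCusp
  | crossing k => crossing k
  | vertex lefts rights => vertex lefts (rights.map fun x => (x.1, f x.2))

def IsVertex : Core A → Prop
  | vertex _ _ => True
  | _ => False

def IsMarked : Core A → Prop
  | crossing k => k = true
  | _ => False

end Core

/-- An event: a shape, and the number `pos` of strands that pass above it. -/
structure Event (A : Type) where
  pos : ℕ
  core : Core A

/-- The front of a bordered Legendrian graph: its events from left to right. -/
abbrev Front (A : Type) := List (Event A)

variable {A B : Type}

/-- A left cusp with potentials `c + 1` (upper strand) and `c` (lower strand) at position `p`. -/
def lcusp (p : ℕ) (c : A) : Event A := ⟨p, .leftCusp c⟩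

/-- A right cusp of the strands `p` and `p + 1`. -/
def rcusp (p : ℕ) : Event A := ⟨p, .rightCusp⟩

/-- A regular (unmarked) crossing of the strands `p` and `p + 1`. -/
def cross (p : ℕ) : Event A := ⟨p, .crossing false⟩

/-- A marked crossing of the strands `p` and `p + 1`. -/
def mcross (p : ℕ) : Event A := ⟨p, .crossing true⟩

/-- A vertex of type `(lefts.length, rights.length)` below `p` strands. -/
def vert (p : ℕ) (lefts : List ℕ) (rights : List (ℕ × A)) : Event A := ⟨p, .vertex lefts rights⟩

namespace Front

/-- Apply a map to all Maslov potentials. -/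
def map (f : A → B) (W : Front A) : Front B := List.map (fun e => ⟨e.pos, e.core.map f⟩) W

/-- All half-edge names of a front. -/
def names (W : Front A) : List ℕ := W.flatMap fun e => e.core.names

/-- The front has no vertices, i.e. it is the front of a bordered Legendrian link. -/
def NoVertices (W : Front A) : Prop := ∀ e ∈ W, ¬ e.core.IsVertex

/-- The front has no marked crossings. -/
def NoMarkings (W : Front A) : Prop := ∀ e ∈ W, ¬ e.core.IsMarked

end Front

section Potentials

variable [CommRing A]

/-- `Event.Trans e s t`: the event `e` fits between a stack of strands with Maslov potentials `s`
(listed from top to bottom) on its left and a stack with Maslov potentials `t` on its right. At a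
cusp the potential of the upper strand is that of the lower strand plus one; a vertex has positive
even valency and imposes no condition on the potential. -/
inductive Event.Trans : Event A → List A → List A → Prop
  | leftCusp (u v : List A) (c : A) :
      Event.Trans (lcusp u.length c) (u ++ v) (u ++ (c + 1) :: c :: v)
  | rightCusp (u v : List A) (c : A) :
      Event.Trans (rcusp u.length) (u ++ (c + 1) :: c :: v) (u ++ v)
  | crossing (u v : List A) (a b : A) (k : Bool) :
      Event.Trans ⟨u.length, .crossing k⟩ (u ++ a :: b :: v) (u ++ b :: a :: v)
  | vertex (u a v : List A) (lefts : List ℕ) (rights : List (ℕ × A)) :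
      a.length = lefts.length → Even (lefts.length + rights.length) →
      0 < lefts.length + rights.length →
      Event.Trans (vert u.length lefts rights) (u ++ a ++ v) (u ++ rights.map Prod.snd ++ v)

/-- `W` is the front of a bordered Legendrian graph with Maslov potential, whose potentials are `s`
at the left border and `t` at the right border; it is of type `(s.length, t.length)`. -/
def IsFront : Front A → List A → List A → Prop
  | [], s, t => s = t
  | e :: W, s, t => ∃ m, e.Trans s m ∧ IsFront W m t

/-- A Legendrian graph (without borders) with Maslov potential and without markings, all of whose
half-edges have different names. -/
structure IsLegendrianGraph (L : Front A) : Prop where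
  isFront : IsFront L [] []
  noMarkings : L.NoMarkings
  names_nodup : L.names.Nodup

/-! ### Reidemeister moves -/

/-- The strand at position `p + k` moves up to position `p`, crossing `k` strands. -/
def strandUp (p k : ℕ) : Front A := (List.range k).reverse.map fun q => cross (p + q)

/-- The strand at position `p` moves down to position `p + k`, crossing `k` strands. -/
def strandDown (p k : ℕ) : Front A := (List.range k).map fun q => cross (p + q)

/-- The local Reidemeister moves for fronts of Legendrian graphs with Maslov potential. -/
inductive Move : Front A → Front A → Prop
  /-- (0): two events with disjoint strands exchange their `x`-coordinates; `c₁` is above `c₂`. -/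
  | zero (p d : ℕ) (c₁ c₂ : Core A) :
      Move [⟨p, c₁⟩, ⟨p + c₁.outs + d, c₂⟩] [⟨p + c₁.ins + d, c₂⟩, ⟨p, c₁⟩]
  /-- (I): a zigzag with one crossing on a strand. -/
  | one_below (p : ℕ) (c : A) : Move [] [lcusp (p + 1) c, cross p, rcusp (p + 1)]
  | one_above (p : ℕ) (c : A) : Move [] [lcusp p c, cross (p + 1), rcusp p]
  /-- (II): a strand passes a cusp. -/
  | two_left_below (p : ℕ) (c : A) :
      Move [lcusp (p + 1) c] [lcusp p c, cross (p + 1), cross p]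
  | two_left_above (p : ℕ) (c : A) :
      Move [lcusp p c] [lcusp (p + 1) c, cross p, cross (p + 1)]
  | two_right_below (p : ℕ) : Move [rcusp (p + 1)] [cross p, cross (p + 1), rcusp p]
  | two_right_above (p : ℕ) : Move [rcusp p] [cross (p + 1), cross p, rcusp (p + 1)]
  /-- (III): a triple point. -/
  | three (p : ℕ) :
      Move [cross p, cross (p + 1), cross p] [cross (p + 1), cross p, cross (p + 1)]
  /-- (IV): a strand passes a vertex. -/
  | four_up (p : ℕ) (ls : List ℕ) (rs : List (ℕ × A)) :
      Move (strandUp p ls.length ++ [vert (p + 1) ls rs])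
        ([vert p ls rs] ++ strandUp p rs.length)
  | four_down (p : ℕ) (ls : List ℕ) (rs : List (ℕ × A)) :
      Move (strandDown p ls.length ++ [vert p ls rs])
        ([vert (p + 1) ls rs] ++ strandDown p rs.length)
  /-- (V): an extreme half-edge swings to the other side of its vertex, which creates a cusp. The
  cyclic order of the half-edges around the vertex does not change. -/
  | five_right_bottom (p : ℕ) (ls : List ℕ) (rs : List (ℕ × A)) (h : ℕ) (c : A) :
      Move [vert p ls (rs ++ [(h, c)])]
        ([lcusp p c] ++ strandDown (p + 1) ls.length ++ [vert p (h :: ls) rs])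
  | five_right_top (p : ℕ) (ls : List ℕ) (rs : List (ℕ × A)) (h : ℕ) (c : A) :
      Move [vert p ls ((h, c + 1) :: rs)]
        ([lcusp (p + ls.length) c] ++ strandUp p ls.length ++ [vert (p + 1) (ls ++ [h]) rs])
  | five_left_bottom (p : ℕ) (ls : List ℕ) (rs : List (ℕ × A)) (h : ℕ) (c : A) :
      Move [vert p (ls ++ [h]) rs]
        ([vert p ls ((h, c + 1) :: rs)] ++ strandUp (p + 1) rs.length ++ [rcusp p])
  | five_left_top (p : ℕ) (ls : List ℕ) (rs : List (ℕ × A)) (h : ℕ) (c : A) :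
      Move [vert p (h :: ls) rs]
        ([vert (p + 1) ls (rs ++ [(h, c)])] ++ strandDown p rs.length ++ [rcusp (p + rs.length)])

/-- Two fronts of Legendrian graphs (without borders) with Maslov potential differ by one
Reidemeister move somewhere in the front. -/
def MoveStep (W W' : Front A) : Prop :=
  IsFront W [] [] ∧ IsFront W' [] [] ∧
    ∃ U V X X' : Front A, Move X X' ∧ W = U ++ X ++ V ∧ W' = U ++ X' ++ V

/-- Equivalence of Legendrian graphs: a finite sequence of Reidemeister moves in either direction.
The names of the half-edges are carried along. -/
def Equivalent : Front A → Front A → Prop := Relation.EqvGen MoveStep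

/-! ### Matchings and resolutions of vertices -/

/-- `φ` restricts to a perfect matching of `{0, …, n - 1}`. -/
def IsPerfectMatching (n : ℕ) (φ : ℕ → ℕ) : Prop :=
  ∀ i < n, φ i < n ∧ φ i ≠ i ∧ φ (φ i) = i

/-- A matching of half-edges `0, …, h.length - 1` with Maslov potentials `h` is graded; the
half-edges `0, …, r - 1` point to the right and the others to the left, each group being listed from
top to bottom. Matched half-edges on the same side will form a cusp, so the potential of the upper
one is that of the lower one plus one; on different sides the potentials agree. -/
def IsGradedMatching (r : ℕ) (h : List A) (φ : ℕ → ℕ) : Prop :=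
  ∀ (i j : ℕ) (x y : A), i < j → φ i = j → h[i]? = some x → h[j]? = some y →
    ((j < r ∨ r ≤ i) → x = y + 1) ∧ ((i < r ∧ r ≤ j) → x = y)

/-- Marked right cusps. `l` lists the strands present, from top to bottom, starting at position `p`;
for each `i` of the second list in turn, the strand `i` moves down through marked crossings to the
strand `φ i` below it, and the two end in a right cusp. -/
def markedRightCusps (φ : ℕ → ℕ) (p : ℕ) : List ℕ → List ℕ → Front A
  | _, [] => []
  | l, i :: is =>
    let a := l.idxOf i
    let b := l.idxOf (φ i)
    ((List.range (b - 1 - a)).map fun q => mcross (p + a + q)) ++ [rcusp (p + (b - 1))] ++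
      markedRightCusps φ p ((l.erase i).erase (φ i)) is

/-- Marked left cusps: the mirror image of marked right cusps. `l` lists the strands present at the
right end. The lower strand `φ i` of each cusp has potential `μ (φ i)`. -/
def markedLeftCusps (φ : ℕ → ℕ) (μ : ℕ → A) (p : ℕ) : List ℕ → List ℕ → Front A
  | _, [] => []
  | l, i :: is =>
    let a := l.idxOf i
    let b := l.idxOf (φ i)
    markedLeftCusps φ μ p ((l.erase i).erase (φ i)) is ++ [lcusp (p + (b - 1)) (μ (φ i))] ++
      ((List.range (b - 1 - a)).reverse.map fun q => mcross (p + a + q))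

/-- Positions of the crossings of the permutation braid (with the minimal number of crossings) that
sorts a list; `lt y x` means that `y` has to end above `x`. -/
def sortBraid (lt : ℕ → ℕ → Bool) : List ℕ → List ℕ
  | [] => []
  | x :: l => (sortBraid lt l).map (· + 1) ++ List.range (l.countP fun y => lt y x)

/-- The resolution, along a perfect matching `φ`, of a vertex of type `(ℓ, r)` below `p` strands.
The right half-edges are `0, …, r - 1` and the left half-edges are `r, …, r + ℓ - 1`, from top to
bottom; `μ i` is the potential of the right half-edge `i`. The matched pairs on the left form marked
right cusps and those on the right form marked left cusps. In between there is the braid `β` of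
regular crossings given by the pairs that go across, then its complement `βᶜ` (so that `β βᶜ` is a
half-twist) and the reverse of `βᶜ`, both with marked crossings. -/
def resolveVertex (p ℓ r : ℕ) (φ : ℕ → ℕ) (μ : ℕ → A) : Front A :=
  let left := (List.range ℓ).map (r + ·)
  let right := List.range r
  let leftPairs := left.filter fun i => i < φ i
  let rightPairs := right.filter fun i => i < φ i ∧ φ i < r
  let leftThrough := left.filter fun i => φ i < r
  let rightThrough := right.filter fun i => r ≤ φ i
  let β := sortBraid (fun y x => y < x) (leftThrough.map φ)
  let βc := sortBraid (fun y x => x < y) (rightThrough.map φ)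
  markedRightCusps φ p left leftPairs ++
    ((β.map fun q => cross (p + q)) ++ (βc.map fun q => mcross (p + q)) ++
      (βc.reverse.map fun q => mcross (p + q))) ++
    markedLeftCusps φ μ p right rightPairs

/-- `FullResolution s W W'`: the front `W` has potentials `s` at its left border, and `W'` is
obtained from `W` by resolving every vertex along some graded perfect matching of its half-edges. -/
inductive FullResolution : List A → Front A → Front A → Prop
  | nil (s : List A) : FullResolution s [] []
  | cons (e : Event A) (s t : List A) (W W' : Front A) :
      ¬ e.core.IsVertex → e.Trans s t → FullResolution t W W' →
      FullResolution s (e :: W) (e :: W')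
  | vertex (u a v : List A) (ls : List ℕ) (rs : List (ℕ × A)) (φ : ℕ → ℕ) (W W' : Front A) :
      a.length = ls.length →
      IsPerfectMatching (rs.length + ls.length) φ →
      IsGradedMatching rs.length (rs.map Prod.snd ++ a) φ →
      FullResolution (u ++ rs.map Prod.snd ++ v) W W' →
      FullResolution (u ++ a ++ v) (vert u.length ls rs :: W)
        (resolveVertex u.length ls.length rs.length φ (fun i => (rs.map Prod.snd).getD i 0) ++ W')

/-! ### Normal rulings

A decomposition of a 0-resolved front into eyes, half-eyes and parallels is recorded by giving
every strand of every stack, besides its potential, the name (a natural number) of the piece that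
it belongs to. Every piece meets a stack in no or in exactly two strands. -/

/-- Non-interlacing at a crossing whose upper strand belongs to the piece `d` and whose lower strand
belongs to the piece `e` after the 0-resolution; `u` and `v` are the pieces of the strands above and
below. Either the companion of the upper strand is above and that of the lower strand is below
(disjoint pieces), or both companions are on the same side and the pieces are nested. -/
def NonInterlacing (u v : List ℕ) (d e : ℕ) : Prop :=
  (d ∈ u ∧ e ∈ v) ∨ [e, d].Sublist u ∨ [e, d].Sublist v

/-- One event of a ruled front without vertices. At a cusp the two strands belong to the same
piece. The strands that meet at a crossing belong to different pieces. Either the pieces follow the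
strands, or the crossing is 0-resolved (`switch`): then it is regular and of degree zero, the
pieces keep their positions and the non-interlacing condition holds. -/
inductive RulingStep : Event A → List (A × ℕ) → List (A × ℕ) → Prop
  | leftCusp (u v : List (A × ℕ)) (c : A) (d : ℕ) :
      d ∉ (u ++ v).map Prod.snd →
      RulingStep (lcusp u.length c) (u ++ v) (u ++ (c + 1, d) :: (c, d) :: v)
  | rightCusp (u v : List (A × ℕ)) (c : A) (d : ℕ) :
      RulingStep (rcusp u.length) (u ++ (c + 1, d) :: (c, d) :: v) (u ++ v)
  | pass (u v : List (A × ℕ)) (a b : A) (d e : ℕ) (k : Bool) :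
      d ≠ e →
      RulingStep ⟨u.length, .crossing k⟩ (u ++ (a, d) :: (b, e) :: v) (u ++ (b, e) :: (a, d) :: v)
  | switch (u v : List (A × ℕ)) (a b : A) (d e : ℕ) :
      d ≠ e → a - b = 0 → NonInterlacing (u.map Prod.snd) (v.map Prod.snd) d e →
      RulingStep (cross u.length) (u ++ (a, d) :: (b, e) :: v) (u ++ (b, d) :: (a, e) :: v)

/-- A ruling of a front without vertices, from the ruled left border to the ruled right border. -/
def IsRuling : Front A → List (A × ℕ) → List (A × ℕ) → Prop
  | [], x, y => x = y
  | e :: W, x, y => ∃ z, RulingStep e x z ∧ IsRuling W z y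

/-- `x` is a stack of ruled strands with potentials `s`, and two different strands belong to the
same piece exactly if `φ` matches them. -/
def Induces (x : List (A × ℕ)) (s : List A) (φ : ℕ → ℕ) : Prop :=
  x.map Prod.fst = s ∧
    ∀ i j, i < s.length → j < s.length →
      ((x.map Prod.snd)[i]? = (x.map Prod.snd)[j]? ↔ j = i ∨ j = φ i)

/-- The set of graded normal rulings of type `(φ, ψ)` of the front `W` with border potentials `s`
and `t` is non-empty: some full resolution of `W` along graded matchings has a normal ruling that
restricts to the graded perfect matchings `φ` and `ψ` of the borders. -/
def HasRulingOfType (W : Front A) (s t : List A) (φ ψ : ℕ → ℕ) : Prop :=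
  IsPerfectMatching s.length φ ∧ IsGradedMatching s.length s φ ∧
  IsPerfectMatching t.length ψ ∧ IsGradedMatching t.length t ψ ∧
  ∃ W' : Front A, FullResolution s W W' ∧
    ∃ x y : List (A × ℕ), Induces x s φ ∧ Induces y t ψ ∧ IsRuling W' x y

/-! ### Gompf standard forms and the double -/

/-- A Gompf standard form of a Legendrian link, with Maslov potential and without markings, in the
connected sum of `handles.length` copies of `S¹ × S²`: a bordered Legendrian link of type `(n, n)`
with `n = n₁ + ⋯ + n_k`, where `handles = (n₁, …, n_k)` consists of positive even integers. The
left and the right border are cut into consecutive blocks of sizes `n₁, …, n_k` from top to bottom,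
and the `i`-th blocks are the two feet of the `i`-th one-handle. The potentials of the two ends of a
strand that runs over a handle need not agree here, so the case where they do is included. -/
structure GompfForm (A : Type) [CommRing A] where
  word : Front A
  left : List A
  right : List A
  handles : List ℕ
  isFront : IsFront word left right
  noVertices : word.NoVertices
  noMarkings : word.NoMarkings
  left_length : left.length = handles.sum
  right_length : right.length = handles.sum
  handles_pos : ∀ n ∈ handles, 0 < n ∧ Even n

/-- `φ` preserves each of the consecutive blocks of sizes given by `handles`. -/
def PreservesBlocks (handles : List ℕ) (φ : ℕ → ℕ) : Prop :=
  ∀ (k n : ℕ), handles[k]? = some n → ∀ i, (handles.take k).sum ≤ i →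
    i < (handles.take k).sum + n →
    (handles.take k).sum ≤ φ i ∧ φ i < (handles.take k).sum + n

/-- Vertices of types `(0, n₁), …, (0, n_k)` that close a left border, from top to bottom. Each
vertex is given by the names and potentials of its half-edges from top to bottom. The first argument
is the number of strands above. -/
def closeLeft : ℕ → List (List (ℕ × A)) → Front A
  | _, [] => []
  | p, h :: hs => vert p [] h :: closeLeft (p + h.length) hs

/-- Vertices of types `(n₁, 0), …, (n_k, 0)` that close a right border, from top to bottom. Each
vertex is given by the names of its half-edges from top to bottom. -/
def closeRight (hs : List (List ℕ)) : Front A := hs.map fun h => vert 0 h []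

/-- `G` is a Gompf standard form of the Legendrian link `[D(L)]` obtained by doubling the Legendrian
graph `L`. Its underlying bordered link is a concatenation of `Λ₁`, of type `(n, 0)`, and `Λ₂`, of
type `(0, n)`. All vertices of one copy of `L` are pulled to the left by Reidemeister moves, which
gives `Λ₁` closed on its left by vertices `v₁, …, v_k`. All vertices of a second copy of `L` are
pulled to the right, which gives `Λ₂` closed on its right by the same vertices `v₁, …, v_k`, the
half-edges of each vertex being listed in the same order. The potential on the second copy may
differ from that on the first by a constant `c`. -/
def IsDouble (L : Front A) (G : GompfForm A) : Prop :=
  ∃ (hs : List (List (ℕ × A))) (Λ₁ Λ₂ : Front A) (c : A),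
    G.word = Λ₁ ++ Λ₂ ∧ G.handles = hs.map List.length ∧
    G.left = hs.flatten.map Prod.snd ∧
    IsFront Λ₁ G.left [] ∧ IsFront Λ₂ [] G.right ∧
    Equivalent L (closeLeft 0 hs ++ Λ₁) ∧
    Equivalent (L.map (· + c)) (Λ₂ ++ closeRight (hs.map (List.map Prod.fst)))

end Potentials

/-! ### `ρ`-graded rulings for potentials in `R = ℤ` (`m = 0`) or `R = ℤ/m` -/

/-- The quotient `R / ρR`. An element of `R` lies in `ρR` exactly if it is zero there. -/
abbrev ModRho (m : ℕ) (ρ : ℤ) : Type := ZMod m ⧸ Ideal.span {(ρ : ZMod m)}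

/-- The class of a potential in `R / ρR`. -/
def toModRho (m : ℕ) (ρ : ℤ) : ZMod m → ModRho m ρ := Ideal.Quotient.mk _

/-- The bordered front `W` with border potentials `s`, `t` has a `ρ`-graded normal ruling of type
`(φ, ψ)`. -/
def HasRhoRulingOfType {m : ℕ} (ρ : ℤ) (W : Front (ZMod m)) (s t : List (ZMod m)) (φ ψ : ℕ → ℕ) :
    Prop :=
  HasRulingOfType (W.map (toModRho m ρ)) (s.map (toModRho m ρ)) (t.map (toModRho m ρ)) φ ψ

/-- The Legendrian graph `L` (without borders) has a `ρ`-graded normal ruling. -/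
def HasNormalRuling {m : ℕ} (ρ : ℤ) (L : Front (ZMod m)) : Prop :=
  ∃ φ ψ : ℕ → ℕ, HasRhoRulingOfType ρ L [] [] φ ψ

/-- A Legendrian link in a connected sum of copies of `S¹ × S²`, in Gompf standard form, has a
`ρ`-graded normal ruling in the sense of Leverson: its bordered front has a `ρ`-graded normal ruling
whose matchings at the left and at the right border coincide and match strands of the same handle. -/
def HasLeversonRuling {m : ℕ} (ρ : ℤ) (G : GompfForm (ZMod m)) : Prop :=
  ∃ φ : ℕ → ℕ, PreservesBlocks G.handles φ ∧ HasRhoRulingOfType ρ G.word G.left G.right φ φ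

end LegendrianFront

namespace LegendrianFront

set_option linter.unusedSectionVars false

variable {A : Type} {P : ℕ → ℕ} {U V : List ℕ}

/-! ### Crossings of ruled stacks -/

/-- A ruled stack: every strand has a potential and the name of a piece. -/
abbrev Stack (A : Type) := List (A × ℕ)

/-- A ruled stack whose strands have names. -/
abbrev Named (A : Type) := List (ℕ × A × ℕ)

/-- The pieces of the strands of a ruled stack. -/
def pieces (x : Stack A) : List ℕ := x.map Prod.snd

@[simp] theorem pieces_nil : pieces ([] : Stack A) = [] := rfl
@[simp] theorem pieces_cons (z : A × ℕ) (x : Stack A) : pieces (z :: x) = z.2 :: pieces x := rfl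
@[simp] theorem pieces_append (x y : Stack A) : pieces (x ++ y) = pieces x ++ pieces y := by
  simp [pieces]
@[simp] theorem length_pieces (x : Stack A) : (pieces x).length = x.length := by simp [pieces]

theorem mem_pieces {x : Stack A} {d : ℕ} : d ∈ pieces x ↔ ∃ a, (a, d) ∈ x := by
  simp [pieces]

/-- Rename the pieces of a ruled stack. -/
def relabel (σ : ℕ → ℕ) (x : Stack A) : Stack A := x.map fun z => (z.1, σ z.2)

@[simp] theorem relabel_nil (σ : ℕ → ℕ) : relabel σ ([] : Stack A) = [] := rfl
@[simp] theorem relabel_cons (σ : ℕ → ℕ) (z : A × ℕ) (x : Stack A) :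
    relabel σ (z :: x) = (z.1, σ z.2) :: relabel σ x := rfl
@[simp] theorem relabel_append (σ : ℕ → ℕ) (x y : Stack A) :
    relabel σ (x ++ y) = relabel σ x ++ relabel σ y := by simp [relabel]
@[simp] theorem length_relabel (σ : ℕ → ℕ) (x : Stack A) :
    (relabel σ x).length = x.length := by simp [relabel]
@[simp] theorem pieces_relabel (σ : ℕ → ℕ) (x : Stack A) :
    pieces (relabel σ x) = (pieces x).map σ := by simp [relabel, pieces]
theorem relabel_eq_self {σ : ℕ → ℕ} {x : Stack A} (h : ∀ d ∈ pieces x, σ d = d) :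
    relabel σ x = x := by
  induction x with
  | nil => rfl
  | cons z x ih =>
    simp only [pieces_cons, List.mem_cons, forall_eq_or_imp] at h
    simp [h.1, ih h.2]

theorem relabel_relabel (σ τ : ℕ → ℕ) (x : Stack A) :
    relabel σ (relabel τ x) = relabel (σ ∘ τ) x := by simp [relabel, Function.comp_def]

theorem map_eq_self {σ : ℕ → ℕ} {x : List ℕ} (h : ∀ d ∈ x, σ d = d) : x.map σ = x := by
  conv_rhs => rw [← List.map_id x]
  exact List.map_congr_left h

/-- Going once around from just above a crossing to just below it, through the pieces `U` above in
upward order and then the pieces `V` below in upward order, one meets `d` before `e`. -/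
def Before (U V : List ℕ) (d e : ℕ) : Prop := [d, e].Sublist (U.reverse ++ V.reverse)

theorem pair_sublist_append {α : Type} (a b : α) (x y : List α) :
    [a, b].Sublist (x ++ y) ↔ [a, b].Sublist x ∨ (a ∈ x ∧ b ∈ y) ∨ [a, b].Sublist y := by
  rw [List.sublist_append_iff]
  constructor
  · rintro ⟨l₁, l₂, h, h₁, h₂⟩
    rcases l₁ with _ | ⟨c, _ | ⟨c', l₁⟩⟩
    · simp at h; subst h; exact .inr (.inr h₂)
    · simp at h; obtain ⟨rfl, rfl⟩ := h
      exact .inr (.inl ⟨by simpa using h₁, by simpa using h₂⟩)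
    · simp at h; obtain ⟨rfl, rfl, rfl, rfl⟩ := h
      exact .inl h₁
  · rintro (h | ⟨h, h'⟩ | h)
    · exact ⟨_, [], by simp, h, by simp⟩
    · exact ⟨[a], [b], rfl, by simpa using h, by simpa using h'⟩
    · exact ⟨[], _, rfl, by simp, h⟩

theorem nonInterlacing_iff (U V : List ℕ) (d e : ℕ) : NonInterlacing U V d e ↔ Before U V d e := by
  have h : ∀ x : List ℕ, [d, e].Sublist x.reverse ↔ [e, d].Sublist x := fun x => by
    rw [← List.reverse_sublist]; simp
  rw [Before, pair_sublist_append, h, h, NonInterlacing]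
  simp only [List.mem_reverse]
  tauto

theorem pair_sublist_filter {α : Type} {p : α → Bool} {a b : α} (ha : p a) (hb : p b)
    (x : List α) : [a, b].Sublist (x.filter p) ↔ [a, b].Sublist x := by
  refine ⟨fun h => h.trans List.filter_sublist, fun h => ?_⟩
  have := h.filter p
  simpa [ha, hb] using this

theorem Before.congr {U V U' V' : List ℕ} {p : ℕ → Bool} {d e : ℕ} (hd : p d) (he : p e)
    (hU : U.filter p = U'.filter p) (hV : V.filter p = V'.filter p) :
    Before U V d e ↔ Before U' V' d e := by
  rw [Before, Before, ← pair_sublist_filter hd he, ← pair_sublist_filter hd he (U'.reverse ++ _)]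
  simp [List.filter_append, List.filter_reverse, hU, hV]

theorem Before.map {d e : ℕ} (h : Before U V d e) (σ : ℕ → ℕ) :
    Before (U.map σ) (V.map σ) (σ d) (σ e) := by
  have := List.Sublist.map σ h
  simpa [Before] using this

theorem Before.flip {d e : ℕ} (h : Before U V d e) :
    Before V.reverse U.reverse e d := by
  have := List.reverse_sublist.2 h
  simpa [Before] using this

/-- The strands `q` and `q + 1` of the block `l` cross, which gives the block `r`; `U` and `V` are
the pieces above and below the block. At a switch the two strands have the same potential and the
pieces keep their positions, so the block does not change. -/
def CrossAt (U V : List ℕ) (k : Bool) (q : ℕ) (l r : Stack A) : Prop :=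
  ∃ s t a b d e, s.length = q ∧ l = s ++ (a, d) :: (b, e) :: t ∧ d ≠ e ∧
    (r = s ++ (b, e) :: (a, d) :: t ∨
      k = false ∧ a = b ∧ Before (U ++ pieces s) (pieces t ++ V) d e ∧ r = l)

/-- A sequence of crossings, each given by its position and its marking. -/
def CrossWord (U V : List ℕ) : List (ℕ × Bool) → Stack A → Stack A → Prop
  | [], l, r => l = r
  | (q, k) :: w, l, r => ∃ m, CrossAt U V k q l m ∧ CrossWord U V w m r

@[simp] theorem crossWord_nil {l r : Stack A} :
    CrossWord U V [] l r ↔ l = r := Iff.rfl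

theorem crossWord_append {w w' : List (ℕ × Bool)} {l r : Stack A} :
    CrossWord U V (w ++ w') l r ↔ ∃ m, CrossWord U V w l m ∧ CrossWord U V w' m r := by
  induction w generalizing l with
  | nil => simp [CrossWord]
  | cons z w ih =>
    obtain ⟨q, k⟩ := z
    simp only [List.cons_append, CrossWord, ih]
    constructor
    · rintro ⟨m, h, m', h', h''⟩; exact ⟨m', ⟨m, h, h'⟩, h''⟩
    · rintro ⟨m', ⟨m, h, h'⟩, h''⟩; exact ⟨m, h, m', h', h''⟩

theorem crossWord_singleton {q : ℕ} {k : Bool} {l r : Stack A} :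
    CrossWord U V [(q, k)] l r ↔ CrossAt U V k q l r := by
  simp [CrossWord]

theorem CrossAt.perm {k : Bool} {q : ℕ} {l r : Stack A}
    (h : CrossAt U V k q l r) : r.Perm l := by
  obtain ⟨s, t, a, b, d, e, -, rfl, -, rfl | ⟨-, -, -, rfl⟩⟩ := h
  · exact List.Perm.append_left s (List.Perm.swap _ _ _)
  · rfl

theorem CrossWord.perm {w : List (ℕ × Bool)} {l r : Stack A}
    (h : CrossWord U V w l r) : r.Perm l := by
  induction w generalizing l with
  | nil => exact .of_eq h.symm
  | cons z w ih => obtain ⟨m, h, h'⟩ := h; exact (ih h').trans h.perm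

theorem CrossWord.perm_pieces {w : List (ℕ × Bool)} {l r : Stack A}
    (h : CrossWord U V w l r) : (pieces r).Perm (pieces l) := h.perm.map _

theorem CrossWord.length_eq {w : List (ℕ × Bool)} {l r : Stack A}
    (h : CrossWord U V w l r) : r.length = l.length := h.perm.length_eq

theorem CrossAt.mirror {k : Bool} {q : ℕ} {l r : Stack A}
    (h : CrossAt U V k q l r) : CrossAt U V k q r l := by
  obtain ⟨s, t, a, b, d, e, hs, rfl, hn, rfl | ⟨hk, hab, hb, rfl⟩⟩ := h
  · exact ⟨s, t, b, a, e, d, hs, rfl, hn.symm, .inl rfl⟩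
  · exact ⟨s, t, a, b, d, e, hs, rfl, hn, .inr ⟨hk, hab, hb, rfl⟩⟩

theorem CrossWord.mirror {w : List (ℕ × Bool)} {l r : Stack A}
    (h : CrossWord U V w l r) : CrossWord U V w.reverse r l := by
  induction w generalizing l with
  | nil => exact Eq.symm h
  | cons z w ih =>
    obtain ⟨m, h, h'⟩ := h
    rw [List.reverse_cons, crossWord_append]
    exact ⟨m, ih h', crossWord_singleton.2 h.mirror⟩

theorem CrossAt.relabel {k : Bool} {q : ℕ} {l r : Stack A}
    (h : CrossAt U V k q l r) {σ : ℕ → ℕ} (hσ : σ.Injective) :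
    CrossAt (U.map σ) (V.map σ) k q (relabel σ l) (relabel σ r) := by
  obtain ⟨s, t, a, b, d, e, hs, rfl, hn, h⟩ := h
  refine ⟨LegendrianFront.relabel σ s, LegendrianFront.relabel σ t, a, b, σ d, σ e, by simpa, by simp,
    hσ.ne hn, ?_⟩
  rcases h with rfl | ⟨hk, hab, hb, rfl⟩
  · left; simp
  · refine .inr ⟨hk, hab, ?_, rfl⟩
    simpa using hb.map σ

theorem CrossWord.relabel {w : List (ℕ × Bool)} {l r : Stack A}
    (h : CrossWord U V w l r) {σ : ℕ → ℕ} (hσ : σ.Injective) :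
    CrossWord (U.map σ) (V.map σ) w (relabel σ l) (relabel σ r) := by
  induction w generalizing l with
  | nil => exact congrArg _ h
  | cons z w ih => obtain ⟨m, h, h'⟩ := h; exact ⟨_, h.relabel hσ, ih h'⟩

theorem CrossWord.relabel_fixed {w : List (ℕ × Bool)} {l r : Stack A}
    (h : CrossWord U V w l r) {σ : ℕ → ℕ} (hσ : σ.Injective) (hU : ∀ d ∈ U, σ d = d)
    (hV : ∀ d ∈ V, σ d = d) :
    CrossWord U V w (LegendrianFront.relabel σ l) (LegendrianFront.relabel σ r) := by
  have := h.relabel hσ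
  rwa [map_eq_self hU, map_eq_self hV] at this

theorem CrossAt.congr {U V U' V' : List ℕ} {k : Bool} {q : ℕ} {l r : Stack A} {p : ℕ → Bool}
    (h : CrossAt U V k q l r) (hp : ∀ d ∈ pieces l, p d)
    (hU : U.filter p = U'.filter p) (hV : V.filter p = V'.filter p) : CrossAt U' V' k q l r := by
  obtain ⟨s, t, a, b, d, e, hs, rfl, hn, h⟩ := h
  refine ⟨s, t, a, b, d, e, hs, rfl, hn, h.imp_right fun ⟨hk, hab, hb, hr⟩ => ⟨hk, hab, ?_, hr⟩⟩
  refine (Before.congr (hp d (by simp)) (hp e (by simp)) ?_ ?_).1 hb <;>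
    simp [List.filter_append, hU, hV]

/-- The crossings of a block only depend on the order of those outer strands whose companions are
in the block. -/
theorem CrossWord.congr {U V U' V' : List ℕ} {w : List (ℕ × Bool)} {l r : Stack A}
    {p : ℕ → Bool} (h : CrossWord U V w l r) (hp : ∀ d ∈ pieces l, p d)
    (hU : U.filter p = U'.filter p) (hV : V.filter p = V'.filter p) : CrossWord U' V' w l r := by
  induction w generalizing l with
  | nil => exact h
  | cons z w ih =>
    obtain ⟨m, h, h'⟩ := h
    exact ⟨m, h.congr hp hU hV, ih h' fun d hd => hp d ((h.perm.map _).subset hd)⟩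

/-! #### Blocks inside larger blocks -/

theorem append_pair_eq_append {α : Type} {s t l v : List α} {x y : α}
    (h : s ++ x :: y :: t = l ++ v) (hl : s.length + 2 ≤ l.length) :
    ∃ t', l = s ++ x :: y :: t' ∧ t = t' ++ v := by
  have h' : (s ++ [x, y]) ++ t = l ++ v := by simpa using h
  rcases List.append_eq_append_iff.1 h' with ⟨c, rfl, rfl⟩ | ⟨c, h₁, rfl⟩
  · exact ⟨c, by simp, rfl⟩
  · have : c = [] := by
      have := congrArg List.length h₁
      simp only [List.length_append, List.length_cons, List.length_nil] at this
      exact List.length_eq_zero_iff.1 (by omega)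
    subst this
    exact ⟨[], by simpa using h₁.symm, by simp⟩

theorem append_eq_append_of_le {α : Type} {s t u v : List α} (h : s ++ t = u ++ v)
    (hl : u.length ≤ s.length) : ∃ s', s = u ++ s' ∧ v = s' ++ t := by
  rcases List.append_eq_append_iff.1 h with ⟨c, rfl, rfl⟩ | ⟨c, rfl, rfl⟩
  · have : c = [] := List.length_eq_zero_iff.1 (by
      simp only [List.length_append] at hl; omega)
    subst this
    exact ⟨[], by simp, by simp⟩
  · exact ⟨c, rfl, rfl⟩

theorem crossAt_append_left {k : Bool} {q : ℕ} {u l r : Stack A} :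
    CrossAt U V k (u.length + q) (u ++ l) r ↔
      ∃ r', r = u ++ r' ∧ CrossAt (U ++ pieces u) V k q l r' := by
  constructor
  · rintro ⟨s, t, a, b, d, e, hs, hl, hn, h⟩
    obtain ⟨s, rfl, rfl⟩ := append_eq_append_of_le hl.symm (by omega)
    rcases h with rfl | ⟨hk, hab, hb, rfl⟩
    · exact ⟨s ++ (b, e) :: (a, d) :: t, by simp, s, t, a, b, d, e, by simpa using hs, rfl, hn,
        .inl rfl⟩
    · refine ⟨_, rfl, s, t, a, b, d, e, by simpa using hs, rfl, hn, .inr ⟨hk, hab, ?_, rfl⟩⟩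
      simpa using hb
  · rintro ⟨r', rfl, s, t, a, b, d, e, rfl, rfl, hn, h⟩
    refine ⟨u ++ s, t, a, b, d, e, by simp, by simp, hn, ?_⟩
    rcases h with rfl | ⟨hk, hab, hb, rfl⟩
    · left; simp
    · refine .inr ⟨hk, hab, ?_, rfl⟩
      simpa using hb

theorem crossAt_append_right {k : Bool} {q : ℕ} {v l r : Stack A}
    (hq : q + 2 ≤ l.length) :
    CrossAt U V k q (l ++ v) r ↔ ∃ r', r = r' ++ v ∧ CrossAt U (pieces v ++ V) k q l r' := by
  constructor
  · rintro ⟨s, t, a, b, d, e, rfl, hl, hn, h⟩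
    obtain ⟨t, rfl, rfl⟩ := append_pair_eq_append hl.symm (by omega)
    rcases h with rfl | ⟨hk, hab, hb, rfl⟩
    · exact ⟨s ++ (b, e) :: (a, d) :: t, by simp, s, t, a, b, d, e, rfl, rfl, hn, .inl rfl⟩
    · refine ⟨_, rfl, s, t, a, b, d, e, rfl, rfl, hn, .inr ⟨hk, hab, ?_, rfl⟩⟩
      simpa using hb
  · rintro ⟨r', rfl, s, t, a, b, d, e, rfl, rfl, hn, h⟩
    refine ⟨s, t ++ v, a, b, d, e, rfl, by simp, hn, ?_⟩
    rcases h with rfl | ⟨hk, hab, hb, rfl⟩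
    · left; simp
    · refine .inr ⟨hk, hab, ?_, rfl⟩
      simpa using hb

/-- Shift all crossings of a word down by `n` strands. -/
def shiftWord (n : ℕ) (w : List (ℕ × Bool)) : List (ℕ × Bool) := w.map fun z => (n + z.1, z.2)

/-- All crossings of the word take place among the first `n` strands. -/
def Fits (w : List (ℕ × Bool)) (n : ℕ) : Prop := ∀ z ∈ w, z.1 + 2 ≤ n

theorem CrossWord.fits {w : List (ℕ × Bool)} {l r : Stack A}
    (h : CrossWord U V w l r) : Fits w l.length := by
  induction w generalizing l with
  | nil => simp [Fits]
  | cons z w ih =>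
    obtain ⟨m, h, h'⟩ := h
    have := ih h'
    rw [h.perm.length_eq] at this
    intro y hy
    rcases List.mem_cons.1 hy with rfl | hy
    · obtain ⟨s, t, a, b, d, e, hs, rfl, -⟩ := h
      simp; omega
    · exact this y hy

theorem crossWord_append_left {w : List (ℕ × Bool)} {u l r : Stack A} :
    CrossWord U V (shiftWord u.length w) (u ++ l) r ↔
      ∃ r', r = u ++ r' ∧ CrossWord (U ++ pieces u) V w l r' := by
  induction w generalizing l with
  | nil => simp [CrossWord, shiftWord, eq_comm]
  | cons z w ih =>
    obtain ⟨q, k⟩ := z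
    simp only [shiftWord, List.map_cons, CrossWord, crossAt_append_left]
    simp only [shiftWord] at ih
    constructor
    · rintro ⟨_, ⟨m, rfl, h⟩, h'⟩
      obtain ⟨r', rfl, h''⟩ := ih.1 h'
      exact ⟨r', rfl, m, h, h''⟩
    · rintro ⟨r', rfl, m, h, h'⟩
      exact ⟨_, ⟨m, rfl, h⟩, ih.2 ⟨r', rfl, h'⟩⟩

theorem crossWord_append_right {w : List (ℕ × Bool)} {v l r : Stack A}
    (hw : Fits w l.length) :
    CrossWord U V w (l ++ v) r ↔ ∃ r', r = r' ++ v ∧ CrossWord U (pieces v ++ V) w l r' := by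
  induction w generalizing l with
  | nil => simp [CrossWord, eq_comm]
  | cons z w ih =>
    obtain ⟨q, k⟩ := z
    simp only [CrossWord, crossAt_append_right (hw (q, k) (by simp))]
    have hw' : ∀ m : Stack A, CrossAt U (pieces v ++ V) k q l m → Fits w m.length :=
      fun m hm y hy => by rw [hm.perm.length_eq]; exact hw y (by simp [hy])
    constructor
    · rintro ⟨_, ⟨m, rfl, h⟩, h'⟩
      obtain ⟨r', rfl, h''⟩ := (ih (hw' m h)).1 h'
      exact ⟨r', rfl, m, h, h''⟩
    · rintro ⟨r', rfl, m, h, h'⟩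
      exact ⟨_, ⟨m, rfl, h⟩, (ih (hw' m h)).2 ⟨r', rfl, h'⟩⟩

theorem CrossAt.filter_eq {k : Bool} {q : ℕ} {l r : Stack A}
    (h : CrossAt U V k q l r) (d : ℕ) : r.filter (·.2 = d) = l.filter (·.2 = d) := by
  obtain ⟨s, t, a, b, e, f, -, rfl, hn, rfl | ⟨-, -, -, rfl⟩⟩ := h
  · simp only [List.filter_append, List.filter_cons]
    split_ifs <;> simp_all
  · rfl

theorem CrossWord.filter_eq {w : List (ℕ × Bool)} {l r : Stack A}
    (h : CrossWord U V w l r) (d : ℕ) : r.filter (·.2 = d) = l.filter (·.2 = d) := by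
  induction w generalizing l with
  | nil => rw [show l = r from h]
  | cons z w ih => obtain ⟨m, h, h'⟩ := h; rw [ih h', h.filter_eq]

/-! #### Reflection in a horizontal axis -/

section

variable [CommRing A]

/-- Reflect a ruled stack in a horizontal axis. -/
def flipStack (x : Stack A) : Stack A := (x.map fun z => (-z.1, z.2)).reverse

@[simp] theorem flipStack_nil : flipStack ([] : Stack A) = [] := rfl
@[simp] theorem flipStack_append (x y : Stack A) :
    flipStack (x ++ y) = flipStack y ++ flipStack x := by simp [flipStack]
@[simp] theorem flipStack_cons (z : A × ℕ) (x : Stack A) :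
    flipStack (z :: x) = flipStack x ++ [(-z.1, z.2)] := by simp [flipStack]
@[simp] theorem length_flipStack (x : Stack A) : (flipStack x).length = x.length := by
  simp [flipStack]
@[simp] theorem pieces_flipStack (x : Stack A) : pieces (flipStack x) = (pieces x).reverse := by
  simp [flipStack, pieces, Function.comp_def]
@[simp] theorem flipStack_flipStack (x : Stack A) : flipStack (flipStack x) = x := by
  simp [flipStack, Function.comp_def]

/-- Reflect a word of crossings of `n` strands in a horizontal axis. -/
def flipWord (n : ℕ) (w : List (ℕ × Bool)) : List (ℕ × Bool) := w.map fun z => (n - 2 - z.1, z.2)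

theorem CrossAt.flip {k : Bool} {q : ℕ} {l r : Stack A}
    (h : CrossAt U V k q l r) :
    CrossAt V.reverse U.reverse k (l.length - 2 - q) (flipStack l) (flipStack r) := by
  obtain ⟨s, t, a, b, d, e, rfl, rfl, hn, h⟩ := h
  refine ⟨flipStack t, flipStack s, -b, -a, e, d, by simp; omega, by simp, hn.symm, ?_⟩
  rcases h with rfl | ⟨hk, hab, hb, rfl⟩
  · left; simp
  · refine .inr ⟨hk, by rw [hab], ?_, rfl⟩
    simpa using hb.flip

theorem CrossWord.flip {w : List (ℕ × Bool)} {l r : Stack A}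
    (h : CrossWord U V w l r) :
    CrossWord V.reverse U.reverse (flipWord l.length w) (flipStack l) (flipStack r) := by
  induction w generalizing l with
  | nil => exact congrArg _ h
  | cons z w ih =>
    obtain ⟨m, h, h'⟩ := h
    have := ih h'
    rw [h.perm.length_eq] at this
    exact ⟨_, h.flip, this⟩

/-! #### Balanced blocks -/

/-- Every piece that meets the block `l` meets the whole stack in exactly two strands, and if both
are in the block, the potential of the upper one is that of the lower one plus one. -/
structure Balanced (U V : List ℕ) (l : Stack A) : Prop where
  count : ∀ d ∈ pieces l, (U ++ pieces l ++ V).count d = 2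
  pot : ∀ a b d, [(a, d), (b, d)].Sublist l → a = b + 1

theorem CrossWord.balanced {U V U' V' : List ℕ} {w : List (ℕ × Bool)} {l r : Stack A}
    (h : CrossWord U' V' w l r) (hl : Balanced U V l) : Balanced U V r where
  count d hd := by
    rw [← hl.count d (h.perm_pieces.subset hd)]
    simp [List.count_append, h.perm_pieces.count_eq]
  pot a b d hs := by
    refine hl.pot a b d ?_
    rw [← pair_sublist_filter (p := (·.2 = d)) (by simp) (by simp), h.filter_eq] at hs
    exact hs.trans List.filter_sublist

theorem Balanced.flip {l : Stack A} (h : Balanced U V l) :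
    Balanced V.reverse U.reverse (flipStack l) where
  count d hd := by
    have := h.count d (by simpa using hd)
    simp only [pieces_flipStack, List.count_append, List.count_reverse] at this ⊢
    omega
  pot a b d hs := by
    have := h.pot (-b) (-a) d (by
      rw [← flipStack_flipStack l]
      have := (hs.map fun z => (-z.1, z.2)).reverse
      simpa [flipStack] using this)
    linear_combination this

theorem Balanced.relabel {l : Stack A} (h : Balanced U V l) {σ : ℕ → ℕ}
    (hσ : σ.Injective) : Balanced (U.map σ) (V.map σ) (relabel σ l) where
  count d hd := by
    rw [pieces_relabel, List.mem_map] at hd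
    obtain ⟨d, hd, rfl⟩ := hd
    rw [← h.count d hd, pieces_relabel, ← List.map_append, ← List.map_append,
      List.count_map_of_injective _ _ hσ]
  pot a b d hs := by
    obtain ⟨l', hl', h'⟩ := List.sublist_map_iff.1 hs
    rcases l' with _ | ⟨⟨x, i⟩, _ | ⟨⟨y, j⟩, _ | ⟨z, l'⟩⟩⟩ <;> simp at h'
    obtain ⟨⟨rfl, rfl⟩, rfl, hij⟩ := h'
    have := hσ hij
    subst this
    exact h.pot _ _ _ hl'

theorem Balanced.mid {s l t : Stack A} (h : Balanced U V (s ++ l ++ t)) :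
    Balanced (U ++ pieces s) (pieces t ++ V) l where
  count d hd := by
    rw [← h.count d (by simp [hd])]
    simp
  pot a b d hs := h.pot a b d
    ((hs.trans (List.sublist_append_right s l)).trans (List.sublist_append_left _ t))

end

/-! ### A strand that crosses a block downwards -/

/-- A strand of potential `a`, whose piece is `d` at first and `f` at the end, crosses all strands
of the block `l` downwards, and `l'` is the block afterwards. -/
inductive Down (V : List ℕ) (a : A) :
    List ℕ → ℕ → Stack A → Stack A → ℕ → Prop
  | nil (U : List ℕ) (d : ℕ) : Down V a U d [] [] d
  | pass (U : List ℕ) (d : ℕ) (b : A) (e : ℕ) (l l' : Stack A) (f : ℕ) : d ≠ e →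
      Down V a (U ++ [e]) d l l' f → Down V a U d ((b, e) :: l) ((b, e) :: l') f
  | switch (U : List ℕ) (d e : ℕ) (l l' : Stack A) (f : ℕ) : d ≠ e →
      Before U (pieces l ++ V) d e → Down V a (U ++ [d]) e l l' f →
      Down V a U d ((a, e) :: l) ((a, d) :: l') f

/-- A word of regular crossings. -/
def regular (w : List ℕ) : List (ℕ × Bool) := w.map fun q => (q, false)

@[simp] theorem regular_nil : regular [] = [] := rfl
@[simp] theorem regular_cons (q : ℕ) (w : List ℕ) : regular (q :: w) = (q, false) :: regular w := rfl
@[simp] theorem regular_append (w w' : List ℕ) : regular (w ++ w') = regular w ++ regular w' := by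
  simp [regular]

theorem shiftWord_regular (n : ℕ) (w : List ℕ) :
    shiftWord n (regular w) = regular (w.map (n + ·)) := by
  simp [shiftWord, regular, Function.comp_def]

theorem crossAt_zero {k : Bool} {a : A} {d : ℕ} {l r : Stack A} :
    CrossAt U V k 0 ((a, d) :: l) r ↔ ∃ b e t, l = (b, e) :: t ∧ d ≠ e ∧
      (r = (b, e) :: (a, d) :: t ∨ k = false ∧ a = b ∧ Before U (pieces t ++ V) d e ∧
        r = (a, d) :: l) := by
  constructor
  · rintro ⟨s, t, a', b, d', e, hs, hl, hn, h⟩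
    rw [List.length_eq_zero_iff] at hs
    subst hs
    simp only [List.nil_append, List.cons.injEq, Prod.mk.injEq] at hl
    obtain ⟨⟨rfl, rfl⟩, rfl⟩ := hl
    exact ⟨b, e, t, rfl, hn, by simpa using h⟩
  · rintro ⟨b, e, t, rfl, hn, h⟩
    exact ⟨[], t, a, b, d, e, rfl, rfl, hn, by simpa using h⟩

theorem range_succ_word (n : ℕ) :
    regular (List.range (n + 1)) = (0, false) :: shiftWord 1 (regular (List.range n)) := by
  rw [shiftWord_regular, List.range_succ_eq_map]
  simp [Nat.add_comm 1]

theorem crossWord_down {V : List ℕ} {a : A} {U : List ℕ} {d : ℕ} {l r : Stack A} :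
    CrossWord U V (regular (List.range l.length)) ((a, d) :: l) r ↔
      ∃ l' f, r = l' ++ [(a, f)] ∧ Down V a U d l l' f := by
  induction l generalizing U d r with
  | nil =>
    constructor
    · intro h; exact ⟨[], d, Eq.symm h, .nil _ _⟩
    · rintro ⟨l', f, rfl, h⟩; cases h; rfl
  | cons z l ih =>
    obtain ⟨b, e⟩ := z
    rw [List.length_cons, range_succ_word, CrossWord]
    constructor
    · rintro ⟨m, h, h'⟩
      obtain ⟨b', e', t, hl, hn, h⟩ := crossAt_zero.1 h
      simp only [List.cons.injEq, Prod.mk.injEq] at hl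
      obtain ⟨⟨rfl, rfl⟩, rfl⟩ := hl
      rcases h with rfl | ⟨-, rfl, hb, rfl⟩
      · obtain ⟨r', rfl, h₁⟩ := (crossWord_append_left (u := [(b, e)])).1 h'
        obtain ⟨l', f, rfl, h₂⟩ := ih.1 h₁
        exact ⟨(b, e) :: l', f, rfl, .pass _ _ _ _ _ _ _ hn h₂⟩
      · obtain ⟨r', rfl, h₁⟩ := (crossWord_append_left (u := [(a, d)])).1 h'
        obtain ⟨l', f, rfl, h₂⟩ := ih.1 h₁
        exact ⟨(a, d) :: l', f, rfl, .switch _ _ _ _ _ _ hn hb h₂⟩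
    · rintro ⟨l', f, rfl, h⟩
      cases h with
      | pass _ _ _ _ _ l' _ hn h =>
        refine ⟨(b, e) :: (a, d) :: l, crossAt_zero.2 ⟨_, _, _, rfl, hn, .inl rfl⟩, ?_⟩
        exact (crossWord_append_left (u := [(b, e)])).2 ⟨l' ++ [(a, f)], rfl, ih.2 ⟨l', f, rfl, h⟩⟩
      | switch _ _ _ _ l' _ hn hb h =>
        refine ⟨(a, d) :: (a, e) :: l,
          crossAt_zero.2 ⟨_, _, _, rfl, hn, .inr ⟨rfl, rfl, hb, rfl⟩⟩, ?_⟩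
        exact (crossWord_append_left (u := [(a, d)])).2 ⟨l' ++ [(a, f)], rfl, ih.2 ⟨l', f, rfl, h⟩⟩

/-- Every piece of the block `L` meets the whole stack in exactly two strands. -/
def Paired (U V L : List ℕ) : Prop := ∀ d ∈ L, (U ++ L ++ V).count d = 2

theorem Down.perm {V : List ℕ} {a : A} {U : List ℕ} {d f : ℕ} {l l' : Stack A}
    (h : Down V a U d l l' f) : (f :: pieces l').Perm (d :: pieces l) := by
  induction h with
  | nil => exact .refl _
  | pass U d b e l l' f hn h ih =>
    exact (List.Perm.swap _ _ _).trans ((ih.cons e).trans (List.Perm.swap _ _ _))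
  | switch U d e l l' f hn hb h ih =>
    exact (List.Perm.swap _ _ _).trans (ih.cons d)

theorem Down.map_fst {V : List ℕ} {a : A} {U : List ℕ} {d f : ℕ} {l l' : Stack A}
    (h : Down V a U d l l' f) : l'.map Prod.fst = l.map Prod.fst := by
  induction h with
  | nil => rfl
  | pass U d b e l l' f hn h ih => simpa using ih
  | switch U d e l l' f hn hb h ih => simpa using ih

theorem Down.length_eq {V : List ℕ} {a : A} {U : List ℕ} {d f : ℕ} {l l' : Stack A}
    (h : Down V a U d l l' f) : l'.length = l.length := by
  simpa using congrArg List.length h.map_fst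

theorem Paired.cons_pass {U V L : List ℕ} {d e : ℕ} (h : Paired U V (d :: e :: L)) :
    Paired (U ++ [e]) V (d :: L) := by
  intro g hg
  rw [← h g (by simp at hg ⊢; tauto)]
  simp [List.count_append, List.count_cons]; omega

theorem Paired.cons_switch {U V L : List ℕ} {d e : ℕ} (h : Paired U V (d :: e :: L)) :
    Paired (U ++ [d]) V (e :: L) := by
  intro g hg
  rw [← h g (by simp at hg ⊢; tauto)]
  simp [List.count_append, List.count_cons]

theorem Down.not_mem {V : List ℕ} {a : A} {U : List ℕ} {d f : ℕ} {l l' : Stack A}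
    (h : Down V a U d l l' f) (hc : Paired U V (d :: pieces l)) : d ∉ pieces l := by
  induction h with
  | nil => simp
  | pass U d b e l l' f hn h ih =>
    simpa [hn] using ih hc.cons_pass
  | switch U d e l l' f hn hb h ih =>
    have he := ih hc.cons_switch
    simp only [pieces_cons, List.mem_cons, not_or]
    refine ⟨hn, fun hd => ?_⟩
    have h₁ := hc d (by simp)
    have h₂ := List.count_pos_iff.2 hd
    simp only [pieces_cons, List.count_append, List.count_cons_self,
      List.count_cons_of_ne hn.symm] at h₁
    have hU : d ∉ U := fun hU => by have := List.count_pos_iff.2 hU; omega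
    have hV : d ∉ V := fun hV => by have := List.count_pos_iff.2 hV; omega
    rw [Before, List.reverse_append, pair_sublist_append, pair_sublist_append] at hb
    rcases hb with hb | ⟨hb, -⟩ | hb | ⟨hb, -⟩ | hb
    · exact hU (List.mem_reverse.1 (hb.subset (by simp)))
    · exact hU (List.mem_reverse.1 hb)
    · exact hV (List.mem_reverse.1 (hb.subset (by simp)))
    · exact hV (List.mem_reverse.1 hb)
    · exact he (List.mem_reverse.1 (hb.subset (by simp)))

theorem Before.not_mem_of_paired {U V s L : List ℕ} {d e : ℕ}
    (hc : Paired (U ++ s) V (d :: e :: L)) (hn : d ≠ e) (hd : d ∉ s)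
    (hb : Before (U ++ s) (L ++ V) d e) : e ∉ s := by
  intro he
  have h₁ := hc e (by simp)
  have h₂ := List.count_pos_iff.2 he
  simp only [List.count_append, List.count_cons_self, List.count_cons_of_ne hn] at h₁
  have hU : e ∉ U := fun hU => by have := List.count_pos_iff.2 hU; omega
  have hV : e ∉ V := fun hV => by have := List.count_pos_iff.2 hV; omega
  have hL : e ∉ L := fun hV => by have := List.count_pos_iff.2 hV; omega
  rw [Before, List.reverse_append, List.append_assoc, pair_sublist_append] at hb
  rcases hb with hb | ⟨hb, -⟩ | hb
  · exact hd (List.mem_reverse.1 (hb.subset (by simp)))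
  · exact hd (List.mem_reverse.1 hb)
  · have := hb.subset (List.mem_cons_of_mem _ (List.mem_singleton_self e))
    simp [hU, hV, hL] at this

theorem Down.not_mem_end {V : List ℕ} {a : A} {U : List ℕ} {d f : ℕ} {l l' : Stack A}
    (h : Down V a U d l l' f) (hc : Paired U V (d :: pieces l)) {U₀ s : List ℕ} (hU : U = U₀ ++ s)
    (hd : d ∉ s) : f ∉ s ++ pieces l' := by
  induction h generalizing U₀ s with
  | nil => simpa using hd
  | pass U d b e l l' f hn h ih =>
    subst hU
    have := ih hc.cons_pass (List.append_assoc _ _ _) (by simp [hd, hn])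
    simpa using this
  | switch U d e l l' f hn hb h ih =>
    subst hU
    have he := hb.not_mem_of_paired hc hn hd
    have := ih hc.cons_switch (List.append_assoc _ _ _) (by simp [he, hn.symm])
    simpa using this

theorem Down.nodup {V : List ℕ} {a : A} {U : List ℕ} {d f : ℕ} {l l' : Stack A}
    (h : Down V a U d l l' f) (hc : Paired U V (d :: pieces l)) (hn : (pieces l').Nodup) :
    (d :: pieces l).Nodup := by
  rw [← h.perm.nodup_iff, List.nodup_cons]
  exact ⟨by simpa using h.not_mem_end hc (U₀ := U) (s := []) (by simp) (by simp), hn⟩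

/-- Two blocks with the same strands, whose pieces agree on the strands with pieces in `K`. -/
def AgreeOn (K : ℕ → Bool) : Stack A → Stack A → Prop :=
  List.Forall₂ fun z z' => z.1 = z'.1 ∧ (K z.2 = K z'.2) ∧ (K z.2 → z.2 = z'.2)

/-- Forget the strands with pieces in `K`. -/
def forget (K : ℕ → Bool) (l : Stack A) : Stack A := l.filter fun z => !K z.2

theorem forget_cons (K : ℕ → Bool) (z : A × ℕ) (l : Stack A) :
    forget K (z :: l) = if K z.2 then forget K l else z :: forget K l := by
  simp only [forget, List.filter_cons]
  cases K z.2 <;> simp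
@[simp] theorem forget_append (K : ℕ → Bool) (l l' : Stack A) :
    forget K (l ++ l') = forget K l ++ forget K l' := by simp [forget]
theorem pieces_forget (K : ℕ → Bool) (l : Stack A) :
    pieces (forget K l) = (pieces l).filter (!K ·) := by
  simp [pieces, forget, List.filter_map, Function.comp_def]

/-- Pieces that meet a block twice after a strand has crossed it downwards are not involved in
switches. -/
theorem Down.forget {V : List ℕ} {a : A} {U : List ℕ} {d f : ℕ} {l l' : Stack A}
    (h : Down V a U d l l' f) (hc : Paired U V (d :: pieces l)) {U₀ s : List ℕ} (hU : U = U₀ ++ s)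
    (hd : d ∉ s) {K : ℕ → Bool} (hK : ∀ g, K g → (s ++ pieces l').count g = 2) :
    K d = false ∧ K f = false ∧ AgreeOn K l l' ∧
      Down (V.filter (!K ·)) a (U.filter (!K ·)) d (forget K l) (forget K l') f := by
  induction h generalizing U₀ s with
  | nil _ d =>
    have : K d = false := by
      by_contra hk
      have := hK _ (by simpa using hk)
      simp [List.count_eq_zero_of_not_mem hd] at this
    exact ⟨this, this, .nil, .nil _ _⟩
  | pass U d b e l l' f hn h ih =>
    subst hU
    obtain ⟨h₁, h₂, h₃, h₄⟩ := ih hc.cons_pass (List.append_assoc _ _ _) (by simp [hd, hn])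
      (by simpa using hK)
    refine ⟨h₁, h₂, .cons ⟨rfl, rfl, fun _ => rfl⟩ h₃, ?_⟩
    rw [forget_cons, forget_cons]
    cases he : K e
    · simp only [List.filter_append, List.filter_cons, he] at h₄
      simpa using Down.pass _ _ _ _ _ _ _ hn h₄
    · simpa [he] using h₄
  | switch U d e l l' f hn hb h ih =>
    have hdl := (Down.switch U d e l l' f hn hb h).not_mem hc
    subst hU
    have he := hb.not_mem_of_paired hc hn hd
    obtain ⟨h₁, h₂, h₃, h₄⟩ := ih hc.cons_switch (List.append_assoc _ _ _) (by simp [he, hn.symm])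
      (by simpa using hK)
    have h₅ : K d = false := by
      by_contra hk
      have h₆ := hK _ (by simpa using hk)
      have : d ∈ pieces l' := by
        by_contra h₇
        simp [List.count_eq_zero_of_not_mem hd, List.count_eq_zero_of_not_mem h₇] at h₆
      exact hdl (h.perm.subset (List.mem_cons_of_mem _ this))
    refine ⟨h₅, h₂, .cons ⟨rfl, by simp [h₁, h₅], by simp [h₁]⟩ h₃, ?_⟩
    rw [forget_cons, forget_cons]
    simp only [List.filter_append, List.filter_cons, h₅] at h₄
    simp only [h₅, h₁]
    refine .switch _ _ _ _ _ _ hn ?_ (by simpa using h₄)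
    refine (Before.congr (p := (!K ·)) (by simp [h₅]) (by simp [h₁]) ?_ ?_).1 hb
    · simp
    · simp [pieces_forget]

theorem Down.of_forget {V : List ℕ} {a : A} {U : List ℕ} {d f : ℕ} {l m : Stack A}
    {K : ℕ → Bool} (hd : K d = false)
    (h : Down (V.filter (!K ·)) a (U.filter (!K ·)) d (LegendrianFront.forget K l) m f) :
    ∃ l', Down V a U d l l' f ∧ AgreeOn K l l' ∧ LegendrianFront.forget K l' = m := by
  induction l generalizing U d m with
  | nil => cases h; exact ⟨[], .nil _ _, .nil, rfl⟩
  | cons z l ih =>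
    obtain ⟨b, e⟩ := z
    rw [forget_cons] at h
    cases he : K e
    · simp only [he] at h
      cases h with
      | pass _ _ _ _ _ m _ hn h =>
        obtain ⟨l', h₁, h₂, h₃⟩ := ih (U := U ++ [e]) hd (by simpa [he] using h)
        exact ⟨(b, e) :: l', .pass _ _ _ _ _ _ _ hn h₁, .cons ⟨rfl, rfl, fun _ => rfl⟩ h₂,
          by simp [forget_cons, he, h₃]⟩
      | switch _ _ _ _ m _ hn hb h =>
        obtain ⟨l', h₁, h₂, h₃⟩ := ih (U := U ++ [d]) he (by simpa [hd] using h)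
        refine ⟨(a, d) :: l', .switch _ _ _ _ _ _ hn ?_ h₁, .cons ⟨rfl, by simp [hd, he],
          by simp [he]⟩ h₂, by simp [forget_cons, hd, h₃]⟩
        refine (Before.congr (p := (!K ·)) (by simp [hd]) (by simp [he]) ?_ ?_).1 hb
        · simp
        · simp [pieces_forget]
    · simp only [he, if_true] at h
      obtain ⟨l', h₁, h₂, h₃⟩ := ih (U := U ++ [e]) hd (by simpa [he] using h)
      have hn : d ≠ e := by rintro rfl; simp [hd] at he
      exact ⟨(b, e) :: l', .pass _ _ _ _ _ _ _ hn h₁, .cons ⟨rfl, rfl, fun _ => rfl⟩ h₂,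
        by simp [forget_cons, he, h₃]⟩

theorem Down.append {V : List ℕ} {a : A} {U : List ℕ} {d f : ℕ} {l₁ l₂ l' : Stack A} :
    Down V a U d (l₁ ++ l₂) l' f ↔ ∃ l₁' l₂' e, l' = l₁' ++ l₂' ∧
      Down (pieces l₂ ++ V) a U d l₁ l₁' e ∧ Down V a (U ++ pieces l₁') e l₂ l₂' f := by
  induction l₁ generalizing U d l' with
  | nil =>
    constructor
    · intro h; exact ⟨[], l', d, rfl, .nil _ _, by simpa using h⟩
    · rintro ⟨l₁', l₂', e, rfl, h, h'⟩; cases h; simpa using h'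
  | cons z l₁ ih =>
    obtain ⟨b, g⟩ := z
    constructor
    · intro h
      cases h with
      | pass _ _ _ _ _ m _ hn h =>
        obtain ⟨l₁', l₂', e, rfl, h₁, h₂⟩ := ih.1 h
        exact ⟨(b, g) :: l₁', l₂', e, rfl, .pass _ _ _ _ _ _ _ hn h₁, by simpa using h₂⟩
      | switch _ _ _ _ m _ hn hb h =>
        obtain ⟨l₁', l₂', e, rfl, h₁, h₂⟩ := ih.1 h
        exact ⟨(a, d) :: l₁', l₂', e, rfl, .switch _ _ _ _ _ _ hn (by simpa using hb) h₁,
          by simpa using h₂⟩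
    · rintro ⟨l₁', l₂', e, rfl, h₁, h₂⟩
      cases h₁ with
      | pass _ _ _ _ _ m _ hn h =>
        exact .pass _ _ _ _ _ _ _ hn (ih.2 ⟨m, l₂', e, rfl, h, by simpa using h₂⟩)
      | switch _ _ _ _ m _ hn hb h =>
        exact .switch _ _ _ _ _ _ hn (by simpa using hb)
          (ih.2 ⟨m, l₂', e, rfl, h, by simpa using h₂⟩)

theorem Down.eq_of_not_mem {V : List ℕ} {a : A} {U : List ℕ} {d f : ℕ} {l l' : Stack A}
    (h : Down V a U d l l' f) (hd : d ∉ pieces l') : l' = l ∧ f = d := by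
  induction h with
  | nil => exact ⟨rfl, rfl⟩
  | pass U d b e l l' f hn h ih =>
    obtain ⟨rfl, rfl⟩ := ih fun h => hd (List.mem_cons_of_mem _ h)
    exact ⟨rfl, rfl⟩
  | switch U d e l l' f hn hb h ih => exact absurd (by simp) hd

theorem Down.of_not_mem (V : List ℕ) (a : A) (U : List ℕ) {d : ℕ} {l : Stack A}
    (hd : d ∉ pieces l) : Down V a U d l l d := by
  induction l generalizing U with
  | nil => exact .nil _ _
  | cons z l ih =>
    simp only [pieces_cons, List.mem_cons, not_or] at hd
    exact .pass _ _ _ _ _ _ _ hd.1 (ih _ hd.2)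

/-! ### Braid moves -/

/-- Words of crossings that are related by far commutations and triple point moves. -/
inductive BraidEq : List ℕ → List ℕ → Prop
  | refl (w : List ℕ) : BraidEq w w
  | symm {w w' : List ℕ} : BraidEq w w' → BraidEq w' w
  | trans {w w' w'' : List ℕ} : BraidEq w w' → BraidEq w' w'' → BraidEq w w''
  | far (x y : List ℕ) {p q : ℕ} : p + 2 ≤ q → BraidEq (x ++ p :: q :: y) (x ++ q :: p :: y)
  | three (x y : List ℕ) (p : ℕ) :
      BraidEq (x ++ p :: (p + 1) :: p :: y) (x ++ (p + 1) :: p :: (p + 1) :: y)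

theorem BraidEq.context {w w' : List ℕ} (h : BraidEq w w') (x y : List ℕ) :
    BraidEq (x ++ w ++ y) (x ++ w' ++ y) := by
  induction h with
  | refl => exact .refl _
  | symm _ ih => exact ih.symm
  | trans _ _ ih ih' => exact ih.trans ih'
  | far u v h => simpa using BraidEq.far (x ++ u) (v ++ y) h
  | three u v p => simpa using BraidEq.three (x ++ u) (v ++ y) p

theorem BraidEq.cons {w w' : List ℕ} (h : BraidEq w w') (q : ℕ) : BraidEq (q :: w) (q :: w') := by
  simpa using h.context [q] []

theorem BraidEq.append_comm {w w' : List ℕ} (h : ∀ p ∈ w, ∀ q ∈ w', p + 2 ≤ q) :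
    BraidEq (w ++ w') (w' ++ w) := by
  induction w with
  | nil => simpa only [List.append_nil, List.nil_append] using BraidEq.refl w'
  | cons p w ih =>
    have h₁ : BraidEq (p :: w') (w' ++ [p]) := by
      clear ih
      replace h : ∀ q ∈ w', p + 2 ≤ q := h p (by simp)
      induction w' with
      | nil => exact .refl _
      | cons q w' ih =>
        refine (BraidEq.far [] w' (h q (by simp))).trans ?_
        exact (ih fun q hq => h q (by simp [hq])).cons q
    refine ((ih fun p hp => h p (by simp [hp])).cons p).trans ?_
    simpa using h₁.context [] w

theorem crossAt_block {k : Bool} {s t r : Stack A} {a b : A} {d e : ℕ} :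
    CrossAt U V k s.length (s ++ (a, d) :: (b, e) :: t) r ↔ d ≠ e ∧
      (r = s ++ (b, e) :: (a, d) :: t ∨ k = false ∧ a = b ∧
        Before (U ++ pieces s) (pieces t ++ V) d e ∧ r = s ++ (a, d) :: (b, e) :: t) := by
  constructor
  · rintro ⟨s', t', a', b', d', e', hs, hl, hn, h⟩
    obtain ⟨rfl, hl'⟩ := List.append_inj hl hs.symm
    simp only [List.cons.injEq, Prod.mk.injEq] at hl'
    obtain ⟨⟨rfl, rfl⟩, ⟨rfl, rfl⟩, rfl⟩ := hl'
    exact ⟨hn, h⟩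
  · rintro ⟨hn, h⟩
    exact ⟨s, t, a, b, d, e, rfl, rfl, hn, h⟩

theorem pair_sublist_total {α : Type} {a b : α} (hn : a ≠ b) {x : List α} (ha : a ∈ x)
    (hb : b ∈ x) : [a, b].Sublist x ∨ [b, a].Sublist x := by
  obtain ⟨s, t, rfl⟩ := List.append_of_mem ha
  rw [List.mem_append, List.mem_cons] at hb
  rcases hb with hb | rfl | hb
  · right; exact (pair_sublist_append _ _ _ _).2 (.inr (.inl ⟨hb, by simp⟩))
  · exact absurd rfl hn
  · left; exact (pair_sublist_append _ _ _ _).2 (.inr (.inr (by simpa using hb)))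

theorem pair_sublist_trans {a b c : ℕ} {x : List ℕ} (hx : x.count b = 1)
    (h : [a, b].Sublist x) (h' : [b, c].Sublist x) : [a, c].Sublist x := by
  have hb : b ∈ x := h'.subset (by simp)
  obtain ⟨s, t, rfl⟩ := List.append_of_mem hb
  simp only [List.count_append, List.count_cons_self] at hx
  have hs : b ∉ s := List.count_eq_zero.1 (by omega)
  have ht : b ∉ t := List.count_eq_zero.1 (by omega)
  have ha : a ∈ s ∨ a = b := by
    rcases (pair_sublist_append _ _ _ _).1 h with h | ⟨h, -⟩ | h
    · exact absurd (h.subset (by simp)) hs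
    · exact .inl h
    · rcases List.sublist_cons_iff.1 h with h | ⟨r, hr, h⟩
      · exact absurd (h.subset (by simp)) ht
      · simp at hr; exact .inr hr.1
  have hc : c ∈ t ∨ c = b := by
    rcases (pair_sublist_append _ _ _ _).1 h' with h | ⟨h, -⟩ | h
    · exact absurd (h.subset (by simp)) hs
    · exact absurd h hs
    · rcases List.sublist_cons_iff.1 h with h | ⟨r, hr, h⟩
      · exact absurd (h.subset (by simp)) ht
      · simp at hr; subst hr; exact .inl (by simpa using h)
  rcases ha with ha | rfl
  · rcases hc with hc | rfl
    · exact (pair_sublist_append _ _ _ _).2 (.inr (.inl ⟨ha, by simp [hc]⟩))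
    · exact h
  · exact h'

theorem Before.drop_iff {d e g : ℕ} (hd : d ≠ g) (he : e ≠ g) (U' V' : List ℕ) :
    (Before (U ++ g :: U') V d e ↔ Before (U ++ U') V d e) ∧
      (Before U (V' ++ g :: V) d e ↔ Before U (V' ++ V) d e) := by
  constructor <;>
  exact Before.congr (p := (· ≠ g)) (by simpa) (by simpa) (by simp) (by simp)

theorem crossAt_block_second {s x t r : Stack A} {z₁ z₂ : A × ℕ} {a b : A}
    {d e : ℕ} :
    CrossAt U V false (s.length + 2 + x.length) (s ++ z₁ :: z₂ :: (x ++ (a, d) :: (b, e) :: t)) r ↔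
      d ≠ e ∧ (r = s ++ z₁ :: z₂ :: (x ++ (b, e) :: (a, d) :: t) ∨ a = b ∧
        Before (U ++ (pieces s ++ z₁.2 :: z₂.2 :: pieces x)) (pieces t ++ V) d e ∧
          r = s ++ z₁ :: z₂ :: (x ++ (a, d) :: (b, e) :: t)) := by
  have := crossAt_block (U := U) (V := V) (k := false) (s := s ++ z₁ :: z₂ :: x) (t := t) (r := r)
    (a := a) (b := b) (d := d) (e := e)
  rw [show (s ++ z₁ :: z₂ :: x).length = s.length + 2 + x.length by simp; omega] at this
  simpa using this

theorem before_congr_of_ne {U V V' x y x' y' : List ℕ} {d e d' e' : ℕ}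
    (h : ¬ (d = d' ∧ e = e' ∨ d = e' ∧ e = d')) (hn : d ≠ e) :
    (Before (U ++ (x ++ d :: e :: y)) V d' e' ↔ Before (U ++ (x ++ e :: d :: y)) V d' e') ∧
    (Before U (x' ++ d :: e :: y' ++ V') d' e' ↔ Before U (x' ++ e :: d :: y' ++ V') d' e') := by
  have : [d, e].filter (fun g => g = d' ∨ g = e') = [e, d].filter (fun g => g = d' ∨ g = e') := by
    simp only [List.filter_cons, List.filter_nil]
    by_cases h₁ : d = d' <;> by_cases h₂ : d = e' <;> by_cases h₃ : e = d' <;>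
      by_cases h₄ : e = e' <;> simp_all
  have h' : ∀ x y : List ℕ, (x ++ d :: e :: y).filter (fun g => g = d' ∨ g = e') =
      (x ++ e :: d :: y).filter (fun g => g = d' ∨ g = e') := fun x y => by
    rw [show d :: e :: y = [d, e] ++ y from rfl, show e :: d :: y = [e, d] ++ y from rfl]
    simp only [List.filter_append, this]
  constructor <;>
  refine Before.congr (p := fun g => g = d' ∨ g = e') (by simp) (by simp) ?_ ?_ <;>
    simp only [List.filter_append, h']

section

variable [CommRing A]

/-- Renamings that only concern pieces with both strands inside the block. -/
def FixesOuter (σ : Equiv.Perm ℕ) (U V L : List ℕ) : Prop :=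
  ∀ d, d ∈ U ∨ d ∈ V ∨ d ∉ L → σ d = d

theorem FixesOuter.inv {σ : Equiv.Perm ℕ} {U V L : List ℕ} (h : FixesOuter σ U V L) :
    FixesOuter σ⁻¹ U V L := fun d hd => by
  rw [Equiv.Perm.inv_eq_iff_eq, h d hd]

theorem FixesOuter.mul {σ τ : Equiv.Perm ℕ} {U V L : List ℕ} (h : FixesOuter σ U V L)
    (h' : FixesOuter τ U V L) : FixesOuter (σ * τ) U V L := fun d hd => by
  rw [Equiv.Perm.mul_apply, h' d hd, h d hd]

theorem FixesOuter.swap {U V L : List ℕ} {d e : ℕ} (hd : d ∉ U ∧ d ∉ V ∧ d ∈ L)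
    (he : e ∉ U ∧ e ∉ V ∧ e ∈ L) : FixesOuter (Equiv.swap d e) U V L := fun g hg => by
  refine Equiv.swap_apply_of_ne_of_ne ?_ ?_ <;> rintro rfl <;> tauto

/-- Every passage through the crossings `w` can be replaced, up to renaming pieces, by a passage
through the crossings `w'`. -/
def Simulates (A : Type) [CommRing A] (w w' : List ℕ) : Prop :=
  ∀ (U V : List ℕ) (l r : Stack A), Balanced U V l → CrossWord U V (regular w) l r →
    ∃ σ : Equiv.Perm ℕ, FixesOuter σ U V (pieces l) ∧ CrossWord U V (regular w') l (relabel σ r)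

theorem Simulates.context {w w' : List ℕ} (h : Simulates A w w') (x y : List ℕ) :
    Simulates A (x ++ w ++ y) (x ++ w' ++ y) := by
  intro U V l r hl hw
  simp only [regular_append, crossWord_append] at hw ⊢
  obtain ⟨n, ⟨m, h₁, h₂⟩, h₃⟩ := hw
  obtain ⟨σ, hσ, h₄⟩ := h U V m n (h₁.balanced hl) h₂
  refine ⟨σ, fun d hd => hσ d ?_, _, ⟨m, h₁, h₄⟩, h₃.relabel_fixed σ.injective
    (fun d hd => hσ d (.inl hd)) (fun d hd => hσ d (.inr (.inl hd)))⟩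
  rwa [h₁.perm_pieces.mem_iff]

theorem Simulates.mirror {w w' : List ℕ} (h : Simulates A w w') :
    Simulates A w.reverse w'.reverse := by
  intro U V l r hl hw
  have hr := hw.balanced hl
  have hp := hw.perm_pieces
  have hw := hw.mirror
  rw [show (regular w.reverse).reverse = regular w by simp [regular]] at hw
  obtain ⟨σ, hσ, h'⟩ := h U V r l hr hw
  have hσ' : FixesOuter σ⁻¹ U V (pieces l) := fun d hd => hσ.inv d (by rwa [hp.mem_iff])
  refine ⟨σ⁻¹, hσ', ?_⟩
  have h' := h'.mirror
  rw [show (regular w').reverse = regular w'.reverse by simp [regular]] at h'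
  have := h'.relabel_fixed σ⁻¹.injective (fun d hd => hσ' d (.inl hd))
    (fun d hd => hσ' d (.inr (.inl hd)))
  rwa [relabel_relabel, relabel_eq_self (σ := (σ⁻¹ : Equiv.Perm ℕ) ∘ σ) (by simp)] at this

theorem Simulates.trans {w w' w'' : List ℕ} (h : Simulates A w w') (h' : Simulates A w' w'') :
    Simulates A w w'' := by
  intro U V l r hl hw
  obtain ⟨σ, hσ, h₁⟩ := h U V l r hl hw
  obtain ⟨τ, hτ, h₂⟩ := h' U V l _ hl h₁
  refine ⟨τ * σ, hτ.mul hσ, ?_⟩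
  rwa [relabel_relabel] at h₂

theorem relabel_swap_eq_self {d e : ℕ} {y : Stack A} (hd : d ∉ pieces y) (he : e ∉ pieces y) :
    relabel (Equiv.swap d e) y = y := relabel_eq_self fun _ hg =>
  Equiv.swap_apply_of_ne_of_ne (fun h => hd (h ▸ hg)) fun h => he (h ▸ hg)

theorem simulates_far {p q : ℕ} (hpq : p + 2 ≤ q) : Simulates A [p, q] [q, p] := by
  intro U V l r hl hw
  obtain ⟨m, h₁, _, h₂, rfl⟩ := hw
  obtain ⟨s, t₀, a, b, d, e, rfl, rfl, hn, -⟩ := id h₁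
  obtain ⟨x, t, a', b', d', e', rfl, rfl⟩ : ∃ x t a' b' d' e', t₀ = x ++ (a', d') :: (b', e') :: t ∧
      q = s.length + 2 + x.length := by
    obtain ⟨s', t, a', b', d', e', hs', hm, -, -⟩ := id h₂
    have h₃ := h₁.perm.length_eq
    rw [hm] at h₃
    simp only [List.length_append, List.length_cons] at h₃
    obtain ⟨x, y, hxy, hx⟩ : ∃ x y, t₀ = x ++ y ∧ x.length = q - (s.length + 2) :=
      ⟨_, _, (List.take_append_drop (q - (s.length + 2)) t₀).symm, by
        rw [List.length_take]; omega⟩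
    subst hxy
    rw [List.length_append] at h₃
    rcases y with _ | ⟨⟨a', d'⟩, _ | ⟨⟨b', e'⟩, y⟩⟩
    · simp at h₃; omega
    · simp at h₃; omega
    · exact ⟨x, y, a', b', d', e', rfl, by omega⟩
  have hone : FixesOuter 1 U V (pieces (s ++ (a, d) :: (b, e) :: (x ++ (a', d') :: (b', e') :: t))) :=
    fun _ _ => rfl
  obtain ⟨-, h₁⟩ := crossAt_block.1 h₁
  have hc : (d = d' ∧ e = e' ∨ d = e' ∧ e = d') → (∀ g, g = d ∨ g = e → g ∉ U ∧ g ∉ V ∧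
      g ∉ pieces s ∧ g ∉ pieces x ∧ g ∉ pieces t) := by
    intro h g hg
    have hcg := hl.count g (by simp; tauto)
    simp only [pieces_append, pieces_cons, List.count_append, List.count_cons] at hcg
    simp only [← List.count_eq_zero]
    rcases h with ⟨rfl, rfl⟩ | ⟨rfl, rfl⟩ <;> rcases hg with rfl | rfl <;>
      simp [hn, hn.symm] at hcg <;> omega
  have hrev : ∀ (u v : List ℕ) (g g' : ℕ), g ≠ g' → (g ∉ u ∧ g ∉ v) → (g' ∉ u ∧ g' ∉ v) →
      ¬ [g, g'].Sublist (u ++ g' :: g :: v) := by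
    intro u v g g' hg h₁ h₂ h
    rw [pair_sublist_append] at h
    rcases h with h | h | h
    · exact h₁.1 (h.subset (by simp))
    · exact h₁.1 h.1
    · rcases List.sublist_cons_iff.1 h with h | ⟨r, hr, -⟩
      · rcases List.sublist_cons_iff.1 h with h | ⟨r, hr, h⟩
        · exact h₁.2 (h.subset (by simp))
        · simp at hr; subst hr; exact h₂.2 (by simpa using h)
      · simp at hr; exact hg hr.1
  rcases h₁ with rfl | ⟨-, rfl, hb, rfl⟩
  · obtain ⟨hn', rfl | ⟨rfl, hb, rfl⟩⟩ := crossAt_block_second.1 h₂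
    · exact ⟨1, hone, _, crossAt_block_second.2 ⟨hn', .inl rfl⟩, _,
        crossAt_block.2 ⟨hn, .inl rfl⟩, by simp [relabel_eq_self]⟩
    · by_cases hde : d = d' ∧ e = e' ∨ d = e' ∧ e = d'
      · have hc := hc hde
        have hcd := hc d (.inl rfl)
        have hce := hc e (.inr rfl)
        rcases hde with ⟨rfl, rfl⟩ | ⟨rfl, rfl⟩
        · have h₃ : a = a' + 1 := hl.pot a a' d (by simp)
          have h₄ : b = a' + 1 := hl.pot b a' e (by
            refine List.Sublist.trans ?_ (List.sublist_append_right _ _)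
            simp)
          refine ⟨Equiv.swap d e, .swap (by simp [hcd]) (by simp [hce]), _,
            crossAt_block_second.2 ⟨hn, .inl rfl⟩, _, crossAt_block.2 ⟨hn, .inr ⟨rfl, h₃.trans h₄.symm,
              ?_, rfl⟩⟩, ?_⟩
          · refine (pair_sublist_append _ _ _ _).2 (.inr (.inr ?_))
            simp
          · simp [relabel_swap_eq_self, hcd, hce, h₃, h₄]
        · exfalso
          refine hrev ((pieces x).reverse) ((pieces s).reverse ++ (U.reverse ++
            (V.reverse ++ (pieces t).reverse))) e d hn.symm (by simp [hce]) (by simp [hcd]) ?_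
          simpa [Before] using hb
      · refine ⟨1, hone, _, crossAt_block_second.2 ⟨hn', .inr ⟨rfl, ?_, rfl⟩⟩, _,
          crossAt_block.2 ⟨hn, .inl rfl⟩, by simp [relabel_eq_self]⟩
        exact (before_congr_of_ne (V' := []) (x' := []) (y' := []) hde hn).1.2 hb
  · obtain ⟨hn', rfl | ⟨rfl, hb', rfl⟩⟩ := crossAt_block_second.1 h₂
    · by_cases hde : d' = d ∧ e' = e ∨ d' = e ∧ e' = d
      · have hc := hc (by tauto)
        have hcd := hc d (.inl rfl)
        have hce := hc e (.inr rfl)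
        rcases hde with ⟨rfl, rfl⟩ | ⟨rfl, rfl⟩
        · exfalso
          refine hrev ((pieces s).reverse ++ U.reverse ++ V.reverse ++ (pieces t).reverse)
            (pieces x).reverse d' e' hn (by simp [hcd]) (by simp [hce]) ?_
          simpa [Before] using hb
        · have h₃ : a = b' + 1 := hl.pot a b' e' (by simp)
          have h₄ : a = a' + 1 := hl.pot a a' d' (by
            refine List.Sublist.trans ?_ (List.sublist_append_right _ _)
            simp)
          refine ⟨Equiv.swap e' d', .swap (by simp [hcd]) (by simp [hce]), _,
            crossAt_block_second.2 ⟨hn', .inr ⟨add_right_cancel (h₄.symm.trans h₃), ?_, rfl⟩⟩, _,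
            crossAt_block.2 ⟨hn, .inl rfl⟩, ?_⟩
          · refine (pair_sublist_append _ _ _ _).2 (.inl ?_)
            simp
          · simp [relabel_swap_eq_self, hcd, hce, add_right_cancel (h₄.symm.trans h₃)]
      · refine ⟨1, hone, _, crossAt_block_second.2 ⟨hn', .inl rfl⟩, _,
          crossAt_block.2 ⟨hn, .inr ⟨rfl, rfl, ?_, rfl⟩⟩, by simp [relabel_eq_self]⟩
        have := (before_congr_of_ne (U := U ++ pieces s) (V := []) (V' := V) (x := [])
          (y := []) (x' := pieces x) (y' := pieces t) hde hn').2
        simpa using this.1 (by simpa using hb)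
    · exact ⟨1, hone, _, crossAt_block_second.2 ⟨hn', .inr ⟨rfl, hb', rfl⟩⟩, _,
        crossAt_block.2 ⟨hn, .inr ⟨rfl, rfl, hb, rfl⟩⟩, by simp [relabel_eq_self]⟩

theorem simulates_three_block {x y z : A × ℕ} {r : Stack A}
    (hl : Balanced U V [x, y, z]) (h : CrossWord U V (regular [0, 1, 0]) [x, y, z] r) :
    CrossWord U V (regular [1, 0, 1]) [x, y, z] r := by
  obtain ⟨a, d⟩ := x
  obtain ⟨b, e⟩ := y
  obtain ⟨c, f⟩ := z
  have hnd : [d, e, f].Nodup := by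
    have h' : CrossWord U V (regular (List.range [(b, e), (c, f)].length ++ [0]))
      [(a, d), (b, e), (c, f)] r := h
    rw [regular_append, crossWord_append] at h'
    obtain ⟨m, h₁, h₂⟩ := h'
    obtain ⟨l', g, hm, h₃⟩ := crossWord_down.1 h₁
    refine h₃.nodup hl.count ?_
    obtain ⟨⟨b', e'⟩, ⟨c', f'⟩, hl'⟩ := List.length_eq_two.1 h₃.length_eq
    subst hl' hm
    obtain ⟨_, h₄, -⟩ := h₂
    obtain ⟨_, _, _, hl₁, hne, -⟩ := crossAt_zero.1 h₄
    simp at hl₁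
    simpa [hl₁] using hne
  simp only [List.nodup_cons, List.mem_cons, List.not_mem_nil, or_false, not_or, not_false_eq_true,
    List.nodup_nil, and_true] at hnd
  obtain ⟨⟨hde, hdf⟩, hef⟩ := hnd
  have hcount : ∀ g, g = d ∨ g = e ∨ g = f → (U.reverse ++ V.reverse).count g = 1 := by
    intro g hg
    have := hl.count g (by simpa using hg)
    simp only [pieces_cons, pieces_nil, List.count_append, List.count_cons, List.count_nil] at this
    rw [List.count_append, List.count_reverse, List.count_reverse]
    rcases hg with rfl | rfl | rfl <;>
      simp [hde, hdf, hef, Ne.symm hde, Ne.symm hdf, Ne.symm hef] at this <;> omega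
  have hmem : ∀ g, g = d ∨ g = e ∨ g = f → g ∈ U.reverse ++ V.reverse := fun g hg =>
    List.count_pos_iff.1 (by rw [hcount g hg]; exact one_pos)
  have htrans : ∀ g₁ g₂ g₃, (g₂ = d ∨ g₂ = e ∨ g₂ = f) → Before U V g₁ g₂ → Before U V g₂ g₃ →
    Before U V g₁ g₃ := fun g₁ g₂ g₃ h h₁ h₂ => pair_sublist_trans (hcount g₂ h) h₁ h₂
  have B₀ : ∀ g₁ g₂ g, g₁ ≠ g → g₂ ≠ g → (Before U (g :: V) g₁ g₂ ↔ Before U V g₁ g₂) :=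
    fun g₁ g₂ g h₁ h₂ => (Before.drop_iff h₁ h₂ [] []).2
  have B₁ : ∀ g₁ g₂ g, g₁ ≠ g → g₂ ≠ g → (Before (U ++ [g]) V g₁ g₂ ↔ Before U V g₁ g₂) :=
    fun g₁ g₂ g h₁ h₂ => by simpa using (Before.drop_iff (U := U) (V := V) h₁ h₂ [] []).1
  have C₀ : ∀ (a₁ a₂ : A) (g₁ g₂ : ℕ) (z : A × ℕ) r, g₁ ≠ z.2 → g₂ ≠ z.2 →
      (CrossAt U V false 0 [(a₁, g₁), (a₂, g₂), z] r ↔ g₁ ≠ g₂ ∧ (r = [(a₂, g₂), (a₁, g₁), z] ∨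
        a₁ = a₂ ∧ Before U V g₁ g₂ ∧ r = [(a₁, g₁), (a₂, g₂), z])) := by
    intro a₁ a₂ g₁ g₂ z r h₁ h₂
    have := crossAt_block (U := U) (V := V) (k := false) (s := []) (t := [z]) (r := r)
      (a := a₁) (b := a₂) (d := g₁) (e := g₂)
    simpa [B₀ _ _ _ h₁ h₂] using this
  have C₁ : ∀ (a₁ a₂ : A) (g₁ g₂ : ℕ) (z : A × ℕ) r, g₁ ≠ z.2 → g₂ ≠ z.2 →
      (CrossAt U V false 1 [z, (a₁, g₁), (a₂, g₂)] r ↔ g₁ ≠ g₂ ∧ (r = [z, (a₂, g₂), (a₁, g₁)] ∨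
        a₁ = a₂ ∧ Before U V g₁ g₂ ∧ r = [z, (a₁, g₁), (a₂, g₂)])) := by
    intro a₁ a₂ g₁ g₂ z r h₁ h₂
    have := crossAt_block (U := U) (V := V) (k := false) (s := [z]) (t := []) (r := r)
      (a := a₁) (b := a₂) (d := g₁) (e := g₂)
    simpa [B₁ _ _ _ h₁ h₂] using this
  have ed := Ne.symm hde
  have fd := Ne.symm hdf
  have fe := Ne.symm hef
  simp only [regular_cons, regular_nil, CrossWord] at h ⊢
  obtain ⟨m₁, h₁, m₂, h₂, m₃, h₃, rfl⟩ := h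
  obtain ⟨-, rfl | ⟨rfl, hb₁, rfl⟩⟩ := (C₀ _ _ _ _ _ _ (by assumption) (by assumption)).1 h₁ <;>
  obtain ⟨-, rfl | ⟨rfl, hb₂, rfl⟩⟩ := (C₁ _ _ _ _ _ _ (by assumption) (by assumption)).1 h₂ <;>
  obtain ⟨-, rfl | ⟨hab, hb₃, rfl⟩⟩ := (C₀ _ _ _ _ _ _ (by assumption) (by assumption)).1 h₃
  · exact ⟨_, (C₁ _ _ _ _ _ _ (by assumption) (by assumption)).2 ⟨by assumption, .inl rfl⟩,
      _, (C₀ _ _ _ _ _ _ (by assumption) (by assumption)).2 ⟨by assumption, .inl rfl⟩,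
      _, (C₁ _ _ _ _ _ _ (by assumption) (by assumption)).2 ⟨by assumption, .inl rfl⟩, rfl⟩
  · exact ⟨_, (C₁ _ _ _ _ _ _ (by assumption) (by assumption)).2 ⟨by assumption, .inr ⟨hab, hb₃, rfl⟩⟩,
      _, (C₀ _ _ _ _ _ _ (by assumption) (by assumption)).2 ⟨by assumption, .inl rfl⟩,
      _, (C₁ _ _ _ _ _ _ (by assumption) (by assumption)).2 ⟨by assumption, .inl rfl⟩, rfl⟩
  · exact ⟨_, (C₁ _ _ _ _ _ _ (by assumption) (by assumption)).2 ⟨by assumption, .inl rfl⟩,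
      _, (C₀ _ _ _ _ _ _ (by assumption) (by assumption)).2 ⟨by assumption, .inr ⟨rfl, hb₂, rfl⟩⟩,
      _, (C₁ _ _ _ _ _ _ (by assumption) (by assumption)).2 ⟨by assumption, .inl rfl⟩, rfl⟩
  · exact ⟨_, (C₁ _ _ _ _ _ _ (by assumption) (by assumption)).2 ⟨by assumption,
        .inr ⟨hab, htrans _ _ _ (by simp) hb₃ hb₂, rfl⟩⟩,
      _, (C₀ _ _ _ _ _ _ (by assumption) (by assumption)).2 ⟨by assumption, .inl rfl⟩,
      _, (C₁ _ _ _ _ _ _ (by assumption) (by assumption)).2 ⟨by assumption, .inr ⟨rfl, hb₂, rfl⟩⟩, rfl⟩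
  · exact ⟨_, (C₁ _ _ _ _ _ _ (by assumption) (by assumption)).2 ⟨by assumption, .inl rfl⟩,
      _, (C₀ _ _ _ _ _ _ (by assumption) (by assumption)).2 ⟨by assumption, .inl rfl⟩,
      _, (C₁ _ _ _ _ _ _ (by assumption) (by assumption)).2 ⟨by assumption, .inr ⟨rfl, hb₁, rfl⟩⟩, rfl⟩
  · rcases pair_sublist_total hef (hmem e (by simp)) (hmem f (by simp)) with hb | hb
    · exact ⟨_, (C₁ _ _ _ _ _ _ (by assumption) (by assumption)).2 ⟨by assumption, .inr ⟨hab, hb, rfl⟩⟩,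
        _, (C₀ _ _ _ _ _ _ (by assumption) (by assumption)).2 ⟨by assumption, .inr ⟨rfl, hb₁, rfl⟩⟩,
        _, (C₁ _ _ _ _ _ _ (by assumption) (by assumption)).2 ⟨by assumption, .inl rfl⟩, rfl⟩
    · exact ⟨_, (C₁ _ _ _ _ _ _ (by assumption) (by assumption)).2 ⟨by assumption, .inl rfl⟩,
        _, (C₀ _ _ _ _ _ _ (by assumption) (by assumption)).2 ⟨by assumption, .inr ⟨hab, hb₃, rfl⟩⟩,
        _, (C₁ _ _ _ _ _ _ (by assumption) (by assumption)).2 ⟨by assumption, .inr ⟨hab.symm, hb, rfl⟩⟩, rfl⟩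
  · exact ⟨_, (C₁ _ _ _ _ _ _ (by assumption) (by assumption)).2 ⟨by assumption, .inr ⟨rfl, hb₂, rfl⟩⟩,
      _, (C₀ _ _ _ _ _ _ (by assumption) (by assumption)).2 ⟨by assumption, .inl rfl⟩,
      _, (C₁ _ _ _ _ _ _ (by assumption) (by assumption)).2 ⟨by assumption,
        .inr ⟨rfl, htrans _ _ _ (by simp) hb₁ hb₂, rfl⟩⟩, rfl⟩
  · exact ⟨_, (C₁ _ _ _ _ _ _ (by assumption) (by assumption)).2 ⟨by assumption, .inr ⟨rfl, hb₂, rfl⟩⟩,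
      _, (C₀ _ _ _ _ _ _ (by assumption) (by assumption)).2 ⟨by assumption, .inr ⟨rfl, hb₁, rfl⟩⟩,
      _, (C₁ _ _ _ _ _ _ (by assumption) (by assumption)).2 ⟨by assumption, .inr ⟨rfl, hb₂, rfl⟩⟩, rfl⟩

theorem simulates_three {w w' : List ℕ} (hw : ∀ q ∈ w, q ≤ 1) (hw1 : 1 ∈ w) (hw' : ∀ q ∈ w', q ≤ 1)
    (h : ∀ (U V : List ℕ) (x y z : A × ℕ) (r : Stack A), Balanced U V [x, y, z] →
      CrossWord U V (regular w) [x, y, z] r → CrossWord U V (regular w') [x, y, z] r) (p : ℕ) :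
    Simulates A (w.map (p + ·)) (w'.map (p + ·)) := by
  intro U V l r hl hlr
  have hlen : p + 1 + 2 ≤ l.length := hlr.fits (p + 1, false) (by simpa [regular] using hw1)
  obtain ⟨s, t₀, rfl, rfl⟩ : ∃ s t, l = s ++ t ∧ s.length = p :=
    ⟨_, _, (List.take_append_drop p l).symm, by rw [List.length_take]; omega⟩
  rcases t₀ with _ | ⟨x, _ | ⟨y, _ | ⟨z, t⟩⟩⟩
  · simp at hlen; omega
  · simp at hlen
  · simp at hlen
  have hfit : ∀ w : List ℕ, (∀ q ∈ w, q ≤ 1) → Fits (regular w) [x, y, z].length := by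
    intro w hw z hz
    obtain ⟨q, hq, rfl⟩ := List.mem_map.1 hz
    have := hw q hq
    simpa using this
  rw [← shiftWord_regular, crossWord_append_left] at hlr
  obtain ⟨r', rfl, hlr⟩ := hlr
  rw [show x :: y :: z :: t = [x, y, z] ++ t from rfl, crossWord_append_right (hfit w hw)] at hlr
  obtain ⟨r', rfl, hlr⟩ := hlr
  refine ⟨1, fun _ _ => rfl, ?_⟩
  rw [relabel_eq_self (by simp), ← shiftWord_regular, crossWord_append_left]
  refine ⟨_, rfl, ?_⟩
  rw [show x :: y :: z :: t = [x, y, z] ++ t from rfl, crossWord_append_right (hfit w' hw')]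
  exact ⟨_, rfl, h _ _ _ _ _ _ (Balanced.mid (s := s) (t := t) (by simpa using hl)) hlr⟩

theorem simulates_three_forward (p : ℕ) : Simulates A [p, p + 1, p] [p + 1, p, p + 1] :=
  simulates_three (w := [0, 1, 0]) (w' := [1, 0, 1]) (by simp) (by simp) (by simp)
    (fun _ _ _ _ _ _ hl h => simulates_three_block hl h) p

theorem simulates_three_backward (p : ℕ) : Simulates A [p + 1, p, p + 1] [p, p + 1, p] := by
  refine simulates_three (w := [1, 0, 1]) (w' := [0, 1, 0]) (by simp) (by simp) (by simp)
    (fun U V x y z r hl h => ?_) p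
  have := (simulates_three_block (x := (-z.1, z.2)) (by simpa using hl.flip)
    (by simpa [flipWord] using h.flip)).flip
  simpa [flipWord] using this

theorem BraidEq.simulates {w w' : List ℕ} (h : BraidEq w w') :
    Simulates A w w' ∧ Simulates A w' w := by
  induction h with
  | refl w => exact ⟨fun U V l r _ h => ⟨1, fun _ _ => rfl, by rwa [relabel_eq_self (by simp)]⟩,
      fun U V l r _ h => ⟨1, fun _ _ => rfl, by rwa [relabel_eq_self (by simp)]⟩⟩
  | symm _ ih => exact ih.symm
  | trans _ _ ih ih' => exact ⟨ih.1.trans ih'.1, ih'.2.trans ih.2⟩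
  | far x y h =>
    have h₁ := simulates_far (A := A) h
    exact ⟨by simpa using h₁.context x y, by simpa using h₁.mirror.context x y⟩
  | three x y p =>
    exact ⟨by simpa using (simulates_three_forward p).context x y,
      by simpa using (simulates_three_backward p).context x y⟩

/-- If all pieces of a block are different, no renaming is needed. -/
theorem BraidEq.crossWord {w w' : List ℕ} (h : BraidEq w w') {l r : Stack A}
    (hl : Balanced U V l) (hn : (pieces l).Nodup) (hw : CrossWord U V (regular w) l r) :
    CrossWord U V (regular w') l r := by
  obtain ⟨σ, hσ, h'⟩ := h.simulates.1 U V l r hl hw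
  rwa [relabel_eq_self] at h'
  intro d hd
  refine hσ d ?_
  have hd' := hw.perm_pieces.subset hd
  have := hl.count d hd'
  rw [List.count_append, List.count_append, List.count_eq_one_of_mem hn hd'] at this
  by_contra hc
  rw [not_or, not_or] at hc
  rw [List.count_eq_zero_of_not_mem hc.1, List.count_eq_zero_of_not_mem hc.2.1] at this
  omega

end

/-! ### Reduced words -/

/-- The word `w` of adjacent transpositions leads from the list `L` to the list `M`, and each of
them brings two neighbours into the order in which they appear in `T`. -/
def Sorts (T : List ℕ) : List ℕ → List ℕ → List ℕ → Prop
  | [], L, M => L = M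
  | q :: w, L, M => ∃ s i j t, s.length = q ∧ L = s ++ i :: j :: t ∧ [j, i].Sublist T ∧
      Sorts T w (s ++ j :: i :: t) M

theorem sorts_append {T w w' L M : List ℕ} :
    Sorts T (w ++ w') L M ↔ ∃ N, Sorts T w L N ∧ Sorts T w' N M := by
  induction w generalizing L with
  | nil => simp [Sorts]
  | cons q w ih =>
    simp only [List.cons_append, Sorts, ih]
    constructor
    · rintro ⟨s, i, j, t, h₁, h₂, h₃, N, h₄, h₅⟩; exact ⟨N, ⟨s, i, j, t, h₁, h₂, h₃, h₄⟩, h₅⟩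
    · rintro ⟨N, ⟨s, i, j, t, h₁, h₂, h₃, h₄⟩, h₅⟩; exact ⟨s, i, j, t, h₁, h₂, h₃, N, h₄, h₅⟩

theorem Sorts.perm {T w L M : List ℕ} (h : Sorts T w L M) : M.Perm L := by
  induction w generalizing L with
  | nil => exact .of_eq (Eq.symm h)
  | cons q w ih =>
    obtain ⟨s, i, j, t, -, rfl, -, h⟩ := h
    exact (ih h).trans (List.Perm.append_left s (List.Perm.swap _ _ _))

theorem Sorts.fits {T w L M : List ℕ} (h : Sorts T w L M) : Fits (regular w) L.length := by
  induction w generalizing L with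
  | nil => simp [Fits]
  | cons q w ih =>
    obtain ⟨s, i, j, t, rfl, rfl, -, h⟩ := h
    have := ih h
    intro z hz
    rcases List.mem_cons.1 hz with rfl | hz
    · simp
    · simpa using this z hz

theorem Sorts.mono {T T' w L M : List ℕ} (h : Sorts T w L M) (hT : T.Sublist T') :
    Sorts T' w L M := by
  induction w generalizing L with
  | nil => exact h
  | cons q w ih =>
    obtain ⟨s, i, j, t, h₁, h₂, h₃, h₄⟩ := h
    exact ⟨s, i, j, t, h₁, h₂, h₃.trans hT, ih h₄⟩

theorem Sorts.append_right {T w L M : List ℕ} (h : Sorts T w L M) (N : List ℕ) :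
    Sorts T w (L ++ N) (M ++ N) := by
  induction w generalizing L with
  | nil => exact congrArg (· ++ N) h
  | cons q w ih =>
    obtain ⟨s, i, j, t, h₁, rfl, h₃, h₄⟩ := h
    exact ⟨s, i, j, t ++ N, h₁, by simp, h₃, by simpa using ih h₄⟩

theorem Sorts.append_left {T w L M : List ℕ} (h : Sorts T w L M) (N : List ℕ) :
    Sorts T (w.map (N.length + ·)) (N ++ L) (N ++ M) := by
  induction w generalizing L with
  | nil => exact congrArg (N ++ ·) h
  | cons q w ih =>
    obtain ⟨s, i, j, t, rfl, rfl, h₃, h₄⟩ := h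
    exact ⟨N ++ s, i, j, t, by simp, by simp, h₃, by simpa using ih h₄⟩

theorem Sorts.map {T w L M : List ℕ} (h : Sorts T w L M) (f : ℕ → ℕ) :
    Sorts (T.map f) w (L.map f) (M.map f) := by
  induction w generalizing L with
  | nil => exact congrArg _ h
  | cons q w ih =>
    obtain ⟨s, i, j, t, rfl, rfl, h₃, h₄⟩ := h
    exact ⟨s.map f, f i, f j, t.map f, by simp, by simp, by simpa using h₃.map f,
      by simpa using ih h₄⟩

theorem Sorts.reverse {T w L M : List ℕ} (h : Sorts T w L M) :
    Sorts T.reverse w.reverse M L := by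
  induction w generalizing L with
  | nil => exact Eq.symm h
  | cons q w ih =>
    obtain ⟨s, i, j, t, rfl, rfl, h₃, h₄⟩ := h
    rw [List.reverse_cons, sorts_append]
    exact ⟨_, ih h₄, s, j, i, t, rfl, rfl, by simpa using h₃.reverse, rfl⟩

/-- Reflect a word of transpositions of a list of length `n`. -/
theorem Sorts.flip {T w L M : List ℕ} (h : Sorts T w L M) :
    Sorts T.reverse (w.map (L.length - 2 - ·)) L.reverse M.reverse := by
  induction w generalizing L with
  | nil => exact congrArg _ h
  | cons q w ih =>
    obtain ⟨s, i, j, t, rfl, rfl, h₃, h₄⟩ := h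
    refine ⟨t.reverse, j, i, s.reverse, by simp; omega, by simp, by simpa using h₃.reverse, ?_⟩
    simpa using ih h₄

theorem pair_sublist_asymm {α : Type} {T : List α} (hT : T.Nodup) {i j : α}
    (h : [i, j].Sublist T) (h' : [j, i].Sublist T) : False := by
  induction T with
  | nil => simp at h
  | cons a T ih =>
    rw [List.nodup_cons] at hT
    rcases List.sublist_cons_iff.1 h with h₁ | ⟨r, hr, h₁⟩
    · rcases List.sublist_cons_iff.1 h' with h₂ | ⟨r, hr, h₂⟩
      · exact ih hT.2 h₁ h₂
      · simp at hr; obtain ⟨rfl, rfl⟩ := hr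
        exact hT.1 (h₁.subset (by simp))
    · simp at hr; obtain ⟨rfl, rfl⟩ := hr
      rcases List.sublist_cons_iff.1 h' with h₂ | ⟨r, hr, h₂⟩
      · exact hT.1 (h₂.subset (by simp))
      · simp at hr; obtain ⟨rfl, rfl⟩ := hr
        exact hT.1 (by simpa using h₁)

/-- The transpositions of a reduced word only concern pairs in the order of the initial list. -/
theorem Sorts.of_reduced {R w L M : List ℕ} (hR : R.Nodup) (h : Sorts R w L M) :
    Sorts L.reverse w L M := by
  suffices H : ∀ S : List ℕ, (∀ i j, [i, j].Sublist L → [j, i].Sublist R → [i, j].Sublist S) →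
      Sorts S.reverse w L M from H L fun _ _ h _ => h
  intro S hS
  induction w generalizing L with
  | nil => exact h
  | cons q w ih =>
    obtain ⟨s, i, j, t, h₁, rfl, h₃, h₄⟩ := h
    have hij : [i, j].Sublist S := hS i j (by
      refine List.Sublist.trans ?_ (List.sublist_append_right _ _)
      simp) h₃
    refine ⟨s, i, j, t, h₁, rfl, by simpa using hij.reverse, ih h₄ fun i' j' h' h'' => ?_⟩
    refine hS i' j' ?_ h''
    rw [pair_sublist_append] at h' ⊢
    rcases h' with h' | ⟨h', h₅⟩ | h'
    · exact .inl h'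
    · exact .inr (.inl ⟨h', by simp at h₅ ⊢; tauto⟩)
    · right; right
      rcases List.sublist_cons_iff.1 h' with h' | ⟨r, hr, h'⟩
      · rcases List.sublist_cons_iff.1 h' with h' | ⟨r, hr, h'⟩
        · exact (h'.cons _).cons _
        · simp at hr; obtain ⟨rfl, rfl⟩ := hr
          exact (h'.cons _).cons_cons _
      · simp at hr; obtain ⟨rfl, rfl⟩ := hr
        rcases List.sublist_cons_iff.1 h' with h' | ⟨r, hr, h'⟩
        · exact (h'.cons_cons _).cons _
        · simp at hr; obtain ⟨rfl, rfl⟩ := hr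
          exact (pair_sublist_asymm hR h₃ h'').elim

theorem append_pair_inj {s t s' t' : List ℕ} {i j i' j' : ℕ}
    (h : s ++ i :: j :: t = s' ++ i' :: j' :: t') (hs : s.length = s'.length) :
    s = s' ∧ i = i' ∧ j = j' ∧ t = t' := by
  obtain ⟨rfl, h⟩ := List.append_inj h hs
  simpa using h

theorem append_pair_far {s t s' t' : List ℕ} {i j i' j' : ℕ}
    (h : s ++ i :: j :: t = s' ++ i' :: j' :: t') (hs : s.length + 2 ≤ s'.length) :
    ∃ x, s' = s ++ i :: j :: x ∧ t = x ++ i' :: j' :: t' := by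
  have h' : (s ++ [i, j]) ++ t = s' ++ (i' :: j' :: t') := by simpa using h
  obtain ⟨x, rfl, rfl⟩ := append_eq_append_of_le h'.symm (by simpa using hs)
  exact ⟨x, by simp, rfl⟩

/-- The exchange property: a reduced word can be replaced by one that starts with any given
transposition of neighbours in the wrong order. -/
theorem Sorts.exchange {R : List ℕ} (hR : R.Nodup) (n : ℕ) {w s t : List ℕ} {i j : ℕ}
    (hn : w.length ≤ n) (h : Sorts R w (s ++ i :: j :: t) R) (hij : [j, i].Sublist R) :
    ∃ w', w'.length + 1 = w.length ∧ Sorts R w' (s ++ j :: i :: t) R ∧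
      BraidEq w (s.length :: w') := by
  induction n generalizing w s t i j with
  | zero =>
    obtain rfl : w = [] := List.length_eq_zero_iff.1 (by omega)
    have h : s ++ i :: j :: t = R := h
    refine (pair_sublist_asymm hR hij ?_).elim
    rw [← h]
    exact List.Sublist.trans (by simp) (List.sublist_append_right _ _)
  | succ n ih =>
    rcases w with _ | ⟨q, w⟩
    · exact ih (by simp) h hij
    · obtain ⟨s', i', j', t', rfl, hL, hij', h⟩ := h
      simp only [List.length_cons, Nat.add_le_add_iff_right] at hn
      rcases lt_trichotomy s.length s'.length with hlt | heq | hlt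
      · rcases Nat.lt_or_ge (s.length + 1) s'.length with hlt' | hge
        · obtain ⟨x, rfl, rfl⟩ := append_pair_far hL hlt'
          obtain ⟨w', hw', h', hb⟩ := ih (s := s) (t := x ++ j' :: i' :: t') hn (by simpa using h) hij
          refine ⟨(s ++ i :: j :: x).length :: w', by simp [hw'],
            ⟨s ++ j :: i :: x, i', j', t', by simp, by simp, hij', by simpa using h'⟩, ?_⟩
          exact (hb.cons _).trans (BraidEq.far [] w' (by simp)).symm
        · obtain ⟨rfl, hL'⟩ := List.append_inj (s₁ := s ++ [i]) (t₁ := j :: t)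
            (by simpa using hL) (by simp; omega)
          simp only [List.cons.injEq] at hL'
          obtain ⟨rfl, rfl⟩ := hL'
          have hji : [j', i].Sublist R :=
            pair_sublist_trans (List.count_eq_one_of_mem hR (hij.subset (by simp))) hij' hij
          obtain ⟨w₁, hw₁, h₁, hb₁⟩ := ih (s := s) (t := j :: t') hn (by simpa using h) hji
          obtain ⟨w₂, hw₂, h₂, hb₂⟩ := ih (w := w₁) (s := s ++ [j']) (t := t') (by omega)
            (by simpa using h₁) hij
          refine ⟨(s.length + 1) :: s.length :: w₂, by simp; omega,
            ⟨s ++ [j], i, j', t', by simp, by simp, hji, s, j, j', i :: t', rfl, by simp, hij',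
              by simpa using h₂⟩, ?_⟩
          rw [show (s ++ [i]).length = s.length + 1 by simp]
          rw [show (s ++ [j']).length = s.length + 1 by simp] at hb₂
          exact ((hb₁.trans (hb₂.cons _)).cons _).trans (BraidEq.three [] w₂ s.length).symm
      · obtain ⟨rfl, rfl, rfl, rfl⟩ := append_pair_inj hL heq
        exact ⟨w, rfl, h, .refl _⟩
      · rcases Nat.lt_or_ge (s'.length + 1) s.length with hlt' | hge
        · obtain ⟨x, rfl, rfl⟩ := append_pair_far hL.symm hlt'
          obtain ⟨w', hw', h', hb⟩ := ih (s := s' ++ j' :: i' :: x) (t := t) hn (by simpa using h) hij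
          refine ⟨s'.length :: w', by simp [hw'],
            ⟨s', i', j', x ++ j :: i :: t, by simp, by simp, hij', by simpa using h'⟩, ?_⟩
          rw [show (s' ++ j' :: i' :: x).length = (s' ++ i' :: j' :: x).length by simp] at hb
          exact (hb.cons _).trans (BraidEq.far [] w' (by simp))
        · obtain ⟨rfl, hL'⟩ := List.append_inj (s₁ := s' ++ [i']) (t₁ := j' :: t')
            (s₂ := s) (t₂ := i :: j :: t) (by simpa using hL.symm) (by simp; omega)
          simp only [List.cons.injEq] at hL'
          obtain ⟨rfl, rfl⟩ := hL'
          have hji : [j, i'].Sublist R :=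
            pair_sublist_trans (List.count_eq_one_of_mem hR (hij.subset (by simp))) hij hij'
          obtain ⟨w₁, hw₁, h₁, hb₁⟩ := ih (s := s' ++ [j']) (t := t) hn (by simpa using h) hji
          obtain ⟨w₂, hw₂, h₂, hb₂⟩ := ih (w := w₁) (s := s') (t := i' :: t) (by omega)
            (by simpa using h₁) hij
          refine ⟨s'.length :: (s'.length + 1) :: w₂, by simp; omega,
            ⟨s', i', j, j' :: t, rfl, by simp, hji, s' ++ [j], i', j', t, by simp, by simp, hij',
              by simpa using h₂⟩, ?_⟩
          rw [show (s' ++ [i']).length = s'.length + 1 by simp]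
          rw [show (s' ++ [j']).length = s'.length + 1 by simp] at hb₁
          exact ((hb₁.trans (hb₂.cons _)).cons _).trans (BraidEq.three [] w₂ s'.length)

/-- Two reduced words for the same permutation are related by braid moves. -/
theorem Sorts.braidEq {R w w' L : List ℕ} (hR : R.Nodup) (h : Sorts R w L R)
    (h' : Sorts R w' L R) : BraidEq w w' := by
  induction w' generalizing w L with
  | nil =>
    obtain rfl : L = R := h'
    rcases w with _ | ⟨q, w⟩
    · exact .refl _
    · obtain ⟨s, i, j, t, -, rfl, hij, -⟩ := h
      refine (pair_sublist_asymm hR hij ?_).elim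
      exact List.Sublist.trans (by simp) (List.sublist_append_right _ _)
  | cons q w' ih =>
    obtain ⟨s, i, j, t, rfl, rfl, hij, h'⟩ := h'
    obtain ⟨w₁, -, h₁, hb⟩ := h.exchange hR _ le_rfl hij
    exact hb.trans ((ih h₁ h').cons _)

theorem Sorts.range {T s t : List ℕ} {i : ℕ} (h : ∀ j ∈ s, [j, i].Sublist T) :
    Sorts T (List.range s.length) (i :: (s ++ t)) (s ++ i :: t) := by
  induction s with
  | nil => rfl
  | cons j s ih =>
    rw [List.length_cons, List.range_succ_eq_map]
    refine ⟨[], i, j, s ++ t, rfl, rfl, h j (by simp), ?_⟩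
    have := (ih fun j hj => h j (by simp [hj])).append_left [j]
    simpa [Nat.add_comm 1] using this

/-- The sorting braid of a list is a reduced word. -/
theorem sorts_sortBraid {lt : ℕ → ℕ → Bool} {L T : List ℕ} (hT : T.Nodup) (hLT : L.Perm T)
    (hlt : ∀ x ∈ T, ∀ y ∈ T, x ≠ y → (lt y x = true ↔ [y, x].Sublist T)) :
    Sorts T (sortBraid lt L) L T := by
  induction L generalizing T with
  | nil => exact (List.nil_perm.1 hLT).symm
  | cons x L ih =>
    obtain ⟨s, t, rfl⟩ := List.append_of_mem (hLT.subset (List.mem_cons_self (a := x) (l := L)))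
    have hst : (s ++ t).Sublist (s ++ x :: t) :=
      (List.Sublist.refl s).append (List.sublist_cons_self x t)
    have hL : L.Perm (s ++ t) := (List.perm_cons x).1 (hLT.trans List.perm_middle)
    have hx : x ∉ s ++ t := (List.nodup_cons.1 ((List.perm_middle.nodup_iff).1 hT)).1
    have hpair : ∀ y z, y ≠ x → z ≠ x → ([y, z].Sublist (s ++ x :: t) ↔ [y, z].Sublist (s ++ t)) := by
      intro y z hy hz
      rw [← pair_sublist_filter (p := (· ≠ x)) (by simpa) (by simpa),
        ← pair_sublist_filter (p := (· ≠ x)) (by simpa) (by simpa) (s ++ t)]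
      simp
    have ih := ih (hT.sublist hst) hL fun y hy z hz hyz => by
      rw [hlt y (hst.subset hy) z (hst.subset hz) hyz]
      exact hpair z y (by rintro rfl; exact hx hz) (by rintro rfl; exact hx hy)
    rw [sortBraid, sorts_append]
    have h₁ := (ih.mono hst).append_left [x]
    refine ⟨x :: (s ++ t), by simpa [Nat.add_comm 1] using h₁, ?_⟩
    have hs : ∀ y ∈ s, [y, x].Sublist (s ++ x :: t) := fun y hy =>
      (pair_sublist_append _ _ _ _).2 (.inr (.inl ⟨hy, by simp⟩))
    have ht : ∀ y ∈ t, ¬ [y, x].Sublist (s ++ x :: t) := fun y hy h =>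
      pair_sublist_asymm hT h ((pair_sublist_append _ _ _ _).2 (.inr (.inr (by simpa using hy))))
    have hcount : (L.countP fun y => lt y x) = s.length := by
      rw [hL.countP_eq, List.countP_append]
      rw [List.countP_eq_length.2 fun y hy => (hlt x (by simp) y (by simp [hy])
          (by rintro rfl; exact hx (by simp [hy]))).2 (hs y hy),
        List.countP_eq_zero.2 fun y hy h => ht y hy ((hlt x (by simp) y (by simp [hy])
          (by rintro rfl; exact hx (by simp [hy]))).1 h)]
      rfl
    rw [hcount]
    exact Sorts.range hs

theorem exists_sorts {L T : List ℕ} (hT : T.Nodup) (hLT : L.Perm T) : ∃ w, Sorts T w L T :=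
  ⟨_, sorts_sortBraid (lt := fun y x => decide ([y, x].Sublist T)) hT hLT (by simp)⟩

section

variable [CommRing A]

/-- The pieces that enter a half-twist are pairwise different. -/
theorem nodup_of_halfTwist {U V : List ℕ} {l r : Stack A} {L w : List ℕ} (hL : L.Nodup)
    (hlen : L.length = l.length) (hl : Balanced U V l) (hw : Sorts L.reverse w L L.reverse)
    (h : CrossWord U V (regular w) l r) : (pieces l).Nodup := by
  induction L generalizing U V l r w with
  | nil => simp at hlen; simp [List.eq_nil_of_length_eq_zero hlen.symm]
  | cons i L ih =>
    rcases l with _ | ⟨⟨a, d⟩, l⟩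
    · simp at hlen
    have hL' := List.nodup_cons.1 hL
    have h₁ : Sorts (i :: L).reverse (List.range L.length) (i :: L) (L ++ [i]) := by
      have := Sorts.range (T := (i :: L).reverse) (s := L) (t := []) (i := i) (by
        intro j hj
        rw [List.reverse_cons]
        exact (pair_sublist_append _ _ _ _).2 (.inr (.inl ⟨by simpa, by simp⟩)))
      simpa using this
    obtain ⟨w', h₂⟩ := exists_sorts (L := L) (List.nodup_reverse.2 hL'.2) L.reverse_perm.symm
    have h₃ : Sorts (i :: L).reverse (List.range L.length ++ w') (i :: L) (i :: L).reverse := by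
      refine sorts_append.2 ⟨_, h₁, ?_⟩
      rw [List.reverse_cons]
      exact (h₂.mono (List.sublist_append_left _ _)).append_right [i]
    obtain ⟨σ, -, h₄⟩ := (hw.braidEq (List.nodup_reverse.2 hL) h₃).simulates.1 U V _ _ hl h
    rw [regular_append, crossWord_append] at h₄
    obtain ⟨m, h₅, h₆⟩ := h₄
    simp only [List.length_cons, Nat.add_right_cancel_iff] at hlen
    have hb := h₅.balanced hl
    rw [hlen] at h₅
    obtain ⟨l', f, rfl, h₇⟩ := crossWord_down.1 h₅
    have hlen' : L.length = l'.length := by rw [h₇.length_eq, hlen]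
    obtain ⟨r', -, h₈⟩ := (crossWord_append_right (hlen' ▸ h₂.fits)).1 h₆
    exact h₇.nodup hl.count (ih (U := U) (V := pieces [(a, f)] ++ V) hL'.2 hlen'
      (by simpa using Balanced.mid (s := []) (t := [(a, f)]) hb) h₂ h₈)

end

/-! ### Rulings near a vertex -/

/-- The strands of a list of named strands. -/
def strands (l : Named A) : Stack A := l.map Prod.snd

/-- The names of a list of named strands. -/
def labels (l : Named A) : List ℕ := l.map Prod.fst

/-- The named strands whose partner under `P` has a name in `N`. -/
def through (P : ℕ → ℕ) (N : List ℕ) (l : Named A) : Named A :=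
  l.filter fun z => P z.1 ∈ N

@[simp] theorem strands_nil : strands ([] : Named A) = [] := rfl
@[simp] theorem strands_cons (z : ℕ × A × ℕ) (l : Named A) :
    strands (z :: l) = z.2 :: strands l := rfl
@[simp] theorem strands_append (l m : Named A) :
    strands (l ++ m) = strands l ++ strands m := by simp [strands]
@[simp] theorem length_strands (l : Named A) : (strands l).length = l.length := by
  simp [strands]
@[simp] theorem labels_nil : labels ([] : Named A) = [] := rfl
@[simp] theorem labels_cons (z : ℕ × A × ℕ) (l : Named A) :
    labels (z :: l) = z.1 :: labels l := rfl
@[simp] theorem labels_append (l m : Named A) :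
    labels (l ++ m) = labels l ++ labels m := by simp [labels]
@[simp] theorem length_labels (l : Named A) : (labels l).length = l.length := by
  simp [labels]
@[simp] theorem through_nil (P : ℕ → ℕ) (N : List ℕ) : through P N ([] : Named A) = [] :=
  rfl
@[simp] theorem through_append (P : ℕ → ℕ) (N : List ℕ) (l m : Named A) :
    through P N (l ++ m) = through P N l ++ through P N m := by simp [through]
theorem through_cons (P : ℕ → ℕ) (N : List ℕ) (z : ℕ × A × ℕ) (l : Named A) :
    through P N (z :: l) = if P z.1 ∈ N then z :: through P N l else through P N l := by
  simp [through, List.filter_cons]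

theorem mem_labels {l : Named A} {n : ℕ} : n ∈ labels l ↔ ∃ z ∈ l, z.1 = n := by
  simp only [labels, List.mem_map]

theorem mem_through {N : List ℕ} {l : Named A} {z : ℕ × A × ℕ} :
    z ∈ through P N l ↔ z ∈ l ∧ P z.1 ∈ N := by simp [through]

theorem mem_pieces_strands {l : Named A} {d : ℕ} :
    d ∈ pieces (strands l) ↔ ∃ z ∈ l, z.2.2 = d := by
  simp [pieces, strands]

theorem eq_of_mem_of_labels_nodup {l : Named A} (h : (labels l).Nodup) {z z' : ℕ × A × ℕ}
    (hz : z ∈ l) (hz' : z' ∈ l) (h' : z.1 = z'.1) : z = z' :=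
  List.inj_on_of_nodup_map h hz hz' h'

/-- The conditions on a matching `P` of the half-edges of a vertex and the pieces near the vertex
that do not concern the crossings of its resolution. -/
structure VertexPairs (P : ℕ → ℕ) (l r : Named A) : Prop where
  nodup : (labels l ++ labels r).Nodup
  invol : ∀ n ∈ labels l ++ labels r, P n ∈ labels l ++ labels r ∧ P n ≠ n ∧ P (P n) = n
  left : ∀ z ∈ l, ∀ z' ∈ l, P z.1 = z'.1 → z.2.2 = z'.2.2
  right : ∀ z ∈ r, ∀ z' ∈ r, P z.1 = z'.1 → z.2.2 = z'.2.2

/-- The vertex with named half-edges `l` on the left and `r` on the right can be passed by a ruling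
that uses its resolution along `P`. -/
structure VertexRel (P : ℕ → ℕ) (U V : List ℕ) (l r : Named A) : Prop
    extends VertexPairs P l r where
  distinct : (pieces (strands (through P (labels r) l))).Nodup
  braid : ∃ w, Sorts (labels (through P (labels l) r)) w
      ((labels (through P (labels r) l)).map P) (labels (through P (labels l) r)) ∧
    CrossWord U V (regular w) (strands (through P (labels r) l)) (strands (through P (labels l) r))

/-- A strand runs from `x`, between `l₁` and `l₂` on the left of a vertex, to `y`, below the
half-edges `r` on the right of the vertex, and the ruling switches as at a half-edge. -/
structure ExtRel (P : ℕ → ℕ) (U V : List ℕ) (l₁ : Named A) (x : A × ℕ)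
    (l₂ r : Named A) (y : A × ℕ) : Prop extends VertexPairs P (l₁ ++ l₂) r where
  distinct : (pieces (strands (through P (labels r) l₁) ++
    x :: strands (through P (labels r) l₂))).Nodup
  braid : ∃ w, Sorts ((labels (through P (labels (l₁ ++ l₂)) r)).map (· + 1) ++ [0]) w
      ((labels (through P (labels r) l₁)).map (P · + 1) ++
        0 :: (labels (through P (labels r) l₂)).map (P · + 1))
      ((labels (through P (labels (l₁ ++ l₂)) r)).map (· + 1) ++ [0]) ∧
    CrossWord U V (regular w)
      (strands (through P (labels r) l₁) ++ x :: strands (through P (labels r) l₂))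
      (strands (through P (labels (l₁ ++ l₂)) r) ++ [y])

/-- The pieces of the cusps that join half-edges in `l`, where `N` are the names of the half-edges
on the other side of the vertex. -/
def cuspPieces (P : ℕ → ℕ) (N : List ℕ) (l : Named A) (g : ℕ) : Bool :=
  decide (g ∈ pieces (strands (l.filter fun z => P z.1 ∉ N)))

theorem VertexPairs.exists_partner {l r : Named A} (h : VertexPairs P l r)
    {z : ℕ × A × ℕ} (hz : z ∈ l) (hP : P z.1 ∉ labels r) :
    ∃ z' ∈ l, z'.1 = P z.1 ∧ z' ≠ z ∧ P z'.1 = z.1 ∧ P z'.1 ∉ labels r ∧ z'.2.2 = z.2.2 := by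
  obtain ⟨h₁, h₂, h₃⟩ := h.invol z.1 (by simp [mem_labels]; exact .inl ⟨_, _, hz⟩)
  have h₄ : P z.1 ∈ labels l := by simpa [hP] using h₁
  obtain ⟨z', hz', h₅⟩ := mem_labels.1 h₄
  refine ⟨z', hz', h₅, by rintro rfl; exact h₂ h₅.symm, by rw [h₅, h₃], ?_,
    (h.left z hz z' hz' h₅.symm).symm⟩
  rw [h₅, h₃]
  exact fun h₆ => (List.nodup_append.1 h.nodup).2.2 _ (mem_labels.2 ⟨z, hz, rfl⟩) _ h₆ rfl

theorem count_pieces_strands (l : Named A) (g : ℕ) :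
    (pieces (strands l)).count g = (l.filter (·.2.2 = g)).length := by
  rw [pieces, strands, List.map_map, List.count, List.countP_map, List.countP_eq_length_filter]
  rfl

theorem le_count_of_mem {l k : Named A} {g : ℕ} (hk : k.Nodup)
    (h : ∀ z ∈ k, z ∈ l ∧ z.2.2 = g) : k.length ≤ (pieces (strands l)).count g := by
  rw [count_pieces_strands]
  exact (List.subperm_of_subset hk fun z hz => List.mem_filter.2 (by simpa using h z hz)).length_le

theorem VertexPairs.cuspPieces_iff {l r : Named A} (h : VertexPairs P l r)
    (hc : ∀ g, (pieces (strands l)).count g ≤ 2) {z : ℕ × A × ℕ} (hz : z ∈ l) :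
    cuspPieces P (labels r) l z.2.2 = true ↔ P z.1 ∉ labels r := by
  rw [cuspPieces, decide_eq_true_iff, mem_pieces_strands]
  constructor
  · rintro ⟨z₁, hz₁, h₁⟩ hP
    simp only [decide_not, List.mem_filter, Bool.not_eq_eq_eq_not, Bool.not_true,
      decide_eq_false_iff_not] at hz₁
    obtain ⟨z₂, hz₂, -, hne, -, h₂, h₃⟩ := h.exists_partner hz₁.1 hz₁.2
    have : [z, z₁, z₂].Nodup := by
      simp only [List.nodup_cons, List.mem_cons, List.not_mem_nil, or_false, not_or]
      refine ⟨⟨?_, ?_⟩, hne.symm, by simp⟩ <;> rintro rfl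
      · exact hz₁.2 hP
      · exact h₂ hP
    have := le_count_of_mem (l := l) (g := z.2.2) this (by simp [hz, hz₁.1, hz₂, h₁, h₃])
    have := hc z.2.2
    simp at *
    omega
  · intro hP
    exact ⟨z, by simp [hz, hP], rfl⟩

theorem VertexPairs.count_of_cuspPieces {l r : Named A}
    (h : VertexPairs P l r) (hc : ∀ g, (pieces (strands l)).count g ≤ 2) {g : ℕ}
    (hg : cuspPieces P (labels r) l g = true) : (pieces (strands l)).count g = 2 := by
  rw [cuspPieces, decide_eq_true_iff, mem_pieces_strands] at hg
  obtain ⟨z₁, hz₁, rfl⟩ := hg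
  simp only [decide_not, List.mem_filter, Bool.not_eq_eq_eq_not, Bool.not_true,
    decide_eq_false_iff_not] at hz₁
  obtain ⟨z₂, hz₂, -, hne, -, h₂, h₃⟩ := h.exists_partner hz₁.1 hz₁.2
  refine le_antisymm (hc _) ?_
  exact le_count_of_mem (k := [z₁, z₂]) (by simp [hne.symm]) (by simp [hz₁.1, hz₂, h₃])

theorem forget_strands_of_iff {N : List ℕ} {K : ℕ → Bool} {l : Named A}
    (h : ∀ z ∈ l, K z.2.2 = true ↔ P z.1 ∉ N) : forget K (strands l) = strands (through P N l) := by
  induction l with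
  | nil => rfl
  | cons z l ih =>
    have hz := h z (by simp)
    rw [strands_cons, forget_cons, through_cons, ih fun z hz => h z (by simp [hz])]
    by_cases hP : P z.1 ∈ N
    · simp [hP, show K z.2.2 = false by simpa [hP] using hz]
    · simp [hP, hz.2 hP]

theorem AgreeOn.of_labels_eq {K : ℕ → Bool} {l m : Named A} {Q : ℕ → Prop}
    (h : AgreeOn K (strands l) (strands m)) (hlm : labels m = labels l) :
    ((∀ z ∈ m, K z.2.2 = true ↔ Q z.1) ↔ (∀ z ∈ l, K z.2.2 = true ↔ Q z.1)) ∧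
      ∀ z, K z.2.2 = true → (z ∈ l ↔ z ∈ m) := by
  induction l generalizing m with
  | nil =>
    rcases m with _ | ⟨z, m⟩
    · simp
    · simp at hlm
  | cons z l ih =>
    rcases m with _ | ⟨z', m⟩
    · simp at hlm
    · obtain ⟨n, a, d⟩ := z
      obtain ⟨n', a', d'⟩ := z'
      simp only [labels_cons, List.cons.injEq] at hlm
      obtain ⟨rfl, hlm⟩ := hlm
      cases h with
      | cons h₁ h =>
        obtain ⟨h₁, h₂, h₃⟩ := h₁
        simp only at h₁ h₂ h₃
        obtain ⟨ih₁, ih₂⟩ := ih h hlm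
        subst h₁
        refine ⟨by simp only [List.forall_mem_cons, ih₁, h₂], fun z hz => ?_⟩
        rw [List.mem_cons, List.mem_cons, ih₂ z hz]
        refine or_congr_left ?_
        constructor <;> rintro rfl
        · rw [h₃ hz]
        · rw [h₃ (h₂.trans hz)]

theorem VertexPairs.congr_left {l m r : Named A} (h : VertexPairs P l r)
    (hlm : labels m = labels l) (hm : ∀ z ∈ m, P z.1 ∉ labels r → z ∈ l) : VertexPairs P m r where
  nodup := by rw [hlm]; exact h.nodup
  invol := by rw [hlm]; exact h.invol
  left z hz z' hz' hP := by
    have hd := (List.nodup_append.1 h.nodup).2.2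
    have h₁ : z.1 ∈ labels l := hlm ▸ mem_labels.2 ⟨z, hz, rfl⟩
    have h₂ : z'.1 ∈ labels l := hlm ▸ mem_labels.2 ⟨z', hz', rfl⟩
    refine h.left z (hm z hz fun h₃ => hd _ h₂ _ h₃ hP.symm) z' (hm z' hz' fun h₃ => ?_) hP
    rw [← hP, (h.invol z.1 (by simp [h₁])).2.2] at h₃
    exact hd _ h₁ _ h₃ rfl
  right := h.right

theorem labels_through (P : ℕ → ℕ) (N : List ℕ) (l : Named A) :
    labels (through P N l) = (labels l).filter fun n => P n ∈ N := by
  simp [labels, through, List.filter_map, Function.comp_def]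

theorem Paired.filter {U V L : List ℕ} (h : Paired U V L) (p : ℕ → Bool) :
    Paired (U.filter p) (V.filter p) (L.filter p) := by
  intro d hd
  obtain ⟨hd, hp⟩ := List.mem_filter.1 hd
  rw [← List.filter_append, ← List.filter_append, List.count_filter hp]
  exact h d hd

section

variable [CommRing A]

theorem Balanced.paired {l : Stack A} (h : Balanced U V l) :
    Paired U V (pieces l) := h.count

theorem Balanced.count_le {l : Stack A} (h : Balanced U V l) (d : ℕ) :
    (pieces l).count d ≤ 2 := by
  by_cases hd : d ∈ pieces l
  · have := h.count d hd
    simp only [List.count_append] at this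
    omega
  · simp [List.count_eq_zero_of_not_mem hd]

theorem Balanced.not_mem_of_count {l : Stack A} (h : Balanced U V l) {d : ℕ}
    (hd : (pieces l).count d = 2) : d ∉ U ∧ d ∉ V := by
  have := h.count d (List.count_pos_iff.1 (by omega))
  simp only [List.count_append] at this
  simp only [← List.count_eq_zero]
  omega

theorem Balanced.right_part {s l : Stack A} (h : Balanced U V (s ++ l)) :
    Balanced (U ++ pieces s) V l := by
  simpa using Balanced.mid (s := s) (l := l) (t := []) (by simpa using h)

theorem Balanced.left_part {l t : Stack A} (h : Balanced U V (l ++ t)) :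
    Balanced U (pieces t ++ V) l := by
  simpa using Balanced.mid (s := []) (l := l) (t := t) (by simpa using h)

theorem Balanced.down {s l m : Stack A} {a : A} {e f : ℕ}
    (hl : Balanced U V (s ++ (a, e) :: l)) (hd : Down V a (U ++ pieces s) e l m f) :
    Balanced U V (s ++ m ++ [(a, f)]) := by
  have h₁ := crossWord_append_left.2 ⟨_, rfl, crossWord_down.2 ⟨m, f, rfl, hd⟩⟩
  simpa using h₁.balanced hl

theorem filter_not_eq_self {K : ℕ → Bool} {U : List ℕ} (h : ∀ d ∈ U, K d = false) :
    U.filter (!K ·) = U := by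
  rw [List.filter_eq_self]
  intro d hd
  simp [h d hd]

theorem sorts_down {N K₁ K₂ w : List ℕ} (h : Sorts N w (K₁ ++ K₂) N) :
    Sorts (N.map (· + 1) ++ [0]) ((List.range K₂.length).map (K₁.length + ·) ++ w)
      (K₁.map (· + 1) ++ 0 :: K₂.map (· + 1)) (N.map (· + 1) ++ [0]) := by
  rw [sorts_append]
  refine ⟨(K₁ ++ K₂).map (· + 1) ++ [0], ?_, ?_⟩
  · have := (Sorts.range (T := N.map (· + 1) ++ [0]) (s := K₂.map (· + 1)) (t := []) (i := 0)
      fun j hj => (pair_sublist_append _ _ _ _).2 (.inr (.inl ⟨?_, by simp⟩))).append_left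
        (K₁.map (· + 1))
    · simpa using this
    · obtain ⟨j', hj', rfl⟩ := List.mem_map.1 hj
      exact List.mem_map_of_mem (h.perm.symm.subset (by simp [hj']))
  · exact ((h.map (· + 1)).mono (List.sublist_append_left _ _)).append_right [0]

theorem ExtRel.of_down {l₁ l₂ m r : Named A} {a : A} {e f : ℕ}
    (hl : Balanced U V (strands l₁ ++ (a, e) :: strands l₂)) (he : e ∉ pieces (strands l₁))
    (hlab : labels m = labels l₂)
    (hd : Down V a (U ++ pieces (strands l₁)) e (strands l₂) (strands m) f)
    (hv : VertexRel P U (f :: V) (l₁ ++ m) r) : ExtRel P U V l₁ (a, e) l₂ r (a, f) := by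
  have hb := hl.down hd
  have hb₁ : Balanced U (f :: V) (strands (l₁ ++ m)) := by simpa using hb.left_part
  set K := cuspPieces P (labels r) (l₁ ++ m) with hKdef
  have hK₂ : ∀ g, K g = true → (pieces (strands (l₁ ++ m))).count g = 2 := fun g hg =>
    hv.count_of_cuspPieces hb₁.count_le hg
  have hK : ∀ z ∈ l₁ ++ m, K z.2.2 = true ↔ P z.1 ∉ labels r := fun z hz =>
    hv.cuspPieces_iff hb₁.count_le hz
  have hKU : ∀ d, K d = true → d ∉ U ∧ d ∉ f :: V := fun d hd => hb₁.not_mem_of_count (hK₂ d hd)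
  have hpair : Paired (U ++ pieces (strands l₁)) V (e :: pieces (strands l₂)) := hl.right_part.paired
  obtain ⟨h₁, h₂, h₃, h₄⟩ := hd.forget hpair rfl he (K := K) fun g hg => by
    simpa using hK₂ g hg
  have hKl₂ := ((h₃.of_labels_eq hlab (Q := fun n => P n ∉ labels r)).1).1
    fun z hz => hK z (by simp [hz])
  have e₁ : forget K (strands l₁) = strands (through P (labels r) l₁) :=
    forget_strands_of_iff fun z hz => hK z (by simp [hz])
  have e₂ : forget K (strands l₂) = strands (through P (labels r) l₂) :=
    forget_strands_of_iff hKl₂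
  have e₃ : forget K (strands m) = strands (through P (labels r) m) :=
    forget_strands_of_iff fun z hz => hK z (by simp [hz])
  have fU : U.filter (!K ·) = U := filter_not_eq_self fun d hd => by
    by_contra h; exact (hKU d (by simpa using h)).1 hd
  have fV : V.filter (!K ·) = V := filter_not_eq_self fun d hd => by
    by_contra h; exact (hKU d (by simpa using h)).2 (by simp [hd])
  have hpair' := hpair.filter (!K ·)
  rw [List.filter_append, fU, fV, ← pieces_forget, e₁, List.filter_cons, h₁, ← pieces_forget,
    e₂] at hpair'
  replace hpair' : Paired (U ++ pieces (strands (through P (labels r) l₁))) V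
    (e :: pieces (strands (through P (labels r) l₂))) := by simpa using hpair'
  rw [List.filter_append, fU, fV, ← pieces_forget, e₁, e₂, e₃] at h₄
  have he' : e ∉ pieces (strands (through P (labels r) l₁)) := fun h => he (by
    rw [← e₁, pieces_forget] at h
    exact List.mem_of_mem_filter h)
  have hlab' : labels (l₁ ++ m) = labels (l₁ ++ l₂) := by simp [hlab]
  refine ⟨hv.toVertexPairs.congr_left hlab'.symm ?_, ?_, ?_⟩
  · intro z hz hP
    rcases List.mem_append.1 hz with hz | hz
    · simp [hz]
    · rw [List.mem_append, ← (h₃.of_labels_eq hlab (Q := fun n => P n ∉ labels r)).2 z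
        ((hKl₂ z hz).2 hP)]
      exact .inr hz
  · have h₅ := hv.distinct
    have h₆ := h₄.not_mem_end hpair' rfl he'
    rw [through_append, strands_append, pieces_append] at h₅
    rw [pieces_append, pieces_cons]
    refine (List.Perm.nodup_iff ((h₄.perm.append_left _).symm)).2 ?_
    rw [List.perm_middle.nodup_iff, List.nodup_cons]
    exact ⟨h₆, h₅⟩
  · obtain ⟨w, h₅, h₆⟩ := hv.braid
    rw [hlab', through_append P _ l₁, labels_append (through P (labels r) l₁), List.map_append] at h₅
    rw [hlab'] at h₆
    have hlm : labels (through P (labels r) m) = labels (through P (labels r) l₂) := by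
      rw [labels_through, labels_through, hlab]
    have h₇ := sorts_down h₅
    simp only [List.map_map, Function.comp_def, hlm] at h₇
    refine ⟨_, h₇, ?_⟩
    rw [List.length_map, List.length_map, length_labels, length_labels, ← length_strands,
      ← length_strands, regular_append, ← shiftWord_regular, crossWord_append]
    refine ⟨_, crossWord_append_left.2 ⟨_, rfl, crossWord_down.2 ⟨_, _, rfl, h₄⟩⟩, ?_⟩
    rw [← List.append_assoc, ← strands_append, ← through_append]
    exact (crossWord_append_right h₆.fits).2 ⟨_, rfl, by simpa using h₆⟩

theorem Balanced.forget {l : Stack A} (h : Balanced U V l) (K : ℕ → Bool) :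
    Balanced U V (forget K l) where
  count d hd := by
    rw [pieces_forget] at hd ⊢
    obtain ⟨hd, hK⟩ := List.mem_filter.1 hd
    rw [List.count_append, List.count_append, List.count_filter (p := (!K ·)) hK, ← List.count_append,
      ← List.count_append]
    exact h.count d hd
  pot a b d hab := h.pot a b d (hab.trans List.filter_sublist)

theorem ExtRel.exists_down {l₁ l₂ r : Named A} {a : A} {e : ℕ}
    {y : A × ℕ} (hl : Balanced U V (strands l₁ ++ (a, e) :: strands l₂))
    (h : ExtRel P U V l₁ (a, e) l₂ r y) :
    ∃ m f, y = (a, f) ∧ labels m = labels l₂ ∧ e ∉ pieces (strands l₁) ∧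
      Down V a (U ++ pieces (strands l₁)) e (strands l₂) (strands m) f ∧
      VertexRel P U (f :: V) (l₁ ++ m) r := by
  have hc : ∀ g, (pieces (strands (l₁ ++ l₂))).count g ≤ 2 := fun g => by
    refine (List.Sublist.count_le g ?_).trans (hl.count_le g)
    simp
  set K := cuspPieces P (labels r) (l₁ ++ l₂) with hKdef
  have hK₂ : ∀ g, K g = true → (pieces (strands (l₁ ++ l₂))).count g = 2 := fun g hg =>
    h.count_of_cuspPieces hc hg
  have hK : ∀ z ∈ l₁ ++ l₂, K z.2.2 = true ↔ P z.1 ∉ labels r := fun z hz =>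
    h.cuspPieces_iff hc hz
  have hKc : ∀ d, K d = true → d ∉ U ∧ d ∉ V ∧ d ≠ e := fun d hd => by
    have h₁ := hK₂ d hd
    have h₀ : d ∈ pieces (strands (l₁ ++ l₂)) := List.count_pos_iff.1 (by omega)
    have h₂ := hl.count d (by simp at h₀ ⊢; tauto)
    simp [List.count_cons] at h₁ h₂
    refine ⟨?_, ?_, ?_⟩
    · rw [← List.count_eq_zero]; omega
    · rw [← List.count_eq_zero]; omega
    · rintro rfl; simp at h₂; omega
  have hKe : K e = false := by
    by_contra h; exact (hKc e (by simpa using h)).2.2 rfl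
  have e₁ : LegendrianFront.forget K (strands l₁) = strands (through P (labels r) l₁) :=
    forget_strands_of_iff fun z hz => hK z (by simp [hz])
  have e₂ : LegendrianFront.forget K (strands l₂) = strands (through P (labels r) l₂) :=
    forget_strands_of_iff fun z hz => hK z (by simp [hz])
  have fU : U.filter (!K ·) = U := filter_not_eq_self fun d hd => by
    by_contra h; exact (hKc d (by simpa using h)).1 hd
  have fV : V.filter (!K ·) = V := filter_not_eq_self fun d hd => by
    by_contra h; exact (hKc d (by simpa using h)).2.1 hd
  have hb := hl.forget K
  rw [forget_append, forget_cons, e₁, e₂] at hb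
  simp only [hKe, Bool.false_eq_true, if_false] at hb
  have he : e ∉ pieces (strands l₁) := fun he => by
    have hd := h.distinct
    rw [pieces_append, pieces_cons, List.perm_middle.nodup_iff, List.nodup_cons] at hd
    refine hd.1 (List.mem_append_left _ ?_)
    rw [← e₁, pieces_forget]
    exact List.mem_filter.2 ⟨he, by simp [hKe]⟩
  obtain ⟨w, h₁, h₂⟩ := h.braid
  set N := labels (through P (labels (l₁ ++ l₂)) r) with hN
  have hNn : N.Nodup := (List.filter_sublist.map _).nodup (List.nodup_append.1 h.nodup).2.1
  have hN' : (N.map (· + 1) ++ [0]).Nodup := by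
    rw [List.nodup_append]
    exact ⟨hNn.map fun _ _ => by simp, by simp, by simp⟩
  obtain ⟨w', h₃⟩ := exists_sorts (L := (labels (through P (labels r) l₁)).map P ++
    (labels (through P (labels r) l₂)).map P) hNn (by
      have := h₁.perm
      have := (List.perm_append_comm.trans this).trans List.perm_middle
      have := (List.perm_cons _).1 this
      have := this.map (· - 1)
      simpa [Function.comp_def] using this.symm)
  have h₄ := sorts_down h₃
  simp only [List.map_map, Function.comp_def] at h₄
  have h₅ := (Sorts.braidEq hN' h₁ h₄).crossWord hb h.distinct h₂
  rw [regular_append, List.length_map, crossWord_append, List.length_map,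
    length_labels, length_labels, ← length_strands, ← length_strands, ← shiftWord_regular] at h₅
  obtain ⟨q, h₆, h₇⟩ := h₅
  obtain ⟨q', rfl, h₈⟩ := crossWord_append_left.1 h₆
  obtain ⟨m', f, rfl, h₉⟩ := crossWord_down.1 h₈
  rw [← List.append_assoc] at h₇
  have hfit : Fits (regular w') (strands (through P (labels r) l₁) ++ m').length := by
    have := h₃.fits
    simpa [h₉.length_eq] using this
  obtain ⟨q, hq, h₁₀⟩ := (crossWord_append_right hfit).1 h₇
  obtain ⟨rfl, hy⟩ := List.append_inj' hq rfl
  simp only [List.cons.injEq, and_true] at hy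
  subst hy
  have h₁₁ : Down (V.filter (!K ·)) a ((U ++ pieces (strands l₁)).filter (!K ·)) e
      (LegendrianFront.forget K (strands l₂)) m' f := by
    rw [List.filter_append, fU, fV, ← pieces_forget, e₁, e₂]
    exact h₉
  obtain ⟨l', h₁₂, h₁₃, h₁₄⟩ := Down.of_forget hKe h₁₁
  have hlen : (labels l₂).length = l'.length := by simp [h₁₂.length_eq]
  obtain ⟨m, hm, rfl⟩ : ∃ m : Named A, labels m = labels l₂ ∧ strands m = l' :=
    ⟨(labels l₂).zip l', List.map_fst_zip hlen.le, List.map_snd_zip hlen.ge⟩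
  have hKm := ((h₁₃.of_labels_eq hm (Q := fun n => P n ∉ labels r)).1).2
    fun z hz => hK z (by simp [hz])
  have e₃ : LegendrianFront.forget K (strands m) = strands (through P (labels r) m) :=
    forget_strands_of_iff hKm
  have hlab : labels (l₁ ++ m) = labels (l₁ ++ l₂) := by simp [hm]
  refine ⟨m, f, rfl, hm, he, h₁₂, h.toVertexPairs.congr_left hlab ?_, ?_, ?_⟩
  · intro z hz hP
    rcases List.mem_append.1 hz with hz | hz
    · simp [hz]
    · exact List.mem_append_right _ (((h₁₃.of_labels_eq hm
        (Q := fun n => P n ∉ labels r)).2 z ((hKm z hz).2 hP)).2 hz)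
  · have hd := h.distinct
    rw [pieces_append, pieces_cons] at hd
    rw [through_append, strands_append, pieces_append, ← e₃, h₁₄]
    have := ((h₉.perm.append_left (pieces (strands (through P (labels r) l₁)))).nodup_iff).2 hd
    rw [List.perm_middle.nodup_iff, List.nodup_cons] at this
    exact this.2
  · refine ⟨w', ?_, ?_⟩
    · rw [hlab, through_append, labels_append (through P (labels r) l₁), List.map_append,
        labels_through P (labels r) m, hm, ← labels_through]
      exact h₃
    · rw [hlab, through_append, strands_append, ← e₃, h₁₄]
      simpa using h₁₀

end

/-! ### Symmetries of the vertex relation -/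

theorem through_congr {N N' : List ℕ} {l : Named A}
    (h : ∀ z ∈ l, P z.1 ∈ N ↔ P z.1 ∈ N') : through P N l = through P N' l :=
  List.filter_congr fun z hz => by simp [h z hz]

@[simp] theorem through_reverse_names (P : ℕ → ℕ) (N : List ℕ) (l : Named A) :
    through P N.reverse l = through P N l := through_congr fun _ _ => List.mem_reverse

theorem VertexPairs.mirror {l r : Named A} (h : VertexPairs P l r) :
    VertexPairs P r l where
  nodup := List.perm_append_comm.nodup_iff.1 h.nodup
  invol n hn := by
    have := h.invol n (by simp at hn ⊢; tauto)
    refine ⟨?_, this.2⟩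
    have := this.1
    simp only [List.mem_append] at this ⊢
    tauto
  left := h.right
  right := h.left

theorem VertexPairs.partner_eq {l r : Named A} (h : VertexPairs P l r)
    {L : List ℕ} (hL : ∀ n ∈ L, n ∈ labels l ++ labels r) : (L.map P).map P = L := by
  rw [List.map_map]
  exact (List.map_congr_left fun n hn => (h.invol n (hL n hn)).2.2).trans (List.map_id _)

theorem mem_labels_through {N : List ℕ} {l : Named A} {n : ℕ} :
    n ∈ labels (through P N l) ↔ n ∈ labels l ∧ P n ∈ N := by
  rw [labels_through]; simp

theorem VertexRel.mirror {l r : Named A}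
    (h : VertexRel P U V l r) : VertexRel P U V r l where
  toVertexPairs := h.toVertexPairs.mirror
  distinct := by
    obtain ⟨w, -, hw⟩ := h.braid
    exact hw.perm_pieces.nodup_iff.2 h.distinct
  braid := by
    obtain ⟨w, h₁, h₂⟩ := h.braid
    refine ⟨w.reverse, ?_, by simpa [regular] using h₂.mirror⟩
    have hN : (labels (through P (labels l) r)).Nodup :=
      (List.filter_sublist.map _).nodup (List.nodup_append.1 h.nodup).2.1
    have h₃ := ((h₁.of_reduced hN).reverse.map P)
    rw [List.reverse_reverse, h.toVertexPairs.partner_eq] at h₃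
    · exact h₃
    · intro n hn
      rw [mem_labels_through] at hn
      simp [hn.1]

section

variable [CommRing A]

/-- A list of named strands turned upside down. -/
def flipNamed (l : Named A) : Named A :=
  (l.map fun z => (z.1, -z.2.1, z.2.2)).reverse

@[simp] theorem flipNamed_flipNamed (l : Named A) : flipNamed (flipNamed l) = l := by
  simp [flipNamed, Function.comp_def]
@[simp] theorem strands_flipNamed (l : Named A) :
    strands (flipNamed l) = flipStack (strands l) := by
  simp [flipNamed, strands, flipStack, Function.comp_def]
@[simp] theorem labels_flipNamed (l : Named A) :
    labels (flipNamed l) = (labels l).reverse := by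
  simp [flipNamed, labels, Function.comp_def]
@[simp] theorem through_flipNamed (P : ℕ → ℕ) (N : List ℕ) (l : Named A) :
    through P N (flipNamed l) = flipNamed (through P N l) := by
  simp [flipNamed, through, List.filter_map, Function.comp_def]
theorem mem_flipNamed {l : Named A} {z : ℕ × A × ℕ} :
    z ∈ flipNamed l ↔ (z.1, -z.2.1, z.2.2) ∈ l := by
  simp only [flipNamed, List.mem_reverse, List.mem_map]
  constructor
  · rintro ⟨z, hz, rfl⟩; simpa using hz
  · intro h; exact ⟨_, h, by simp⟩

theorem VertexPairs.flip {l r : Named A} (h : VertexPairs P l r) :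
    VertexPairs P (flipNamed l) (flipNamed r) where
  nodup := by
    rw [labels_flipNamed, labels_flipNamed]
    exact (((labels l).reverse_perm.append (labels r).reverse_perm).nodup_iff).2 h.nodup
  invol n hn := by
    have := h.invol n (by simpa using hn)
    simpa using this
  left z hz z' hz' hP := h.left (z.1, -z.2.1, z.2.2) (mem_flipNamed.1 hz) (z'.1, -z'.2.1, z'.2.2)
    (mem_flipNamed.1 hz') hP
  right z hz z' hz' hP := h.right (z.1, -z.2.1, z.2.2) (mem_flipNamed.1 hz)
    (z'.1, -z'.2.1, z'.2.2) (mem_flipNamed.1 hz') hP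

theorem flipWord_regular (n : ℕ) (w : List ℕ) :
    flipWord n (regular w) = regular (w.map (n - 2 - ·)) := by
  simp [flipWord, regular, Function.comp_def]

theorem VertexRel.flip {l r : Named A}
    (h : VertexRel P U V l r) :
    VertexRel P V.reverse U.reverse (flipNamed l) (flipNamed r) where
  toVertexPairs := h.toVertexPairs.flip
  distinct := by simpa using h.distinct
  braid := by
    obtain ⟨w, h₁, h₂⟩ := h.braid
    have h₃ := h₁.flip
    have h₄ := h₂.flip
    rw [flipWord_regular] at h₄
    refine ⟨w.map ((strands (through P (labels r) l)).length - 2 - ·), ?_, ?_⟩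
    · simpa using h₃
    · simpa using h₄

/-- A strand turned upside down. -/
def flipStrand (x : A × ℕ) : A × ℕ := (-x.1, x.2)

theorem ExtRel.turn {l r : Named A} {x y : A × ℕ}
    (h : ExtRel P U V [] x l r y) :
    ExtRel P V.reverse U.reverse [] (flipStrand y) (flipNamed r) (flipNamed l) (flipStrand x) where
  toVertexPairs := h.toVertexPairs.mirror.flip
  distinct := by
    obtain ⟨w, -, h₂⟩ := h.braid
    have := h₂.perm_pieces.nodup_iff.2 h.distinct
    simp only [through_nil, strands_nil, List.nil_append, labels_flipNamed, through_reverse_names,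
      through_flipNamed, strands_flipNamed, pieces_cons, pieces_flipStack, flipStrand] at this ⊢
    rw [pieces_append] at this
    have := List.nodup_reverse.2 this
    simpa using this
  braid := by
    obtain ⟨w, h₁, h₂⟩ := h.braid
    have hlen := h₁.perm.length_eq
    have hw := h₂.mirror.flip
    simp only [through_nil, labels_nil, List.map_nil, List.nil_append] at h₁ h₂ hlen hw
    have hN : ((labels (through P (labels l) r)).map (· + 1) ++ [0]).Nodup := by
      rw [List.nodup_append]
      refine ⟨((List.filter_sublist.map _).nodup (List.nodup_append.1 h.nodup).2.1).map
        fun _ _ => by simp, by simp, by simp⟩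
    have h₃ := ((h₁.of_reduced hN).reverse.flip.map fun n => if n = 0 then 0 else P (n - 1) + 1)
    have e : ((labels (through P (labels r) l)).map fun n => P (P n) + 1) =
        (labels (through P (labels r) l)).map (· + 1) := List.map_congr_left fun n hn => by
      rw [mem_labels_through] at hn
      rw [(h.invol n (by simp [hn.1])).2.2]
    have hr : (regular w).reverse = regular w.reverse := by simp [regular]
    rw [hr, flipWord_regular] at hw
    refine ⟨w.reverse.map ((strands (through P (labels l) r) ++ [y]).length - 2 - ·), ?_, ?_⟩
    · simp [Function.comp_def, e] at h₃
      simpa [Function.comp_def] using h₃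
    · simpa [flipStrand] using hw

theorem Down.turn {a : A} {d f : ℕ} {l l' : Stack A}
    (h : Down V a U d l l' f) :
    Down U.reverse (-a) V.reverse f (flipStack l') (flipStack l) d := by
  have h₁ := (crossWord_down.2 ⟨l', f, rfl, h⟩).mirror.flip
  have hr : (regular (List.range l.length)).reverse = regular (List.range l.length).reverse := by
    simp [regular]
  rw [hr, flipWord_regular] at h₁
  have e : (List.range l.length).reverse.map ((l' ++ [(a, f)]).length - 2 - ·) =
      List.range (flipStack l').length := by
    apply List.ext_getElem
    · simp [h.length_eq]
    · intro i hi hi'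
      simp [h.length_eq] at hi hi' ⊢
      omega
  rw [e, flipStack_append, flipStack_cons, flipStack_cons] at h₁
  obtain ⟨m, g, h₂, h₃⟩ := crossWord_down.1 h₁
  obtain ⟨rfl, h₄⟩ := List.append_inj' h₂ rfl
  simp only [List.cons.injEq, Prod.mk.injEq, and_true, true_and] at h₄
  rwa [h₄]

end

/-! ### Pairs of half-edges -/

theorem extRel_iff {l₁ l₂ r : Named A} {t h : ℕ} {x y : A × ℕ}
    (hth : P t = h) (hht : P h = t)
    (hn : (labels (l₁ ++ (t, x) :: l₂) ++ labels (r ++ [(h, y)])).Nodup) :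
    VertexRel P U V (l₁ ++ (t, x) :: l₂) (r ++ [(h, y)]) ↔ ExtRel P U V l₁ x l₂ r y := by
  have hsub : (labels (l₁ ++ l₂) ++ labels r).Sublist
      (labels (l₁ ++ (t, x) :: l₂) ++ labels (r ++ [(h, y)])) := by
    simp
  have ht : t ∉ labels (l₁ ++ l₂) ++ labels r := by
    simp [List.nodup_append] at hn ⊢
    grind
  have hh : h ∉ labels (l₁ ++ l₂) ++ labels r := by
    simp [List.nodup_append] at hn ⊢
    grind
  have hne : t ≠ h := by
    simp [List.nodup_append] at hn
    grind
  have e₁ : (∀ n ∈ labels (l₁ ++ l₂) ++ labels r, P (P n) = n) →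
      ∀ z ∈ l₁ ++ l₂, P z.1 ∈ labels (r ++ [(h, y)]) ↔ P z.1 ∈ labels r := fun hP z hz => by
    have hz' : z.1 ∈ labels (l₁ ++ l₂) := mem_labels.2 ⟨z, hz, rfl⟩
    simp only [labels_append, labels_cons, labels_nil, List.mem_append, List.mem_cons,
      List.not_mem_nil, or_false, or_iff_left_iff_imp]
    intro h₁
    have := hP z.1 (List.mem_append_left _ hz')
    rw [h₁, hht] at this
    exact absurd (List.mem_append_left _ hz') (this ▸ ht)
  have e₂ : (∀ n ∈ labels (l₁ ++ l₂) ++ labels r, P (P n) = n) →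
      ∀ z ∈ r, P z.1 ∈ labels (l₁ ++ (t, x) :: l₂) ↔ P z.1 ∈ labels (l₁ ++ l₂) := fun hP z hz => by
    have hz' : z.1 ∈ labels r := mem_labels.2 ⟨z, hz, rfl⟩
    simp only [labels_append, labels_cons, List.mem_append, List.mem_cons]
    have : P z.1 ≠ t := fun h₁ => by
      have := hP z.1 (List.mem_append_right _ hz')
      rw [h₁, hth] at this
      exact absurd (List.mem_append_right _ hz') (this ▸ hh)
    tauto
  have f₁ : ∀ hP : (∀ n ∈ labels (l₁ ++ l₂) ++ labels r, P (P n) = n),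
      through P (labels (r ++ [(h, y)])) (l₁ ++ (t, x) :: l₂) =
        through P (labels r) l₁ ++ (t, x) :: through P (labels r) l₂ := fun hP => by
    rw [through_append, through_cons, if_pos (by simp [hth]),
      through_congr (l := l₁) fun z hz => e₁ hP z (by simp [hz]),
      through_congr (l := l₂) fun z hz => e₁ hP z (by simp [hz])]
  have f₂ : ∀ hP : (∀ n ∈ labels (l₁ ++ l₂) ++ labels r, P (P n) = n),
      through P (labels (l₁ ++ (t, x) :: l₂)) (r ++ [(h, y)]) =
        through P (labels (l₁ ++ l₂)) r ++ [(h, y)] := fun hP => by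
    rw [through_append, through_cons, if_pos (by simp [hht]), through_congr (e₂ hP), through_nil]
  have g₁ : ∀ N : List ℕ, (∀ n ∈ N, n ≠ h) →
      N.map (fun n => if n = h then 0 else n + 1) = N.map (· + 1) := fun N hN =>
    List.map_congr_left fun n hn => if_neg (hN n hn)
  have g₂ : ∀ N : List ℕ, (N.map (· + 1)).map (fun n => if n = 0 then h else n - 1) = N := fun N => by
    simp [Function.comp_def]
  constructor
  · intro H
    have hP : ∀ n ∈ labels (l₁ ++ l₂) ++ labels r, P (P n) = n := fun n hn =>
      (H.invol n (hsub.subset hn)).2.2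
    obtain ⟨w, h₁, h₂⟩ := H.braid
    have h₀ := H.distinct
    rw [f₁ hP, strands_append, strands_cons] at h₀
    rw [f₁ hP, f₂ hP, strands_append, strands_cons, strands_append] at h₂
    rw [f₁ hP, f₂ hP, labels_append (through P (labels (l₁ ++ l₂)) r),
        labels_append (through P (labels r) l₁), labels_cons, labels_cons, List.map_append,
        List.map_cons] at h₁
    refine ⟨⟨hn.sublist hsub, fun n hn' => ?_, ?_, ?_⟩, h₀, w, ?_, h₂⟩
    · obtain ⟨h₃, h₄, h₅⟩ := H.invol n (hsub.subset hn')
      refine ⟨?_, h₄, h₅⟩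
      have h₆ : P n ≠ t := fun h₆ => hh (by rw [← hth, ← h₆, h₅]; exact hn')
      have h₇ : P n ≠ h := fun h₇ => ht (by rw [← hht, ← h₇, h₅]; exact hn')
      simp at h₃ ⊢
      tauto
    · exact fun z hz z' hz' => H.left z (by simp at hz ⊢; tauto) z' (by simp at hz' ⊢; tauto)
    · exact fun z hz z' hz' => H.right z (by simp [hz]) z' (by simp [hz'])
    · have h₃ := h₁.map fun n => if n = h then 0 else n + 1
      have k₁ : ∀ n ∈ labels (through P (labels (l₁ ++ l₂)) r), n ≠ h := fun n hn₁ e => by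
        rw [mem_labels_through, e] at hn₁
        exact hh (by simp [hn₁.1])
      have k₂ : ∀ l' : Named A, ∀ n ∈ (labels (through P (labels r) l')).map P, n ≠ h := by
        intro l' n hn
        obtain ⟨n', hn', rfl⟩ := List.mem_map.1 hn
        rw [mem_labels_through] at hn'
        intro e
        exact hh (by rw [e] at hn'; simp [hn'.2])
      rw [List.map_append, List.map_append, g₁ _ k₁, g₁ _ (k₂ _), List.map_cons,
        List.map_cons, g₁ _ (k₂ _)] at h₃
      simpa [Function.comp_def, hth] using h₃
  · intro H
    have hP : ∀ n ∈ labels (l₁ ++ l₂) ++ labels r, P (P n) = n := fun n hn => (H.invol n hn).2.2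
    obtain ⟨w, h₁, h₂⟩ := H.braid
    have hcase : ∀ n ∈ labels (l₁ ++ (t, x) :: l₂) ++ labels (r ++ [(h, y)]),
        n = t ∨ n = h ∨ n ∈ labels (l₁ ++ l₂) ++ labels r := fun n hn => by
      simp at hn ⊢; tauto
    have hP' : ∀ n ∈ labels (l₁ ++ l₂) ++ labels r, P n ≠ t ∧ P n ≠ h := fun n hn => by
      have := H.invol n hn
      exact ⟨fun e => ht (e ▸ this.1), fun e => hh (e ▸ this.1)⟩
    refine ⟨⟨hn, fun n hn' => ?_, ?_, ?_⟩, ?_, w, ?_, ?_⟩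
    · rcases hcase n hn' with rfl | rfl | hn'
      · exact ⟨by simp [hth], hth ▸ hne.symm, by rw [hth, hht]⟩
      · exact ⟨by simp [hht], hht ▸ hne, by rw [hht, hth]⟩
      · exact ⟨hsub.subset (H.invol n hn').1, (H.invol n hn').2⟩
    · intro z hz z' hz' e
      have hm : ∀ z ∈ l₁ ++ (t, x) :: l₂, z = (t, x) ∨ z ∈ l₁ ++ l₂ := fun z hz => by
        simp at hz ⊢; tauto
      have hl : ∀ z ∈ l₁ ++ l₂, z.1 ∈ labels (l₁ ++ l₂) ++ labels r := fun z hz =>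
        List.mem_append_left _ (mem_labels.2 ⟨z, hz, rfl⟩)
      rcases hm z hz with rfl | hz <;> rcases hm z' hz' with rfl | hz'
      · rfl
      · exact absurd (hl z' hz') (by rw [← e, hth]; exact hh)
      · exact absurd e (hP' _ (hl z hz)).1
      · exact H.left z hz z' hz' e
    · intro z hz z' hz' e
      have hm : ∀ z ∈ r ++ [(h, y)], z = (h, y) ∨ z ∈ r := fun z hz => by
        simp at hz ⊢; tauto
      have hl : ∀ z ∈ r, z.1 ∈ labels (l₁ ++ l₂) ++ labels r := fun z hz =>
        List.mem_append_right _ (mem_labels.2 ⟨z, hz, rfl⟩)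
      rcases hm z hz with rfl | hz <;> rcases hm z' hz' with rfl | hz'
      · rfl
      · exact absurd (hl z' hz') (by rw [← e, hht]; exact ht)
      · exact absurd e (hP' _ (hl z hz)).2
      · exact H.right z hz z' hz' e
    · rw [f₁ hP, strands_append, strands_cons]; exact H.distinct
    · rw [f₁ hP, f₂ hP, labels_append (through P (labels (l₁ ++ l₂)) r),
        labels_append (through P (labels r) l₁), labels_cons, labels_cons, List.map_append,
        List.map_cons]
      have h₃ := h₁.map fun n => if n = 0 then h else n - 1
      have e₃ : ∀ N : List ℕ, N.map (P · + 1) = (N.map P).map (· + 1) := fun N => by simp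
      rw [List.map_append, List.map_append, g₂, List.map_cons, e₃, e₃, g₂, List.map_cons, g₂] at h₃
      simpa [hth] using h₃
    · rw [f₁ hP, f₂ hP, strands_append, strands_cons, strands_append]; exact h₂

theorem vertexRel_pair_iff {l₁ l₂ r : Named A} {t h : ℕ}
    {x y : A × ℕ} (hth : P t = h) (hht : P h = t) (hxy : x.2 = y.2)
    (hn : (labels ((h, y) :: (l₁ ++ (t, x) :: l₂)) ++ labels r).Nodup) :
    VertexRel P U V ((h, y) :: (l₁ ++ (t, x) :: l₂)) r ↔ VertexRel P U V (l₁ ++ l₂) r := by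
  have hsub : (labels (l₁ ++ l₂) ++ labels r).Sublist
      (labels ((h, y) :: (l₁ ++ (t, x) :: l₂)) ++ labels r) := by
    simp
  have ht : t ∉ labels (l₁ ++ l₂) ++ labels r := by
    simp [List.nodup_append] at hn ⊢
    grind
  have hh : h ∉ labels (l₁ ++ l₂) ++ labels r := by
    simp [List.nodup_append] at hn ⊢
    grind
  have hne : t ≠ h := by
    simp [List.nodup_append] at hn
    grind
  have f₁ : through P (labels r) ((h, y) :: (l₁ ++ (t, x) :: l₂)) =
        through P (labels r) (l₁ ++ l₂) := by
    rw [through_cons, through_append, through_cons, if_neg, if_neg, ← through_append]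
    · exact fun h₁ => hh (by rw [hth] at h₁; simp [h₁])
    · exact fun h₁ => ht (by rw [hht] at h₁; simp [h₁])
  have f₂ : ∀ hP : (∀ n ∈ labels (l₁ ++ l₂) ++ labels r, P (P n) = n),
      through P (labels ((h, y) :: (l₁ ++ (t, x) :: l₂))) r = through P (labels (l₁ ++ l₂)) r := by
    refine fun hP => through_congr fun z hz => ?_
    have hz' : z.1 ∈ labels (l₁ ++ l₂) ++ labels r :=
      List.mem_append_right _ (mem_labels.2 ⟨z, hz, rfl⟩)
    have k₁ : P z.1 ≠ t := fun e => by
      have := hP _ hz'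
      rw [e, hth] at this
      exact hh (this ▸ hz')
    have k₂ : P z.1 ≠ h := fun e => by
      have := hP _ hz'
      rw [e, hht] at this
      exact ht (this ▸ hz')
    simp [k₁, k₂]
  have hcase : ∀ n ∈ labels ((h, y) :: (l₁ ++ (t, x) :: l₂)) ++ labels r,
      n = t ∨ n = h ∨ n ∈ labels (l₁ ++ l₂) ++ labels r := fun n hn => by
    simp at hn ⊢; tauto
  constructor
  · intro H
    have hP : ∀ n ∈ labels (l₁ ++ l₂) ++ labels r, P (P n) = n := fun n hn =>
      (H.invol n (hsub.subset hn)).2.2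
    refine ⟨⟨hn.sublist hsub, fun n hn' => ?_, ?_, H.right⟩, f₁ ▸ H.distinct, ?_⟩
    · obtain ⟨h₃, h₄, h₅⟩ := H.invol n (hsub.subset hn')
      refine ⟨?_, h₄, h₅⟩
      rcases hcase _ h₃ with h₆ | h₆ | h₆
      · exact absurd hn' (by rw [← h₅, h₆, hth]; exact hh)
      · exact absurd hn' (by rw [← h₅, h₆, hht]; exact ht)
      · exact h₆
    · exact fun z hz z' hz' => H.left z (by simp at hz ⊢; tauto) z' (by simp at hz' ⊢; tauto)
    · have := H.braid
      rwa [f₁, f₂ hP] at this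
  · intro H
    have hP : ∀ n ∈ labels (l₁ ++ l₂) ++ labels r, P (P n) = n := fun n hn => (H.invol n hn).2.2
    refine ⟨⟨hn, fun n hn' => ?_, ?_, H.right⟩, f₁.symm ▸ H.distinct, ?_⟩
    · rcases hcase n hn' with rfl | rfl | hn'
      · exact ⟨by simp [hth], hth ▸ hne.symm, by rw [hth, hht]⟩
      · exact ⟨by simp [hht], hht ▸ hne, by rw [hht, hth]⟩
      · exact ⟨hsub.subset (H.invol n hn').1, (H.invol n hn').2⟩
    · have hm : ∀ z ∈ (h, y) :: (l₁ ++ (t, x) :: l₂), z = (h, y) ∨ z = (t, x) ∨ z ∈ l₁ ++ l₂ :=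
        fun z hz => by simp at hz ⊢; tauto
      have hl : ∀ z ∈ l₁ ++ l₂, z.1 ∈ labels (l₁ ++ l₂) ++ labels r := fun z hz =>
        List.mem_append_left _ (mem_labels.2 ⟨z, hz, rfl⟩)
      have hP' : ∀ z ∈ l₁ ++ l₂, P z.1 ≠ t ∧ P z.1 ≠ h := fun z hz => by
        have := H.invol _ (hl z hz)
        exact ⟨fun e => ht (e ▸ this.1), fun e => hh (e ▸ this.1)⟩
      intro z hz z' hz' e
      rcases hm z hz with rfl | rfl | hz <;> rcases hm z' hz' with rfl | rfl | hz'
      · rfl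
      · exact hxy.symm
      · exact absurd (hl z' hz') (by rw [← e, hht]; exact ht)
      · exact hxy
      · rfl
      · exact absurd (hl z' hz') (by rw [← e, hth]; exact hh)
      · exact absurd e (hP' z hz).2
      · exact absurd e (hP' z hz).1
      · exact H.left z hz z' hz' e
    · rw [f₁, f₂ hP]
      exact H.braid

/-! ### A half-edge swings around its vertex -/

theorem Down.congr {V V' : List ℕ} {a : A} {U U' : List ℕ} {d f : ℕ} {l l' : Stack A}
    {p : ℕ → Bool} (h : Down V a U d l l' f) (hp : ∀ e ∈ d :: pieces l, p e)
    (hU : U.filter p = U'.filter p) (hV : V.filter p = V'.filter p) : Down V' a U' d l l' f := by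
  obtain ⟨m, g, h₁, h₂⟩ := crossWord_down.1
    ((crossWord_down.2 ⟨l', f, rfl, h⟩).congr (p := p) (by simpa using hp) hU hV)
  obtain ⟨rfl, h₃⟩ := List.append_inj' h₁ rfl
  simp only [List.cons.injEq, Prod.mk.injEq, and_true, true_and] at h₃
  rwa [h₃]

theorem Down.eq_of_guard {V W : List ℕ} {a : A} {U X : List ℕ} {d f : ℕ} {l l' : Stack A}
    (h : Down W a U d l l' f) (hW : W = X ++ d :: V) (hn : (pieces l ++ X).Nodup) (hU : d ∉ U)
    (hV : d ∉ V) : l' = l ∧ f = d := by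
  induction h with
  | nil => simp
  | pass U d b e l l' f hde h ih =>
    obtain ⟨rfl, rfl⟩ := ih hW (by simp at hn ⊢; exact hn.2) (by simp [hU, hde]) hV
    simp
  | switch U d e l l' f hde hb h ih =>
    exfalso
    have he : e ∉ pieces l ++ X := (List.nodup_cons.1 hn).1
    subst hW
    have e₁ : U.reverse ++ (pieces l ++ (X ++ d :: V)).reverse =
        (U.reverse ++ V.reverse) ++ ([d] ++ (pieces l ++ X).reverse) := by simp
    rw [Before, e₁, pair_sublist_append, pair_sublist_append _ _ [d]] at hb
    have hUV : d ∉ U.reverse ++ V.reverse := by simp [hU, hV]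
    rcases hb with hb | ⟨hb, -⟩ | hb | ⟨-, hb⟩ | hb
    · exact hUV (hb.subset (List.mem_cons_self ..))
    · exact hUV hb
    · simpa using hb.length_le
    · exact he (List.mem_reverse.1 hb)
    · exact he (List.mem_reverse.1 (hb.subset (by simp)))

theorem exists_fresh (L : List ℕ) : ∃ d, d ∉ L := by
  obtain ⟨d, hd⟩ := Infinite.exists_notMem_finset L.toFinset
  exact ⟨d, by simpa using hd⟩

/-- The through strands when the half-edge `h`, which is matched with a half-edge `k` on the right,
is at the bottom on the right or at the top on the left. -/
theorem through_swing {L R₁ R₂ : Named A} {h k : ℕ} {x y y' : A × ℕ}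
    (hk : P h = k) (hh : P k = h)
    (hn : (labels L ++ labels (R₁ ++ (k, x) :: R₂ ++ [(h, y)])).Nodup)
    (hP : ∀ n ∈ labels L ++ labels (R₁ ++ (k, x) :: R₂), P (P n) = n) :
    through P (labels (R₁ ++ (k, x) :: R₂ ++ [(h, y)])) L =
      through P (labels (R₁ ++ (k, x) :: R₂)) L ∧
    through P (labels L) (R₁ ++ (k, x) :: R₂ ++ [(h, y)]) =
      through P (labels L) R₁ ++ through P (labels L) R₂ ∧
    through P (labels ((h, y') :: L)) (R₁ ++ (k, x) :: R₂) =
      through P (labels L) R₁ ++ (k, x) :: through P (labels L) R₂ ∧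
    through P (labels (R₁ ++ (k, x) :: R₂)) ((h, y') :: L) =
      (h, y') :: through P (labels (R₁ ++ (k, x) :: R₂)) L := by
  have h₁ : h ∉ labels L := by simp [List.nodup_append] at hn; grind
  have h₂ : k ∉ labels L ++ labels R₁ ++ labels R₂ := by
    simp [List.nodup_append] at hn ⊢; grind
  have h₃ : ∀ n ∈ labels L ++ labels R₁ ++ labels R₂, P n ≠ h := fun n hn₁ e => by
    have := hP n (by simp at hn₁ ⊢; tauto)
    rw [e, hk] at this
    exact h₂ (this ▸ hn₁)
  have h₄ : ∀ z : ℕ × A × ℕ, z ∈ L ∨ z ∈ R₁ ∨ z ∈ R₂ → P z.1 ≠ h := fun z hz =>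
    h₃ _ (by
      have : ∀ l : Named A, z ∈ l → z.1 ∈ labels l := fun l hz => mem_labels.2 ⟨z, hz, rfl⟩
      simp only [List.mem_append]
      rcases hz with hz | hz | hz <;> simp [this _ hz])
  have h₅ : k ∉ labels L := by simp at h₂; exact h₂.1
  refine ⟨through_congr fun z hz => ?_, ?_, ?_, ?_⟩
  · simp [h₄ z (.inl hz)]
  · simp [through_cons, hk, hh, h₁, h₅]
  · rw [through_append, through_cons, if_pos (by simp [hh]),
      through_congr (N' := labels L) (l := R₁), through_congr (N' := labels L) (l := R₂)]
    · intro z hz; simp [h₄ z (.inr (.inr hz))]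
    · intro z hz; simp [h₄ z (.inr (.inl hz))]
  · rw [through_cons, if_pos (by simp [hk])]

theorem VertexPairs.exists_of_mem_right {r : Named A} {n : ℕ}
    (h : P n ∈ labels r) : ∃ r₁ x r₂, r = r₁ ++ (P n, x) :: r₂ := by
  obtain ⟨⟨k, x⟩, hz, hk⟩ := mem_labels.1 h
  obtain ⟨r₁, r₂, rfl⟩ := List.append_of_mem hz
  exact ⟨r₁, x, r₂, by rw [← hk]⟩

section

variable [CommRing A]

theorem Balanced.insert_cusp {l₁ l₂ l₃ : Stack A} {d : ℕ} (c : A)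
    (h : Balanced U V (l₁ ++ l₂ ++ l₃)) (hU : d ∉ U) (hV : d ∉ V)
    (hd : d ∉ pieces (l₁ ++ l₂ ++ l₃)) :
    Balanced U V (l₁ ++ (c + 1, d) :: (l₂ ++ (c, d) :: l₃)) where
  count e he := by
    rw [← List.count_eq_zero] at hU hV hd
    by_cases hde : e = d
    · subst hde
      simp only [pieces_append, List.count_append] at hd
      simp
      omega
    · have := h.count e (by simp at he ⊢; tauto)
      simp [List.count_cons_of_ne (Ne.symm hde)] at this ⊢
      omega
  pot a b e he := by
    by_cases hde : e = d
    · subst hde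
      have h₁ := he.filter (·.2 = e)
      have h₂ : ∀ l : Stack A, e ∉ pieces l → l.filter (·.2 = e) = [] := fun l hl => by
        rw [List.filter_eq_nil_iff]
        rintro ⟨a, g⟩ hg
        simp only [decide_eq_true_eq]
        rintro rfl
        exact hl (mem_pieces.2 ⟨a, hg⟩)
      simp only [pieces_append, List.mem_append, not_or] at hd
      simp [h₂ _ hd.1.1, h₂ _ hd.1.2, h₂ _ hd.2] at h₁
      have h₃ := h₁.eq_of_length rfl
      simp only [List.cons.injEq, Prod.mk.injEq, and_true] at h₃
      rw [h₃.1, h₃.2]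
    · refine h.pot a b e ?_
      have h₁ := he.filter (·.2 ≠ d)
      have h₂ : ∀ l : Stack A, d ∉ pieces l → l.filter (·.2 ≠ d) = l := fun l hl => by
        rw [List.filter_eq_self]
        rintro ⟨a, g⟩ hg
        simp only [decide_eq_true_eq]
        rintro rfl
        exact hl (mem_pieces.2 ⟨a, hg⟩)
      simp only [pieces_append, List.mem_append, not_or] at hd
      rw [List.filter_append, List.filter_cons (xs := l₂ ++ _), List.filter_append,
        List.filter_cons (xs := l₃), h₂ _ hd.1.1, h₂ _ hd.1.2, h₂ _ hd.2] at h₁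
      simpa [hde] using h₁

theorem mem_of_before {U V X Y : List ℕ} {d e : ℕ} (h : Before (U ++ d :: X) (Y ++ V) d e)
    (hU : d ∉ U) (hV : d ∉ V) (hX : d ∉ X) (hY : d ∉ Y) : e ∈ U ∨ e ∈ Y ∨ e ∈ V := by
  have e₁ : (U ++ d :: X).reverse ++ (Y ++ V).reverse =
      X.reverse ++ ([d] ++ (U.reverse ++ (V.reverse ++ Y.reverse))) := by simp
  rw [Before, e₁, pair_sublist_append, pair_sublist_append _ _ [d]] at h
  rcases h with h | ⟨h, -⟩ | h | ⟨-, h⟩ | h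
  · exact absurd (h.subset (List.mem_cons_self ..)) (by simpa using hX)
  · exact absurd h (by simpa using hX)
  · simpa using h.length_le
  · simp at h; tauto
  · exact absurd (h.subset (List.mem_cons_self ..)) (by simp; tauto)

theorem VertexRel.exists_swing {L R : Named A} {h : ℕ} {c : A}
    {f : ℕ} (hl : Balanced U V (strands L)) (hr : Balanced U V (strands R ++ [(c, f)]))
    (H : VertexRel P U V L (R ++ [(h, c, f)])) (hf : P h ∈ labels R → f ∉ pieces (strands L)) :
    ∃ d L', d ∉ U ∧ d ∉ V ∧ d ∉ pieces (strands L) ∧ labels L' = labels L ∧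
      Down V c (U ++ [d]) d (strands L) (strands L') f ∧
      VertexRel P U (f :: V) ((h, c + 1, d) :: L') R := by
  have hh := H.invol h (by simp)
  have hP : ∀ n ∈ labels L ++ labels R, P (P n) = n := fun n hn =>
    (H.invol n (by simp at hn ⊢; tauto)).2.2
  by_cases hPh : P h ∈ labels R
  · specialize hf hPh
    obtain ⟨R₁, ⟨b, g⟩, R₂, rfl⟩ := VertexPairs.exists_of_mem_right hPh
    have hg : f = g := H.right (h, c, f) (by simp) (P h, b, g) (by simp) rfl
    subst hg
    have hb : b = c + 1 := hr.pot b c f (by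
      rw [strands_append, strands_cons, List.append_assoc]
      refine (List.Sublist.trans ?_ (List.sublist_append_right _ _))
      simp)
    subst hb
    obtain ⟨hfU, hfV⟩ := hr.not_mem_of_count (d := f) (le_antisymm (hr.count_le f)
      ((le_count_of_mem (l := R₁ ++ (P h, c + 1, f) :: R₂ ++ [(h, c, f)]) (g := f)
        (k := [(P h, c + 1, f), (h, c, f)]) (by simp [hh.2.1]) (by simp)).trans (by simp)))
    have hS := fun y' => through_swing (L := L) (R₁ := R₁) (R₂ := R₂) (x := (c + 1, f))
      (y := (c, f)) (y' := y') rfl hh.2.2 H.nodup hP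
    obtain ⟨s₁, s₂, s₃, s₄⟩ := hS (c + 1, f)
    have hnod := H.nodup
    refine ⟨f, L, hfU, hfV, hf, rfl, Down.of_not_mem _ _ _ hf, ⟨?_, ?_, ?_, ?_⟩, ?_, ?_⟩
    · refine (List.Perm.nodup_iff ?_).1 hnod
      simp only [labels_append, labels_cons, labels_nil, ← List.append_assoc]
      exact List.perm_append_comm.trans (by simp)
    · intro n hn
      have := H.invol n (by simp at hn ⊢; tauto)
      refine ⟨?_, this.2⟩
      have := this.1
      simp at this ⊢
      tauto
    · have key : ∀ z ∈ L, P z.1 ≠ h := fun z hz e => by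
        have := hP z.1 (by simp [mem_labels.2 ⟨z, hz, rfl⟩])
        rw [e] at this
        exact (List.nodup_append.1 hnod).2.2 _ (mem_labels.2 ⟨z, hz, rfl⟩) (P h) (by simp) this.symm
      intro z hz z' hz' e
      rcases List.mem_cons.1 hz with rfl | hz <;> rcases List.mem_cons.1 hz' with rfl | hz'
      · rfl
      · exact absurd e.symm ((List.nodup_append.1 hnod).2.2 _ (mem_labels.2 ⟨z', hz', rfl⟩) (P h)
          (by simp))
      · exact absurd e (key z hz)
      · exact H.left z hz z' hz' e
    · exact fun z hz z' hz' => H.right z (by simp at hz ⊢; tauto) z' (by simp at hz' ⊢; tauto)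
    · have h₁ := H.distinct
      rw [s₁] at h₁
      rw [s₄, strands_cons, pieces_cons, List.nodup_cons]
      refine ⟨fun h₂ => hf ?_, h₁⟩
      exact ((List.filter_sublist.map _).map _).subset h₂
    · obtain ⟨w, h₁, h₂⟩ := H.braid
      rw [s₁, s₂] at h₁ h₂
      rw [s₃, s₄]
      set T := through P (labels (R₁ ++ (P h, c + 1, f) :: R₂)) L
      set S₁ := through P (labels L) R₁
      set S₂ := through P (labels L) R₂
      have hfT : f ∉ pieces (strands T) := fun h₃ => hf (((List.filter_sublist.map _).map _).subset h₃)
      have hfS : f ∉ pieces (strands (S₁ ++ S₂)) := fun h₃ => hfT (h₂.perm_pieces.subset h₃)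
      refine ⟨w.map (1 + ·) ++ List.range S₁.length, ?_, ?_⟩
      · rw [sorts_append]
        refine ⟨P h :: labels (S₁ ++ S₂), ?_, ?_⟩
        · have h₃ := (h₁.mono (T' := labels (S₁ ++ (P h, c + 1, f) :: S₂)) (by simp)).append_left
            [P h]
          simpa using h₃
        · rw [labels_append, labels_append, labels_cons, ← length_labels]
          refine Sorts.range fun j hj => ?_
          rw [pair_sublist_append]
          exact .inr (.inl ⟨hj, by simp⟩)
      · rw [regular_append, crossWord_append, ← shiftWord_regular]
        refine ⟨(c + 1, f) :: strands (S₁ ++ S₂), (crossWord_append_left (u := [(c + 1, f)])).2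
          ⟨_, rfl, ?_⟩, ?_⟩
        · refine h₂.congr (p := (· ≠ f)) (fun d hd => ?_) ?_ ?_
          · simp only [decide_eq_true_eq]
            rintro rfl
            exact hfT hd
          · simp
          · simp
        · have h₃ := crossWord_down.2 ⟨_, _, rfl, Down.of_not_mem (pieces (strands S₂) ++ f :: V)
            (c + 1) U (d := f) (l := strands S₁) fun h₃ => hfS (by simp at h₃ ⊢; exact .inl h₃)⟩
          rw [length_strands] at h₃
          have h₄ := (crossWord_append_right (v := strands S₂) (V := f :: V)
            (r := strands S₁ ++ [(c + 1, f)] ++ strands S₂) h₃.fits).2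
            ⟨_, rfl, h₃⟩
          simpa using h₄
  · have ht : P h ∈ labels L := by
      have := hh.1
      simp only [labels_append, labels_cons, labels_nil, List.mem_append, List.mem_cons,
        List.not_mem_nil, or_false] at this
      rcases this with h₁ | h₁ | h₁
      · exact h₁
      · exact absurd h₁ hPh
      · exact absurd h₁ hh.2.1
    obtain ⟨L₁, ⟨a, e⟩, L₂, rfl⟩ := VertexPairs.exists_of_mem_right ht
    have hnod := H.nodup
    rw [extRel_iff hh.2.2 rfl hnod] at H
    rw [strands_append, strands_cons] at hl
    obtain ⟨m, f', hy, hm, heL, hD, hv⟩ := H.exists_down hl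
    simp only [Prod.mk.injEq] at hy
    obtain ⟨rfl, rfl⟩ := hy
    obtain ⟨d, hd⟩ := exists_fresh (U ++ V ++ pieces (strands (L₁ ++ (P h, c, e) :: L₂)))
    simp only [List.mem_append, not_or] at hd
    obtain ⟨⟨hdU, hdV⟩, hdL⟩ := hd
    have hdL' := hdL
    simp only [strands_append, strands_cons, pieces_append, pieces_cons, List.mem_append,
      List.mem_cons, not_or] at hdL'
    obtain ⟨hd₁, hde, hd₂⟩ := hdL'
    refine ⟨d, L₁ ++ (P h, c, d) :: m, hdU, hdV, hdL, by simp [hm], ?_, ?_⟩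
    · rw [strands_append, strands_cons, strands_append, strands_cons]
      refine Down.append.2 ⟨strands L₁, (c, d) :: strands m, d, rfl, Down.of_not_mem _ _ _ hd₁,
        .switch _ d e _ _ _ hde ?_ ?_⟩
      · have he := hl.count e (by simp)
        have he' : e ∈ U ∨ e ∈ pieces (strands L₂) ∨ e ∈ V := by
          by_contra hcon
          simp only [not_or, ← List.count_eq_zero] at hcon heL
          simp only [pieces_append, pieces_cons, List.count_append, List.count_cons_self] at he
          omega
        have e₁ : (U ++ [d] ++ pieces (strands L₁)).reverse ++ (pieces (strands L₂) ++ V).reverse =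
            (pieces (strands L₁)).reverse ++ ([d] ++
              (U.reverse ++ (V.reverse ++ (pieces (strands L₂)).reverse))) := by simp
        rw [Before, e₁, pair_sublist_append, pair_sublist_append _ _ [d]]
        refine .inr (.inr (.inr (.inl ⟨by simp, ?_⟩)))
        simp
        tauto
      · refine hD.congr (p := (· ≠ d)) (fun g hg => ?_) ?_ rfl
        · simp only [decide_eq_true_eq]
          rintro rfl
          rcases List.mem_cons.1 hg with hg | hg
          · exact hde hg
          · exact hd₂ hg
        · simp
    · refine (vertexRel_pair_iff (x := (c, d)) (y := (c + 1, d)) hh.2.2 rfl rfl ?_).2 hv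
      refine (List.Perm.nodup_iff ?_).1 hnod
      simp only [labels_append, labels_cons, labels_nil, hm, ← List.append_assoc]
      exact List.perm_append_comm.trans (by simp)

theorem eq_of_labels_of_strands {l m : Named A} (h : labels l = labels m)
    (h' : strands l = strands m) : l = m := by
  exact (List.zip_of_prod (xs := l) h h').trans (List.zip_of_prod rfl rfl).symm

theorem VertexRel.of_swing {L L' R : Named A} {h : ℕ} {c : A}
    {d f : ℕ} (hl : Balanced U V (strands L)) (hU : d ∉ U) (hV : d ∉ V) (hL : d ∉ pieces (strands L))
    (hlab : labels L' = labels L) (hD : Down V c (U ++ [d]) d (strands L) (strands L') f)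
    (H : VertexRel P U (f :: V) ((h, c + 1, d) :: L') R) : VertexRel P U V L (R ++ [(h, c, f)]) := by
  have hh := H.invol h (by simp)
  have hb₀ : Balanced U V ((c + 1, d) :: (c, d) :: strands L) := by
    simpa using Balanced.insert_cusp (l₁ := []) (l₂ := []) c (by simpa using hl) hU hV (by simpa)
  have hb : Balanced U V ([(c + 1, d)] ++ strands L' ++ [(c, f)]) :=
    Balanced.down (s := [(c + 1, d)]) (by simpa using hb₀) (by simpa using hD)
  have hnod : (labels L ++ labels (R ++ [(h, c, f)])).Nodup := by
    refine (List.Perm.nodup_iff ?_).1 H.nodup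
    simp only [labels_append, labels_cons, labels_nil, hlab, ← List.append_assoc]
    exact List.Perm.trans (by simp) List.perm_append_comm
  by_cases hPh : P h ∈ labels R
  · have hd' : d ∉ pieces (strands L') := by
      intro hd
      obtain ⟨z, hz, hzd⟩ := mem_pieces_strands.1 hd
      have hc : ∀ g, (pieces (strands ((h, c + 1, d) :: L'))).count g ≤ 2 := fun g =>
        (List.Sublist.count_le g (by simp)).trans (hb.count_le g)
      have h₁ := H.cuspPieces_iff hc (z := (h, c + 1, d)) (by simp)
      have h₂ := H.cuspPieces_iff hc (z := z) (by simp [hz])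
      rw [hzd] at h₂
      have h₃ : P z.1 ∈ labels R := by
        by_contra h₃
        exact h₁.1 (h₂.2 h₃) hPh
      have h₄ := H.distinct
      rw [through_cons, if_pos hPh, strands_cons, pieces_cons, List.nodup_cons] at h₄
      exact h₄.1 (mem_pieces_strands.2 ⟨z, mem_through.2 ⟨hz, h₃⟩, hzd⟩)
    obtain ⟨h₁, rfl⟩ := hD.eq_of_not_mem hd'
    obtain rfl := eq_of_labels_of_strands hlab h₁
    obtain ⟨R₁, x, R₂, rfl⟩ := VertexPairs.exists_of_mem_right hPh
    have hP : ∀ n ∈ labels L' ++ labels (R₁ ++ (P h, x) :: R₂), P (P n) = n := fun n hn =>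
      (H.invol n (by simp at hn ⊢; tauto)).2.2
    obtain ⟨s₁, s₂, s₃, s₄⟩ := through_swing (L := L') (R₁ := R₁) (R₂ := R₂) (x := x)
      (y := (c, f)) (y' := (c + 1, f)) rfl hh.2.2 hnod hP
    obtain ⟨w, h₂, h₃⟩ := H.braid
    have h₄ := H.distinct
    rw [s₃, s₄] at h₂ h₃
    rw [s₄] at h₄
    set T := through P (labels (R₁ ++ (P h, x) :: R₂)) L' with hT
    set S₁ := through P (labels L') R₁
    set S₂ := through P (labels L') R₂
    have hbT : Balanced U (f :: V) ((c + 1, f) :: strands T) := by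
      have h₅ := hb.left_part (l := [(c + 1, f)] ++ strands L') (t := [(c, f)])
      have hc : ∀ g, (pieces (strands ((h, c + 1, f) :: L'))).count g ≤ 2 := fun g =>
        (List.Sublist.count_le g (by simp)).trans (hb.count_le g)
      have h₆ := h₅.forget (cuspPieces P (labels (R₁ ++ (P h, x) :: R₂)) ((h, c + 1, f) :: L'))
      have h₇ := forget_strands_of_iff fun z hz => H.cuspPieces_iff hc (z := z) hz
      rw [s₄] at h₇
      have h₈ : [(c + 1, f)] ++ strands L' = strands ((h, c + 1, f) :: L') := rfl
      rw [h₈, h₇] at h₆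
      exact h₆
    have hN : (labels (S₁ ++ (P h, x) :: S₂)).Nodup := by
      rw [← s₃]
      exact (List.filter_sublist.map _).nodup (List.nodup_append.1 H.nodup).2.1
    have hN' : (labels (S₁ ++ S₂)).Nodup := hN.sublist (by simp)
    obtain ⟨w', h₅⟩ := exists_sorts (L := (labels T).map P) hN' (by
      have h₆ := h₂.perm
      simp only [labels_append, labels_cons, List.map_cons] at h₆ ⊢
      exact ((List.perm_middle.symm.trans h₆).cons_inv).symm)
    have h₆ : Sorts (labels (S₁ ++ (P h, x) :: S₂)) (w'.map (1 + ·) ++ List.range S₁.length)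
        ((labels ((h, c + 1, f) :: T)).map P) (labels (S₁ ++ (P h, x) :: S₂)) := by
      rw [sorts_append]
      refine ⟨P h :: labels (S₁ ++ S₂), ?_, ?_⟩
      · have h₃ := (h₅.mono (T' := labels (S₁ ++ (P h, x) :: S₂)) (by simp)).append_left [P h]
        simpa using h₃
      · rw [labels_append, labels_append, labels_cons, ← length_labels]
        refine Sorts.range fun j hj => ?_
        rw [pair_sublist_append]
        exact .inr (.inl ⟨hj, by simp⟩)
    have h₇ := (Sorts.braidEq hN h₂ h₆).crossWord hbT h₄ h₃
    rw [regular_append, crossWord_append, ← shiftWord_regular] at h₇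
    obtain ⟨q, h₈, h₉⟩ := h₇
    obtain ⟨q, rfl, h₁₀⟩ := (crossWord_append_left (u := [(c + 1, f)])).1 h₈
    have hq : q.length = S₁.length + S₂.length := by
      have h₁₁ := h₁₀.length_eq
      have h₁₂ := h₅.perm.length_eq
      simp only [labels_append, List.length_append, length_labels, List.length_map] at h₁₁ h₁₂
      omega
    obtain ⟨q₁, q₂, rfl, hq₁⟩ : ∃ q₁ q₂, q = q₁ ++ q₂ ∧ q₁.length = S₁.length :=
      ⟨q.take S₁.length, q.drop S₁.length, by simp, by simp; omega⟩
    have h₁₁ : CrossWord U (f :: V) (regular (List.range q₁.length)) (((c + 1, f) :: q₁) ++ q₂)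
      (strands (S₁ ++ (P h, x) :: S₂)) := by rw [hq₁]; exact h₉
    rw [crossWord_append_right (by
      intro z hz
      simp [regular] at hz ⊢
      obtain ⟨a, ha, rfl⟩ := hz
      simp; omega)] at h₁₁
    obtain ⟨r', h₁₂, h₁₃⟩ := h₁₁
    obtain ⟨l', f', rfl, h₁₄⟩ := crossWord_down.1 h₁₃
    have h₁₅ : f ∉ pieces q₁ ++ pieces q₂ := fun h₁₅ => by
      rw [← pieces_append] at h₁₅
      exact (List.nodup_cons.1 h₄).1 (h₁₀.perm_pieces.subset h₁₅)
    have h₁₆ : (pieces q₁ ++ pieces q₂).Nodup := by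
      rw [← pieces_append]
      exact h₁₀.perm_pieces.nodup_iff.2 (List.nodup_cons.1 h₄).2
    obtain ⟨rfl, rfl⟩ := h₁₄.eq_of_guard rfl h₁₆ hU hV
    rw [strands_append, strands_cons, List.append_assoc] at h₁₂
    obtain ⟨h₁₇, h₁₈⟩ := List.append_inj h₁₂ (by simp [hq₁])
    simp only [List.singleton_append, List.cons.injEq] at h₁₈
    obtain ⟨rfl, h₁₈⟩ := h₁₈
    refine ⟨⟨hnod, ?_, ?_, ?_⟩, ?_, w', ?_, ?_⟩
    · intro n hn
      have := H.invol n (by simp at hn ⊢; tauto)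
      refine ⟨?_, this.2⟩
      have := this.1
      simp at this ⊢
      tauto
    · exact fun z hz z' hz' => H.left z (by simp [hz]) z' (by simp [hz'])
    · have hnR : (labels (R₁ ++ (P h, c + 1, f') :: R₂)).Nodup := (List.nodup_append.1 H.nodup).2.1
      have hhR : h ∉ labels (R₁ ++ (P h, c + 1, f') :: R₂) := fun h₁ =>
        (List.nodup_append.1 H.nodup).2.2 h (by simp) h h₁ rfl
      intro z hz z' hz' e
      have hm : ∀ z ∈ R₁ ++ (P h, c + 1, f') :: R₂ ++ [(h, c, f')],
          z ∈ R₁ ++ (P h, c + 1, f') :: R₂ ∨ z = (h, c, f') := fun z hz => by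
        simp at hz ⊢; tauto
      have key : ∀ z ∈ R₁ ++ (P h, c + 1, f') :: R₂, z.1 = P h → z.2.2 = f' := fun z hz e => by
        rw [eq_of_mem_of_labels_nodup hnR hz (z' := (P h, c + 1, f')) (by simp) e]
      rcases hm z hz with hz | rfl <;> rcases hm z' hz' with hz' | rfl
      · exact H.right z hz z' hz' e
      · refine key z hz ?_
        simp only at e
        rw [← e, (H.invol z.1 (List.mem_append_right _ (mem_labels.2 ⟨z, hz, rfl⟩))).2.2]
      · exact (key z' hz' e.symm).symm
      · rfl
    · rw [s₁]
      exact (List.nodup_cons.1 h₄).2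
    · rw [s₁, s₂]
      exact h₅
    · rw [s₁, s₂, strands_append, h₁₇, h₁₈]
      refine h₁₀.congr (p := (· ≠ f')) (fun d hd => ?_) ?_ ?_
      · simp only [decide_eq_true_eq]
        rintro rfl
        exact (List.nodup_cons.1 h₄).1 hd
      · simp
      · simp
  · have ht : P h ∈ labels L' := by
      have := hh.1
      simp only [labels_cons, List.mem_append, List.mem_cons] at this
      rcases this with (h₁ | h₁) | h₁
      · exact absurd h₁ hh.2.1
      · exact h₁
      · exact absurd h₁ hPh
    obtain ⟨L₁', ⟨b, g⟩, L₂', rfl⟩ := VertexPairs.exists_of_mem_right ht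
    obtain rfl : d = g := H.left (h, c + 1, d) (by simp) (P h, b, g) (by simp) rfl
    rw [labels_append, labels_cons] at hlab
    obtain ⟨L₁, L₂', rfl, h₁, h₂⟩ := List.map_eq_append_iff.1 hlab.symm
    obtain ⟨⟨_, a, e⟩, L₂, rfl, h₃, h₂'⟩ := List.map_eq_cons_iff.1 h₂
    simp only at h₃
    subst h₃
    rw [strands_append, strands_append, strands_cons, strands_cons] at hD
    obtain ⟨l₁, l₂, d', h₄, hD₁, hD₂⟩ := Down.append.1 hD
    have hlen : L₁.length = L₁'.length := by simpa [labels] using congrArg List.length h₁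
    obtain ⟨rfl, rfl⟩ := List.append_inj h₄ (by
      rw [hD₁.length_eq]; simp [hlen])
    have hcd := hb.count d (by simp)
    simp [List.count_cons] at hcd
    have hd₁ : d ∉ pieces (strands L₁') := by rw [← List.count_eq_zero]; omega
    obtain ⟨h₅, rfl⟩ := hD₁.eq_of_not_mem hd₁
    obtain rfl := eq_of_labels_of_strands h₁.symm h₅
    simp only [strands_append, strands_cons, pieces_append, pieces_cons, List.mem_append,
      List.mem_cons, not_or] at hL
    cases hD₂ with
    | pass => exact absurd rfl hL.2.1
    | switch _ _ _ _ _ _ hne hbef hD₃ =>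
      rw [extRel_iff hh.2.2 rfl hnod]
      rw [strands_append, strands_cons] at hl
      have he : e ∉ pieces (strands L₁') := fun he => by
        have h₆ := mem_of_before (U := U) (X := pieces (strands L₁')) (by simpa using hbef) hU hV hL.1
          hL.2.2
        have h₇ := hl.count e (by simp)
        simp only [pieces_append, pieces_cons, List.count_append, List.count_cons_self] at h₇
        simp only [← List.count_pos_iff] at h₆ he
        omega
      refine ExtRel.of_down hl he h₂'.symm
        (hD₃.congr (p := (· ≠ d')) (fun g hg => ?_) (by simp) rfl) ?_
      · simp only [decide_eq_true_eq]
        rintro rfl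
        rcases List.mem_cons.1 hg with hg | hg
        · exact hne hg
        · exact hL.2.2 hg
      · exact (vertexRel_pair_iff (x := (c, d')) (y := (c + 1, d')) hh.2.2 rfl rfl H.nodup).1 H

end

variable [CommRing A]

/-! ### Rulings of fronts with vertices -/

/-- A ruling near an event, where `P` matches the names of the half-edges at the vertices; `U` and
`V` are the pieces of the strands above and below. -/
inductive CoreRel (P : ℕ → ℕ) (U V : List ℕ) : Core A → Stack A → Stack A → Prop
  | leftCusp (c : A) (d : ℕ) : d ∉ U → d ∉ V →
      CoreRel P U V (.leftCusp c) [] [(c + 1, d), (c, d)]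
  | rightCusp (c : A) (d : ℕ) : CoreRel P U V .rightCusp [(c + 1, d), (c, d)] []
  | crossing (k : Bool) (x y : A × ℕ) (r : Stack A) :
      CrossAt U V k 0 [x, y] r → CoreRel P U V (.crossing k) [x, y] r
  | vertex (L R : Named A) : VertexRel P U V L R → Balanced U V (strands R) →
      CoreRel P U V (.vertex (labels L) (R.map fun z => (z.1, z.2.1))) (strands L) (strands R)

/-- A ruling step at an event. -/
def PStep (P : ℕ → ℕ) (U V : List ℕ) (e : Event A) (x y : Stack A) : Prop :=
  ∃ s l r t, s.length = e.pos ∧ x = s ++ l ++ t ∧ y = s ++ r ++ t ∧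
    CoreRel P (U ++ pieces s) (pieces t ++ V) e.core l r

/-- A ruling of a front with vertices. -/
def PRul (P : ℕ → ℕ) (U V : List ℕ) : Front A → Stack A → Stack A → Prop
  | [], x, y => x = y
  | e :: W, x, y => ∃ z, PStep P U V e x z ∧ PRul P U V W z y

@[simp] theorem pRul_nil {x y : Stack A} : PRul P U V [] x y ↔ x = y := Iff.rfl

theorem pRul_append {W W' : Front A} {x y : Stack A} :
    PRul P U V (W ++ W') x y ↔ ∃ z, PRul P U V W x z ∧ PRul P U V W' z y := by
  induction W generalizing x with
  | nil => simp
  | cons e W ih =>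
    simp only [List.cons_append, PRul, ih]
    grind

theorem pRul_singleton {e : Event A} {x y : Stack A} :
    PRul P U V [e] x y ↔ PStep P U V e x y := by
  simp [PRul]

theorem forget_relabel (K : ℕ → Bool) (σ : ℕ → ℕ) (l : Stack A) :
    forget K (relabel σ l) = relabel σ (forget (K ∘ σ) l) := by
  simp [forget, relabel, List.filter_map, Function.comp_def]

/-- Named strands with pieces renamed. -/
def relabelNamed (σ : ℕ → ℕ) (l : Named A) : Named A :=
  l.map fun z => (z.1, z.2.1, σ z.2.2)

@[simp] theorem strands_relabelNamed (σ : ℕ → ℕ) (l : Named A) :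
    strands (relabelNamed σ l) = relabel σ (strands l) := by
  simp [strands, relabelNamed, relabel, Function.comp_def]
@[simp] theorem labels_relabelNamed (σ : ℕ → ℕ) (l : Named A) :
    labels (relabelNamed σ l) = labels l := by
  simp [labels, relabelNamed, Function.comp_def]
@[simp] theorem through_relabelNamed (N : List ℕ) (σ : ℕ → ℕ) (l : Named A) :
    through P N (relabelNamed σ l) = relabelNamed σ (through P N l) := by
  simp [through, relabelNamed, List.filter_map, Function.comp_def]

theorem map_relabelNamed (σ : ℕ → ℕ) (l : Named A) :
    (relabelNamed σ l).map (fun z => (z.1, z.2.1)) = l.map fun z => (z.1, z.2.1) := by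
  simp [relabelNamed, Function.comp_def]

theorem mem_relabelNamed {σ : ℕ → ℕ} {l : Named A} {z : ℕ × A × ℕ}
    (h : z ∈ relabelNamed σ l) : ∃ z' ∈ l, z'.1 = z.1 ∧ σ z'.2.2 = z.2.2 := by
  obtain ⟨z', hz', rfl⟩ := List.mem_map.1 h
  exact ⟨z', hz', rfl, rfl⟩

theorem VertexPairs.relabel_right {L R : Named A} (h : VertexPairs P L R) (σ : ℕ → ℕ) :
    VertexPairs P L (relabelNamed σ R) where
  nodup := by simpa using h.nodup
  invol := by simpa using h.invol
  left := h.left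
  right z hz z' hz' hP := by
    obtain ⟨x, hx, h₁, h₂⟩ := mem_relabelNamed hz
    obtain ⟨x', hx', h₁', h₂'⟩ := mem_relabelNamed hz'
    rw [← h₂, ← h₂', h.right x hx x' hx' (by rw [h₁, h₁', hP])]

theorem VertexRel.relabel {L R : Named A} (h : VertexRel P U V L R) {σ : ℕ → ℕ}
    (hσ : σ.Injective) :
    VertexRel P (U.map σ) (V.map σ) (relabelNamed σ L) (relabelNamed σ R) where
  toVertexPairs := (h.toVertexPairs.relabel_right σ).mirror.relabel_right σ |>.mirror
  distinct := by
    simpa using h.distinct.map hσ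
  braid := by
    obtain ⟨w, h₁, h₂⟩ := h.braid
    exact ⟨w, by simpa using h₁, by simpa using h₂.relabel hσ⟩

theorem CoreRel.relabel {c : Core A} {l r : Stack A} (h : CoreRel P U V c l r) {σ : ℕ → ℕ}
    (hσ : σ.Injective) :
    CoreRel P (U.map σ) (V.map σ) c (relabel σ l) (LegendrianFront.relabel σ r) := by
  cases h with
  | leftCusp c d hU hV =>
    refine .leftCusp c (σ d) ?_ ?_ <;> rwa [List.mem_map_of_injective hσ]
  | rightCusp c d => exact .rightCusp c (σ d)
  | crossing k x y r h => exact .crossing k _ _ _ (h.relabel hσ)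
  | vertex L R h hb =>
    have := CoreRel.vertex _ _ (h.relabel hσ) (by simpa using hb.relabel hσ)
    simpa [map_relabelNamed] using this

theorem CoreRel.length_eq {c : Core A} {l r : Stack A} (h : CoreRel P U V c l r) :
    l.length = c.ins ∧ r.length = c.outs := by
  cases h with
  | leftCusp c d hU hV => simp [Core.ins, Core.outs]
  | rightCusp c d => simp [Core.ins, Core.outs]
  | crossing k x y r h => simpa [Core.ins, Core.outs] using h.perm.length_eq
  | vertex L R h hb => simp [Core.ins, Core.outs]

theorem balanced_pair {c : A} {d : ℕ} (hU : d ∉ U) (hV : d ∉ V) :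
    Balanced U V [(c + 1, d), (c, d)] := by
  have h : Balanced U V ([] : Stack A) := ⟨by simp, by simp⟩
  simpa using Balanced.insert_cusp (l₁ := []) (l₂ := []) (l₃ := []) c h hU hV (by simp)

theorem CoreRel.balanced {c : Core A} {l r : Stack A} (h : CoreRel P U V c l r)
    (hl : Balanced U V l) : Balanced U V r := by
  cases h with
  | leftCusp c d hU hV => exact balanced_pair hU hV
  | rightCusp c d => exact ⟨by simp, by simp⟩
  | crossing k x y r h => exact (crossWord_singleton.2 h).balanced hl
  | vertex L R h hb => exact hb

theorem CoreRel.factor {c : Core A} {l r : Stack A} (h : CoreRel P U V c l r)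
    (hl : Balanced U V l) : ∃ (K K' : ℕ → Bool) (w : List (ℕ × Bool)),
      (∀ d, K d = true → (pieces l).count d = 2) ∧ (∀ d, K' d = true ↔ (pieces r).count d = 2) ∧
      CrossWord U V w (forget K l) (forget K' r) ∧ (¬ c.IsMarked → ∃ w', w = regular w') ∧
      ∀ (U' V' : List ℕ) (σ : Equiv.Perm ℕ), Balanced U' V' (LegendrianFront.relabel σ r) →
        CrossWord U' V' w (forget K l) (LegendrianFront.relabel σ (forget K' r)) →
        CoreRel P U' V' c l (LegendrianFront.relabel σ r) := by
  cases h with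
  | leftCusp c d hU hV =>
    refine ⟨fun _ => false, (· == d), [], by simp, ?_, by simp [forget], fun _ => ⟨[], rfl⟩, ?_⟩
    · intro g
      by_cases hg : g = d
      · subst hg; simp
      · simp [hg, List.count_cons_of_ne (Ne.symm hg)]
    · intro U' V' σ hb _
      obtain ⟨h₁, h₂⟩ := hb.not_mem_of_count (d := σ d) (by simp)
      exact .leftCusp c (σ d) h₁ h₂
  | rightCusp c d =>
    refine ⟨(· == d), fun _ => false, [], ?_, by simp, by simp [forget], fun _ => ⟨[], rfl⟩, ?_⟩
    · intro g hg
      simp only [beq_iff_eq] at hg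
      subst hg; simp
    · intro U' V' σ hb _
      exact .rightCusp c d
  | crossing k x y r h =>
    have e : ∀ l : Stack A, forget (fun _ => false) l = l := fun l => by simp [forget]
    refine ⟨fun _ => false, fun _ => false, [(0, k)], by simp, ?_, ?_, ?_, ?_⟩
    · obtain ⟨b, e, t, h₁, h₂, -⟩ := crossAt_zero.1 h
      simp only [List.cons.injEq] at h₁
      obtain ⟨rfl, rfl⟩ := h₁
      intro d
      have := h.perm.map Prod.snd |>.count_eq d
      simp only [pieces, Bool.false_eq_true, false_iff]
      rw [this]
      simp [List.count_cons]
      intro h₃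
      split_ifs at h₃ <;> simp_all
    · rw [e, e]
      exact crossWord_singleton.2 h
    · intro hk
      have : k = false := by simpa [Core.IsMarked] using hk
      exact ⟨[0], by simp [this]⟩
    · intro U' V' σ _ hw
      rw [e, e] at hw
      exact .crossing k _ _ _ (crossWord_singleton.1 hw)
  | vertex L R h hb =>
    obtain ⟨w, h₁, h₂⟩ := h.braid
    have e₁ := forget_strands_of_iff fun z hz => h.cuspPieces_iff hl.count_le (z := z) hz
    have e₂ := forget_strands_of_iff fun z hz => h.mirror.cuspPieces_iff hb.count_le (z := z) hz
    refine ⟨cuspPieces P (labels R) L, cuspPieces P (labels L) R, regular w,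
      fun d hd => h.count_of_cuspPieces hl.count_le hd,
      fun d => ⟨fun hd => h.mirror.count_of_cuspPieces hb.count_le hd, fun hd => ?_⟩, ?_,
      fun _ => ⟨w, rfl⟩, ?_⟩
    · by_contra hK
      have h₃ := h.mirror.distinct
      rw [← e₂, pieces_forget] at h₃
      have h₄ := List.nodup_iff_count_le_one.1 h₃ d
      rw [List.count_filter (by simpa using hK)] at h₄
      omega
    · rw [e₁, e₂]
      exact h₂
    · intro U' V' σ hb' hw
      rw [e₁, e₂] at hw
      have h₃ : VertexRel P U' V' L (relabelNamed σ R) := by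
        refine ⟨h.toVertexPairs.relabel_right σ, by simpa using h.distinct, w, by simpa using h₁, ?_⟩
        simpa using hw
      have := CoreRel.vertex _ _ h₃ (by simpa using hb')
      simpa [map_relabelNamed] using this

theorem Balanced.of_perm_forget {l r : Stack A} {K K' : ℕ → Bool} (hl : Balanced U V l)
    (hK' : ∀ d, K' d = true → (pieces r).count d = 2 ∧ d ∉ U ∧ d ∉ V)
    (hp : (LegendrianFront.forget K' r).Perm (LegendrianFront.forget K l))
    (hpot : ∀ a b d, [(a, d), (b, d)].Sublist r → a = b + 1) :
    Balanced U V r where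
  count d hd := by
    by_cases h : K' d = true
    · obtain ⟨h₁, h₂, h₃⟩ := hK' d h
      rw [← List.count_eq_zero] at h₂ h₃
      simp only [List.count_append]
      omega
    · have h₁ : d ∈ pieces (LegendrianFront.forget K' r) := by
        rw [pieces_forget]
        exact List.mem_filter.2 ⟨hd, by simpa using h⟩
      have h₂ : d ∈ pieces (LegendrianFront.forget K l) := (hp.map Prod.snd).subset h₁
      rw [pieces_forget] at h₂
      obtain ⟨h₃, h₄⟩ := List.mem_filter.1 h₂
      have h₅ := (hp.map Prod.snd).count_eq d
      change (pieces (LegendrianFront.forget K' r)).count d = (pieces (LegendrianFront.forget K l)).count d at h₅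
      rw [pieces_forget, pieces_forget, List.count_filter (by simpa using h),
        List.count_filter (by simpa using h₄)] at h₅
      have := hl.count d h₃
      simp only [List.count_append] at this ⊢
      omega
  pot := hpot

theorem forget_eq_self {K : ℕ → Bool} {l : Stack A} (h : ∀ d ∈ pieces l, K d = false) :
    forget K l = l := by
  rw [forget, List.filter_eq_self]
  rintro ⟨a, d⟩ hd
  simp [h d (mem_pieces.2 ⟨a, hd⟩)]

theorem mem_forget {K : ℕ → Bool} {l : Stack A} {z : A × ℕ} :
    z ∈ forget K l ↔ z ∈ l ∧ K z.2 = false := by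
  simp [forget]

theorem CoreRel.balanced_stack {c : Core A} {s l r t : Stack A}
    (h : CoreRel P (U ++ pieces s) (pieces t ++ V) c l r) (hl : Balanced U V (s ++ l ++ t)) :
    Balanced U V (s ++ r ++ t) := by
  have hm := hl.mid
  have hr := h.balanced hm
  obtain ⟨K, K', w, hK, hK', hw, -⟩ := h.factor hm
  have k₁ : ∀ d, K d = true → d ∉ U ++ pieces s ∧ d ∉ pieces t ++ V := fun d hd =>
    hm.not_mem_of_count (hK d hd)
  have k₂ : ∀ d, K' d = true → d ∉ U ++ pieces s ∧ d ∉ pieces t ++ V := fun d hd =>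
    hr.not_mem_of_count ((hK' d).1 hd)
  simp only [List.mem_append, not_or] at k₁ k₂
  have e₁ : forget K (s ++ l ++ t) = s ++ forget K l ++ t := by
    rw [forget_append, forget_append, forget_eq_self (l := s), forget_eq_self (l := t)]
    · intro d hd; by_contra h; exact (k₁ d (by simpa using h)).2.1 hd
    · intro d hd; by_contra h; exact (k₁ d (by simpa using h)).1.2 hd
  have e₂ : forget K' (s ++ r ++ t) = s ++ forget K' r ++ t := by
    rw [forget_append, forget_append, forget_eq_self (l := s), forget_eq_self (l := t)]
    · intro d hd; by_contra h; exact (k₂ d (by simpa using h)).2.1 hd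
    · intro d hd; by_contra h; exact (k₂ d (by simpa using h)).1.2 hd
  have key : ∀ (a : A) (d : ℕ), (a, d) ∈ r → K' d = false → (a, d) ∈ l := fun a d h₁ h₂ =>
    (mem_forget.1 (hw.perm.subset (mem_forget.2 ⟨h₁, h₂⟩))).1
  have hm' : ∀ (a : A) (d : ℕ), (a, d) ∈ s ∨ (a, d) ∈ t → K' d = false := fun a d h => by
    by_contra h₁
    have h₂ := k₂ d (by simpa using h₁)
    rcases h with h | h
    · exact h₂.1.2 (mem_pieces.2 ⟨a, h⟩)
    · exact h₂.2.1 (mem_pieces.2 ⟨a, h⟩)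
  refine hl.of_perm_forget (K := K) (K' := K') (fun d hd => ?_) ?_ ?_
  · obtain ⟨⟨h₁, h₂⟩, h₃, h₄⟩ := k₂ d hd
    refine ⟨?_, h₁, h₄⟩
    rw [← List.count_eq_zero] at h₂ h₃
    have := (hK' d).1 hd
    simp only [pieces_append, List.count_append]
    omega
  · rw [e₁, e₂]
    exact (hw.perm.append_left s).append_right t
  · intro a b d hab
    rw [pair_sublist_append, pair_sublist_append] at hab
    have g : ∀ {x}, [(a, d), (b, d)].Sublist x → x.Sublist (s ++ l ++ t) → a = b + 1 :=
      fun h h' => hl.pot a b d (h.trans h')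
    have h₁ : s.Sublist (s ++ l ++ t) := by simp
    rcases hab with (hab | ⟨ha, hb⟩ | hab) | ⟨ha, hb⟩ | hab
    · exact g hab (by simp)
    · refine hl.pot a b d ((pair_sublist_append _ _ _ _).2 (.inl ((pair_sublist_append _ _ _ _).2
        (.inr (.inl ⟨ha, key b d hb (hm' a d (.inl ha))⟩)))))
    · exact hr.pot a b d hab
    · refine hl.pot a b d ((pair_sublist_append _ _ _ _).2 (.inr (.inl ⟨?_, hb⟩)))
      rcases List.mem_append.1 ha with ha | ha
      · simp [ha]
      · simp [key a d ha (hm' b d (.inr hb))]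
    · exact g hab (by simp)

theorem PStep.balanced {e : Event A} {x y : Stack A} (h : PStep P U V e x y)
    (hx : Balanced U V x) : Balanced U V y := by
  obtain ⟨s, l, r, t, -, rfl, rfl, h⟩ := h
  exact h.balanced_stack hx

theorem PRul.balanced {W : Front A} {x y : Stack A} (h : PRul P U V W x y)
    (hx : Balanced U V x) : Balanced U V y := by
  induction W generalizing x with
  | nil => exact h ▸ hx
  | cons e W ih =>
    obtain ⟨z, h₁, h₂⟩ := h
    exact ih h₂ (h₁.balanced hx)

theorem PStep.relabel {e : Event A} {x y : Stack A} (h : PStep P U V e x y) {σ : ℕ → ℕ}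
    (hσ : σ.Injective) :
    PStep P (U.map σ) (V.map σ) e (relabel σ x) (LegendrianFront.relabel σ y) := by
  obtain ⟨s, l, r, t, hs, rfl, rfl, h⟩ := h
  refine ⟨LegendrianFront.relabel σ s, LegendrianFront.relabel σ l, LegendrianFront.relabel σ r,
    LegendrianFront.relabel σ t, by simpa, by simp, by simp, ?_⟩
  simpa using h.relabel hσ

theorem PRul.relabel {W : Front A} {x y : Stack A} (h : PRul P U V W x y) {σ : ℕ → ℕ}
    (hσ : σ.Injective) :
    PRul P (U.map σ) (V.map σ) W (relabel σ x) (LegendrianFront.relabel σ y) := by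
  induction W generalizing x with
  | nil => exact congrArg _ h
  | cons e W ih =>
    obtain ⟨z, h₁, h₂⟩ := h
    exact ⟨_, h₁.relabel hσ, ih h₂⟩

/-- A front below `n` further strands. -/
def Front.shift (n : ℕ) (W : Front A) : Front A := List.map (fun e => ⟨n + e.pos, e.core⟩) W

theorem pStep_append_left {e : Event A} {u l y : Stack A} :
    PStep P U V ⟨u.length + e.pos, e.core⟩ (u ++ l) y ↔
      ∃ r, y = u ++ r ∧ PStep P (U ++ pieces u) V e l r := by
  constructor
  · rintro ⟨s, m, m', t, hs, hl, rfl, h⟩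
    rw [List.append_assoc] at hl
    obtain ⟨s', rfl, rfl⟩ := append_eq_append_of_le hl.symm (by simp at hs; omega)
    refine ⟨s' ++ m' ++ t, by simp, s', m, m', t, by simpa using hs, by simp, rfl, by simpa using h⟩
  · rintro ⟨r, rfl, s, m, m', t, hs, rfl, rfl, h⟩
    exact ⟨u ++ s, m, m', t, by simp [hs], by simp, by simp, by simpa using h⟩

theorem pRul_append_left {W : Front A} {u l y : Stack A} :
    PRul P U V (W.shift u.length) (u ++ l) y ↔ ∃ r, y = u ++ r ∧ PRul P (U ++ pieces u) V W l r := by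
  induction W generalizing l with
  | nil => simp [Front.shift, eq_comm]
  | cons e W ih =>
    change (∃ z, PStep P U V ⟨u.length + e.pos, e.core⟩ (u ++ l) z ∧
      PRul P U V (Front.shift u.length W) z y) ↔ _
    simp only [pStep_append_left, PRul]
    constructor
    · rintro ⟨_, ⟨r, rfl, h₁⟩, h₂⟩
      obtain ⟨r', rfl, h₃⟩ := ih.1 h₂
      exact ⟨r', rfl, r, h₁, h₃⟩
    · rintro ⟨r', rfl, r, h₁, h₃⟩
      exact ⟨_, ⟨r, rfl, h₁⟩, ih.2 ⟨r', rfl, h₃⟩⟩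

theorem pStep_append_right {e : Event A} {v l y : Stack A} (he : e.pos + e.core.ins ≤ l.length) :
    PStep P U V e (l ++ v) y ↔ ∃ r, y = r ++ v ∧ PStep P U (pieces v ++ V) e l r := by
  constructor
  · rintro ⟨s, m, m', t, hs, hl, rfl, h⟩
    obtain ⟨t', ht, rfl⟩ := append_eq_append_of_le hl (by
      have := h.length_eq; simp; omega)
    refine ⟨s ++ m' ++ t', by simp, s, m, m', t', hs, ht, rfl, by simpa using h⟩
  · rintro ⟨r, rfl, s, m, m', t, hs, rfl, rfl, h⟩
    exact ⟨s, m, m', t ++ v, by simp [hs], by simp, by simp, by simpa using h⟩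

theorem crossAt_iff_pStep {k : Bool} {q : ℕ} {x y : Stack A} :
    PStep P U V ⟨q, .crossing k⟩ x y ↔ CrossAt U V k q x y := by
  constructor
  · rintro ⟨s, l, r, t, rfl, rfl, rfl, h⟩
    cases h with
    | crossing _ x y r h =>
      have h₁ := (crossAt_append_right (V := V) (by simp)).2 ⟨r, rfl, h⟩
      have h₂ := (crossAt_append_left (q := 0)).2 ⟨_, rfl, h₁⟩
      simpa using h₂
  · rintro ⟨s, t, a, b, d, e, rfl, rfl, hne, h⟩
    rcases h with rfl | ⟨rfl, rfl, hb, rfl⟩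
    · refine ⟨s, [(a, d), (b, e)], [(b, e), (a, d)], t, rfl, by simp, by simp, .crossing _ _ _ _ ?_⟩
      exact crossAt_zero.2 ⟨b, e, [], rfl, hne, .inl rfl⟩
    · refine ⟨s, [(a, d), (a, e)], [(a, d), (a, e)], t, rfl, by simp, by simp, .crossing _ _ _ _ ?_⟩
      exact crossAt_zero.2 ⟨a, e, [], rfl, hne, .inr ⟨rfl, rfl, by simpa using hb, rfl⟩⟩

theorem pRul_crossings {w : List (ℕ × Bool)} {x y : Stack A} :
    PRul P U V (w.map fun z => (⟨z.1, .crossing z.2⟩ : Event A)) x y ↔ CrossWord U V w x y := by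
  induction w generalizing x with
  | nil => simp
  | cons z w ih => simp only [List.map_cons, PRul, crossAt_iff_pStep, ih, CrossWord]

theorem exists_bound (L : List ℕ) : ∃ N, ∀ d ∈ L, d < N := by
  induction L with
  | nil => exact ⟨0, by simp⟩
  | cons a L ih =>
    obtain ⟨N, hN⟩ := ih
    refine ⟨max N (a + 1), fun d hd => ?_⟩
    rcases List.mem_cons.1 hd with rfl | hd
    · omega
    · have := hN d hd; omega

theorem exists_perm_avoid {D S : List ℕ} (h : ∀ d ∈ D, d ∉ S) (F : List ℕ) :
    ∃ τ : Equiv.Perm ℕ, (∀ d ∈ S, τ d = d) ∧ ∀ d ∈ D, τ d ∉ F := by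
  obtain ⟨N, hN⟩ := exists_bound (D ++ S ++ F)
  have hD : ∀ d ∈ D, d < N := fun d hd => hN d (by simp [hd])
  have hf : Function.Involutive
      fun x => if x ∈ D then x + N else if N ≤ x ∧ x - N ∈ D then x - N else x := by
    intro x
    by_cases h₁ : x ∈ D
    · have h₂ : x + N ∉ D := fun h₂ => by have := hD _ h₂; omega
      simp [h₁, h₂]
    · by_cases h₂ : N ≤ x ∧ x - N ∈ D
      · simp [h₁, h₂]
      · simp only [h₁, if_false, h₂]
  refine ⟨Function.Involutive.toPerm _ hf, fun d hd => ?_, fun d hd hF => ?_⟩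
  · have h₁ : d ∉ D := fun h₁ => h d h₁ hd
    have h₂ : ¬ (N ≤ d ∧ d - N ∈ D) := fun h₂ => by
      have := hN d (by simp [hd]); omega
    simp [Function.Involutive.toPerm, h₁, h₂]
  · have h₁ : Function.Involutive.toPerm _ hf d = d + N := by simp [Function.Involutive.toPerm, hd]
    have := hN _ (by rw [List.mem_append]; exact .inr hF)
    omega

theorem CoreRel.refresh {c : Core A} {l r : Stack A} (h : CoreRel P U V c l r)
    (hl : Balanced U V l) (F : List ℕ) : ∃ τ : Equiv.Perm ℕ, (∀ d ∈ U, τ d = d) ∧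
      (∀ d ∈ V, τ d = d) ∧ CoreRel P U V c l (LegendrianFront.relabel τ r) ∧
      ∀ d, (pieces (LegendrianFront.relabel τ r)).count d = 2 → d ∉ F := by
  have hr := h.balanced hl
  obtain ⟨K, K', w, hK, hK', hw, -, hrec⟩ := h.factor hl
  obtain ⟨τ, h₁, h₂⟩ := exists_perm_avoid (D := (pieces r).filter (K' ·))
    (S := U ++ V ++ pieces (forget K' r)) (fun d hd => by
      have h₃ := (List.mem_filter.1 hd).2
      have h₄ := hr.not_mem_of_count ((hK' d).1 h₃)
      simp only [List.mem_append, not_or, pieces_forget, List.mem_filter, not_and]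
      exact ⟨h₄, fun _ => by simp [h₃]⟩) F
  have hU : ∀ d ∈ U, τ d = d := fun d hd => h₁ d (by simp [hd])
  have hV : ∀ d ∈ V, τ d = d := fun d hd => h₁ d (by simp [hd])
  refine ⟨τ, hU, hV, hrec U V τ ?_ ?_, fun d hd hF => ?_⟩
  · have := hr.relabel τ.injective
    rwa [map_eq_self hU, map_eq_self hV] at this
  · rwa [relabel_eq_self (x := forget K' r) fun d hd => h₁ d (by simp [hd])]
  · rw [pieces_relabel] at hd
    obtain ⟨d, rfl⟩ := τ.surjective d
    rw [List.count_map_of_injective _ _ τ.injective] at hd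
    exact h₂ d (List.mem_filter.2 ⟨List.count_pos_iff.1 (by omega), (hK' d).2 hd⟩) hF

theorem forget_congr {K K' : ℕ → Bool} {l : Stack A} (h : ∀ d ∈ pieces l, K d = K' d) :
    forget K l = forget K' l :=
  List.filter_congr fun z hz => by rw [h z.2 (mem_pieces.2 ⟨z.1, hz⟩)]

/-- Events with disjoint strands may be exchanged. -/
theorem coreRel_exchange {c₁ c₂ : Core A} {l₁ r₁ m l₂ r₂ : Stack A} (k₁ : ¬ c₁.IsMarked)
    (k₂ : ¬ c₂.IsMarked) (hl : Balanced U V (l₁ ++ m ++ l₂))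
    (h₁ : CoreRel P U (pieces (m ++ l₂) ++ V) c₁ l₁ r₁)
    (h₂ : CoreRel P (U ++ pieces (r₁ ++ m)) V c₂ l₂ r₂) :
    ∃ σ : Equiv.Perm ℕ, (∀ d ∈ U, σ d = d) ∧ (∀ d ∈ V, σ d = d) ∧ relabel σ m = m ∧
      CoreRel P (U ++ pieces (l₁ ++ m)) V c₂ l₂ (relabel σ r₂) ∧
      CoreRel P U (pieces (m ++ relabel σ r₂) ++ V) c₁ l₁ (relabel σ r₁) := by
  have hl₁ : Balanced U (pieces (m ++ l₂) ++ V) l₁ :=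
    Balanced.left_part (t := m ++ l₂) (by simpa using hl)
  have hb₁ : Balanced U V (r₁ ++ m ++ l₂) := by
    have := CoreRel.balanced_stack (s := []) (t := m ++ l₂) (by simpa using h₁) (by simpa using hl)
    simpa using this
  have hl₂ : Balanced (U ++ pieces (r₁ ++ m)) V l₂ := hb₁.right_part
  obtain ⟨τ, t₁, t₂, t₃, t₄⟩ := h₂.refresh hl₂ (pieces l₁)
  suffices key : ∀ r₂, CoreRel P (U ++ pieces (r₁ ++ m)) V c₂ l₂ r₂ →
      (∀ d, (pieces r₂).count d = 2 → d ∉ pieces l₁) →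
      ∃ σ : Equiv.Perm ℕ, (∀ d ∈ U, σ d = d) ∧ (∀ d ∈ V, σ d = d) ∧ relabel σ m = m ∧
        CoreRel P (U ++ pieces (l₁ ++ m)) V c₂ l₂ (relabel σ r₂) ∧
        CoreRel P U (pieces (m ++ relabel σ r₂) ++ V) c₁ l₁ (relabel σ r₁) by
    obtain ⟨σ, s₁, s₂, s₃, s₄, s₅⟩ := key _ t₃ t₄
    have e₁ : relabel τ m = m := relabel_eq_self fun d hd => t₁ d (by simp [hd])
    have e₂ : relabel τ r₁ = r₁ := relabel_eq_self fun d hd => t₁ d (by simp [hd])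
    rw [relabel_relabel] at s₄ s₅
    refine ⟨σ * τ, fun d hd => ?_, fun d hd => ?_, ?_, s₄, ?_⟩
    · simp [t₁ d (by simp [hd]), s₁ d hd]
    · simp [t₂ d hd, s₂ d hd]
    · rw [Equiv.Perm.coe_mul, ← relabel_relabel, e₁, s₃]
    · rw [Equiv.Perm.coe_mul, ← relabel_relabel σ τ r₁, e₂]
      exact s₅
  clear! r₂
  intro r₂ h₂ hF
  have hb₂ : Balanced U V (r₁ ++ m ++ r₂) := by
    have := CoreRel.balanced_stack (s := r₁ ++ m) (t := []) (by simpa using h₂)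
      (by simpa using hb₁)
    simpa using this
  obtain ⟨K₁, K₁', w₁, a₁, a₁', b₁, d₁, g₁⟩ := h₁.factor hl₁
  obtain ⟨K₂, K₂', w₂, a₂, a₂', b₂, d₂, g₂⟩ := h₂.factor hl₂
  obtain ⟨w₁, rfl⟩ := d₁ k₁
  obtain ⟨w₂, rfl⟩ := d₂ k₂
  have cnt : ∀ (x y z : Stack A) d, Balanced U V (x ++ y ++ z) →
      d ∈ pieces x ∨ d ∈ pieces y ∨ d ∈ pieces z →
      U.count d + (pieces x).count d + (pieces y).count d + (pieces z).count d + V.count d = 2 :=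
    fun x y z d hb hd => by
      have := hb.count d (by simpa using hd)
      simp only [pieces_append, List.count_append] at this
      omega
  have hmem : ∀ (d : ℕ) (x : List ℕ), x.count d = 2 → d ∈ x := fun d x h =>
    List.count_pos_iff.1 (by omega)
  have nK₁ : ∀ d, K₁ d = true → d ∉ U ∧ d ∉ pieces m ∧ d ∉ pieces l₂ ∧ d ∉ V := fun d hd => by
    have e₁ := a₁ d hd
    have e₂ := cnt _ _ _ d hl (.inl (hmem d _ e₁))
    simp only [← List.count_eq_zero]
    omega
  have nK₂ : ∀ d, K₂ d = true → d ∉ U ∧ d ∉ pieces m ∧ d ∉ pieces l₁ ∧ d ∉ V ∧ d ∉ pieces r₁ :=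
    fun d hd => by
    have e₁ := a₂ d hd
    have e₂ := cnt _ _ _ d hl (.inr (.inr (hmem d _ e₁)))
    have e₃ := cnt _ _ _ d hb₁ (.inr (.inr (hmem d _ e₁)))
    simp only [← List.count_eq_zero]
    omega
  have nK₁' : ∀ d, K₁' d = true → d ∉ U ∧ d ∉ pieces m ∧ d ∉ pieces l₂ ∧ d ∉ V ∧ d ∉ pieces r₂ :=
    fun d hd => by
    have e₁ := (a₁' d).1 hd
    have e₂ := cnt _ _ _ d hb₁ (.inl (hmem d _ e₁))
    have e₃ := cnt _ _ _ d hb₂ (.inl (hmem d _ e₁))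
    simp only [← List.count_eq_zero]
    omega
  have nK₂' : ∀ d, K₂' d = true → d ∉ U ∧ d ∉ pieces m ∧ d ∉ pieces l₁ ∧ d ∉ V ∧ d ∉ pieces r₁ :=
    fun d hd => by
    have e₁ := (a₂' d).1 hd
    have e₃ := cnt _ _ _ d hb₂ (.inr (.inr (hmem d _ e₁)))
    refine ⟨?_, ?_, hF d e₁, ?_, ?_⟩ <;> rw [← List.count_eq_zero] <;> omega
  have mf : ∀ (K : ℕ → Bool) (x : Stack A) d, d ∈ pieces (forget K x) ↔
      d ∈ pieces x ∧ K d = false := fun K x d => by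
    rw [pieces_forget, List.mem_filter]; simp
  have nb : ∀ {K : ℕ → Bool} {d : ℕ} {Q : Prop}, (K d = true → ¬ Q) → Q → K d = false :=
    fun h q => by
      by_contra hc
      exact h (by simpa using hc) q
  set K : ℕ → Bool := fun d => K₁ d || K₂ d with hK
  have eb : forget K (l₁ ++ m ++ l₂) = forget K₁ l₁ ++ m ++ forget K₂ l₂ := by
    rw [forget_append, forget_append, forget_eq_self (l := m), forget_congr (K' := K₁),
      forget_congr (l := l₂) (K' := K₂)]
    · intro d hd
      simp [hK, nb (K := K₁) (fun h => (nK₁ d h).2.2.1) hd]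
    · intro d hd
      simp [hK, nb (K := K₂) (fun h => (nK₂ d h).2.2.1) hd]
    · intro d hd
      simp [hK, nb (K := K₁) (fun h => (nK₁ d h).2.1) hd, nb (K := K₂) (fun h => (nK₂ d h).2.1) hd]
  have hblock := hl.forget K
  rw [eb] at hblock
  have c₁' : CrossWord U (pieces (m ++ forget K₂ l₂) ++ V) (regular w₁) (forget K₁ l₁)
      (forget K₁' r₁) := by
    refine b₁.congr (p := (!K₂ ·)) (fun d hd => ?_) rfl ?_
    · simp [nb (K := K₂) (fun h => (nK₂ d h).2.2.1) ((mf _ _ _).1 hd).1]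
    · simp [pieces_forget, List.filter_filter]
  have c₂' : CrossWord (U ++ pieces (forget K₁' r₁ ++ m)) V (regular w₂) (forget K₂ l₂)
      (forget K₂' r₂) := by
    refine b₂.congr (p := (!K₁' ·)) (fun d hd => ?_) ?_ rfl
    · simp [nb (K := K₁') (fun h => (nK₁' d h).2.2.1) ((mf _ _ _).1 hd).1]
    · simp [pieces_forget, List.filter_filter]
  have hword : CrossWord U V (regular (w₁ ++ w₂.map ((forget K₁' r₁ ++ m).length + ·)))
      (forget K₁ l₁ ++ m ++ forget K₂ l₂) (forget K₁' r₁ ++ m ++ forget K₂' r₂) := by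
    rw [regular_append, crossWord_append, ← shiftWord_regular]
    refine ⟨forget K₁' r₁ ++ m ++ forget K₂ l₂, ?_, crossWord_append_left.2 ⟨_, rfl, c₂'⟩⟩
    rw [List.append_assoc, crossWord_append_right b₁.fits]
    exact ⟨forget K₁' r₁, by simp, c₁'⟩
  have hlen₁ := c₁'.length_eq
  obtain ⟨σ, hσ, hs⟩ := (BraidEq.append_comm fun p hp q hq => by
    obtain ⟨q, -, rfl⟩ := List.mem_map.1 hq
    have := b₁.fits (p, false) (by simpa [regular] using hp)
    simp at this ⊢
    omega : BraidEq (w₁ ++ w₂.map ((forget K₁' r₁ ++ m).length + ·)) _).simulates.1 _ _ _ _ hblock hword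
  have hlen₂ : (forget K₁' r₁ ++ m).length = (forget K₁ l₁ ++ m).length := by simp [hlen₁]
  rw [regular_append, crossWord_append, ← shiftWord_regular, hlen₂] at hs
  obtain ⟨q, q₁, q₂⟩ := hs
  obtain ⟨q, rfl, q₃⟩ := crossWord_append_left.1 q₁
  rw [List.append_assoc, crossWord_append_right b₁.fits] at q₂
  obtain ⟨q', q₄, q₅⟩ := q₂
  rw [relabel_append, relabel_append, List.append_assoc] at q₄
  obtain ⟨rfl, q₆⟩ := List.append_inj q₄ (by simp [hlen₁, q₅.length_eq])
  obtain ⟨hm, rfl⟩ := List.append_inj q₆ (by simp)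
  have hσU : ∀ d ∈ U, σ d = d := fun d hd => hσ d (.inl hd)
  have hσV : ∀ d ∈ V, σ d = d := fun d hd => hσ d (.inr (.inl hd))
  have hp₁ : ∀ d, d ∈ pieces (forget K₁ l₁) ↔ d ∈ pieces (forget K₁' r₁) := fun d =>
    c₁'.perm_pieces.symm.mem_iff
  have hp₂ : ∀ d, d ∈ pieces (forget K₂ l₂) ↔ d ∈ pieces (forget K₂' r₂) := fun d =>
    c₂'.perm_pieces.symm.mem_iff
  have hσ₁ : ∀ d, K₁' d = true → σ d = d := fun d hd => hσ d (.inr (.inr (by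
    simp only [pieces_append, List.mem_append, not_or, hp₁, mf, hd]
    have := nK₁' d hd
    simp [this])))
  have hσ₂ : ∀ d, K₂' d = true → σ d = d := fun d hd => hσ d (.inr (.inr (by
    simp only [pieces_append, List.mem_append, not_or, hp₂, mf, hd]
    have := nK₂' d hd
    simp [this])))
  have hcomp : ∀ K : ℕ → Bool, (∀ d, K d = true → σ d = d) → K ∘ σ = K := fun K h => by
    funext d
    rw [Bool.eq_iff_iff]
    constructor
    · intro h'
      have := h _ h'
      rw [← σ.injective this]
      exact h'
    · intro h'
      simpa [h d h'] using h'
  have hcnt : ∀ (K : ℕ → Bool) (x : Stack A) d, σ d = d →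
      (pieces (relabel σ x)).count d = (pieces x).count d := fun K x d hd => by
    rw [pieces_relabel]
    conv_lhs => rw [← hd]
    exact List.count_map_of_injective _ _ σ.injective _
  have hbσ := hb₂.relabel σ.injective
  rw [map_eq_self hσU, map_eq_self hσV] at hbσ
  simp only [relabel_append] at hbσ
  have hbr₂ : Balanced (U ++ pieces (l₁ ++ m)) V (relabel σ r₂) := by
    refine hl.right_part.of_perm_forget (K := K₂) (K' := K₂') (fun d hd => ?_) ?_ ?_
    · rw [hcnt K₂' _ _ (hσ₂ d hd)]
      refine ⟨(a₂' d).1 hd, ?_⟩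
      have := nK₂' d hd
      simp [this]
    · rw [forget_relabel, hcomp _ hσ₂]
      exact q₃.perm
    · intro a b d hab
      exact hbσ.pot a b d (hab.trans (List.sublist_append_right _ _))
  have f₂ : CoreRel P (U ++ pieces (l₁ ++ m)) V c₂ l₂ (relabel σ r₂) := by
    refine g₂ _ _ σ hbr₂ (q₃.congr (p := (!K₁ ·)) (fun d hd => ?_) ?_ rfl)
    · simp [nb (K := K₁) (fun h => (nK₁ d h).2.2.1) ((mf _ _ _).1 hd).1]
    · simp [pieces_forget, List.filter_filter]
  have hnew : Balanced U V (l₁ ++ m ++ relabel σ r₂) := by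
    have := CoreRel.balanced_stack (s := l₁ ++ m) (t := []) (by simpa using f₂) (by simpa using hl)
    simpa using this
  refine ⟨σ, hσU, hσV, hm, f₂, g₁ _ _ σ ?_ (q₅.congr (p := (!K₂' ·)) (fun d hd => ?_) rfl ?_)⟩
  · refine (Balanced.left_part (l := l₁) (t := m ++ relabel σ r₂)
      (by simpa using hnew)).of_perm_forget (K := K₁) (K' := K₁') (fun d hd => ?_) ?_ ?_
    · rw [hcnt K₁' _ _ (hσ₁ d hd)]
      have h₃ := nK₁' d hd
      refine ⟨(a₁' d).1 hd, h₃.1, ?_⟩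
      have h₄ : d ∉ pieces (relabel σ r₂) := by
        rw [pieces_relabel]
        intro h₄
        obtain ⟨g, hg, hg'⟩ := List.mem_map.1 h₄
        rw [← hσ₁ d hd] at hg'
        rw [σ.injective hg'] at hg
        exact h₃.2.2.2.2 hg
      simp only [pieces_append, List.mem_append, not_or]
      exact ⟨⟨h₃.2.1, h₄⟩, h₃.2.2.2.1⟩
    · rw [forget_relabel, hcomp _ hσ₁]
      exact q₅.perm
    · intro a b d hab
      exact hbσ.pot a b d (hab.trans (by simp))
  · simp [nb (K := K₂') (fun h => (nK₂' d h).2.2.1) ((mf _ _ _).1 hd).1]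
  · have : relabel σ (forget K₂' r₂) = forget K₂' (relabel σ r₂) := by
      rw [forget_relabel, hcomp _ hσ₂]
    rw [this]
    simp [pieces_forget, List.filter_filter]

/-- An event turned upside down. -/
def Core.flip : Core A → Core A
  | .leftCusp c => .leftCusp (-(c + 1))
  | .rightCusp => .rightCusp
  | .crossing k => .crossing k
  | .vertex ls rs => .vertex ls.reverse (rs.map fun x => (x.1, -x.2)).reverse

@[simp] theorem Core.flip_flip (c : Core A) : c.flip.flip = c := by
  cases c <;> simp [Core.flip, Function.comp_def]

theorem Core.isMarked_flip (c : Core A) : c.flip.IsMarked ↔ c.IsMarked := by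
  cases c <;> simp [Core.flip, Core.IsMarked]

theorem CoreRel.flip {c : Core A} {l r : Stack A} (h : CoreRel P U V c l r) :
    CoreRel P V.reverse U.reverse c.flip (flipStack l) (flipStack r) := by
  cases h with
  | leftCusp c d hU hV =>
    have := CoreRel.leftCusp (P := P) (U := V.reverse) (V := U.reverse) (-(c + 1)) d (by simpa)
      (by simpa)
    simpa [Core.flip] using this
  | rightCusp c d =>
    have := CoreRel.rightCusp (P := P) (U := V.reverse) (V := U.reverse) (-(c + 1)) d
    simpa [Core.flip] using this
  | crossing k x y r h =>
    have := h.flip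
    exact .crossing k (-y.1, y.2) (-x.1, x.2) _ (by simpa using this)
  | vertex L R h hb =>
    have := CoreRel.vertex _ _ h.flip (by simpa using hb.flip)
    simpa [Core.flip, flipNamed, strands, labels, flipStack, Function.comp_def] using this

theorem flipStack_relabel (σ : ℕ → ℕ) (l : Stack A) :
    flipStack (relabel σ l) = relabel σ (flipStack l) := by
  simp [flipStack, relabel, Function.comp_def]

theorem coreRel_exchange_symm {c₁ c₂ : Core A} {l₁ r₁ m l₂ r₂ : Stack A} (k₁ : ¬ c₁.IsMarked)
    (k₂ : ¬ c₂.IsMarked) (hl : Balanced U V (l₁ ++ m ++ l₂))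
    (h₂ : CoreRel P (U ++ pieces (l₁ ++ m)) V c₂ l₂ r₂)
    (h₁ : CoreRel P U (pieces (m ++ r₂) ++ V) c₁ l₁ r₁) :
    ∃ σ : Equiv.Perm ℕ, (∀ d ∈ U, σ d = d) ∧ (∀ d ∈ V, σ d = d) ∧ relabel σ m = m ∧
      CoreRel P U (pieces (m ++ l₂) ++ V) c₁ l₁ (relabel σ r₁) ∧
      CoreRel P (U ++ pieces (relabel σ r₁ ++ m)) V c₂ l₂ (relabel σ r₂) := by
  obtain ⟨σ, s₁, s₂, s₃, s₄, s₅⟩ := coreRel_exchange (U := V.reverse) (V := U.reverse)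
    (m := flipStack m) (mt c₂.isMarked_flip.1 k₂) (mt c₁.isMarked_flip.1 k₁) (by simpa using hl.flip)
    (by simpa using h₂.flip) (by simpa using h₁.flip)
  refine ⟨σ, by simpa using s₂, by simpa using s₁, ?_, ?_, ?_⟩
  · rw [← flipStack_relabel] at s₃
    simpa using congrArg flipStack s₃
  · have := s₄.flip
    rw [← flipStack_relabel] at this
    simpa using this
  · have := s₅.flip
    rw [← flipStack_relabel, ← flipStack_relabel] at this
    simpa using this

/-! ### Single steps -/

/-- The potentials of a stack. -/
def pots (x : Stack A) : List A := x.map Prod.fst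

@[simp] theorem pots_nil : pots ([] : Stack A) = [] := rfl
@[simp] theorem pots_cons (z : A × ℕ) (x : Stack A) : pots (z :: x) = z.1 :: pots x := rfl
@[simp] theorem pots_append (x y : Stack A) : pots (x ++ y) = pots x ++ pots y := by
  simp [pots]
@[simp] theorem length_pots (x : Stack A) : (pots x).length = x.length := by simp [pots]
theorem pStep_block {c : Core A} {s l t y : Stack A} (hl : l.length = c.ins) :
    PStep P U V ⟨s.length, c⟩ (s ++ l ++ t) y ↔
      ∃ r, y = s ++ r ++ t ∧ CoreRel P (U ++ pieces s) (pieces t ++ V) c l r := by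
  constructor
  · rintro ⟨s', l', r, t', hs, h, rfl, hr⟩
    obtain ⟨h₁, rfl⟩ := List.append_inj h (by simp [hr.length_eq.1, hl]; simpa using hs.symm)
    obtain ⟨rfl, rfl⟩ := List.append_inj h₁ hs.symm
    exact ⟨r, rfl, hr⟩
  · rintro ⟨r, rfl, hr⟩
    exact ⟨s, l, r, t, rfl, rfl, rfl, hr⟩

theorem pStep_leftCusp {c : A} {s t y : Stack A} :
    PStep P U V (lcusp s.length c) (s ++ t) y ↔ ∃ d, d ∉ U ++ pieces s ∧ d ∉ pieces t ++ V ∧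
      y = s ++ (c + 1, d) :: (c, d) :: t := by
  have := pStep_block (P := P) (U := U) (V := V) (c := .leftCusp c) (s := s) (l := []) (t := t)
    (y := y) rfl
  rw [List.append_nil] at this
  refine this.trans ⟨?_, ?_⟩
  · rintro ⟨r, rfl, h⟩
    cases h with
    | leftCusp c d h₁ h₂ => exact ⟨d, h₁, h₂, by simp⟩
  · rintro ⟨d, h₁, h₂, rfl⟩
    exact ⟨_, by simp, .leftCusp c d h₁ h₂⟩

theorem pStep_rightCusp {a b : A} {d e : ℕ} {s t y : Stack A} :
    PStep P U V (rcusp s.length) (s ++ (a, d) :: (b, e) :: t) y ↔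
      a = b + 1 ∧ d = e ∧ y = s ++ t := by
  have := pStep_block (P := P) (U := U) (V := V) (c := .rightCusp) (s := s) (l := [(a, d), (b, e)])
    (t := t) (y := y) rfl
  rw [List.append_assoc] at this
  refine this.trans ⟨?_, ?_⟩
  · rintro ⟨r, rfl, h⟩
    cases h with
    | rightCusp c d => exact ⟨rfl, rfl, by simp⟩
  · rintro ⟨rfl, rfl, rfl⟩
    exact ⟨[], by simp, .rightCusp b d⟩

theorem coreRel_vertex {ls : List ℕ} {rs : List (ℕ × A)} {l r : Stack A} :
    CoreRel P U V (.vertex ls rs) l r ↔ ∃ L R : Named A, ls = labels L ∧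
      rs = R.map (fun z => (z.1, z.2.1)) ∧ l = strands L ∧ r = strands R ∧ VertexRel P U V L R ∧
      Balanced U V (strands R) := by
  constructor
  · intro h
    cases h with
    | vertex L R h hb => exact ⟨L, R, rfl, rfl, rfl, rfl, h, hb⟩
  · rintro ⟨L, R, rfl, rfl, rfl, rfl, h, hb⟩
    exact .vertex L R h hb

theorem pStep_vertex {ls : List ℕ} {rs : List (ℕ × A)} {s l t y : Stack A}
    (hl : l.length = ls.length) :
    PStep P U V (vert s.length ls rs) (s ++ l ++ t) y ↔ ∃ L R : Named A, ls = labels L ∧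
      rs = R.map (fun z => (z.1, z.2.1)) ∧ l = strands L ∧ y = s ++ strands R ++ t ∧
      VertexRel P (U ++ pieces s) (pieces t ++ V) L R ∧
      Balanced (U ++ pieces s) (pieces t ++ V) (strands R) := by
  refine (pStep_block hl).trans ?_
  simp only [coreRel_vertex]
  constructor
  · rintro ⟨r, rfl, L, R, h₁, h₂, h₃, rfl, h₄⟩
    exact ⟨L, R, h₁, h₂, h₃, rfl, h₄⟩
  · rintro ⟨L, R, h₁, h₂, h₃, rfl, h₄⟩
    exact ⟨_, rfl, L, R, h₁, h₂, h₃, rfl, h₄⟩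

theorem strandDown_eq (p k : ℕ) : (strandDown p k : Front A) =
    (shiftWord p (regular (List.range k))).map fun z => ⟨z.1, .crossing z.2⟩ := by
  simp [strandDown, shiftWord, regular, cross, Function.comp_def]

theorem strandUp_eq (p k : ℕ) : (strandUp p k : Front A) =
    (shiftWord p (regular (List.range k).reverse)).map fun z => ⟨z.1, .crossing z.2⟩ := by
  simp [strandUp, shiftWord, regular, cross, Function.comp_def, List.map_reverse]

theorem pRul_strandDown {s l y : Stack A} {a : A} {d : ℕ} :
    PRul P U V (strandDown s.length l.length) (s ++ (a, d) :: l) y ↔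
      ∃ m f, y = s ++ m ++ [(a, f)] ∧ Down V a (U ++ pieces s) d l m f := by
  rw [strandDown_eq, pRul_crossings, crossWord_append_left]
  simp only [crossWord_down]
  constructor
  · rintro ⟨_, rfl, m, f, rfl, h⟩; exact ⟨m, f, by simp, h⟩
  · rintro ⟨m, f, rfl, h⟩; exact ⟨_, by simp, m, f, rfl, h⟩

theorem pRul_strandUp {s m y : Stack A} {a : A} {f : ℕ} :
    PRul P U V (strandUp s.length m.length) (s ++ m ++ [(a, f)]) y ↔
      ∃ l d, y = s ++ (a, d) :: l ∧ Down V a (U ++ pieces s) d l m f := by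
  rw [strandUp_eq, pRul_crossings, List.append_assoc, crossWord_append_left]
  have e : regular (List.range m.length).reverse = (regular (List.range m.length)).reverse := by
    simp [regular]
  constructor
  · rintro ⟨r, rfl, h⟩
    have hlen := h.length_eq
    have h₁ := h.mirror
    rw [e, List.reverse_reverse] at h₁
    obtain ⟨⟨b, d⟩, l, rfl⟩ : ∃ z l, r = z :: l := by
      cases r with
      | nil => simp at hlen
      | cons z l => exact ⟨z, l, rfl⟩
    have hl : m.length = l.length := by simpa using hlen.symm
    rw [hl] at h₁
    obtain ⟨m', f', h₂, h₃⟩ := crossWord_down.1 h₁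
    obtain ⟨rfl, h₄⟩ := List.append_inj' h₂ rfl
    simp only [List.cons.injEq, Prod.mk.injEq, and_true] at h₄
    obtain ⟨rfl, rfl⟩ := h₄
    exact ⟨l, d, rfl, h₃⟩
  · rintro ⟨l, d, rfl, h⟩
    refine ⟨_, rfl, ?_⟩
    have := (crossWord_down.2 ⟨m, f, rfl, h⟩).mirror
    rwa [← h.length_eq, ← e] at this

/-! ### Potentials -/

/-- The potentials that enter and leave an event, without the strands above and below. -/
def CoreTrans : Core A → List A → List A → Prop
  | .leftCusp c, l, r => l = [] ∧ r = [c + 1, c]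
  | .rightCusp, l, r => ∃ c, l = [c + 1, c] ∧ r = []
  | .crossing _, l, r => ∃ a b, l = [a, b] ∧ r = [b, a]
  | .vertex ls rs, l, r => l.length = ls.length ∧ r = rs.map Prod.snd ∧
      Even (ls.length + rs.length) ∧ 0 < ls.length + rs.length

theorem CoreTrans.length_eq {c : Core A} {l r : List A} (h : CoreTrans c l r) :
    l.length = c.ins ∧ r.length = c.outs := by
  cases c with
  | leftCusp c => obtain ⟨rfl, rfl⟩ := h; exact ⟨rfl, rfl⟩
  | rightCusp => obtain ⟨c, rfl, rfl⟩ := h; exact ⟨rfl, rfl⟩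
  | crossing k => obtain ⟨a, b, rfl, rfl⟩ := h; exact ⟨rfl, rfl⟩
  | vertex ls rs => obtain ⟨h, rfl, -⟩ := h; exact ⟨h, by simp [Core.outs]⟩

theorem trans_iff {e : Event A} {x y : List A} : e.Trans x y ↔
    ∃ s l r t, s.length = e.pos ∧ x = s ++ l ++ t ∧ y = s ++ r ++ t ∧ CoreTrans e.core l r := by
  constructor
  · intro h
    cases h with
    | leftCusp u v c => exact ⟨u, [], [c + 1, c], v, rfl, by simp, by simp, rfl, rfl⟩
    | rightCusp u v c => exact ⟨u, [c + 1, c], [], v, rfl, by simp, by simp, c, rfl, rfl⟩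
    | crossing u v a b k => exact ⟨u, [a, b], [b, a], v, rfl, by simp, by simp, a, b, rfl, rfl⟩
    | vertex u a v ls rs h₁ h₂ h₃ => exact ⟨u, a, _, v, rfl, rfl, rfl, h₁, rfl, h₂, h₃⟩
  · rintro ⟨s, l, r, t, hs, rfl, rfl, h⟩
    obtain ⟨p, c⟩ := e
    obtain rfl : s.length = p := hs
    cases c with
    | leftCusp c => obtain ⟨rfl, rfl⟩ := h; simpa [lcusp] using Event.Trans.leftCusp s t c
    | rightCusp => obtain ⟨c, rfl, rfl⟩ := h; simpa [rcusp] using Event.Trans.rightCusp s t c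
    | crossing k => obtain ⟨a, b, rfl, rfl⟩ := h; simpa using Event.Trans.crossing s t a b k
    | vertex ls rs =>
      obtain ⟨h₁, rfl, h₂, h₃⟩ := h
      exact Event.Trans.vertex s l t ls rs h₁ h₂ h₃

theorem trans_block {c : Core A} {s l t y : List A} (hl : l.length = c.ins) :
    Event.Trans ⟨s.length, c⟩ (s ++ l ++ t) y ↔ ∃ r, y = s ++ r ++ t ∧ CoreTrans c l r := by
  rw [trans_iff]
  constructor
  · rintro ⟨s', l', r, t', hs, h, rfl, hr⟩
    obtain ⟨h₁, rfl⟩ := List.append_inj h (by simp [hr.length_eq.1, hl]; simpa using hs.symm)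
    obtain ⟨rfl, rfl⟩ := List.append_inj h₁ hs.symm
    exact ⟨r, rfl, hr⟩
  · rintro ⟨r, rfl, hr⟩
    exact ⟨s, l, r, t, rfl, rfl, rfl, hr⟩

theorem CoreTrans.eq_pots {c : Core A} {l r : Stack A} {y : List A}
    (h : CoreTrans c (pots l) y) (hr : CoreRel P U V c l r) : y = pots r := by
  cases hr with
  | leftCusp c d _ _ => obtain ⟨-, rfl⟩ := h; rfl
  | rightCusp c d => obtain ⟨_, -, rfl⟩ := h; rfl
  | crossing k x y r hr =>
    obtain ⟨a, b, h, rfl⟩ := h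
    simp only [pots_cons, pots_nil, List.cons.injEq, and_true] at h
    obtain ⟨rfl, rfl⟩ := h
    have h₁ := (crossAt_block (s := []) (t := []) (U := U) (V := V) (k := k) (a := x.1) (b := y.1)
      (d := x.2) (e := y.2)).1 hr
    rcases h₁ with ⟨-, h₁ | ⟨-, h₁, -, h₂⟩⟩
    · simp [h₁]
    · simp [h₂, h₁]
  | vertex L R _ _ =>
    obtain ⟨-, rfl, -⟩ := h
    simp [pots, strands]

theorem _root_.LegendrianFront.Event.Trans.eq_pots {e : Event A} {x y : Stack A} {t : List A}
    (h : e.Trans (pots x) t) (hr : PStep P U V e x y) : t = pots y := by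
  obtain ⟨s, l, r, u, hs, rfl, rfl, hr⟩ := hr
  obtain ⟨p, c⟩ := e
  obtain rfl : s.length = p := hs
  rw [← length_pots s, pots_append, pots_append] at h
  obtain ⟨m, rfl, hm⟩ := (trans_block (by simpa using hr.length_eq.1)).1 h
  simp [hm.eq_pots hr]

/-! ### Moves on a block of strands -/

/-- Rulings of `X` on a block of `n` strands give rulings of `X'`, up to renaming pieces. -/
def BlockSim (P : ℕ → ℕ) (X X' : Front A) (n : ℕ) : Prop :=
  ∀ (U V : List ℕ) (l r : Stack A) (t : List A), l.length = n → Balanced U V l →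
    IsFront X' (pots l) t → PRul P U V X l r →
    ∃ σ : Equiv.Perm ℕ, (∀ d ∈ U, σ d = d) ∧ (∀ d ∈ V, σ d = d) ∧ PRul P U V X' l (relabel σ r)

theorem relabel_one (x : Stack A) : relabel (1 : Equiv.Perm ℕ) x = x :=
  relabel_eq_self fun _ _ => rfl

theorem BlockSim.of_eq {X X' : Front A} {n : ℕ} (h : ∀ (U V : List ℕ) (l r : Stack A)
    (t : List A), l.length = n → Balanced U V l → IsFront X' (pots l) t → PRul P U V X l r →
    PRul P U V X' l r) : BlockSim P X X' n := fun U V l r t h₁ h₂ h₃ h₄ =>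
  ⟨1, fun _ _ => rfl, fun _ _ => rfl, by rw [relabel_one]; exact h U V l r t h₁ h₂ h₃ h₄⟩

theorem blockSim_zero (d : ℕ) {c₁ c₂ : Core A} (k₁ : ¬ c₁.IsMarked) (k₂ : ¬ c₂.IsMarked) :
    BlockSim P [⟨0, c₁⟩, ⟨c₁.outs + d, c₂⟩] [⟨c₁.ins + d, c₂⟩, ⟨0, c₁⟩] (c₁.ins + d + c₂.ins) ∧
    BlockSim P [⟨c₁.ins + d, c₂⟩, ⟨0, c₁⟩] [⟨0, c₁⟩, ⟨c₁.outs + d, c₂⟩] (c₁.ins + d + c₂.ins) := by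
  have split : ∀ l : Stack A, l.length = c₁.ins + d + c₂.ins → ∃ l₁ m l₂, l = l₁ ++ m ++ l₂ ∧
      l₁.length = c₁.ins ∧ m.length = d ∧ l₂.length = c₂.ins := fun l hl =>
    ⟨l.take c₁.ins, (l.drop c₁.ins).take d, (l.drop c₁.ins).drop d, by simp, by simp; omega,
      by simp; omega, by simp; omega⟩
  have step₁ : ∀ (U V : List ℕ) (l₁ m l₂ y : Stack A), l₁.length = c₁.ins →
      (PStep P U V ⟨0, c₁⟩ (l₁ ++ m ++ l₂) y ↔
        ∃ r₁, y = r₁ ++ m ++ l₂ ∧ CoreRel P U (pieces (m ++ l₂) ++ V) c₁ l₁ r₁) := by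
    intro U V l₁ m l₂ y h₁
    have := pStep_block (P := P) (U := U) (V := V) (s := []) (t := m ++ l₂) (y := y) h₁
    simpa using this
  have step₂ : ∀ (U V : List ℕ) (l₁ m l₂ y : Stack A), l₂.length = c₂.ins →
      (PStep P U V ⟨l₁.length + m.length, c₂⟩ (l₁ ++ m ++ l₂) y ↔
        ∃ r₂, y = l₁ ++ m ++ r₂ ∧ CoreRel P (U ++ pieces (l₁ ++ m)) V c₂ l₂ r₂) := by
    intro U V l₁ m l₂ y h₁
    have := pStep_block (P := P) (U := U) (V := V) (s := l₁ ++ m) (t := []) (y := y) h₁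
    simpa using this
  constructor
  · intro U V l r t hl hb _ h
    obtain ⟨l₁, m, l₂, rfl, h₁, rfl, h₂⟩ := split l hl
    obtain ⟨z, hz, y, hy, rfl⟩ := h
    obtain ⟨r₁, rfl, g₁⟩ := (step₁ _ _ _ _ _ _ h₁).1 hz
    rw [← g₁.length_eq.2] at hy
    obtain ⟨r₂, rfl, g₂⟩ := (step₂ _ _ _ _ _ _ h₂).1 hy
    obtain ⟨σ, s₁, s₂, s₃, s₄, s₅⟩ := coreRel_exchange k₁ k₂ hb g₁ g₂
    refine ⟨σ, s₁, s₂, _, ?_, _, (step₁ _ _ _ _ _ _ h₁).2 ⟨_, rfl, s₅⟩, ?_⟩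
    · rw [← h₁]
      exact (step₂ _ _ _ _ _ _ h₂).2 ⟨_, rfl, s₄⟩
    · simp [s₃]
  · intro U V l r t hl hb _ h
    obtain ⟨l₁, m, l₂, rfl, h₁, rfl, h₂⟩ := split l hl
    obtain ⟨z, hz, y, hy, rfl⟩ := h
    rw [← h₁] at hz
    obtain ⟨r₂, rfl, g₂⟩ := (step₂ _ _ _ _ _ _ h₂).1 hz
    obtain ⟨r₁, rfl, g₁⟩ := (step₁ _ _ _ _ _ _ h₁).1 hy
    obtain ⟨σ, s₁, s₂, s₃, s₄, s₅⟩ := coreRel_exchange_symm k₁ k₂ hb g₂ g₁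
    refine ⟨σ, s₁, s₂, relabel σ r₁ ++ m ++ l₂, (step₁ _ _ _ _ _ _ h₁).2 ⟨_, rfl, s₄⟩,
      relabel σ r₁ ++ m ++ relabel σ r₂, ?_, ?_⟩
    · rw [← g₁.length_eq.2, ← length_relabel σ r₁]
      exact (step₂ _ _ _ _ _ _ h₂).2 ⟨_, rfl, s₅⟩
    · simp [s₃]

theorem crossAt_pair {s t r : Stack A} {x y : A × ℕ} :
    PStep P U V (cross s.length) (s ++ x :: y :: t) r ↔ x.2 ≠ y.2 ∧ (r = s ++ y :: x :: t ∨
      x.1 = y.1 ∧ Before (U ++ pieces s) (pieces t ++ V) x.2 y.2 ∧ r = s ++ x :: y :: t) := by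
  have := crossAt_iff_pStep (P := P) (U := U) (V := V) (k := false) (q := s.length)
    (x := s ++ x :: y :: t) (y := r)
  rw [cross, this]
  obtain ⟨a, d⟩ := x
  obtain ⟨b, e⟩ := y
  rw [crossAt_block]
  simp

theorem isFront_zigzag {c a : A} {t : List A}
    (h : IsFront [lcusp 1 c, cross 0, rcusp 1] [a] t) : a = c + 1 := by
  obtain ⟨t₁, h₁, t₂, h₂, t₃, h₃, rfl⟩ := h
  obtain ⟨r, rfl, g₁⟩ := (trans_block (s := [a]) (l := []) (t := []) rfl).1 h₁
  obtain ⟨-, rfl⟩ := g₁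
  obtain ⟨r, rfl, g₂⟩ := (trans_block (s := []) (l := [a, c + 1]) (t := [c]) rfl).1 h₂
  obtain ⟨x, y, h₄, rfl⟩ := g₂
  simp only [List.cons.injEq, and_true] at h₄
  obtain ⟨rfl, rfl⟩ := h₄
  obtain ⟨r, rfl, g₃⟩ := (trans_block (s := [c + 1]) (l := [a, c]) (t := []) rfl).1 h₃
  obtain ⟨x, h₄, rfl⟩ := g₃
  simp only [List.cons.injEq, and_true] at h₄
  obtain ⟨rfl, rfl⟩ := h₄
  rfl

theorem blockSim_one (c : A) :
    BlockSim P [] [lcusp 1 c, cross 0, rcusp 1] 1 ∧ BlockSim P [lcusp 1 c, cross 0, rcusp 1] [] 1 := by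
  constructor
  · refine BlockSim.of_eq fun U V l r t hl hb hf h => ?_
    obtain ⟨⟨a, e⟩, rfl⟩ := List.length_eq_one_iff.1 hl
    obtain rfl : [(a, e)] = r := h
    obtain rfl := isFront_zigzag hf
    obtain ⟨d, hd⟩ := exists_fresh (U ++ V ++ [e])
    simp only [List.mem_append, List.mem_singleton, not_or] at hd
    refine ⟨_, (pStep_leftCusp (s := [(c + 1, e)]) (t := [])).2 ⟨d, ?_, ?_, rfl⟩, _,
      (crossAt_pair (s := []) (x := (c + 1, e)) (y := (c + 1, d)) (t := [(c, d)])).2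
        ⟨Ne.symm hd.2, .inr ⟨rfl, ?_, rfl⟩⟩, _,
      (pStep_rightCusp (s := [(c + 1, e)]) (t := [])).2 ⟨rfl, rfl, rfl⟩, rfl⟩
    · simp [hd]
    · simp [hd]
    · have := hb.count e (by simp)
      have h₁ : e ∈ U ∨ e ∈ V := by
        simp only [← List.count_pos_iff]
        simp [List.count_append] at this
        omega
      simp only [Before, pieces_nil, pieces_cons, List.append_nil, List.singleton_append,
        List.reverse_cons, ← List.append_assoc]
      rw [pair_sublist_append]
      exact .inr (.inl ⟨by simpa using h₁, by simp⟩)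
  · refine BlockSim.of_eq fun U V l r t hl hb _ h => ?_
    obtain ⟨⟨a, e⟩, rfl⟩ := List.length_eq_one_iff.1 hl
    obtain ⟨z₁, h₁, z₂, h₂, z₃, h₃, rfl⟩ := h
    obtain ⟨d, d₁, d₂, rfl⟩ := (pStep_leftCusp (s := [(a, e)]) (t := [])).1 h₁
    have hde : d ≠ e := by simp at d₁; exact d₁.2
    obtain ⟨-, rfl | ⟨-, -, rfl⟩⟩ := (crossAt_pair (s := []) (x := (a, e)) (y := (c + 1, d))
      (t := [(c, d)])).1 h₂
    · have := ((pStep_rightCusp (s := [(c + 1, d)]) (t := [])).1 h₃).2.1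
      exact absurd this.symm hde
    · exact ((pStep_rightCusp (s := [(a, e)]) (t := [])).1 h₃).2.2.symm

theorem not_before_of_not_mem {d e : ℕ} {t : List ℕ} (hU : d ∉ U) (hV : d ∉ V)
    (he : e ∉ t) : ¬ Before U (t ++ V) d e := by
  intro h
  rw [Before, List.reverse_append, ← List.append_assoc, pair_sublist_append] at h
  rcases h with h | ⟨h, -⟩ | h
  · have := h.subset (List.mem_cons_self ..)
    simp [hU, hV] at this
  · simp [hU, hV] at h
  · exact he (List.mem_reverse.1 (h.subset (by simp)))

theorem blockSim_two_left (c : A) :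
    BlockSim P [lcusp 1 c] [lcusp 0 c, cross 1, cross 0] 1 ∧
      BlockSim P [lcusp 0 c, cross 1, cross 0] [lcusp 1 c] 1 := by
  constructor
  · refine BlockSim.of_eq fun U V l r t hl hb _ h => ?_
    obtain ⟨⟨a, e⟩, rfl⟩ := List.length_eq_one_iff.1 hl
    obtain ⟨z, h, rfl⟩ := h
    obtain ⟨d, d₁, d₂, rfl⟩ := (pStep_leftCusp (s := [(a, e)]) (t := [])).1 h
    simp at d₁ d₂
    refine ⟨_, (pStep_leftCusp (s := []) (t := [(a, e)])).2 ⟨d, by simpa using d₁.1, by simp [d₁, d₂],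
      rfl⟩, _, (crossAt_pair (s := [(c + 1, d)]) (x := (c, d)) (y := (a, e)) (t := [])).2
        ⟨d₁.2, .inl rfl⟩, _, (crossAt_pair (s := []) (x := (c + 1, d)) (y := (a, e))
        (t := [(c, d)])).2 ⟨d₁.2, .inl rfl⟩, rfl⟩
  · refine BlockSim.of_eq fun U V l r t hl hb _ h => ?_
    obtain ⟨⟨a, e⟩, rfl⟩ := List.length_eq_one_iff.1 hl
    obtain ⟨z₁, h₁, z₂, h₂, z₃, h₃, rfl⟩ := h
    obtain ⟨d, d₁, d₂, rfl⟩ := (pStep_leftCusp (s := []) (t := [(a, e)])).1 h₁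
    simp at d₁ d₂
    obtain ⟨-, rfl | ⟨-, -, rfl⟩⟩ := (crossAt_pair (s := [(c + 1, d)]) (x := (c, d)) (y := (a, e))
      (t := [])).1 h₂
    · obtain ⟨-, rfl | ⟨-, hb, -⟩⟩ := (crossAt_pair (s := []) (x := (c + 1, d)) (y := (a, e))
        (t := [(c, d)])).1 h₃
      · exact ⟨_, (pStep_leftCusp (s := [(a, e)]) (t := [])).2 ⟨d, by simp [d₁, d₂], by simp [d₂],
          rfl⟩, rfl⟩
      · refine absurd (by simpa using hb) (not_before_of_not_mem (t := [d]) d₁ d₂.2 ?_)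
        simpa using Ne.symm d₂.1
    · exact absurd rfl ((crossAt_pair (s := []) (x := (c + 1, d)) (y := (c, d))
        (t := [(a, e)])).1 h₃).1

theorem blockSim_two_right :
    BlockSim P [rcusp 1] ([cross 0, cross 1, rcusp 0] : Front A) 3 ∧
      BlockSim P [cross 0, cross 1, rcusp 0] ([rcusp 1] : Front A) 3 := by
  constructor
  · refine BlockSim.of_eq fun U V l r t hl hb _ h => ?_
    obtain ⟨⟨a, e⟩, ⟨x, d⟩, ⟨y, d'⟩, rfl⟩ := List.length_eq_three.1 hl
    obtain ⟨z, h, rfl⟩ := h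
    obtain ⟨rfl, rfl, rfl⟩ := (pStep_rightCusp (s := [(a, e)]) (t := [])).1 h
    have hde : e ≠ d := by
      rintro rfl
      have := hb.count_le e
      simp at this
    exact ⟨_, (crossAt_pair (s := []) (x := (a, e)) (y := (y + 1, d)) (t := [(y, d)])).2
      ⟨hde, .inl rfl⟩, _, (crossAt_pair (s := [(y + 1, d)]) (x := (a, e)) (y := (y, d)) (t := [])).2
      ⟨hde, .inl rfl⟩, _, (pStep_rightCusp (s := []) (t := [(a, e)])).2 ⟨rfl, rfl, rfl⟩, rfl⟩
  · refine BlockSim.of_eq fun U V l r t hl hb _ h => ?_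
    obtain ⟨⟨a, e⟩, ⟨x, d⟩, ⟨y, d'⟩, rfl⟩ := List.length_eq_three.1 hl
    obtain ⟨z₁, h₁, z₂, h₂, z₃, h₃, rfl⟩ := h
    obtain ⟨hn, rfl | ⟨-, hbef, rfl⟩⟩ := (crossAt_pair (s := []) (x := (a, e)) (y := (x, d))
      (t := [(y, d')])).1 h₁
    · obtain ⟨-, rfl | ⟨-, -, rfl⟩⟩ := (crossAt_pair (s := [(x, d)]) (x := (a, e)) (y := (y, d'))
        (t := [])).1 h₂
      · obtain ⟨rfl, rfl, rfl⟩ := (pStep_rightCusp (s := []) (t := [(a, e)])).1 h₃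
        exact ⟨_, (pStep_rightCusp (s := [(a, e)]) (t := [])).2 ⟨rfl, rfl, rfl⟩, rfl⟩
      · exact absurd ((pStep_rightCusp (s := []) (t := [(y, d')])).1 h₃).2.1.symm hn
    · obtain ⟨hn', rfl | ⟨-, -, rfl⟩⟩ := (crossAt_pair (s := [(a, e)]) (x := (x, d)) (y := (y, d'))
        (t := [])).1 h₂
      · obtain rfl : e = d' := ((pStep_rightCusp (s := []) (t := [(x, d)])).1 h₃).2.1
        obtain ⟨hU, hV⟩ := hb.not_mem_of_count (d := e) (by
          simp at hn; simp [Ne.symm hn])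
        exact absurd (by simpa using hbef) (not_before_of_not_mem (t := [e]) hU hV
          (by simpa using Ne.symm hn))
      · exact absurd ((pStep_rightCusp (s := []) (t := [(y, d')])).1 h₃).2.1 hn

theorem blockSim_three : BlockSim P [cross 0, cross 1, cross 0] ([cross 1, cross 0, cross 1] : Front A) 3 ∧
    BlockSim P [cross 1, cross 0, cross 1] ([cross 0, cross 1, cross 0] : Front A) 3 := by
  have key : ∀ w w' : List ℕ, Simulates A w w' → BlockSim P
      ((regular w).map fun z => (⟨z.1, .crossing z.2⟩ : Event A))
      ((regular w').map fun z => ⟨z.1, .crossing z.2⟩) 3 := by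
    intro w w' hs U V l r t hl hb _ h
    obtain ⟨σ, h₁, h₂⟩ := hs U V l r hb (pRul_crossings.1 h)
    exact ⟨σ, fun d hd => h₁ d (.inl hd), fun d hd => h₁ d (.inr (.inl hd)), pRul_crossings.2 h₂⟩
  have := (BraidEq.three [] [] 0).simulates (A := A)
  exact ⟨key _ _ this.1, key _ _ this.2⟩

/-! ### Moves at a vertex -/

theorem exists_named {ns : List ℕ} {l : Stack A} (h : ns.length = l.length) :
    ∃ L : Named A, labels L = ns ∧ strands L = l :=
  ⟨ns.zip l, by simp [labels, List.map_fst_zip, h], by simp [strands, List.map_snd_zip, h]⟩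

theorem named_pots_congr {l m : Named A} (h : labels l = labels m)
    (h' : (strands l).map Prod.fst = (strands m).map Prod.fst) :
    l.map (fun z => (z.1, z.2.1)) = m.map fun z => (z.1, z.2.1) := by
  refine (List.zip_of_prod (l := labels m) (l' := (strands m).map Prod.fst) ?_ ?_).trans
    (List.zip_of_prod ?_ ?_).symm
  · simpa [labels, Function.comp_def] using h
  · simpa [strands, Function.comp_def] using h'
  · simp [labels, Function.comp_def]
  · simp [strands, Function.comp_def]

/-- A strand that passes to the left of a vertex may pass to its right instead. -/
theorem VertexRel.pass_right {L M R : Named A} {a : A} {e f : ℕ}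
    (hl : Balanced U V ((a, e) :: strands L)) (hr : Balanced U V (strands R ++ [(a, f)]))
    (hlab : labels M = labels L) (hd : Down V a U e (strands L) (strands M) f)
    (hv : VertexRel P U (f :: V) M R) :
    ∃ N, labels N = labels R ∧ Down V a U e (strands N) (strands R) f ∧
      VertexRel P (U ++ [e]) V L N := by
  have h₁ := ExtRel.of_down (l₁ := []) (by simpa using hl) (by simp) hlab (by simpa using hd)
    (by simpa using hv)
  obtain ⟨m, g, h₂, h₃, -, h₄, h₅⟩ := h₁.turn.exists_down (by simpa [flipStrand] using hr.flip)
  obtain ⟨-, rfl⟩ := Prod.mk.inj h₂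
  refine ⟨flipNamed m, by simp [h₃], ?_, ?_⟩
  · simpa using h₄.turn
  · simpa using h₅.flip.mirror

theorem VertexRel.pass_left {L N R : Named A} {a : A} {e f : ℕ}
    (hl : Balanced U V ((a, e) :: strands L)) (hr : Balanced U V (strands R ++ [(a, f)]))
    (hlab : labels N = labels R) (hd : Down V a U e (strands N) (strands R) f)
    (hv : VertexRel P (U ++ [e]) V L N) :
    ∃ M, labels M = labels L ∧ Down V a U e (strands L) (strands M) f ∧
      VertexRel P U (f :: V) M R := by
  obtain ⟨m, h₁, h₂, h₃⟩ := VertexRel.pass_right (P := P) (U := V.reverse) (V := U.reverse)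
    (L := flipNamed R) (M := flipNamed N) (R := flipNamed L) (a := -a) (e := f) (f := e)
    (by simpa using hr.flip) (by simpa using hl.flip) (by simp [hlab]) (by simpa using hd.turn)
    (by simpa using hv.mirror.flip)
  refine ⟨flipNamed m, by simp [h₁], by simpa using h₂.turn, by simpa using h₃.flip.mirror⟩

theorem Down.balanced_symm {s l m : Stack A} {a : A} {e f : ℕ}
    (hd : Down V a (U ++ pieces s) e l m f) (hl : Balanced U V (s ++ m ++ [(a, f)])) :
    Balanced U V (s ++ (a, e) :: l) := by
  have h₁ := crossWord_append_left.2 ⟨_, rfl, crossWord_down.2 ⟨m, f, rfl, hd⟩⟩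
  exact h₁.mirror.balanced (by simpa using hl)

theorem blockSim_four_down (ls : List ℕ) (rs : List (ℕ × A)) :
    BlockSim P (strandDown 0 ls.length ++ [vert 0 ls rs])
      ([vert 1 ls rs] ++ strandDown 0 rs.length) (ls.length + 1) ∧
    BlockSim P ([vert 1 ls rs] ++ strandDown 0 rs.length)
      (strandDown 0 ls.length ++ [vert 0 ls rs]) (ls.length + 1) := by
  constructor
  · refine BlockSim.of_eq fun U V l r t hl hb _ h => ?_
    have hbr := h.balanced hb
    obtain ⟨⟨a, e⟩, l, rfl⟩ : ∃ z l', l = z :: l' := by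
      cases l with
      | nil => simp at hl
      | cons z l => exact ⟨z, l, rfl⟩
    simp only [List.length_cons, Nat.add_right_cancel_iff] at hl
    obtain ⟨y, h₁, z, h₂, rfl⟩ := pRul_append.1 h
    rw [← hl] at h₁
    obtain ⟨m, f, rfl, hd⟩ := (pRul_strandDown (s := [])).1 h₁
    obtain ⟨M, R, rfl, rfl, rfl, rfl, hv, -⟩ := (pStep_vertex (s := [])
      (by rw [← hl, hd.length_eq])).1 (by simpa using h₂)
    obtain ⟨L, hL, rfl⟩ := exists_named (ns := labels M) (l := l) hl.symm
    simp only [List.nil_append, pieces_nil, List.append_nil, pieces_cons, List.cons_append]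
      at hd hv hbr
    obtain ⟨N, hN, hD, hV⟩ := VertexRel.pass_right hb hbr hL.symm hd hv
    refine pRul_append.2 ⟨(a, e) :: strands N, pRul_singleton.2 ?_, ?_⟩
    · rw [show (a, e) :: strands N = [(a, e)] ++ strands N ++ [] by simp,
        show (a, e) :: strands L = [(a, e)] ++ strands L ++ [] by simp]
      refine (pStep_vertex (s := [(a, e)]) (l := strands L) (t := []) hl).2
        ⟨L, N, hL.symm, (named_pots_congr hN hD.map_fst.symm).symm, rfl, rfl,
          by simpa using hV, ?_⟩
      have := Down.balanced_symm (s := []) (by simpa using hD) (by simpa using hbr)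
      exact Balanced.right_part (s := [(a, e)]) this
    · have : (R.map fun z : ℕ × A × ℕ => (z.1, z.2.1)).length = (strands N).length := by
        rw [← hD.length_eq]; simp
      rw [this]
      exact (pRul_strandDown (s := [])).2 ⟨strands R, f, by simp, by simpa using hD⟩
  · refine BlockSim.of_eq fun U V l r t hl hb _ h => ?_
    have hbr := h.balanced hb
    obtain ⟨⟨a, e⟩, l, rfl⟩ : ∃ z l', l = z :: l' := by
      cases l with
      | nil => simp at hl
      | cons z l => exact ⟨z, l, rfl⟩
    simp only [List.length_cons, Nat.add_right_cancel_iff] at hl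
    obtain ⟨y, h₁, h₂⟩ := pRul_append.1 h
    obtain ⟨L, N, rfl, rfl, rfl, rfl, hv, -⟩ := (pStep_vertex (s := [(a, e)]) (t := []) hl).1
      (by simpa using pRul_singleton.1 h₁)
    have : (N.map fun z : ℕ × A × ℕ => (z.1, z.2.1)).length = (strands N).length := by simp
    rw [this] at h₂
    rw [List.append_nil] at h₂
    obtain ⟨m, f, rfl, hd⟩ := (pRul_strandDown (s := [])).1 h₂
    obtain ⟨R, hR, rfl⟩ := exists_named (ns := labels N) (l := m) (by simp [hd.length_eq])
    simp only [List.nil_append, pieces_nil, List.append_nil, pieces_cons] at hd hv hbr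
    obtain ⟨M, hM, hD, hV⟩ := VertexRel.pass_left hb hbr hR.symm hd hv
    refine pRul_append.2 ⟨strands M ++ [(a, f)], ?_, pRul_singleton.2 ?_⟩
    · rw [← hl]
      exact (pRul_strandDown (s := [])).2 ⟨strands M, f, by simp, by simpa using hD⟩
    · refine (pStep_vertex (s := []) (l := strands M) (t := [(a, f)])
        (by rw [hD.length_eq, hl])).2 ⟨M, R, hM.symm,
          named_pots_congr hR.symm hd.map_fst.symm, rfl, by simp, by simpa using hV, ?_⟩
      simpa using hbr.left_part

theorem exists_snoc {R : Named A} {rs : List (ℕ × A)} {h : ℕ} {c : A}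
    (e : rs ++ [(h, c)] = R.map fun z => (z.1, z.2.1)) : ∃ R' f, R = R' ++ [(h, c, f)] ∧
      rs = R'.map fun z => (z.1, z.2.1) := by
  obtain ⟨R', R'', rfl, rfl, e'⟩ := List.map_eq_append_iff.1 e.symm
  obtain ⟨⟨h', c', f⟩, rfl, h₁⟩ := List.map_eq_singleton_iff.1 e'
  simp only [Prod.mk.injEq] at h₁
  obtain ⟨rfl, rfl⟩ := h₁
  exact ⟨R', f, rfl, rfl⟩

theorem VertexRel.count_eq_two {L R : Named A} {h : ℕ} {c : A} {f : ℕ}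
    (H : VertexRel P U V L (R ++ [(h, c, f)])) (hb : Balanced U V (strands R ++ [(c, f)]))
    (hP : P h ∈ labels R) : (pieces (strands R ++ [(c, f)])).count f = 2 := by
  obtain ⟨R₁, ⟨b, g⟩, R₂, rfl⟩ := VertexPairs.exists_of_mem_right hP
  obtain rfl : f = g := H.right (h, c, f) (by simp) (P h, b, g) (by simp) rfl
  refine le_antisymm (hb.count_le f) ?_
  simp [List.count_append]
  omega

theorem pRul_vertex {ls : List ℕ} {rs : List (ℕ × A)} {l y : Stack A}
    (hl : l.length = ls.length) :
    PRul P U V [vert 0 ls rs] l y ↔ CoreRel P U V (.vertex ls rs) l y := by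
  have := pStep_block (P := P) (U := U) (V := V) (s := []) (t := []) (y := y)
    (c := .vertex ls rs) hl
  rw [pRul_singleton]
  simpa [vert] using this

theorem blockSim_five_right_bottom (ls : List ℕ) (rs : List (ℕ × A)) (h : ℕ) (c : A) :
    BlockSim P [vert 0 ls (rs ++ [(h, c)])]
      ([lcusp 0 c] ++ strandDown 1 ls.length ++ [vert 0 (h :: ls) rs]) ls.length ∧
    BlockSim P ([lcusp 0 c] ++ strandDown 1 ls.length ++ [vert 0 (h :: ls) rs])
      [vert 0 ls (rs ++ [(h, c)])] ls.length := by
  constructor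
  · intro U V l r t hl hb _ hr
    obtain ⟨τ, t₁, t₂, t₃, t₄⟩ := ((pRul_vertex hl).1 hr).refresh hb (pieces l)
    refine ⟨τ, t₁, t₂, ?_⟩
    obtain ⟨L, R, rfl, h₂, rfl, h₃, H, hbr⟩ := coreRel_vertex.1 t₃
    obtain ⟨R, f, rfl, rfl⟩ := exists_snoc h₂
    simp only [strands_append, strands_cons, strands_nil] at h₃ hbr
    obtain ⟨d, L', d₁, d₂, d₃, hL', hD, hV⟩ := H.exists_swing hb hbr fun hP =>
      t₄ f (by rw [h₃]; exact H.count_eq_two hbr hP)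
    rw [h₃, List.append_assoc, List.cons_append, List.nil_append]
    refine ⟨_, (pStep_leftCusp (s := [])).2 ⟨d, by simpa using d₁,
      List.not_mem_append d₃ d₂, rfl⟩, pRul_append.2
        ⟨(c + 1, d) :: (strands L' ++ [(c, f)]), ?_, pRul_singleton.2 ?_⟩⟩
    · rw [← hl]
      exact (pRul_strandDown (s := [(c + 1, d)])).2 ⟨strands L', f, by simp, by simpa using hD⟩
    · exact (pStep_vertex (s := []) (l := strands ((h, c + 1, d) :: L')) (t := [(c, f)])
        (by simp [← hL'])).2 ⟨_, R, by simp [hL'], rfl, rfl, by simp, by simpa using hV,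
          by simpa using hbr.left_part⟩
  · refine BlockSim.of_eq fun U V l r t hl hb _ hr => ?_
    have hbr := hr.balanced hb
    rw [List.append_assoc, List.cons_append, List.nil_append] at hr
    obtain ⟨y, h₁, hr⟩ := hr
    obtain ⟨d, d₁, d₂, rfl⟩ := (pStep_leftCusp (s := [])).1 h₁
    obtain ⟨z, h₂, h₃⟩ := pRul_append.1 hr
    rw [← hl] at h₂
    obtain ⟨m, f, rfl, hD⟩ := (pRul_strandDown (s := [(c + 1, d)])).1 h₂
    obtain ⟨M, R, e₁, rfl, e₂, rfl, hV, -⟩ := (pStep_vertex (s := []) (l := (c + 1, d) :: m)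
      (t := [(c, f)]) (by simp [hD.length_eq, hl])).1 (pRul_singleton.1 h₃)
    obtain ⟨⟨h', c', d'⟩, L', rfl⟩ : ∃ z M', M = z :: M' := by
      cases M with
      | nil => simp at e₂
      | cons z M => exact ⟨z, M, rfl⟩
    simp only [labels_cons, strands_cons, List.cons.injEq, Prod.mk.injEq] at e₁ e₂
    obtain ⟨rfl, rfl⟩ := e₁
    obtain ⟨⟨rfl, rfl⟩, rfl⟩ := e₂
    obtain ⟨L, hL, rfl⟩ := exists_named (ns := labels L') (l := l) hl.symm
    simp only [List.nil_append, pieces_nil, List.append_nil, pieces_cons, List.cons_append,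
      List.mem_append, not_or] at d₁ d₂ hD hV hbr
    refine (pRul_vertex hl).2 (coreRel_vertex.2 ⟨L, R ++ [(h, c, f)], hL.symm, by simp, rfl,
      by simp, ?_, ?_⟩)
    · simpa using VertexRel.of_swing hb d₁ d₂.2 d₂.1 hL.symm hD hV
    · simpa using hbr

theorem isFront_append {W W' : Front A} {x y : List A} :
    IsFront (W ++ W') x y ↔ ∃ z, IsFront W x z ∧ IsFront W' z y := by
  induction W generalizing x with
  | nil => simp [IsFront]
  | cons e W ih =>
    simp only [List.cons_append, IsFront, ih]
    grind

theorem isFront_singleton {e : Event A} {x y : List A} : IsFront [e] x y ↔ e.Trans x y := by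
  simp [IsFront]

theorem isFront_strandUp {s m u t : List A} {a : A}
    (h : IsFront (strandUp s.length m.length) (s ++ m ++ a :: u) t) : t = s ++ a :: (m ++ u) := by
  induction m using List.reverseRecOn generalizing u with
  | nil => simpa [strandUp, IsFront] using h.symm
  | append_singleton m b ih =>
    have e : (strandUp s.length (m ++ [b]).length : Front A) =
        cross (s ++ m).length :: strandUp s.length m.length := by
      simp [strandUp, List.range_succ]
    rw [e] at h
    obtain ⟨z, h₁, h₂⟩ := h
    obtain ⟨r, rfl, g₁⟩ := (trans_block (s := s ++ m) (l := [b, a]) (t := u)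
      (c := .crossing false) rfl).1 (by simpa [cross] using h₁)
    obtain ⟨x, y, h₃, rfl⟩ := g₁
    simp only [List.cons.injEq, and_true] at h₃
    obtain ⟨rfl, rfl⟩ := h₃
    simpa using ih (u := b :: u) (by simpa using h₂)

theorem blockSim_five_left_bottom (ls : List ℕ) (rs : List (ℕ × A)) (h : ℕ) (c : A) :
    BlockSim P [vert 0 (ls ++ [h]) rs]
      ([vert 0 ls ((h, c + 1) :: rs)] ++ strandUp 1 rs.length ++ [rcusp 0]) (ls.length + 1) ∧
    BlockSim P ([vert 0 ls ((h, c + 1) :: rs)] ++ strandUp 1 rs.length ++ [rcusp 0])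
      [vert 0 (ls ++ [h]) rs] (ls.length + 1) := by
  constructor
  · intro U V l r t hl hb hf hr
    obtain ⟨τ, t₁, t₂, t₃, t₄⟩ := ((pRul_vertex (by simpa using hl)).1 hr).refresh hb (pieces l)
    refine ⟨τ, t₁, t₂, ?_⟩
    obtain ⟨M, R, h₁, rfl, rfl, h₃, H, hbr⟩ := coreRel_vertex.1 t₃
    obtain ⟨L, c₀, f, rfl, rfl⟩ : ∃ L c₀ f, M = L ++ [(h, c₀, f)] ∧ ls = labels L := by
      obtain ⟨L, M', rfl, rfl, e'⟩ := List.map_eq_append_iff.1 h₁.symm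
      obtain ⟨⟨h', c', f⟩, rfl, h₁⟩ := List.map_eq_singleton_iff.1 e'
      obtain rfl : h = h' := by simpa [labels] using h₁
      exact ⟨L, c', f, rfl, rfl⟩
    obtain rfl : c₀ = c := by
      rw [List.append_assoc, List.cons_append, List.nil_append] at hf
      obtain ⟨z, f₁, f₂⟩ := hf
      obtain ⟨w, f₂, f₃⟩ := isFront_append.1 f₂
      obtain ⟨_, rfl, -, rfl, -⟩ := (trans_block (s := []) (l := pots (strands L)) (t := [c₀])
        (c := .vertex (labels L) _) (by simp [Core.ins])).1 (by simpa [vert] using f₁)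
      have := isFront_strandUp (s := [c + 1]) (m := pots (strands R)) (a := c₀) (u := [])
        (by simpa [pots, strands, Function.comp_def] using f₂)
      subst this
      obtain ⟨_, -, _, h₄, -⟩ := (trans_block (s := []) (l := [c + 1, c₀])
        (t := pots (strands R)) (c := .rightCusp) rfl).1 (by simpa [rcusp] using isFront_singleton.1 f₃)
      simp only [List.cons.injEq, and_true, add_left_inj] at h₄
      exact h₄.2.trans h₄.1.symm
    simp only [strands_append, strands_cons, strands_nil] at h₃ hbr hb t₄ ⊢
    obtain ⟨d, L', d₁, d₂, d₃, hL', hD, hV⟩ := H.mirror.exists_swing hbr hb fun hP hm => by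
      have h₄ := H.mirror.count_eq_two hb hP
      have h₅ := hb.not_mem_of_count h₄
      refine t₄ f ?_ (by simp)
      have := hbr.count f hm
      rw [h₃]
      rw [List.count_append, List.count_append, List.count_eq_zero_of_not_mem h₅.1,
        List.count_eq_zero_of_not_mem h₅.2] at this
      simpa using this
    have hb₀ := Balanced.insert_cusp (l₁ := []) (l₂ := []) c₀ (by simpa using hbr) d₁ d₂
      (by simpa using d₃)
    have hb' : Balanced U V ([(c₀ + 1, d)] ++ strands L' ++ [(c₀, f)]) :=
      Balanced.down (by simpa using hb₀) (by simpa using hD)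
    rw [h₃, List.append_assoc, List.cons_append, List.nil_append]
    refine ⟨_, (pStep_vertex (s := []) (l := strands L) (t := [(c₀, f)]) (by simp)).2
      ⟨L, (h, c₀ + 1, d) :: L', rfl, by simp [named_pots_congr hL' hD.map_fst], rfl, rfl,
        by simpa using hV.mirror, by simpa using hb'.left_part⟩,
      pRul_append.2 ⟨(c₀ + 1, d) :: (c₀, d) :: strands R, ?_, pRul_singleton.2 ?_⟩⟩
    · have := (pRul_strandUp (P := P) (U := U) (V := V) (s := [(c₀ + 1, d)]) (m := strands L')
        (a := c₀) (f := f)).2 ⟨strands R, d, rfl, by simpa using hD⟩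
      rw [hD.length_eq] at this
      simpa using this
    · exact (pStep_rightCusp (s := [])).2 ⟨rfl, rfl, rfl⟩
  · refine BlockSim.of_eq fun U V l r t hl hb _ hr => ?_
    have hbr := hr.balanced hb
    rw [List.append_assoc, List.cons_append, List.nil_append] at hr
    obtain ⟨y, h₁, hr⟩ := hr
    obtain ⟨l₀, ⟨c₀, f⟩, rfl⟩ : ∃ l₀ z, l = l₀ ++ [z] :=
      ⟨_, _, (List.dropLast_append_getLast (by rintro rfl; simp at hl)).symm⟩
    simp only [List.length_append, List.length_singleton, Nat.add_right_cancel_iff] at hl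
    obtain ⟨L, M, rfl, e₁, rfl, rfl, hV, hbM⟩ := (pStep_vertex (s := []) (l := l₀)
      (t := [(c₀, f)]) hl).1 (by simpa using h₁)
    obtain ⟨⟨h', c', d⟩, L', rfl⟩ : ∃ z M', M = z :: M' := by
      cases M with
      | nil => simp at e₁
      | cons z M => exact ⟨z, M, rfl⟩
    simp only [List.map_cons, List.cons.injEq, Prod.mk.injEq] at e₁
    obtain ⟨⟨rfl, rfl⟩, rfl⟩ := e₁
    obtain ⟨z, h₂, h₃⟩ := pRul_append.1 hr
    obtain ⟨R₀, d', rfl, hD⟩ := (pRul_strandUp (s := [(c + 1, d)]) (m := strands L')).1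
      (by simpa using h₂)
    obtain ⟨e, rfl, rfl⟩ := (pStep_rightCusp (s := [])).1 (pRul_singleton.1 h₃)
    obtain rfl : c = c₀ := by simpa using e
    obtain ⟨R, hR, rfl⟩ := exists_named (ns := labels L') (l := r) (by simp [← hD.length_eq])
    simp only [List.nil_append, pieces_nil, List.append_nil, pieces_cons, List.cons_append]
      at hD hV hbr
    have hb' : Balanced U V ([(c + 1, d)] ++ (c, d) :: strands R) := Down.balanced_symm
      (by simpa using hD) (by
        have := PRul.balanced (W := [_]) (pRul_singleton.2 h₁) hb
        simpa using this)
    have hd := hb'.count d (by simp)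
    simp only [List.count_append, List.cons_append, List.nil_append, pieces_cons, List.count_cons,
      beq_self_eq_true, if_true] at hd
    refine (pRul_vertex (by simp)).2 (coreRel_vertex.2 ⟨L ++ [(h, c, f)], R, by simp,
      named_pots_congr hR.symm hD.map_fst, by simp, rfl, ?_, by simpa using hbr⟩)
    simpa using (VertexRel.of_swing hbr (List.count_eq_zero.1 (by omega))
      (List.count_eq_zero.1 (by omega)) (List.count_eq_zero.1 (by omega)) hR.symm hD
      hV.mirror).mirror

/-! ### Reflecting a front -/

/-- The potentials of the stack reflected in a horizontal line. -/
def flipPots (x : List A) : List A := (x.map fun a => -a).reverse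

@[simp] theorem flipPots_append (x y : List A) : flipPots (x ++ y) = flipPots y ++ flipPots x := by
  simp [flipPots]
@[simp] theorem length_flipPots (x : List A) : (flipPots x).length = x.length := by simp [flipPots]
theorem pots_flipStack (x : Stack A) : pots (flipStack x) = flipPots (pots x) := by
  simp [pots, flipPots, flipStack, Function.comp_def]

/-- The reflection of an event between stacks of strands, `n` strands entering from the left. -/
def flipEvent (n : ℕ) (e : Event A) : Event A := ⟨n - e.pos - e.core.ins, e.core.flip⟩

/-- The reflection of a front with `n` strands at its left border. -/
def flipFront : ℕ → Front A → Front A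
  | _, [] => []
  | n, e :: W => flipEvent n e :: flipFront (n - e.core.ins + e.core.outs) W

theorem CoreTrans.flip {c : Core A} {l r : List A} (h : CoreTrans c l r) :
    CoreTrans c.flip (flipPots l) (flipPots r) := by
  cases c with
  | leftCusp c =>
    obtain ⟨rfl, rfl⟩ := h
    simp [CoreTrans, Core.flip, flipPots]
  | rightCusp =>
    obtain ⟨c, rfl, rfl⟩ := h
    exact ⟨-(c + 1), by simp [flipPots], rfl⟩
  | crossing k =>
    obtain ⟨a, b, rfl, rfl⟩ := h
    exact ⟨-b, -a, rfl, rfl⟩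
  | vertex ls rs =>
    obtain ⟨h₁, rfl, h₂, h₃⟩ := h
    exact ⟨by simpa using h₁, by simp [flipPots, Function.comp_def], by simpa using h₂,
      by simpa using h₃⟩

theorem IsFront.flip {W : Front A} {x y : List A} (h : IsFront W x y) :
    IsFront (flipFront x.length W) (flipPots x) (flipPots y) := by
  induction W generalizing x with
  | nil => exact congrArg flipPots h
  | cons e W ih =>
    obtain ⟨z, h, h'⟩ := h
    obtain ⟨s, l, r, t, hs, rfl, rfl, h₁⟩ := trans_iff.1 h
    have hl := h₁.length_eq
    refine ⟨flipPots (s ++ r ++ t), trans_iff.2 ⟨flipPots t, flipPots l, flipPots r, flipPots s,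
      by simp [flipEvent, ← hl.1, ← hs], by simp, by simp, h₁.flip⟩, ?_⟩
    convert ih h' using 2
    simp [← hl.1, ← hl.2]
    omega

theorem PRul.flip {W : Front A} {x y : Stack A} (h : PRul P U V W x y) :
    PRul P V.reverse U.reverse (flipFront x.length W) (flipStack x) (flipStack y) := by
  induction W generalizing x with
  | nil => exact congrArg flipStack h
  | cons e W ih =>
    obtain ⟨z, h, h'⟩ := h
    obtain ⟨s, l, r, t, hs, rfl, rfl, h⟩ := h
    have hl := h.length_eq
    refine ⟨flipStack (s ++ r ++ t), ⟨flipStack t, flipStack l, flipStack r, flipStack s,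
      by simp [flipEvent, ← hl.1, ← hs], by simp, by simp, by simpa [flipEvent] using h.flip⟩, ?_⟩
    convert ih h' using 2
    simp [← hl.1, ← hl.2]
    omega

theorem BlockSim.flip {X X' Y Y' : Front A} {n : ℕ} (h : BlockSim P X X' n)
    (e₁ : flipFront n Y = X) (e₂ : flipFront n Y' = X') (e₃ : flipFront n X' = Y') :
    BlockSim P Y Y' n := by
  rintro U V l r t rfl hb hf hr
  have h₁ := hr.flip
  have h₂ := hf.flip
  rw [length_pots, ← pots_flipStack] at h₂
  rw [e₁] at h₁
  rw [e₂] at h₂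
  obtain ⟨σ, s₁, s₂, s₃⟩ := h _ _ _ _ _ (by simp) hb.flip h₂ h₁
  refine ⟨σ, by simpa using s₂, by simpa using s₁, ?_⟩
  have := s₃.flip
  rw [length_flipStack, e₃, ← flipStack_relabel] at this
  simpa using this

theorem flipFront_strandDown {p k n : ℕ} (h : p + k < n) (W : Front A) :
    flipFront n (strandDown p k ++ W) = strandUp (n - p - k - 1) k ++ flipFront n W := by
  induction k generalizing W with
  | zero => rfl
  | succ k ih =>
    have e : (strandDown p (k + 1) : Front A) = strandDown p k ++ [cross (p + k)] := by
      simp [strandDown, List.range_succ]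
    have e' : ∀ q, (strandUp q (k + 1) : Front A) = strandUp (q + 1) k ++ [cross q] := by
      intro q
      simp [strandUp, List.range_succ_eq_map, Function.comp_def, List.map_reverse, add_assoc,
        add_comm 1]
    rw [e, e', List.append_assoc, ih (by omega), List.append_assoc]
    congr 1
    · congr 1; omega
    · simp only [List.cons_append, List.nil_append, flipFront, cross, flipEvent, Core.ins, Core.outs,
        Core.flip]
      congr 2 <;> omega

theorem flipFront_strandUp {p k n : ℕ} (h : p + k < n) (W : Front A) :
    flipFront n (strandUp p k ++ W) = strandDown (n - p - k - 1) k ++ flipFront n W := by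
  induction k generalizing W p with
  | zero => rfl
  | succ k ih =>
    have e : ∀ q, (strandDown q (k + 1) : Front A) = strandDown q k ++ [cross (q + k)] := by
      simp [strandDown, List.range_succ]
    have e' : (strandUp p (k + 1) : Front A) = strandUp (p + 1) k ++ [cross p] := by
      simp [strandUp, List.range_succ_eq_map, Function.comp_def, List.map_reverse, add_assoc,
        add_comm 1]
    rw [e, e', List.append_assoc, ih (by omega), List.append_assoc]
    congr 1
    · congr 1; omega
    · simp only [List.cons_append, List.nil_append, flipFront, cross, flipEvent, Core.ins, Core.outs,
        Core.flip]
      congr 2 <;> omega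

theorem BlockSim.flip_iff {X X' Y Y' : Front A} {n : ℕ}
    (h : BlockSim P X X' n ∧ BlockSim P X' X n)
    (e₁ : flipFront n Y = X) (e₂ : flipFront n Y' = X') (e₃ : flipFront n X = Y)
    (e₄ : flipFront n X' = Y') : BlockSim P Y Y' n ∧ BlockSim P Y' Y n :=
  ⟨h.1.flip e₁ e₂ e₄, h.2.flip e₂ e₁ e₃⟩

theorem blockSim_one_above (c : A) : BlockSim P [] [lcusp 0 c, cross 1, rcusp 0] 1 ∧
    BlockSim P [lcusp 0 c, cross 1, rcusp 0] [] 1 :=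
  BlockSim.flip_iff (blockSim_one (-(c + 1))) rfl rfl rfl
    (by simp [flipFront, flipEvent, lcusp, cross, rcusp, Core.ins, Core.outs, Core.flip])

theorem blockSim_two_left_above (c : A) :
    BlockSim P [lcusp 0 c] [lcusp 1 c, cross 0, cross 1] 1 ∧
      BlockSim P [lcusp 1 c, cross 0, cross 1] [lcusp 0 c] 1 := by
  refine BlockSim.flip_iff (blockSim_two_left (-(c + 1))) ?_ ?_ ?_ ?_ <;>
  simp [flipFront, flipEvent, lcusp, cross, Core.ins, Core.outs, Core.flip]

theorem blockSim_two_right_above :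
    BlockSim P [rcusp 0] ([cross 1, cross 0, rcusp 1] : Front A) 3 ∧
      BlockSim P [cross 1, cross 0, rcusp 1] ([rcusp 0] : Front A) 3 :=
  BlockSim.flip_iff blockSim_two_right rfl rfl rfl rfl

theorem blockSim_four_up (ls : List ℕ) (rs : List (ℕ × A)) :
    BlockSim P (strandUp 0 ls.length ++ [vert 1 ls rs])
      ([vert 0 ls rs] ++ strandUp 0 rs.length) (ls.length + 1) ∧
    BlockSim P ([vert 0 ls rs] ++ strandUp 0 rs.length)
      (strandUp 0 ls.length ++ [vert 1 ls rs]) (ls.length + 1) := by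
  have h := blockSim_four_down (P := P) ls.reverse (rs.map fun x => (x.1, -x.2)).reverse
  rw [List.length_reverse] at h
  refine BlockSim.flip_iff h ?_ ?_ ?_ ?_
  · rw [flipFront_strandUp (by omega)]
    simp [flipFront, flipEvent, vert, Core.ins, Core.flip]
  · have := flipFront_strandUp (p := 0) (k := rs.length) (n := rs.length + 1) (by omega)
      ([] : Front A)
    simpa [flipFront, flipEvent, vert, Core.ins, Core.outs, Core.flip, add_comm 1] using this
  · rw [flipFront_strandDown (by omega)]
    simp [flipFront, flipEvent, vert, Core.ins, Core.flip, Function.comp_def]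
  · have := flipFront_strandDown (p := 0) (k := rs.length) (n := rs.length + 1) (by omega)
      ([] : Front A)
    simpa [flipFront, flipEvent, vert, Core.ins, Core.outs, Core.flip, Function.comp_def,
      add_comm 1] using this

theorem blockSim_five_right_top (ls : List ℕ) (rs : List (ℕ × A)) (h : ℕ) (c : A) :
    BlockSim P [vert 0 ls ((h, c + 1) :: rs)]
      ([lcusp ls.length c] ++ strandUp 0 ls.length ++ [vert 1 (ls ++ [h]) rs]) ls.length ∧
    BlockSim P ([lcusp ls.length c] ++ strandUp 0 ls.length ++ [vert 1 (ls ++ [h]) rs])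
      [vert 0 ls ((h, c + 1) :: rs)] ls.length := by
  have h := blockSim_five_right_bottom (P := P) ls.reverse (rs.map fun x => (x.1, -x.2)).reverse h
    (-(c + 1))
  rw [List.length_reverse] at h
  refine BlockSim.flip_iff h ?_ ?_ ?_ ?_
  · simp [flipFront, flipEvent, vert, Core.ins, Core.flip]
  · simp only [List.cons_append, List.nil_append, flipFront, lcusp]
    rw [flipFront_strandUp (by simp [Core.ins, Core.outs])]
    simp [flipFront, flipEvent, vert, Core.ins, Core.outs, Core.flip]
  · simp [flipFront, flipEvent, vert, Core.ins, Core.flip, Function.comp_def]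
  · simp only [List.cons_append, List.nil_append, flipFront, lcusp]
    rw [flipFront_strandDown (by simp [Core.ins, Core.outs]; omega)]
    simp [flipFront, flipEvent, vert, Core.ins, Core.outs, Core.flip, Function.comp_def]

theorem blockSim_five_left_top (ls : List ℕ) (rs : List (ℕ × A)) (h : ℕ) (c : A) :
    BlockSim P [vert 0 (h :: ls) rs]
      ([vert 1 ls (rs ++ [(h, c)])] ++ strandDown 0 rs.length ++ [rcusp rs.length])
      (ls.length + 1) ∧
    BlockSim P ([vert 1 ls (rs ++ [(h, c)])] ++ strandDown 0 rs.length ++ [rcusp rs.length])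
      [vert 0 (h :: ls) rs] (ls.length + 1) := by
  have h := blockSim_five_left_bottom (P := P) ls.reverse (rs.map fun x => (x.1, -x.2)).reverse h
    (-(c + 1))
  rw [List.length_reverse, List.length_reverse, List.length_map] at h
  refine BlockSim.flip_iff h ?_ ?_ ?_ ?_
  · simp [flipFront, flipEvent, vert, Core.ins, Core.flip]
  · simp only [List.cons_append, List.nil_append, flipFront, vert]
    rw [flipFront_strandDown (by simp [Core.ins, Core.outs]; omega)]
    simp [flipFront, flipEvent, rcusp, Core.ins, Core.outs, Core.flip,
      show 1 + (rs.length + 1) - rs.length - 1 = 1 by omega,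
      show 1 + (rs.length + 1) - rs.length - 2 = 0 by omega]
  · simp [flipFront, flipEvent, vert, Core.ins, Core.flip, Function.comp_def]
  · simp only [List.cons_append, List.nil_append, flipFront, vert]
    rw [flipFront_strandUp (by simp [Core.ins, Core.outs])]
    simp [flipFront, flipEvent, rcusp, Core.ins, Core.outs, Core.flip, Function.comp_def, add_comm 1]

/-! ### Invariance under Reidemeister moves -/

/-- Every event of the front meets only the given `n` strands and those that arise from them. -/
def FitsFront : ℕ → Front A → Prop
  | _, [] => True
  | n, e :: W => e.pos + e.core.ins ≤ n ∧ FitsFront (n - e.core.ins + e.core.outs) W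

theorem PStep.fits {e : Event A} {x y : Stack A} (h : PStep P U V e x y) :
    e.pos + e.core.ins ≤ x.length ∧ y.length = x.length - e.core.ins + e.core.outs := by
  obtain ⟨s, l, r, t, hs, rfl, rfl, h⟩ := h
  have := h.length_eq
  simp [← this.1, ← this.2, ← hs]
  omega

theorem trans_fits {e : Event A} {x y : List A} (h : e.Trans x y) :
    e.pos + e.core.ins ≤ x.length ∧ y.length = x.length - e.core.ins + e.core.outs := by
  obtain ⟨s, l, r, t, hs, rfl, rfl, h₁⟩ := trans_iff.1 h
  have := h₁.length_eq
  simp [← this.1, ← this.2, ← hs]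
  omega

theorem IsFront.fits {W : Front A} {x y : List A} (h : IsFront W x y) : FitsFront x.length W := by
  induction W generalizing x with
  | nil => trivial
  | cons e W ih =>
    obtain ⟨z, h₁, h₂⟩ := h
    have h₃ := trans_fits h₁
    exact ⟨h₃.1, h₃.2 ▸ ih h₂⟩

theorem pRul_append_right {W : Front A} {l t y : Stack A} (hW : FitsFront l.length W) :
    PRul P U V W (l ++ t) y ↔ ∃ r, y = r ++ t ∧ PRul P U (pieces t ++ V) W l r := by
  induction W generalizing l with
  | nil => simp [PRul, eq_comm]
  | cons e W ih =>
    simp only [PRul, pStep_append_right (U := U) (V := V) hW.1]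
    constructor
    · rintro ⟨_, ⟨z, rfl, h⟩, h'⟩
      obtain ⟨r, rfl, h''⟩ := (ih (h.fits.2 ▸ hW.2)).1 h'
      exact ⟨r, rfl, z, h, h''⟩
    · rintro ⟨r, rfl, z, h, h'⟩
      exact ⟨_, ⟨z, rfl, h⟩, (ih (h.fits.2 ▸ hW.2)).2 ⟨r, rfl, h'⟩⟩

theorem isFront_append_right {W : Front A} {l t y : List A} (hW : FitsFront l.length W)
    (h : IsFront W (l ++ t) y) : ∃ r, IsFront W l r := by
  induction W generalizing l with
  | nil => exact ⟨l, rfl⟩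
  | cons e W ih =>
    obtain ⟨z, h, h'⟩ := h
    obtain ⟨s, m, m', u, hs, e₁, rfl, g⟩ := trans_iff.1 h
    have hl := g.length_eq
    obtain ⟨u', rfl, rfl⟩ := append_eq_append_of_le e₁ (by simp [hl.1, hs, hW.1])
    have h₁ : e.Trans (s ++ m ++ u') (s ++ m' ++ u') :=
      trans_iff.2 ⟨s, m, m', u', hs, rfl, rfl, g⟩
    rw [← List.append_assoc] at h'
    obtain ⟨r, hr⟩ := ih ((trans_fits h₁).2 ▸ hW.2) h'
    exact ⟨r, _, h₁, hr⟩

theorem isFront_append_left {W : Front A} {u l y : List A}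
    (h : IsFront (W.shift u.length) (u ++ l) y) : ∃ r, IsFront W l r := by
  induction W generalizing l with
  | nil => exact ⟨l, rfl⟩
  | cons e W ih =>
    obtain ⟨z, h, h'⟩ := h
    obtain ⟨s, m, m', t, hs, e₁, rfl, g⟩ := trans_iff.1 h
    rw [List.append_assoc] at e₁
    obtain ⟨s', rfl, rfl⟩ := append_eq_append_of_le e₁.symm (by simp at hs; omega)
    have h₁ : e.Trans (s' ++ (m ++ t)) (s' ++ m' ++ t) :=
      trans_iff.2 ⟨s', m, m', t, by simp at hs; omega, by simp, rfl, g⟩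
    simp only [List.append_assoc] at h' h₁
    obtain ⟨r, hr⟩ := ih h'
    exact ⟨r, _, h₁, hr⟩

/-- Replacing `X` by `X'` somewhere in a front does not change the existence of rulings. -/
def Replaceable (P : ℕ → ℕ) (X X' : Front A) : Prop :=
  ∃ (p n : ℕ) (X₀ X₀' : Front A), X = X₀.shift p ∧ X' = X₀'.shift p ∧ FitsFront n X₀ ∧
    FitsFront n X₀' ∧ (∀ N, FitsFront N X → FitsFront N X' → p + n ≤ N) ∧
      BlockSim P X₀ X₀' n ∧ BlockSim P X₀' X₀ n

theorem Replaceable.symm {X X' : Front A} (h : Replaceable P X X') : Replaceable P X' X := by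
  obtain ⟨p, n, X₀, X₀', h₁, h₂, h₃, h₄, h₅, h₆, h₇⟩ := h
  exact ⟨p, n, X₀', X₀, h₂, h₁, h₄, h₃, fun N a b => h₅ N b a, h₇, h₆⟩

theorem Replaceable.pRul {X X' : Front A} (h : Replaceable P X X') {x y : Stack A}
    {t t' : List A} (hb : Balanced [] [] x) (hf : IsFront X (pots x) t)
    (hf' : IsFront X' (pots x) t') (hr : PRul P [] [] X x y) :
    ∃ σ : Equiv.Perm ℕ, PRul P [] [] X' x (relabel σ y) := by
  obtain ⟨p, n, X₀, X₀', rfl, rfl, h₃, h₄, h₅, h₆, -⟩ := h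
  have hN := h₅ _ hf.fits hf'.fits
  rw [length_pots] at hN
  obtain ⟨u, l, v, rfl, rfl, rfl⟩ : ∃ u l v : Stack A, x = u ++ (l ++ v) ∧ u.length = p ∧ l.length = n :=
    ⟨x.take p, (x.drop p).take n, (x.drop p).drop n, by simp, by simp; omega, by simp; omega⟩
  obtain ⟨r', rfl, hr₁⟩ := pRul_append_left.1 hr
  obtain ⟨r, rfl, hr₂⟩ := (pRul_append_right h₃).1 hr₁
  rw [pots_append, pots_append, ← length_pots u] at hf'
  obtain ⟨_, hf'⟩ := isFront_append_left hf'
  obtain ⟨_, hf''⟩ := isFront_append_right (by simpa using h₄) hf'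
  have hb' : Balanced ([] ++ pieces u) (pieces v ++ []) l := Balanced.mid (by simpa using hb)
  obtain ⟨σ, s₁, s₂, s₃⟩ := h₆ _ _ _ _ _ rfl hb' hf'' hr₂
  refine ⟨σ, pRul_append_left.2 ⟨relabel σ r ++ v, ?_, (pRul_append_right h₄).2 ⟨_, rfl, s₃⟩⟩⟩
  rw [relabel_append, relabel_append, relabel_eq_self (x := u) fun z hz => s₁ _ (by
    simpa using hz), relabel_eq_self (x := v) fun z hz => s₂ _ (by
    simpa using hz)]

theorem IsFront.eq_pots {W : Front A} {x y : Stack A} {t : List A}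
    (h : IsFront W (pots x) t) (hr : PRul P U V W x y) : t = pots y := by
  induction W generalizing x with
  | nil => exact h.symm.trans (congrArg pots hr)
  | cons e W ih =>
    obtain ⟨z, h₁, h₂⟩ := h
    obtain ⟨w, h₃, h₄⟩ := hr
    obtain rfl := h₁.eq_pots h₃
    exact ih h₂ h₄

theorem Replaceable.closed {W W' X X' : Front A} (h : Replaceable P X X')
    (hf : IsFront (W ++ X ++ W') [] []) (hf' : IsFront (W ++ X' ++ W') [] [])
    (hr : PRul P [] [] (W ++ X ++ W') [] []) : PRul P [] [] (W ++ X' ++ W') [] [] := by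
  simp only [isFront_append] at hf hf'
  obtain ⟨y, ⟨x, hr₁, hr₂⟩, hr₃⟩ := by simpa only [pRul_append] using hr
  obtain ⟨t, ⟨s, f₁, f₂⟩, -⟩ := hf
  obtain ⟨t', ⟨s', f₁', f₂'⟩, -⟩ := hf'
  obtain rfl := IsFront.eq_pots (x := []) f₁ hr₁
  obtain rfl := IsFront.eq_pots (x := []) f₁' hr₁
  have hb : Balanced [] [] x := hr₁.balanced ⟨by simp, by simp⟩
  obtain ⟨σ, hσ⟩ := h.pRul hb f₂ f₂' hr₂
  refine pRul_append.2 ⟨_, pRul_append.2 ⟨x, hr₁, hσ⟩, ?_⟩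
  simpa using hr₃.relabel σ.injective

theorem fitsFront_crossings {n : ℕ} {w : List ℕ} {W : Front A} :
    FitsFront n (w.map (fun q => cross q) ++ W) ↔ (∀ q ∈ w, q + 2 ≤ n) ∧ FitsFront n W := by
  induction w with
  | nil => simp
  | cons q w ih =>
    simp only [List.map_cons, List.cons_append, FitsFront, List.forall_mem_cons, and_assoc]
    refine and_congr_right fun h => ?_
    rw [← ih]
    simp only [cross, Core.ins, Core.outs] at h ⊢
    rw [Nat.sub_add_cancel (by omega)]

theorem fitsFront_strandDown {n p k : ℕ} {W : Front A} :
    FitsFront n (strandDown p k ++ W) ↔ (∀ q < k, p + q + 2 ≤ n) ∧ FitsFront n W := by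
  have := fitsFront_crossings (n := n) (w := (List.range k).map (p + ·)) (W := W)
  simpa [strandDown, Function.comp_def] using this

theorem fitsFront_strandUp {n p k : ℕ} {W : Front A} :
    FitsFront n (strandUp p k ++ W) ↔ (∀ q < k, p + q + 2 ≤ n) ∧ FitsFront n W := by
  have := fitsFront_crossings (n := n) (w := (List.range k).reverse.map (p + ·)) (W := W)
  simpa [strandUp, Function.comp_def] using this

theorem fitsFront_strandDown_nil {n p k : ℕ} :
    FitsFront n (strandDown p k : Front A) ↔ ∀ q < k, p + q + 2 ≤ n := by
  simpa [FitsFront] using fitsFront_strandDown (n := n) (p := p) (k := k) (W := ([] : Front A))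

theorem fitsFront_strandUp_nil {n p k : ℕ} :
    FitsFront n (strandUp p k : Front A) ↔ ∀ q < k, p + q + 2 ≤ n := by
  simpa [FitsFront] using fitsFront_strandUp (n := n) (p := p) (k := k) (W := ([] : Front A))

theorem shift_append (p : ℕ) (W W' : Front A) :
    Front.shift p (W ++ W') = W.shift p ++ W'.shift p := by simp [Front.shift]

theorem shift_cons (p q : ℕ) (c : Core A) (W : Front A) :
    Front.shift p (⟨q, c⟩ :: W) = ⟨p + q, c⟩ :: W.shift p := rfl

theorem shift_nil (p : ℕ) : Front.shift p ([] : Front A) = [] := rfl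

theorem shift_strandDown (p q k : ℕ) : (strandDown q k : Front A).shift p = strandDown (p + q) k := by
  simp [Front.shift, strandDown, cross, Function.comp_def, add_assoc]

theorem shift_strandUp (p q k : ℕ) : (strandUp q k : Front A).shift p = strandUp (p + q) k := by
  simp [Front.shift, strandUp, cross, Function.comp_def, add_assoc]

theorem Replaceable.of_blockSim {X X' X₀ X₀' : Front A} (p n : ℕ)
    (h : BlockSim P X₀ X₀' n ∧ BlockSim P X₀' X₀ n) (hX : X = X₀.shift p) (hX' : X' = X₀'.shift p)
    (h₀ : FitsFront n X₀) (h₀' : FitsFront n X₀')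
    (hN : ∀ N, FitsFront N X → FitsFront N X' → p + n ≤ N) : Replaceable P X X' :=
  ⟨p, n, X₀, X₀', hX, hX', h₀, h₀', hN, h⟩

theorem move_replaceable {X X' : Front A} (h : Move X X') (hX : X.NoMarkings) :
    Replaceable P X X' := by
  cases h
  case zero p d c₁ c₂ =>
    refine .of_blockSim p _ (blockSim_zero d (hX ⟨p, c₁⟩ (by simp))
      (hX ⟨p + c₁.outs + d, c₂⟩ (by simp))) ?_ ?_ ?_ ?_ ?_
    · simp [shift_cons, shift_nil, add_assoc]
    · simp [shift_cons, shift_nil, add_assoc]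
    · simp [FitsFront]; omega
    · simp [FitsFront]; omega
    · rintro N - ⟨h, -⟩
      change p + c₁.ins + d + c₂.ins ≤ N at h
      change p + (c₁.ins + d + c₂.ins) ≤ N
      omega
  all_goals clear hX
  case' one_below p c => refine .of_blockSim p _ (blockSim_one c) ?_ ?_ ?_ ?_ ?_
  case' one_above p c => refine .of_blockSim p _ (blockSim_one_above c) ?_ ?_ ?_ ?_ ?_
  case' two_left_below p c => refine .of_blockSim p _ (blockSim_two_left c) ?_ ?_ ?_ ?_ ?_
  case' two_left_above p c => refine .of_blockSim p _ (blockSim_two_left_above c) ?_ ?_ ?_ ?_ ?_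
  case' two_right_below p => refine .of_blockSim p _ blockSim_two_right ?_ ?_ ?_ ?_ ?_
  case' two_right_above p => refine .of_blockSim p _ blockSim_two_right_above ?_ ?_ ?_ ?_ ?_
  case' three p => refine .of_blockSim p _ blockSim_three ?_ ?_ ?_ ?_ ?_
  case' four_up p ls rs => refine .of_blockSim p _ (blockSim_four_up ls rs) ?_ ?_ ?_ ?_ ?_
  case' four_down p ls rs => refine .of_blockSim p _ (blockSim_four_down ls rs) ?_ ?_ ?_ ?_ ?_
  case' five_right_bottom p ls rs h c =>
    refine .of_blockSim p _ (blockSim_five_right_bottom ls rs h c) ?_ ?_ ?_ ?_ ?_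
  case' five_right_top p ls rs h c =>
    refine .of_blockSim p _ (blockSim_five_right_top ls rs h c) ?_ ?_ ?_ ?_ ?_
  case' five_left_bottom p ls rs h c =>
    refine .of_blockSim p _ (blockSim_five_left_bottom ls rs h c) ?_ ?_ ?_ ?_ ?_
  case' five_left_top p ls rs h c =>
    refine .of_blockSim p _ (blockSim_five_left_top ls rs h c) ?_ ?_ ?_ ?_ ?_
  all_goals simp [shift_append, shift_cons, shift_nil, shift_strandDown, shift_strandUp, FitsFront,
    fitsFront_strandDown_nil, fitsFront_strandUp_nil, fitsFront_strandDown, fitsFront_strandUp,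
    lcusp, rcusp, cross, vert, Core.ins, Core.outs, add_assoc]
  all_goals grind

theorem noMarkings_append {W W' : Front A} :
    (W ++ W').NoMarkings ↔ W.NoMarkings ∧ W'.NoMarkings := by
  simp [Front.NoMarkings, or_imp, forall_and]

theorem noMarkings_strandDown (p k : ℕ) : (strandDown p k : Front A).NoMarkings := by
  simp [Front.NoMarkings, strandDown, cross, Core.IsMarked]

theorem noMarkings_strandUp (p k : ℕ) : (strandUp p k : Front A).NoMarkings := by
  simp [Front.NoMarkings, strandUp, cross, Core.IsMarked]

theorem move_noMarkings {X X' : Front A} (h : Move X X') : X.NoMarkings ↔ X'.NoMarkings := by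
  cases h <;> (try simp only [noMarkings_append, noMarkings_strandDown, noMarkings_strandUp]) <;>
    simp [Front.NoMarkings, lcusp, rcusp, cross, vert, Core.IsMarked, and_comm]

theorem names_append (W W' : Front A) : (W ++ W').names = W.names ++ W'.names := by
  simp [Front.names]

theorem names_strandDown (p k : ℕ) : (strandDown p k : Front A).names = [] := by
  simp [Front.names, strandDown, cross, Core.names]

theorem names_strandUp (p k : ℕ) : (strandUp p k : Front A).names = [] := by
  simp [Front.names, strandUp, cross, Core.names]

theorem move_names {X X' : Front A} (h : Move X X') : X.names.Perm X'.names := by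
  cases h with
  | zero p d c₁ c₂ => simpa [Front.names] using List.perm_append_comm
  | _ =>
    try simp only [names_append, names_strandDown, names_strandUp]
    simp [Front.names, lcusp, rcusp, cross, vert, Core.names]
    try grind

theorem MoveStep.noMarkings {W W' : Front A} (h : MoveStep W W') :
    W.NoMarkings ↔ W'.NoMarkings := by
  obtain ⟨-, -, S, T, X, X', h, rfl, rfl⟩ := h
  simp [noMarkings_append, move_noMarkings h]

theorem MoveStep.pRul {W W' : Front A} (h : MoveStep W W') (hW : W.NoMarkings) :
    PRul P [] [] W [] [] ↔ PRul P [] [] W' [] [] := by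
  obtain ⟨h₁, h₂, S, T, X, X', h, rfl, rfl⟩ := h
  have hX := move_replaceable (P := P) h (noMarkings_append.1 (noMarkings_append.1 hW).1).2
  exact ⟨hX.closed h₁ h₂, hX.symm.closed h₂ h₁⟩

theorem Equivalent.invariant {W W' : Front A} (h : Equivalent W W') :
    (W.NoMarkings ↔ W'.NoMarkings) ∧ W.names.Perm W'.names ∧
      (W.NoMarkings → (PRul P [] [] W [] [] ↔ PRul P [] [] W' [] [])) := by
  induction h with
  | rel W W' h =>
    refine ⟨h.noMarkings, ?_, h.pRul⟩
    obtain ⟨-, -, S, T, X, X', h, rfl, rfl⟩ := h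
    simp only [names_append]
    exact ((move_names h).append_left _).append_right _
  | refl W => exact ⟨.rfl, .refl _, fun _ => .rfl⟩
  | symm W W' _ ih => exact ⟨ih.1.symm, ih.2.1.symm, fun h => (ih.2.2 (ih.1.2 h)).symm⟩
  | trans W W' W'' _ _ ih ih' =>
    exact ⟨ih.1.trans ih'.1, ih.2.1.trans ih'.2.1, fun h => (ih.2.2 h).trans (ih'.2.2 (ih.1.1 h))⟩

/-! ### Marked crossings and marked cusps -/

theorem pStep_mcross {s t r : Stack A} {x y : A × ℕ} :
    PStep P U V (mcross s.length) (s ++ x :: y :: t) r ↔ x.2 ≠ y.2 ∧ r = s ++ y :: x :: t := by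
  have := crossAt_iff_pStep (P := P) (U := U) (V := V) (k := true) (q := s.length)
    (x := s ++ x :: y :: t) (y := r)
  rw [mcross, this]
  obtain ⟨a, d⟩ := x
  obtain ⟨b, e⟩ := y
  rw [crossAt_block]
  simp

theorem pRul_marked_down {s m t y : Stack A} {x : A × ℕ} :
    PRul P U V ((List.range m.length).map fun q => mcross (s.length + q)) (s ++ x :: (m ++ t)) y ↔
      x.2 ∉ pieces m ∧ y = s ++ m ++ x :: t := by
  induction m generalizing s with
  | nil => simp [eq_comm]
  | cons z m ih =>
    have := ih (s := s ++ [z])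
    simp only [List.length_append, List.length_singleton, List.append_assoc, List.singleton_append]
      at this
    simp only [List.length_cons, List.range_succ_eq_map, List.map_cons, List.map_map, PRul,
      Nat.add_zero, List.cons_append, pStep_mcross, Function.comp_def, pieces_cons, List.mem_cons,
      not_or]
    constructor
    · rintro ⟨_, ⟨h₁, rfl⟩, h₂⟩
      have h₃ := this.1 (by simpa [add_comm, add_left_comm] using h₂)
      exact ⟨⟨h₁, h₃.1⟩, by simpa using h₃.2⟩
    · rintro ⟨⟨h₁, h₂⟩, rfl⟩
      refine ⟨_, ⟨h₁, rfl⟩, ?_⟩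
      simpa [add_comm, add_left_comm] using this.2 ⟨h₂, by simp⟩

theorem pRul_marked_up {s m t y : Stack A} {x : A × ℕ} :
    PRul P U V ((List.range m.length).reverse.map fun q => mcross (s.length + q))
      (s ++ m ++ x :: t) y ↔ x.2 ∉ pieces m ∧ y = s ++ x :: (m ++ t) := by
  induction m using List.reverseRecOn generalizing t with
  | nil => simp [eq_comm]
  | append_singleton m z ih =>
    have h (r) := pStep_mcross (P := P) (U := U) (V := V) (s := s ++ m) (x := z) (y := x) (t := t)
      (r := r)
    simp only [List.length_append] at h
    simp only [List.length_append, List.length_singleton, List.range_succ, List.reverse_append,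
      List.reverse_singleton, List.singleton_append, List.map_cons, PRul]
    rw [show s ++ (m ++ [z]) ++ x :: t = s ++ m ++ z :: x :: t by simp]
    simp only [h, pieces_append, pieces_cons, pieces_nil, List.mem_append, List.mem_singleton, not_or]
    constructor
    · rintro ⟨_, ⟨h₁, rfl⟩, h₂⟩
      have h₃ := ih.1 h₂
      exact ⟨⟨h₃.1, Ne.symm h₁⟩, by simpa using h₃.2⟩
    · rintro ⟨⟨h₁, h₂⟩, rfl⟩
      exact ⟨_, ⟨Ne.symm h₂, rfl⟩, ih.2 ⟨h₁, by simp⟩⟩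

theorem Balanced.not_mem_between {s m t : Stack A} {a b : A} {d : ℕ}
    (hb : Balanced U V (s ++ (a, d) :: (m ++ (b, d) :: t))) : d ∉ U ∧ d ∉ V ∧ d ∉ pieces (s ++ m ++ t) := by
  have := hb.count d (by simp)
  simp only [List.count_append, List.count_cons, pieces_append, pieces_cons, beq_self_eq_true,
    if_true] at this
  refine ⟨List.count_eq_zero.1 (by omega), List.count_eq_zero.1 (by omega), List.count_eq_zero.1 ?_⟩
  simp only [List.count_append, pieces_append]
  omega

theorem pRul_marked_rightCusp {s m t z : Stack A} {x y : A × ℕ}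
    (hb : Balanced U V (s ++ x :: (m ++ y :: t))) :
    PRul P U V (((List.range m.length).map fun q => mcross (s.length + q)) ++
      [rcusp (s.length + m.length)]) (s ++ x :: (m ++ y :: t)) z ↔ x.2 = y.2 ∧ z = s ++ m ++ t := by
  have h (b : A) (e : ℕ) := pStep_rightCusp (P := P) (U := U) (V := V) (s := s ++ m) (a := x.1)
    (b := b) (d := x.2) (e := e) (t := t) (y := z)
  simp only [List.length_append] at h
  simp only [pRul_append, pRul_marked_down, pRul_singleton]
  obtain ⟨b, e⟩ := y
  constructor
  · rintro ⟨_, ⟨-, rfl⟩, h₂⟩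
    exact ((h b e).1 h₂).2
  · rintro ⟨h₁, rfl⟩
    obtain ⟨a, d⟩ := x
    obtain rfl : d = e := h₁
    have h₁ := hb.not_mem_between
    refine ⟨_, ⟨fun h => h₁.2.2 (by simp [h]), rfl⟩, (h b d).2 ⟨hb.pot a b d ?_, rfl, rfl⟩⟩
    exact ((List.Sublist.refl [(a, d)]).append (List.singleton_sublist.2 (by simp))).trans
      (List.sublist_append_right _ _)

theorem pRul_marked_leftCusp {s m t y : Stack A} {c : A} :
    PRul P U V ([lcusp (s.length + m.length) c] ++
      ((List.range m.length).reverse.map fun q => mcross (s.length + q))) (s ++ m ++ t) y ↔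
      ∃ d, d ∉ U ∧ d ∉ V ∧ d ∉ pieces (s ++ m ++ t) ∧
        y = s ++ (c + 1, d) :: (m ++ (c, d) :: t) := by
  have h (y) := pStep_leftCusp (P := P) (U := U) (V := V) (s := s ++ m) (c := c) (t := t) (y := y)
  simp only [List.length_append] at h
  simp only [pRul_append, pRul_singleton, h]
  constructor
  · rintro ⟨_, ⟨d, h₁, h₂, rfl⟩, h₃⟩
    obtain ⟨h₃, rfl⟩ := pRul_marked_up.1 h₃
    simp at h₁ h₂
    exact ⟨d, h₁.1, h₂.2, by simp [h₁, h₂], rfl⟩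
  · rintro ⟨d, h₁, h₂, h₃, rfl⟩
    simp at h₃
    exact ⟨_, ⟨d, by simp [h₁, h₃], by simp [h₂, h₃], rfl⟩, pRul_marked_up.2 ⟨by simp [h₃], rfl⟩⟩

/-- The named strands that are not matched by the pairs `i`, `φ i` with `i ∈ is`. -/
def rest (φ : ℕ → ℕ) (is : List ℕ) (M : Named A) : Named A :=
  M.filter fun w => w.1 ∉ is ∧ φ w.1 ∉ is

/-- The strands `i`, `φ i` with `i ∈ is` belong to the same piece. -/
def SamePiece (φ : ℕ → ℕ) (is : List ℕ) (M : Named A) : Prop :=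
  ∀ w ∈ M, ∀ w' ∈ M, w.1 ∈ is → φ w.1 = w'.1 → w.2.2 = w'.2.2

/-- The pairs `i`, `φ i` with `i ∈ is` are disjoint pairs in the increasing list `ks`. -/
structure Nested (φ : ℕ → ℕ) (ks is : List ℕ) : Prop where
  sorted : ks.Pairwise (· < ·)
  nodup : is.Nodup
  mem : ∀ i ∈ is, i ∈ ks ∧ φ i ∈ ks ∧ i < φ i
  invol : ∀ i ∈ ks, φ (φ i) = i

theorem Nested.split {φ : ℕ → ℕ} {ks is : List ℕ} {i : ℕ} (h : Nested φ ks (i :: is)) :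
    ∃ k₁ k₂ k₃, ks = k₁ ++ i :: (k₂ ++ φ i :: k₃) ∧ (k₁ ++ i :: (k₂ ++ φ i :: k₃)).Nodup ∧
      Nested φ (k₁ ++ k₂ ++ k₃) is := by
  obtain ⟨h₁, h₂, h₃⟩ := h.mem i (by simp)
  obtain ⟨k₁, k, rfl⟩ := List.append_of_mem h₁
  have hs := h.sorted
  have hk : φ i ∈ k := by
    simp only [List.mem_append, List.mem_cons] at h₂
    rcases h₂ with h₂ | h₂ | h₂
    · have := (List.pairwise_append.1 hs).2.2 _ h₂ i (by simp)
      omega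
    · omega
    · exact h₂
  obtain ⟨k₂, k₃, rfl⟩ := List.append_of_mem hk
  have hn : (k₁ ++ i :: (k₂ ++ φ i :: k₃)).Nodup := hs.imp (fun h => Nat.ne_of_lt h)
  have hn' := (List.nodup_cons.1 h.nodup)
  have hsub : (k₁ ++ k₂ ++ k₃).Sublist (k₁ ++ i :: (k₂ ++ φ i :: k₃)) := by
    rw [List.append_assoc]
    exact (List.Sublist.refl k₁).append ((((List.Sublist.refl k₂).append
      (List.sublist_cons_self _ _))).trans (List.sublist_cons_self _ _))
  refine ⟨k₁, k₂, k₃, rfl, hn, hs.sublist hsub, hn'.2, fun j hj => ?_,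
    fun j hj => h.invol j (hsub.subset hj)⟩
  obtain ⟨m₁, m₂, m₃⟩ := h.mem j (by simp [hj])
  have e₁ := h.invol i h₁
  have e₂ := h.invol j m₁
  have h₄ : j ≠ i := fun e => hn'.1 (e ▸ hj)
  have h₅ : j ≠ φ i := by rintro rfl; omega
  have h₆ : φ j ≠ i := by rintro e; rw [e] at e₂; omega
  have h₇ : φ j ≠ φ i := fun e => h₄ (by rw [← e₂, e, e₁])
  simp only [List.mem_append, List.mem_cons] at m₁ m₂ ⊢
  tauto

theorem idxOf_erase_split {k₁ k₂ k₃ : List ℕ} {i j : ℕ} (h : (k₁ ++ i :: (k₂ ++ j :: k₃)).Nodup) :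
    (k₁ ++ i :: (k₂ ++ j :: k₃)).idxOf i = k₁.length ∧
      (k₁ ++ i :: (k₂ ++ j :: k₃)).idxOf j = k₁.length + 1 + k₂.length ∧
      ((k₁ ++ i :: (k₂ ++ j :: k₃)).erase i).erase j = k₁ ++ k₂ ++ k₃ := by
  have h₁ := List.nodup_middle.1 h
  simp only [List.nodup_cons, List.mem_append, List.mem_cons, not_or] at h₁
  have h₂ : j ∉ k₁ ++ k₂ := by
    have := h₁.2
    rw [← List.append_assoc, List.nodup_middle] at this
    have := (List.nodup_cons.1 this).1
    simp at this ⊢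
    tauto
  simp only [List.mem_append, not_or] at h₂
  refine ⟨?_, ?_, ?_⟩
  · rw [List.idxOf_append_of_notMem h₁.1.1]; simp
  · rw [List.idxOf_append_of_notMem h₂.1, List.idxOf_cons_ne _ h₁.1.2.2.1,
      List.idxOf_append_of_notMem h₂.2]
    simp; omega
  · rw [List.erase_append_right _ h₁.1.1, List.erase_cons_head, List.erase_append_right _ h₂.1,
      List.erase_append_right _ h₂.2, List.erase_cons_head, List.append_assoc]

theorem labels_eq_split {M : Named A} {k₁ k₂ k₃ : List ℕ} {i j : ℕ}
    (h : labels M = k₁ ++ i :: (k₂ ++ j :: k₃)) : ∃ S T W x y, M = S ++ (i, x) :: (T ++ (j, y) :: W) ∧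
      labels S = k₁ ∧ labels T = k₂ ∧ labels W = k₃ := by
  obtain ⟨S, M, rfl, h₁, h⟩ := List.map_eq_append_iff.1 h
  obtain ⟨⟨i', x⟩, M, rfl, rfl, g⟩ := List.map_eq_cons_iff.1 h
  obtain ⟨T, M, rfl, h₂, g⟩ := List.map_eq_append_iff.1 g
  obtain ⟨⟨j', y⟩, W, rfl, rfl, h₃⟩ := List.map_eq_cons_iff.1 g
  exact ⟨S, T, W, x, y, rfl, h₁, h₂, h₃⟩

section split

variable {φ : ℕ → ℕ} {is : List ℕ} {i : ℕ} {S T W : Named A} {x y : A × ℕ}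

theorem Nested.others (h : Nested φ (labels (S ++ (i, x) :: (T ++ (φ i, y) :: W))) (i :: is)) :
    ∀ w ∈ S ++ T ++ W, w.1 ≠ i ∧ φ w.1 ≠ i ∧ w.1 ≠ φ i ∧ φ w.1 ≠ φ i := by
  intro w hw
  have hn : (labels (S ++ (i, x) :: (T ++ (φ i, y) :: W))).Nodup :=
    h.sorted.imp fun h => Nat.ne_of_lt h
  have e := h.invol w.1 (by
    refine List.mem_map_of_mem ?_
    simp at hw ⊢
    tauto)
  have e' := h.invol i (by simp)
  have hw' : w.1 ∈ labels (S ++ T ++ W) := List.mem_map_of_mem hw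
  have h₁ : w.1 ≠ i := by
    rintro rfl
    simp only [labels_append, labels_cons, List.nodup_middle, List.nodup_cons] at hn
    simp only [labels_append, List.mem_append, List.mem_cons] at hn hw'
    tauto
  have h₂ : w.1 ≠ φ i := by
    intro h₂
    rw [h₂] at hw'
    simp only [labels_append, labels_cons] at hn
    rw [← List.cons_append, ← List.append_assoc, List.nodup_middle, List.nodup_cons] at hn
    simp only [labels_append, List.mem_append, List.mem_cons] at hn hw'
    tauto
  exact ⟨h₁, fun h => h₂ (by rw [← e, h]), h₂, fun h => h₁ (by rw [← e, h, e'])⟩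

theorem Nested.rest_eq (h : Nested φ (labels (S ++ (i, x) :: (T ++ (φ i, y) :: W))) (i :: is)) :
    rest φ (i :: is) (S ++ (i, x) :: (T ++ (φ i, y) :: W)) = rest φ is (S ++ T ++ W) := by
  have e' := h.invol i (by simp)
  have ho := h.others
  have key : ∀ X : Named A, (∀ w ∈ X, w ∈ S ++ T ++ W) →
      X.filter (fun w => w.1 ∉ i :: is ∧ φ w.1 ∉ i :: is) =
        X.filter fun w => w.1 ∉ is ∧ φ w.1 ∉ is := fun X hX =>
    List.filter_congr fun w hw => by simp [ho w (hX w hw)]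
  simp only [rest, List.filter_append, List.filter_cons]
  rw [key S (by simp +contextual), key T (by simp +contextual), key W (by simp +contextual)]
  simp [e']

theorem Nested.samePiece (h : Nested φ (labels (S ++ (i, x) :: (T ++ (φ i, y) :: W))) (i :: is)) :
    SamePiece φ (i :: is) (S ++ (i, x) :: (T ++ (φ i, y) :: W)) ↔
      x.2 = y.2 ∧ SamePiece φ is (S ++ T ++ W) := by
  have ho := h.others
  have e' := h.invol i (by simp)
  have hi := (h.mem i (by simp)).2.2
  constructor
  · intro hs
    refine ⟨hs (i, x) (by simp) (φ i, y) (by simp) (by simp) rfl, fun w hw w' hw' h₁ h₂ => ?_⟩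
    exact hs w (by simp at hw ⊢; tauto) w' (by simp at hw' ⊢; tauto) (by simp [h₁]) h₂
  · rintro ⟨h₁, h₂⟩ w hw w' hw' h₃ h₄
    have hmem : ∀ w, w ∈ S ++ (i, x) :: (T ++ (φ i, y) :: W) →
        w = (i, x) ∨ w = (φ i, y) ∨ w ∈ S ++ T ++ W := fun w hw => by
      simp at hw ⊢; tauto
    have hφi : φ i ∉ i :: is := fun hm => by
      have := (h.mem _ hm).2.2
      omega
    rcases hmem w hw with rfl | rfl | hw
    · rcases hmem w' hw' with rfl | rfl | hw'
      · simp at h₄; omega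
      · exact h₁
      · exact absurd h₄.symm (ho w' hw').2.2.1
    · exact absurd h₃ hφi
    · have := ho w hw
      rcases hmem w' hw' with rfl | rfl | hw'
      · exact absurd h₄ this.2.1
      · exact absurd h₄ this.2.2.2
      · exact h₂ w hw w' hw' (by simpa [this.1] using h₃) h₄

end split

theorem pRul_markedRightCusps {φ : ℕ → ℕ} {is : List ℕ} {M : Named A} {z : Stack A}
    (h : Nested φ (labels M) is) (hb : Balanced U V (strands M)) :
    PRul P U V (markedRightCusps φ 0 (labels M) is) (strands M) z ↔
      SamePiece φ is M ∧ z = strands (rest φ is M) := by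
  induction is generalizing M with
  | nil => simp [markedRightCusps, SamePiece, rest, eq_comm]
  | cons i is ih =>
    obtain ⟨k₁, k₂, k₃, hk, hn, h'⟩ := h.split
    obtain ⟨S, T, W, x, y, rfl, rfl, rfl, rfl⟩ := labels_eq_split hk
    obtain ⟨e₁, e₂, e₃⟩ := idxOf_erase_split hn
    have e₄ : (labels S).length + 1 + (labels T).length - 1 - (labels S).length =
        (strands T).length := by simp only [length_labels, length_strands]; omega
    have e₅ : (labels S).length + 1 + (labels T).length - 1 =
        (strands S).length + (strands T).length := by
      simp only [length_labels, length_strands]; omega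
    have e₆ : (labels S).length = (strands S).length := by simp
    simp only [markedRightCusps]
    rw [pRul_append, hk, e₁, e₂, e₃, e₄, e₅, e₆, h.rest_eq, h.samePiece]
    simp only [Nat.zero_add, strands_append, strands_cons] at hb ⊢
    simp only [pRul_marked_rightCusp hb]
    rw [← labels_append, ← labels_append] at h' ⊢
    have hstep : x.2 = y.2 → Balanced U V (strands (S ++ T ++ W)) := fun hxy => by
      have := (pRul_marked_rightCusp (P := id) hb).2 ⟨hxy, rfl⟩
      simpa using this.balanced hb
    constructor
    · rintro ⟨_, ⟨h₁, rfl⟩, h₂⟩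
      obtain ⟨h₃, h₄⟩ := (ih h' (hstep h₁)).1 (by simpa using h₂)
      exact ⟨⟨h₁, h₃⟩, h₄⟩
    · rintro ⟨⟨h₁, h₂⟩, h₃⟩
      exact ⟨_, ⟨h₁, rfl⟩, by simpa using (ih h' (hstep h₁)).2 ⟨h₂, h₃⟩⟩

theorem pRul_markedLeftCusps {φ : ℕ → ℕ} {μ : ℕ → A} {ks is : List ℕ} {y z : Stack A}
    (h : Nested φ ks is) (hz : z.length + 2 * is.length = ks.length) (hb : Balanced U V z) :
    PRul P U V (markedLeftCusps φ μ 0 ks is) z y ↔ ∃ M, labels M = ks ∧ y = strands M ∧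
      Balanced U V (strands M) ∧ SamePiece φ is M ∧ (∀ w ∈ M, φ w.1 ∈ is → w.2.1 = μ w.1) ∧
      z = strands (rest φ is M) := by
  induction is generalizing ks y with
  | nil =>
    simp only [markedLeftCusps, PRul, SamePiece, rest, List.not_mem_nil]
    constructor
    · rintro rfl
      obtain ⟨M, rfl, rfl⟩ := exists_named (ns := ks) (l := z) (by simpa using hz.symm)
      exact ⟨M, rfl, rfl, hb, by simp, by simp, by simp⟩
    · rintro ⟨M, -, rfl, -, -, -, rfl⟩
      simp
  | cons i is ih =>
    obtain ⟨k₁, k₂, k₃, rfl, hn, h'⟩ := h.split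
    obtain ⟨e₁, e₂, e₃⟩ := idxOf_erase_split hn
    have e₄ : k₁.length + 1 + k₂.length - 1 - k₁.length = k₂.length := by omega
    have e₅ : k₁.length + 1 + k₂.length - 1 = k₁.length + k₂.length := by omega
    have hinv := h.invol i (by simp)
    have hz' : z.length + 2 * is.length = (k₁ ++ k₂ ++ k₃).length := by
      simp at hz ⊢; omega
    simp only [markedLeftCusps]
    rw [e₁, e₂, e₃, e₄, e₅, List.append_assoc, pRul_append]
    simp only [Nat.zero_add]
    constructor
    · rintro ⟨_, h₁, h₂⟩
      have hb₁ := h₁.balanced hb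
      have hb₂ := h₂.balanced hb₁
      obtain ⟨M, hM, rfl, -, m₁, m₂, rfl⟩ := (ih h' hz').1 h₁
      obtain ⟨M', W, rfl, hM', rfl⟩ := List.map_eq_append_iff.1 hM
      obtain ⟨S, T, rfl, rfl, rfl⟩ := List.map_eq_append_iff.1 hM'
      have := pRul_marked_leftCusp (P := P) (U := U) (V := V) (s := strands S) (m := strands T)
        (t := strands W) (c := μ (φ i)) (y := y)
      simp only [length_strands, List.length_map] at this h₂
      obtain ⟨d, d₁, d₂, d₃, rfl⟩ := this.1 (by simpa using h₂)
      have hh : Nested φ (labels (S ++ (i, μ (φ i) + 1, d) :: (T ++ (φ i, μ (φ i), d) :: W)))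
          (i :: is) := by simpa [labels] using h
      refine ⟨S ++ (i, μ (φ i) + 1, d) :: (T ++ (φ i, μ (φ i), d) :: W), by simp [labels], by simp,
        by simpa using hb₂, ?_, ?_, ?_⟩
      · exact hh.samePiece.2 ⟨rfl, m₁⟩
      · intro w hw hm
        have hmem : w = (i, μ (φ i) + 1, d) ∨ w = (φ i, μ (φ i), d) ∨ w ∈ S ++ T ++ W := by
          simp at hw ⊢; tauto
        rcases hmem with rfl | rfl | hw
        · change φ i ∈ i :: is at hm
          have := (h.mem _ hm).2.2
          rw [hinv] at this
          have := (h.mem i (by simp)).2.2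
          omega
        · rfl
        · exact m₂ w hw (by simpa [(hh.others w hw).2.1] using hm)
      · rw [hh.rest_eq]
    · rintro ⟨M, hM, rfl, hb', m₁, m₂, rfl⟩
      obtain ⟨S, T, W, ⟨a, d⟩, y, rfl, rfl, rfl, rfl⟩ := labels_eq_split hM
      rw [← hM] at h
      obtain ⟨rfl, m₃⟩ := h.samePiece.1 m₁
      have hb₀ : Balanced U V (strands S ++ (a, y.2) :: (strands T ++ y :: strands W)) := by
        simpa using hb'
      have hy : y.1 = μ (φ i) := m₂ (φ i, y) (by simp) (by simp [hinv])
      have ha : a = y.1 + 1 := hb₀.pot a y.1 y.2 (((List.Sublist.refl [(a, y.2)]).append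
        (List.singleton_sublist.2 (by simp))).trans (List.sublist_append_right _ _))
      have hstep := (pRul_marked_rightCusp (P := id) hb₀).2 ⟨rfl, rfl⟩
      have hbn := hb₀.not_mem_between
      refine ⟨strands (S ++ T ++ W), (ih h' hz').2 ⟨S ++ T ++ W, by simp, rfl,
        by simpa using hstep.balanced hb₀, m₃, fun w hw hm => m₂ w (by simp at hw ⊢; tauto)
          (by simp [hm]), by rw [h.rest_eq]⟩, ?_⟩
      have := (pRul_marked_leftCusp (P := P) (U := U) (V := V) (s := strands S) (m := strands T)
        (t := strands W) (c := μ (φ i)) (y := strands S ++ (a, y.2) :: (strands T ++ y :: strands W))).2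
          ⟨y.2, hbn.1, hbn.2.1, hbn.2.2, by rw [ha, ← hy]⟩
      simpa using this

/-! ### The resolution of a vertex -/

/-- A word of marked crossings. -/
def marked (w : List ℕ) : List (ℕ × Bool) := w.map fun q => (q, true)

theorem crossAt_marked {s t r : Stack A} {x y : A × ℕ} :
    CrossAt U V true s.length (s ++ x :: y :: t) r ↔ x.2 ≠ y.2 ∧ r = s ++ y :: x :: t := by
  obtain ⟨a, d⟩ := x
  obtain ⟨b, e⟩ := y
  rw [crossAt_block]
  simp

theorem CrossAt.exists_block {k : Bool} {q : ℕ} {l r : Stack A} (h : CrossAt U V k q l r) :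
    ∃ s x y t, s.length = q ∧ l = s ++ x :: y :: t := by
  obtain ⟨s, t, a, b, d, e, hs, hl, -⟩ := h
  exact ⟨s, (a, d), (b, e), t, hs, hl⟩

theorem CrossWord.of_marked {w : List ℕ} {l r : Stack A} (h : CrossWord U V (marked w) l r) :
    CrossWord U V (regular w) l r := by
  induction w generalizing l with
  | nil => exact h
  | cons q w ih =>
    obtain ⟨m, h₁, h₂⟩ := h
    refine ⟨m, ?_, ih h₂⟩
    obtain ⟨s, x, y, t, rfl, rfl⟩ := h₁.exists_block
    obtain ⟨h₃, h₄⟩ := crossAt_marked.1 h₁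
    exact crossAt_block.2 ⟨h₃, .inl h₄⟩

theorem CrossWord.marked_unique {w : List ℕ} {l r r' : Stack A}
    (h : CrossWord U V (marked w) l r) (h' : CrossWord U V (marked w) l r') : r = r' := by
  induction w generalizing l with
  | nil => exact Eq.trans (Eq.symm h) h'
  | cons q w ih =>
    obtain ⟨m, h₁, h₂⟩ := h
    obtain ⟨m', h₁', h₂'⟩ := h'
    obtain ⟨s, x, y, t, rfl, rfl⟩ := h₁.exists_block
    obtain ⟨-, rfl⟩ := crossAt_marked.1 h₁
    obtain ⟨-, rfl⟩ := crossAt_marked.1 h₁'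
    exact ih h₂ h₂'

theorem exists_crossWord_marked {w : List ℕ} {l : Stack A} (hl : (pieces l).Nodup)
    (hw : Fits (regular w) l.length) : ∃ r, CrossWord U V (marked w) l r := by
  induction w generalizing l with
  | nil => exact ⟨l, rfl⟩
  | cons q w ih =>
    have hq : q + 2 ≤ l.length := hw (q, false) (by simp)
    obtain ⟨s, x, y, t, rfl, rfl⟩ : ∃ s x y t, s.length = q ∧ l = s ++ x :: y :: t := by
      refine ⟨l.take q, l[q], l[q + 1], l.drop (q + 2), by simp; omega, ?_⟩
      rw [← List.drop_eq_getElem_cons, ← List.drop_eq_getElem_cons, List.take_append_drop]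
    have hp : (pieces (s ++ y :: x :: t)).Perm (pieces (s ++ x :: y :: t)) := by
      simpa using (List.Perm.swap ..).append_left _
    have hn : x.2 ≠ y.2 := by
      have := (List.nodup_append.1 (by simpa using hl)).2.1
      simp at this
      tauto
    obtain ⟨r, hr⟩ := ih (hp.nodup_iff.2 hl) fun z hz => by
      have := hw z (List.mem_cons_of_mem _ hz)
      simpa using this
    exact ⟨r, _, crossAt_marked.2 ⟨hn, rfl⟩, hr⟩

/-- The braid of a resolved vertex: the crossings of `β` are regular and those of the rest of the
half-twist are marked, so the ruling of `β` has pairwise different pieces. -/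
theorem crossWord_resolve {K : List ℕ} {β γ : List ℕ} {l r : Stack A} (hK : K.Nodup)
    (hlen : K.length = l.length) (hl : Balanced U V l) (hβ : Sorts K.reverse (β ++ γ) K K.reverse) :
    CrossWord U V (regular β ++ marked γ ++ marked γ.reverse) l r ↔
      (pieces l).Nodup ∧ CrossWord U V (regular β) l r := by
  rw [crossWord_append]
  simp only [crossWord_append]
  have hrev : marked γ.reverse = (marked γ).reverse := by simp [marked]
  constructor
  · rintro ⟨n, ⟨m, h₁, h₂⟩, h₃⟩
    rw [hrev] at h₃
    have h₄ := h₃.mirror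
    rw [List.reverse_reverse] at h₄
    have h₅ := h₂.mirror
    rw [← hrev] at h₃ h₅
    obtain rfl := h₅.marked_unique h₃
    refine ⟨nodup_of_halfTwist (r := n) hK hlen hl hβ ?_, h₁⟩
    rw [regular_append]
    exact crossWord_append.2 ⟨_, h₁, h₂.of_marked⟩
  · rintro ⟨hn, h⟩
    have hfit : Fits (regular γ) r.length := by
      have := hβ.fits
      rw [hlen] at this
      intro z hz
      have := this z (by simp [hz])
      rwa [h.length_eq]
    obtain ⟨n, h₁⟩ := exists_crossWord_marked (U := U) (V := V) (h.perm_pieces.nodup_iff.2 hn) hfit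
    exact ⟨n, ⟨r, h, h₁⟩, hrev ▸ h₁.mirror⟩

theorem Sorts.zip_pots {T w K M : List ℕ} {l r : Stack A} (h : Sorts T w K M)
    (hlen : K.length = l.length) (hc : CrossWord U V (regular w) l r) :
    (M.zip (pots r)).Perm (K.zip (pots l)) := by
  induction w generalizing K l with
  | nil => obtain rfl : K = M := h; obtain rfl : l = r := hc; exact .refl _
  | cons q w ih =>
    obtain ⟨s, i, j, t, rfl, rfl, -, h⟩ := h
    obtain ⟨m, h₁, h₂⟩ := hc
    obtain ⟨s', x, y, t', hs, rfl⟩ := h₁.exists_block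
    rw [← hs] at h₁
    obtain ⟨a, d⟩ := x
    obtain ⟨b, e⟩ := y
    have hp : pots m = pots s' ++ b :: a :: pots t' := by
      rcases (crossAt_block.1 h₁).2 with rfl | ⟨-, rfl, -, rfl⟩ <;> simp
    refine (ih h ?_ h₂).trans ?_
    · rw [← length_pots m, hp]; simp at hlen ⊢; omega
    · rw [hp, List.zip_append (by simp [hs]), pots_append, List.zip_append (by simp [hs])]
      simpa using (List.Perm.swap ..).append_left _

theorem VertexRel.pot_eq {L R : Named A} (h : VertexRel P U V L R) {w w' : ℕ × A × ℕ}
    (hw : w ∈ L) (hw' : w' ∈ R) (e : P w.1 = w'.1) : w.2.1 = w'.2.1 := by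
  obtain ⟨u, h₁, h₂⟩ := h.braid
  have h₃ := h₁.zip_pots (by simp) h₂
  have hN : (labels (through P (labels L) R)).Nodup :=
    (List.filter_sublist.map _).nodup (List.nodup_append.1 h.nodup).2.1
  have hwL : w.1 ∈ labels L := List.mem_map_of_mem hw
  have hwR : w'.1 ∈ labels R := List.mem_map_of_mem hw'
  have hP := (h.invol w.1 (by simp [hwL])).2.2
  have m₁ : (P w.1, w.2.1) ∈ ((labels (through P (labels R) L)).map P).zip
      (pots (strands (through P (labels R) L))) := by
    have : ((labels (through P (labels R) L)).map P).zip (pots (strands (through P (labels R) L))) =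
        (through P (labels R) L).map fun z => (P z.1, z.2.1) := by
      simp [labels, pots, strands, List.zip_map', Function.comp_def]
    rw [this]
    exact List.mem_map.2 ⟨w, List.mem_filter.2 ⟨hw, by simpa [e] using hwR⟩, rfl⟩
  have m₂ := h₃.symm.subset m₁
  have : (labels (through P (labels L) R)).zip (pots (strands (through P (labels L) R))) =
      (through P (labels L) R).map fun z => (z.1, z.2.1) := by
    simp [labels, pots, strands, List.zip_map', Function.comp_def]
  rw [this] at m₂
  obtain ⟨z, hz, h₄⟩ := List.mem_map.1 m₂
  simp only [Prod.mk.injEq] at h₄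
  obtain rfl : z = w' := List.inj_on_of_nodup_map (List.nodup_append.1 h.nodup).2.1
    (List.mem_filter.1 hz).1 hw' (h₄.1.trans e)
  exact h₄.2.symm

theorem Nested.length_rest {φ : ℕ → ℕ} {is : List ℕ} {M : Named A}
    (h : Nested φ (labels M) is) : (rest φ is M).length + 2 * is.length = M.length := by
  induction is generalizing M with
  | nil => simp [rest]
  | cons i is ih =>
    obtain ⟨k₁, k₂, k₃, hk, -, h'⟩ := h.split
    obtain ⟨S, T, W, x, y, rfl, rfl, rfl, rfl⟩ := labels_eq_split hk
    rw [h.rest_eq]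
    have := ih (M := S ++ T ++ W) (by simpa using h')
    simp at this ⊢
    omega

section matching

variable {φ : ℕ → ℕ} {ℓ r : ℕ}

/-- The left half-edges at a vertex. -/
def leftEdges (r ℓ : ℕ) : List ℕ := (List.range ℓ).map (r + ·)

theorem mem_leftEdges {i : ℕ} : i ∈ leftEdges r ℓ ↔ r ≤ i ∧ i < r + ℓ := by
  simp only [leftEdges, List.mem_map, List.mem_range]
  constructor
  · rintro ⟨j, h, rfl⟩; omega
  · rintro ⟨h₁, h₂⟩; exact ⟨i - r, by omega, by omega⟩

theorem sorted_leftEdges (r ℓ : ℕ) : (leftEdges r ℓ).Pairwise (· < ·) :=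
  List.pairwise_map.2 (List.pairwise_lt_range.imp (by omega))

theorem nested_left (hφ : IsPerfectMatching (r + ℓ) φ) :
    Nested φ (leftEdges r ℓ) ((leftEdges r ℓ).filter fun i => i < φ i) where
  sorted := sorted_leftEdges r ℓ
  nodup := ((sorted_leftEdges r ℓ).imp fun h => Nat.ne_of_lt h).filter _
  mem i hi := by
    obtain ⟨h₁, h₂⟩ := List.mem_filter.1 hi
    have h₃ := mem_leftEdges.1 h₁
    have := hφ i h₃.2
    simp only [decide_eq_true_eq] at h₂
    exact ⟨h₁, mem_leftEdges.2 ⟨by omega, this.1⟩, h₂⟩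
  invol i hi := (hφ i (mem_leftEdges.1 hi).2).2.2

theorem nested_right (hφ : IsPerfectMatching (r + ℓ) φ) :
    Nested φ (List.range r) ((List.range r).filter fun i => i < φ i ∧ φ i < r) where
  sorted := List.pairwise_lt_range
  nodup := List.nodup_range.filter _
  mem i hi := by
    obtain ⟨h₁, h₂⟩ := List.mem_filter.1 hi
    simp only [decide_eq_true_eq] at h₂
    exact ⟨h₁, List.mem_range.2 h₂.2, h₂.1⟩
  invol i hi := (hφ i (by have := List.mem_range.1 hi; omega)).2.2

theorem rest_left {L : Named A} (hφ : IsPerfectMatching (r + ℓ) φ)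
    (hL : labels L = leftEdges r ℓ) :
    rest φ ((leftEdges r ℓ).filter fun i => i < φ i) L = through φ (List.range r) L := by
  refine List.filter_congr fun w hw => ?_
  have hm : w.1 ∈ leftEdges r ℓ := hL ▸ List.mem_map_of_mem hw
  have h₁ := mem_leftEdges.1 hm
  obtain ⟨h₂, h₃, h₄⟩ := hφ w.1 h₁.2
  simp only [List.mem_filter, decide_eq_true_eq, mem_leftEdges, h₄, List.mem_range]
  congr 1
  simp only [eq_iff_iff]
  omega

theorem rest_right {R : Named A} (hφ : IsPerfectMatching (r + ℓ) φ)
    (hR : labels R = List.range r) :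
    rest φ ((List.range r).filter fun i => i < φ i ∧ φ i < r) R = through φ (leftEdges r ℓ) R := by
  refine List.filter_congr fun w hw => ?_
  have hm : w.1 ∈ List.range r := hR ▸ List.mem_map_of_mem hw
  have h₁ := List.mem_range.1 hm
  obtain ⟨h₂, h₃, h₄⟩ := hφ w.1 (by omega)
  simp only [List.mem_filter, decide_eq_true_eq, mem_leftEdges, h₄, List.mem_range]
  congr 1
  simp only [eq_iff_iff]
  omega

theorem samePiece_left {L : Named A} (hφ : IsPerfectMatching (r + ℓ) φ)
    (hL : labels L = leftEdges r ℓ) : SamePiece φ ((leftEdges r ℓ).filter fun i => i < φ i) L ↔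
      ∀ z ∈ L, ∀ z' ∈ L, φ z.1 = z'.1 → z.2.2 = z'.2.2 := by
  constructor
  · intro h z hz z' hz' e
    have hm : z.1 ∈ leftEdges r ℓ := hL ▸ List.mem_map_of_mem hz
    have hm' : z'.1 ∈ leftEdges r ℓ := hL ▸ List.mem_map_of_mem hz'
    obtain ⟨h₂, h₃, h₄⟩ := hφ z.1 (mem_leftEdges.1 hm).2
    rcases Nat.lt_or_gt_of_ne h₃ with h₅ | h₅
    · exact (h z' hz' z hz (List.mem_filter.2 ⟨hm', by simpa [← e, h₄] using h₅⟩)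
        (by rw [← e, h₄])).symm
    · exact h z hz z' hz' (List.mem_filter.2 ⟨hm, by simpa using h₅⟩) e
  · intro h w hw w' hw' _ e
    exact h w hw w' hw' e

theorem samePiece_right {R : Named A} (hφ : IsPerfectMatching (r + ℓ) φ)
    (hR : labels R = List.range r) :
    SamePiece φ ((List.range r).filter fun i => i < φ i ∧ φ i < r) R ↔
      ∀ z ∈ R, ∀ z' ∈ R, φ z.1 = z'.1 → z.2.2 = z'.2.2 := by
  constructor
  · intro h z hz z' hz' e
    have hm : z.1 ∈ List.range r := hR ▸ List.mem_map_of_mem hz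
    have hm' : z'.1 ∈ List.range r := hR ▸ List.mem_map_of_mem hz'
    have l₁ := List.mem_range.1 hm
    have l₂ := List.mem_range.1 hm'
    obtain ⟨h₂, h₃, h₄⟩ := hφ z.1 (by omega)
    rcases Nat.lt_or_gt_of_ne h₃ with h₅ | h₅
    · exact (h z' hz' z hz (List.mem_filter.2 ⟨hm', by simp [← e, h₄]; omega⟩)
        (by rw [← e, h₄])).symm
    · exact h z hz z' hz' (List.mem_filter.2 ⟨hm, by simp; omega⟩) e
  · intro h w hw w' hw' _ e
    exact h w hw w' hw' e

/-- The left ends of the pairs that go across a vertex, and the right ends. -/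
theorem across_perm (hφ : IsPerfectMatching (r + ℓ) φ) :
    (((leftEdges r ℓ).filter fun i => φ i < r).map φ).Perm
      ((List.range r).filter fun i => r ≤ φ i) := by
  refine (List.perm_ext_iff_of_nodup ?_ (List.nodup_range.filter _)).2 fun i => ?_
  · refine List.Nodup.map_on ?_ (((sorted_leftEdges r ℓ).imp fun h => Nat.ne_of_lt h).filter _)
    intro i hi j hj e
    have h₁ := (hφ i (mem_leftEdges.1 (List.mem_filter.1 hi).1).2).2.2
    have h₂ := (hφ j (mem_leftEdges.1 (List.mem_filter.1 hj).1).2).2.2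
    rw [← h₁, e, h₂]
  · simp only [List.mem_map, List.mem_filter, decide_eq_true_eq, mem_leftEdges, List.mem_range]
    constructor
    · rintro ⟨j, ⟨⟨h₁, h₂⟩, h₃⟩, rfl⟩
      exact ⟨h₃, by rwa [(hφ j h₂).2.2]⟩
    · rintro ⟨h₁, h₂⟩
      have := hφ i (by omega)
      exact ⟨φ i, ⟨⟨h₂, this.1⟩, by rwa [this.2.2]⟩, this.2.2⟩

end matching

/-! ### Rulings of a resolved vertex -/

theorem pair_sublist_of_sorted {α : Type} {f : α → ℕ} {l : List α}
    (hl : l.Pairwise fun x y => f x < f y) {x y : α} (hx : x ∈ l) (hy : y ∈ l) (h : f x < f y) :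
    [x, y].Sublist l := by
  obtain ⟨s, t, rfl⟩ := List.append_of_mem hx
  have hm : y ∈ t := by
    simp only [List.mem_append, List.mem_cons] at hy
    rcases hy with h' | rfl | h'
    · have := (List.pairwise_append.1 hl).2.2 _ h' x (by simp)
      omega
    · omega
    · exact h'
  exact ((List.singleton_sublist.2 hm).cons_cons x).trans (List.sublist_append_right s _)

theorem pot_of_sorted {R : Named A} (hR : (labels R).Pairwise (· < ·))
    (hb : Balanced U V (strands R)) {w w' : ℕ × A × ℕ} (hw : w ∈ R) (hw' : w' ∈ R)
    (h : w.1 < w'.1) (e : w.2.2 = w'.2.2) : w.2.1 = w'.2.1 + 1 := by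
  refine hb.pot _ _ w.2.2 ?_
  have := (pair_sublist_of_sorted (List.pairwise_map.1 hR) hw hw' h).map Prod.snd
  obtain ⟨_, a, d⟩ := w
  obtain ⟨_, b, d'⟩ := w'
  obtain rfl : d = d' := e
  exact this

theorem exists_of_getElem_right {r i : ℕ} {L R : Named A} {x : A}
    (hR : labels R = List.range r) (hi : i < r)
    (hx : (pots (strands R) ++ pots (strands L))[i]? = some x) : ∃ w ∈ R, w.1 = i ∧ w.2.1 = x := by
  have hlen : R.length = r := by simpa using congrArg List.length hR
  rw [List.getElem?_append_left (by simp [hlen, hi])] at hx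
  refine ⟨R[i], by simp, ?_, ?_⟩
  · have : (labels R)[i]? = some i := by simp [hR, hi]
    simpa [labels, hlen, hi] using this
  · simpa [pots, strands, hlen, hi] using hx

theorem exists_of_getElem_left {ℓ r i : ℕ} {L R : Named A} {x : A}
    (hR : labels R = List.range r) (hL : labels L = leftEdges r ℓ) (hi : r ≤ i)
    (hx : (pots (strands R) ++ pots (strands L))[i]? = some x) : ∃ w ∈ L, w.1 = i ∧ w.2.1 = x := by
  have hlen : R.length = r := by simpa using congrArg List.length hR
  have hlenL : L.length = ℓ := by simpa [leftEdges] using congrArg List.length hL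
  rw [List.getElem?_append_right (by simp [hlen, hi])] at hx
  simp only [length_pots, length_strands, hlen] at hx
  have hi' : i - r < ℓ := by
    have := (List.getElem?_eq_some_iff.1 hx).1
    simpa [hlenL] using this
  refine ⟨L[i - r], by simp, ?_, ?_⟩
  · have : (labels L)[i - r]? = some i := by simp [hL, leftEdges, hi']; omega
    simpa [labels, hlenL, hi'] using this
  · simpa [pots, strands, hlenL, hi'] using hx

/-- The matching of a ruled vertex is graded. -/
theorem VertexRel.isGraded {φ : ℕ → ℕ} {ℓ r : ℕ} {L R : Named A}
    (h : VertexRel φ U V L R) (hR : labels R = List.range r) (hL : labels L = leftEdges r ℓ)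
    (hbL : Balanced U V (strands L)) (hbR : Balanced U V (strands R)) :
    IsGradedMatching r (pots (strands R) ++ pots (strands L)) φ := by
  have sR : (labels R).Pairwise (· < ·) := hR ▸ List.pairwise_lt_range
  have sL : (labels L).Pairwise (· < ·) := hL ▸ sorted_leftEdges r ℓ
  intro i j x y hij e hx hy
  constructor
  · rintro (hj | hi)
    · obtain ⟨w, hw, rfl, rfl⟩ := exists_of_getElem_right hR (by omega) hx
      obtain ⟨w', hw', rfl, rfl⟩ := exists_of_getElem_right hR hj hy
      exact pot_of_sorted sR hbR hw hw' hij (h.right w hw w' hw' e)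
    · obtain ⟨w, hw, rfl, rfl⟩ := exists_of_getElem_left hR hL hi hx
      obtain ⟨w', hw', rfl, rfl⟩ := exists_of_getElem_left hR hL (by omega) hy
      exact pot_of_sorted sL hbL hw hw' hij (h.left w hw w' hw' e)
  · rintro ⟨hi, hj⟩
    obtain ⟨w, hw, rfl, rfl⟩ := exists_of_getElem_right hR hi hx
    obtain ⟨w', hw', rfl, rfl⟩ := exists_of_getElem_left hR hL hj hy
    exact h.mirror.pot_eq hw hw' e

theorem lt_iff_pair_sublist {T : List ℕ} (hT : T.Pairwise (· < ·)) {x y : ℕ} (hx : x ∈ T)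
    (hy : y ∈ T) : y < x ↔ [y, x].Sublist T := by
  refine ⟨pair_sublist_of_sorted (f := id) hT hy hx, fun h => ?_⟩
  simpa using hT.sublist h

theorem sorts_beta {φ : ℕ → ℕ} {ℓ r : ℕ} (hφ : IsPerfectMatching (r + ℓ) φ) :
    Sorts ((List.range r).filter fun i => r ≤ φ i)
      (sortBraid (fun y x => y < x) (((leftEdges r ℓ).filter fun i => φ i < r).map φ))
      (((leftEdges r ℓ).filter fun i => φ i < r).map φ)
      ((List.range r).filter fun i => r ≤ φ i) := by
  have hs : ((List.range r).filter fun i => r ≤ φ i).Pairwise (· < ·) :=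
    List.pairwise_lt_range.filter _
  exact sorts_sortBraid (List.nodup_range.filter _) (across_perm hφ) fun x hx y hy _ => by
    simpa using lt_iff_pair_sublist hs hx hy

theorem sorts_halfTwist {φ : ℕ → ℕ} {ℓ r : ℕ} (hφ : IsPerfectMatching (r + ℓ) φ) :
    Sorts ((leftEdges r ℓ).filter fun i => φ i < r).reverse
      (sortBraid (fun y x => y < x) (((leftEdges r ℓ).filter fun i => φ i < r).map φ) ++
        sortBraid (fun y x => x < y) (((List.range r).filter fun i => r ≤ φ i).map φ))
      ((leftEdges r ℓ).filter fun i => φ i < r)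
      ((leftEdges r ℓ).filter fun i => φ i < r).reverse := by
  have hs : ((leftEdges r ℓ).filter fun i => φ i < r).Pairwise (· < ·) :=
    (sorted_leftEdges r ℓ).filter _
  have hn := hs.imp fun h => Nat.ne_of_lt h
  have hinv : (((leftEdges r ℓ).filter fun i => φ i < r).map φ).map φ =
      (leftEdges r ℓ).filter fun i => φ i < r := by
    rw [List.map_map]
    refine (List.map_congr_left fun i hi => ?_).trans (List.map_id _)
    exact (hφ i (mem_leftEdges.1 (List.mem_filter.1 hi).1).2).2.2
  have hp := (across_perm hφ).map φ
  rw [hinv] at hp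
  have h₁ := (sorts_beta hφ).map φ
  rw [hinv] at h₁
  refine sorts_append.2 ⟨_, h₁.of_reduced (hp.nodup_iff.1 hn), ?_⟩
  refine sorts_sortBraid (List.nodup_reverse.2 hn) (hp.symm.trans (List.reverse_perm _).symm)
    fun x hx y hy _ => ?_
  have := lt_iff_pair_sublist hs (List.mem_reverse.1 hy) (List.mem_reverse.1 hx)
  rw [decide_eq_true_iff, this, ← List.reverse_sublist]
  simp

theorem resolveVertex_zero (ℓ r : ℕ) (φ : ℕ → ℕ) (μ : ℕ → A) :
    resolveVertex 0 ℓ r φ μ =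
      markedRightCusps φ 0 (leftEdges r ℓ) ((leftEdges r ℓ).filter fun i => i < φ i) ++
      ((regular (sortBraid (fun y x => y < x) (((leftEdges r ℓ).filter fun i => φ i < r).map φ)) ++
        marked (sortBraid (fun y x => x < y) (((List.range r).filter fun i => r ≤ φ i).map φ)) ++
        marked (sortBraid (fun y x => x < y)
          (((List.range r).filter fun i => r ≤ φ i).map φ)).reverse).map
        fun z => ⟨z.1, .crossing z.2⟩) ++
      markedLeftCusps φ μ 0 (List.range r)
        ((List.range r).filter fun i => i < φ i ∧ φ i < r) := by
  simp [resolveVertex, leftEdges, regular, marked, cross, mcross, Function.comp_def]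

theorem length_across_right {φ : ℕ → ℕ} {ℓ r : ℕ} (hφ : IsPerfectMatching (r + ℓ) φ) :
    ((List.range r).filter fun i => r ≤ φ i).length +
      2 * ((List.range r).filter fun i => i < φ i ∧ φ i < r).length = (List.range r).length := by
  obtain ⟨M, hM, -⟩ := exists_named (A := ℤ) (ns := List.range r)
    (l := (List.range r).map fun _ => (0, 0)) (by simp)
  have := Nested.length_rest (hM.symm ▸ nested_right (ℓ := ℓ) hφ)
  have h : labels (through φ (leftEdges r ℓ) M) = (List.range r).filter fun i => r ≤ φ i := by
    rw [labels_through, hM]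
    refine List.filter_congr fun i hi => ?_
    have := (hφ i (by have := List.mem_range.1 hi; omega)).1
    simp [mem_leftEdges, this]
  rw [hM, rest_right hφ hM] at this
  rw [← h]
  simpa [← hM] using this

theorem length_across_left {φ : ℕ → ℕ} {ℓ r : ℕ} (hφ : IsPerfectMatching (r + ℓ) φ) :
    ((leftEdges r ℓ).filter fun i => φ i < r).length +
      2 * ((leftEdges r ℓ).filter fun i => i < φ i).length = (leftEdges r ℓ).length := by
  obtain ⟨M, hM, -⟩ := exists_named (A := ℤ) (ns := leftEdges r ℓ)
    (l := (leftEdges r ℓ).map fun _ => (0, 0)) (by simp)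
  have := Nested.length_rest (hM.symm ▸ nested_left (ℓ := ℓ) hφ)
  have h : labels (through φ (List.range r) M) = (leftEdges r ℓ).filter fun i => φ i < r := by
    simp [labels_through, hM]
  rw [hM, rest_left hφ hM] at this
  rw [← h]
  simpa [← hM] using this

theorem pRul_resolveVertex {φ : ℕ → ℕ} {μ : ℕ → A} {ℓ r : ℕ} {L : Named A}
    {y : Stack A} (hφ : IsPerfectMatching (r + ℓ) φ) (hL : labels L = leftEdges r ℓ)
    (hb : Balanced U V (strands L))
    (hg : IsGradedMatching r ((List.range r).map μ ++ pots (strands L)) φ) :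
    PRul P U V (resolveVertex 0 ℓ r φ μ) (strands L) y ↔ ∃ R, labels R = List.range r ∧
      strands R = y ∧ (∀ w ∈ R, w.2.1 = μ w.1) ∧ VertexRel φ U V L R ∧
      Balanced U V (strands R) := by
  have hN : ((leftEdges r ℓ).filter fun i => φ i < r).Nodup :=
    ((sorted_leftEdges r ℓ).imp fun h => Nat.ne_of_lt h).filter _
  have hT : ((List.range r).filter fun i => r ≤ φ i).Nodup := List.nodup_range.filter _
  have hlabL : labels (through φ (List.range r) L) = (leftEdges r ℓ).filter fun i => φ i < r := by
    simp [labels_through, hL]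
  have hlabR : ∀ R : Named A, labels R = List.range r →
      labels (through φ (leftEdges r ℓ) R) = (List.range r).filter fun i => r ≤ φ i := by
    intro R hR
    rw [labels_through, hR]
    refine List.filter_congr fun i hi => ?_
    have := (hφ i (by have := List.mem_range.1 hi; omega)).1
    simp [mem_leftEdges, this]
  have hbt : Balanced U V (strands L) → SamePiece φ ((leftEdges r ℓ).filter fun i => i < φ i) L →
      Balanced U V (strands (through φ (List.range r) L)) := fun hb hs => by
    rw [← rest_left hφ hL]
    have := (pRul_markedRightCusps (P := id) (U := U) (V := V) (hL.symm ▸ nested_left hφ) hb).2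
      ⟨hs, rfl⟩
    exact this.balanced hb
  have hlen : (((leftEdges r ℓ).filter fun i => φ i < r)).length =
      (strands (through φ (List.range r) L)).length := by rw [← hlabL]; simp
  have hfirst (z) := pRul_markedRightCusps (P := P) (U := U) (V := V) (z := z)
    (hL.symm ▸ nested_left hφ) hb
  rw [resolveVertex_zero, pRul_append]
  simp only [pRul_append, pRul_crossings]
  rw [hL] at hfirst
  simp only [hfirst, rest_left hφ hL]
  have hcount := length_across_right (ℓ := ℓ) hφ
  constructor
  · rintro ⟨_, ⟨_, ⟨hs, rfl⟩, h₂⟩, h₃⟩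
    have hb₁ := hbt hb hs
    obtain ⟨hd, hw⟩ := (crossWord_resolve hN hlen hb₁ (sorts_halfTwist hφ)).1 h₂
    have hb₂ := h₂.balanced hb₁
    obtain ⟨R, hR, rfl, hbR, m₁, m₂, hm⟩ := (pRul_markedLeftCusps (nested_right hφ) (by
      rw [h₂.length_eq, ← hlen, ← List.length_map φ, (across_perm hφ).length_eq, hcount]) hb₂).1 h₃
    rw [rest_right hφ hR] at hm
    have hV : VertexRel φ U V L R := by
      refine ⟨⟨?_, ?_, (samePiece_left hφ hL).1 hs, (samePiece_right hφ hR).1 m₁⟩, ?_, ?_⟩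
      · rw [hL, hR]
        refine List.nodup_append.2 ⟨(sorted_leftEdges r ℓ).imp fun h => Nat.ne_of_lt h,
          List.nodup_range, fun i hi j hj => ?_⟩
        have := mem_leftEdges.1 hi
        have := List.mem_range.1 hj
        omega
      · rw [hL, hR]
        intro n hn
        simp only [List.mem_append, mem_leftEdges, List.mem_range] at hn ⊢
        have := hφ n (by omega)
        exact ⟨by omega, this.2⟩
      · rw [hR]; exact hd
      · rw [hR, hL, hlabL, hlabR R hR]
        exact ⟨_, sorts_beta hφ, hm ▸ hw⟩
    refine ⟨R, hR, rfl, fun w hw => ?_, hV, hbR⟩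
    have hlenL : L.length = ℓ := by simpa [leftEdges] using congrArg List.length hL
    have hw₁ : w.1 < r := by
      have : w.1 ∈ labels R := List.mem_map_of_mem hw
      simpa [hR] using this
    have hx : ((List.range r).map μ ++ pots (strands L))[w.1]? = some (μ w.1) := by
      rw [List.getElem?_append_left (by simpa using hw₁)]
      simp [hw₁]
    obtain ⟨f₁, f₂, f₃⟩ := hφ w.1 (by omega)
    by_cases hφw : φ w.1 < r
    · rcases Nat.lt_or_gt_of_ne f₂ with h₅ | h₅
      · exact m₂ w hw (List.mem_filter.2 ⟨by simpa using hφw, by simp [f₃, h₅, hw₁]⟩)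
      · obtain ⟨w', hw', e⟩ := mem_labels.1 (show φ w.1 ∈ labels R by simpa [hR] using hφw)
        have hw₂ := m₂ w' hw' (by
          rw [e, f₃]
          exact List.mem_filter.2 ⟨by simpa using hw₁, by simp [h₅, hφw]⟩)
        have hy : ((List.range r).map μ ++ pots (strands L))[φ w.1]? = some (μ (φ w.1)) := by
          rw [List.getElem?_append_left (by simpa using hφw)]
          simp [hφw]
        rw [pot_of_sorted (hR ▸ List.pairwise_lt_range) hbR hw hw' (by omega)
          (hV.right w hw w' hw' e.symm), hw₂, e]
        exact ((hg _ _ _ _ h₅ rfl hx hy).1 (.inl hφw)).symm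
    · obtain ⟨k, hk⟩ : ∃ k, φ w.1 = r + k := ⟨φ w.1 - r, by omega⟩
      have hkℓ : k < L.length := by omega
      have hlab : L[k].1 = φ w.1 := by
        have : (labels L)[k]? = some (r + k) := by
          rw [hL]; simp [leftEdges, hlenL ▸ hkℓ]
        simpa [labels, hkℓ, hk] using this
      have hy : ((List.range r).map μ ++ pots (strands L))[φ w.1]? = some L[k].2.1 := by
        rw [List.getElem?_append_right (by simp [hk])]
        simp [hk, pots, strands, hkℓ]
      rw [← hV.pot_eq (List.getElem_mem hkℓ) hw (by rw [hlab, f₃])]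
      exact ((hg _ _ _ _ (by omega) rfl hx hy).2 ⟨hw₁, by omega⟩).symm
  · rintro ⟨R, hR, rfl, hμ, hV, hbR⟩
    have hs := (samePiece_left hφ hL).2 hV.left
    obtain ⟨w, hw, hc⟩ := hV.braid
    have hd := hV.distinct
    rw [hR] at hd hw hc
    rw [hL, hlabL, hlabR R hR] at hw
    rw [hL] at hc
    refine ⟨_, ⟨_, ⟨hs, rfl⟩, (crossWord_resolve hN hlen (hbt hb hs) (sorts_halfTwist hφ)).2
      ⟨hd, (Sorts.braidEq hT hw (sorts_beta hφ)).crossWord (hbt hb hs) hd hc⟩⟩, ?_⟩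
    have hbm := hc.balanced (hbt hb hs)
    refine (pRul_markedLeftCusps (nested_right hφ) ?_ hbm).2 ⟨R, hR, rfl, hbR,
      (samePiece_right hφ hR).2 hV.right, fun w hw _ => hμ w hw, by rw [rest_right hφ hR]⟩
    rw [← hcount, ← hlabR R hR]
    simp

/-! ### Names of half-edges -/

/-- Rename the strands of a list. -/
def rename (ν : ℕ → ℕ) (l : Named A) : Named A := l.map fun z => (ν z.1, z.2)

@[simp] theorem labels_rename (ν : ℕ → ℕ) (l : Named A) :
    labels (rename ν l) = (labels l).map ν := by simp [labels, rename, Function.comp_def]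
@[simp] theorem strands_rename (ν : ℕ → ℕ) (l : Named A) :
    strands (rename ν l) = strands l := by simp [strands, rename, Function.comp_def]

theorem mem_map_of_injOn {ν : ℕ → ℕ} {S : List ℕ} (hν : ∀ n ∈ S, ∀ n' ∈ S, ν n = ν n' → n = n')
    {T : List ℕ} (hT : ∀ n ∈ T, n ∈ S) {n : ℕ} (hn : n ∈ S) : ν n ∈ T.map ν ↔ n ∈ T := by
  constructor
  · intro h
    obtain ⟨m, hm, e⟩ := List.mem_map.1 h
    exact hν m (hT m hm) n hn e ▸ hm
  · exact List.mem_map_of_mem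

theorem VertexRel.rename {P' ν : ℕ → ℕ} {L R : Named A} (h : VertexRel P U V L R)
    (hν : ∀ n ∈ labels L ++ labels R, ∀ n' ∈ labels L ++ labels R, ν n = ν n' → n = n')
    (hP : ∀ n ∈ labels L ++ labels R, P' (ν n) = ν (P n)) :
    VertexRel P' U V (rename ν L) (LegendrianFront.rename ν R) := by
  have hmem : ∀ {X : Named A} {z}, z ∈ X → z.1 ∈ labels X := List.mem_map_of_mem
  have key : ∀ X Y : Named A, (∀ n ∈ labels X, n ∈ labels L ++ labels R) →
      (∀ n ∈ labels Y, n ∈ labels L ++ labels R) →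
      through P' ((labels Y).map ν) (LegendrianFront.rename ν X) =
        LegendrianFront.rename ν (through P (labels Y) X) := by
    intro X Y hX hY
    simp only [through, LegendrianFront.rename, List.filter_map]
    congr 1
    refine List.filter_congr fun z hz => ?_
    have hz' := hX _ (hmem hz)
    simp only [Function.comp, hP _ hz', mem_map_of_injOn hν hY (h.invol _ hz').1]
  have kL := key L R (by simp +contextual) (by simp +contextual)
  have kR := key R L (by simp +contextual) (by simp +contextual)
  have same : ∀ X : Named A, (∀ n ∈ labels X, n ∈ labels L ++ labels R) →
      (∀ z ∈ X, ∀ z' ∈ X, P z.1 = z'.1 → z.2.2 = z'.2.2) → ∀ z ∈ LegendrianFront.rename ν X,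
        ∀ z' ∈ LegendrianFront.rename ν X, P' z.1 = z'.1 → z.2.2 = z'.2.2 := by
    intro X hX hs z hz z' hz' e
    obtain ⟨w, hw, rfl⟩ := List.mem_map.1 hz
    obtain ⟨w', hw', rfl⟩ := List.mem_map.1 hz'
    have h₁ := hX _ (hmem hw)
    refine hs w hw w' hw' (hν _ (h.invol _ h₁).1 _ (hX _ (hmem hw')) ?_)
    rw [← hP _ h₁, e]
  refine ⟨⟨?_, ?_, same L (by simp +contextual) h.left, same R (by simp +contextual) h.right⟩, ?_, ?_⟩
  · rw [labels_rename, labels_rename, ← List.map_append]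
    exact List.Nodup.map_on hν h.nodup
  · rw [labels_rename, labels_rename, ← List.map_append]
    intro n hn
    obtain ⟨m, hm, rfl⟩ := List.mem_map.1 hn
    obtain ⟨h₁, h₂, h₃⟩ := h.invol m hm
    rw [hP m hm]
    exact ⟨List.mem_map_of_mem h₁, fun e => h₂ (hν _ h₁ _ hm e), by rw [hP _ h₁, h₃]⟩
  · rw [labels_rename, kL, strands_rename]
    exact h.distinct
  · obtain ⟨w, h₁, h₂⟩ := h.braid
    refine ⟨w, ?_, ?_⟩
    · rw [labels_rename, labels_rename, kL, kR, labels_rename, labels_rename]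
      convert h₁.map ν using 1
      rw [List.map_map, List.map_map]
      exact List.map_congr_left fun n hn => hP n (by
        have := (mem_labels_through.1 hn).1
        simp [this])
    · rw [labels_rename, labels_rename, kL, kR, strands_rename, strands_rename]
      exact h₂

theorem rename_id (l : Named A) : rename id l = l := by simp [rename]

theorem CoreRel.congr_matching {P' : ℕ → ℕ} {c : Core A} {l r : Stack A}
    (h : CoreRel P U V c l r) (hP : ∀ n ∈ c.names, P n = P' n) : CoreRel P' U V c l r := by
  cases h with
  | leftCusp c d h₁ h₂ => exact .leftCusp c d h₁ h₂
  | rightCusp c d => exact .rightCusp c d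
  | crossing k x y r h => exact .crossing k x y r h
  | vertex L R h hb =>
    refine .vertex L R ?_ hb
    have := h.rename (P' := P') (ν := id) (fun _ _ _ _ e => e) fun n hn => by
      refine (hP n ?_).symm
      simp only [Core.names, List.map_map, Function.comp_def, List.mem_append] at hn ⊢
      simpa [labels, or_comm] using hn
    rwa [rename_id, rename_id] at this

theorem PRul.congr_matching {P' : ℕ → ℕ} {W : Front A} {x y : Stack A}
    (h : PRul P U V W x y) (hP : ∀ n ∈ W.names, P n = P' n) : PRul P' U V W x y := by
  induction W generalizing x with
  | nil => exact h
  | cons e W ih =>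
    obtain ⟨z, ⟨s, l, r, t, hs, hx, hy, h⟩, h'⟩ := h
    simp only [Front.names, List.flatMap_cons, List.mem_append] at hP
    exact ⟨z, ⟨s, l, r, t, hs, hx, hy, h.congr_matching fun n hn => hP n (.inl hn)⟩,
      ih h' fun n hn => hP n (.inr hn)⟩

theorem map_idxOf_self {l : List ℕ} (hl : l.Nodup) : l.map l.idxOf = List.range l.length := by
  refine List.ext_getElem (by simp) fun i h₁ h₂ => ?_
  simp [hl.idxOf_getElem]

theorem map_getD_range (l : List ℕ) : (List.range l.length).map (fun i => l.getD i 0) = l := by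
  refine List.ext_getElem (by simp) fun i h₁ h₂ => ?_
  simp at h₁
  simp [h₁]

/-! ### Rulings of fronts without vertices -/

theorem rulingStep_iff {e : Event A} (he : ¬ e.core.IsVertex) {x y : Stack A} :
    RulingStep e x y ↔ PStep P [] [] e x y := by
  constructor
  · intro h
    cases h with
    | leftCusp u v c d hd =>
      have hd' : d ∉ pieces (u ++ v) := hd
      simp at hd'
      exact pStep_leftCusp.2 ⟨d, by simp [hd'], by simp [hd'], rfl⟩
    | rightCusp u v c d => exact pStep_rightCusp.2 ⟨rfl, rfl, rfl⟩
    | pass u v a b d e k hn => exact crossAt_iff_pStep.2 (crossAt_block.2 ⟨hn, .inl rfl⟩)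
    | switch u v a b d e hn hab hi =>
      obtain rfl := sub_eq_zero.1 hab
      exact crossAt_pair.2 ⟨hn, .inr ⟨rfl, by
        simpa [pieces] using (nonInterlacing_iff _ _ _ _).1 hi, rfl⟩⟩
  · rintro ⟨s, l, r, t, hs, rfl, rfl, h⟩
    obtain ⟨p, c⟩ := e
    obtain rfl : s.length = p := hs
    cases h with
    | leftCusp c d h₁ h₂ =>
      have := RulingStep.leftCusp s t c d (by
        change d ∉ pieces (s ++ t)
        simpa using And.intro h₁ h₂)
      simpa [lcusp] using this
    | rightCusp c d => simpa [rcusp] using RulingStep.rightCusp s t c d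
    | crossing k x y r h =>
      obtain ⟨a, d⟩ := x
      obtain ⟨b, e⟩ := y
      obtain ⟨hn, rfl | ⟨rfl, rfl, hb, rfl⟩⟩ := (crossAt_block (s := []) (t := [])).1 h
      · simpa using RulingStep.pass s t a b d e k hn
      · have := RulingStep.switch s t a a d e hn (sub_self a) ((nonInterlacing_iff _ _ _ _).2 (by
          simpa [pieces] using hb))
        simpa [cross] using this
    | vertex => exact absurd trivial he

theorem isRuling_iff {W : Front A} (hW : W.NoVertices) {x y : Stack A} :
    IsRuling W x y ↔ PRul P [] [] W x y := by
  induction W generalizing x with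
  | nil => rfl
  | cons e W ih =>
    simp only [IsRuling, PRul, rulingStep_iff (P := P) (hW e (by simp)),
      ih fun e he => hW e (List.mem_cons_of_mem _ he)]

theorem isRuling_append {W W' : Front A} {x y : Stack A} :
    IsRuling (W ++ W') x y ↔ ∃ z, IsRuling W x z ∧ IsRuling W' z y := by
  induction W generalizing x with
  | nil => simp [IsRuling]
  | cons e W ih =>
    simp only [List.cons_append, IsRuling, ih]
    grind

/-! ### The resolution of a vertex below other strands -/

theorem noVertices_append {W W' : Front A} :
    (W ++ W').NoVertices ↔ W.NoVertices ∧ W'.NoVertices := by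
  simp [Front.NoVertices, or_imp, forall_and]

theorem noVertices_markedRightCusps (φ : ℕ → ℕ) (p : ℕ) (ks is : List ℕ) :
    (markedRightCusps φ p ks is : Front A).NoVertices := by
  induction is generalizing ks with
  | nil => simp [markedRightCusps, Front.NoVertices]
  | cons i is ih =>
    simp only [markedRightCusps, noVertices_append, ih, and_true]
    simp [Front.NoVertices, mcross, rcusp, Core.IsVertex]

theorem noVertices_markedLeftCusps (φ : ℕ → ℕ) (μ : ℕ → A) (p : ℕ) (ks is : List ℕ) :
    (markedLeftCusps φ μ p ks is).NoVertices := by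
  induction is generalizing ks with
  | nil => simp [markedLeftCusps, Front.NoVertices]
  | cons i is ih =>
    simp only [markedLeftCusps, noVertices_append, ih, true_and]
    simp [Front.NoVertices, mcross, lcusp, Core.IsVertex]

theorem noVertices_resolveVertex (p ℓ r : ℕ) (φ : ℕ → ℕ) (μ : ℕ → A) :
    (resolveVertex p ℓ r φ μ).NoVertices := by
  simp only [resolveVertex, noVertices_append, noVertices_markedRightCusps,
    noVertices_markedLeftCusps]
  simp [Front.NoVertices, mcross, cross, Core.IsVertex]

theorem shift_markedRightCusps (φ : ℕ → ℕ) (p : ℕ) (ks is : List ℕ) :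
    (markedRightCusps φ p ks is : Front A) = (markedRightCusps φ 0 ks is).shift p := by
  induction is generalizing ks with
  | nil => rfl
  | cons i is ih =>
    simp only [markedRightCusps, shift_append, ← ih]
    simp [Front.shift, mcross, rcusp, Function.comp_def, add_assoc]

theorem shift_markedLeftCusps (φ : ℕ → ℕ) (μ : ℕ → A) (p : ℕ) (ks is : List ℕ) :
    markedLeftCusps φ μ p ks is = (markedLeftCusps φ μ 0 ks is).shift p := by
  induction is generalizing ks with
  | nil => rfl
  | cons i is ih =>
    simp only [markedLeftCusps, shift_append, ← ih]
    simp [Front.shift, mcross, lcusp, Function.comp_def, add_assoc]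

theorem shift_resolveVertex (p ℓ r : ℕ) (φ : ℕ → ℕ) (μ : ℕ → A) :
    resolveVertex p ℓ r φ μ = (resolveVertex 0 ℓ r φ μ).shift p := by
  simp only [resolveVertex, shift_append, ← shift_markedRightCusps, ← shift_markedLeftCusps]
  simp [Front.shift, mcross, cross, Function.comp_def]

theorem FitsFront.crossings {n : ℕ} {w : List (ℕ × Bool)} {W : Front A} (hw : Fits w n)
    (hW : FitsFront n W) : FitsFront n (w.map (fun z => ⟨z.1, .crossing z.2⟩) ++ W) := by
  induction w with
  | nil => exact hW
  | cons z w ih =>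
    have hz : z.1 + 2 ≤ n := hw z (by simp)
    refine ⟨hz, ?_⟩
    simp only [Core.ins, Core.outs]
    rw [Nat.sub_add_cancel (by omega)]
    exact ih fun z hz => hw z (List.mem_cons_of_mem _ hz)

theorem FitsFront.markedRightCusps {φ : ℕ → ℕ} {ks is : List ℕ} {W : Front A} {n : ℕ}
    (h : Nested φ ks is) (hn : n + 2 * is.length = ks.length) (hW : FitsFront n W) :
    FitsFront ks.length (markedRightCusps φ 0 ks is ++ W) := by
  induction is generalizing ks with
  | nil => simpa [LegendrianFront.markedRightCusps, ← hn] using hW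
  | cons i is ih =>
    obtain ⟨k₁, k₂, k₃, rfl, hk, h'⟩ := h.split
    obtain ⟨e₁, e₂, e₃⟩ := idxOf_erase_split hk
    simp only [LegendrianFront.markedRightCusps, e₁, e₂, e₃]
    have := FitsFront.crossings (A := A) (n := (k₁ ++ i :: (k₂ ++ φ i :: k₃)).length)
      (w := (List.range k₂.length).map fun q => (k₁.length + q, true))
      (W := rcusp (k₁.length + k₂.length) ::
        (LegendrianFront.markedRightCusps φ 0 (k₁ ++ k₂ ++ k₃) is ++ W)) (by
        simp [Fits]; omega) (by
        refine ⟨by simp [rcusp, Core.ins]; omega, ?_⟩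
        convert ih h' (by simp at hn ⊢; omega) using 1
        simp [rcusp, Core.ins, Core.outs]; omega)
    convert this using 1
    simp [mcross, Function.comp_def,
      show k₁.length + 1 + k₂.length - 1 = k₁.length + k₂.length by omega]

theorem FitsFront.markedLeftCusps {φ : ℕ → ℕ} {μ : ℕ → A} {ks is : List ℕ} {W : Front A} {n : ℕ}
    (h : Nested φ ks is) (hn : n + 2 * is.length = ks.length) (hW : FitsFront ks.length W) :
    FitsFront n (markedLeftCusps φ μ 0 ks is ++ W) := by
  induction is generalizing ks W with
  | nil =>
    obtain rfl : n = ks.length := by simpa using hn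
    exact hW
  | cons i is ih =>
    obtain ⟨k₁, k₂, k₃, rfl, hk, h'⟩ := h.split
    obtain ⟨e₁, e₂, e₃⟩ := idxOf_erase_split hk
    simp only [LegendrianFront.markedLeftCusps, e₁, e₂, e₃, List.append_assoc]
    rw [← List.append_assoc k₁]
    refine ih h' (by simp at hn ⊢; omega) ⟨by simp [lcusp, Core.ins], ?_⟩
    have := FitsFront.crossings (A := A) (n := (k₁ ++ i :: (k₂ ++ φ i :: k₃)).length)
      (w := (List.range k₂.length).reverse.map fun q => (k₁.length + q, true)) (by
        simp [Fits]; omega) hW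
    convert this using 1
    · simp [lcusp, Core.ins, Core.outs]; omega
    · simp [mcross, Function.comp_def]

theorem fits_resolveVertex {φ : ℕ → ℕ} {μ : ℕ → A} {ℓ r : ℕ} (hφ : IsPerfectMatching (r + ℓ) φ) :
    FitsFront ℓ (resolveVertex 0 ℓ r φ μ) := by
  have h₁ := length_across_left (ℓ := ℓ) hφ
  have h₂ := length_across_right (ℓ := ℓ) hφ
  have h₃ := (across_perm (ℓ := ℓ) hφ).length_eq
  rw [List.length_map] at h₃
  have hf := (sorts_halfTwist (ℓ := ℓ) hφ).fits
  have hℓ : ℓ = (leftEdges r ℓ).length := by simp [leftEdges]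
  rw [resolveVertex_zero, List.append_assoc]
  conv => lhs; rw [hℓ]
  refine FitsFront.markedRightCusps (nested_left hφ) h₁ (FitsFront.crossings ?_ ?_)
  · intro z hz
    simp only [Fits, regular, List.map_append, List.mem_append, List.mem_map, or_imp,
      forall_and, forall_exists_index, and_imp] at hf
    simp only [regular, marked, List.mem_append, List.mem_map, List.mem_reverse] at hz
    rcases hz with (⟨q, hq, rfl⟩ | ⟨q, hq, rfl⟩) | ⟨q, hq, rfl⟩
    · exact hf.1 (q, false) q hq rfl
    · exact hf.2 (q, false) q hq rfl
    · exact hf.2 (q, false) q hq rfl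
  · rw [← List.append_nil (LegendrianFront.markedLeftCusps _ _ _ _ _)]
    exact FitsFront.markedLeftCusps (nested_right hφ) (by rw [h₃, h₂]) trivial

/-! ### Rulings of resolutions and rulings of fronts with vertices -/

theorem range_add_eq (r ℓ : ℕ) : List.range (r + ℓ) = List.range r ++ leftEdges r ℓ :=
  List.range_add

theorem map_getD_split (l l' : List ℕ) :
    (List.range l.length).map (fun i => (l ++ l').getD i 0) = l ∧
      (leftEdges l.length l'.length).map (fun i => (l ++ l').getD i 0) = l' := by
  have := map_getD_range (l ++ l')
  rw [List.length_append, range_add_eq, List.map_append] at this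
  exact List.append_inj this (by simp)

theorem map_idxOf_split {l l' : List ℕ} (h : (l ++ l').Nodup) :
    l.map (l ++ l').idxOf = List.range l.length ∧
      l'.map (l ++ l').idxOf = leftEdges l.length l'.length := by
  have := map_idxOf_self h
  rw [List.length_append, range_add_eq, List.map_append] at this
  exact List.append_inj this (by simp)

theorem idxOf_getD {l : List ℕ} (h : l.Nodup) {i : ℕ} (hi : i < l.length) :
    l.idxOf (l.getD i 0) = i := by
  rw [List.getD_eq_getElem _ _ hi, h.idxOf_getElem]

theorem getD_idxOf {l : List ℕ} {n : ℕ} (h : n ∈ l) : l.getD (l.idxOf n) 0 = n := by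
  rw [List.getD_eq_getElem _ _ (List.idxOf_lt_length_iff.2 h), List.getElem_idxOf]

theorem exists_coreRel_of_resolution {Q φ : ℕ → ℕ} {ls : List ℕ} {rs : List (ℕ × A)}
    {l y : Stack A} (hN : (rs.map Prod.fst ++ ls).Nodup) (hl : l.length = ls.length)
    (hb : Balanced U V l) (hφ : IsPerfectMatching (rs.length + ls.length) φ)
    (hg : IsGradedMatching rs.length (rs.map Prod.snd ++ pots l) φ)
    (h : PRul Q U V (resolveVertex 0 ls.length rs.length φ fun i => (rs.map Prod.snd).getD i 0) l y) :
    ∃ P, CoreRel P U V (.vertex ls rs) l y := by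
  obtain ⟨L, hL, rfl⟩ := exists_named (ns := leftEdges rs.length ls.length) (l := l)
    (by simp [leftEdges, hl])
  have hμ : (List.range rs.length).map (fun i => (rs.map Prod.snd).getD i 0) = rs.map Prod.snd :=
    List.ext_getElem (by simp) fun i h₁ h₂ => by simp at h₁; simp [h₁]
  obtain ⟨R, hR, rfl, hRμ, hV, hbR⟩ := (pRul_resolveVertex hφ hL hb (by rwa [hμ])).1 h
  set N := rs.map Prod.fst ++ ls with hNdef
  have hlen : N.length = rs.length + ls.length := by simp [N]
  have hmem : ∀ n ∈ labels L ++ labels R, n < N.length := by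
    intro n hn
    simp only [hL, hR, List.mem_append, mem_leftEdges, List.mem_range] at hn
    omega
  have hspl := map_getD_split (rs.map Prod.fst) ls
  rw [List.length_map] at hspl
  refine ⟨fun n => N.getD (φ (N.idxOf n)) 0, coreRel_vertex.2
    ⟨rename (fun i => N.getD i 0) L, rename (fun i => N.getD i 0) R, ?_, ?_, by simp, by simp,
      hV.rename ?_ ?_, by simpa using hbR⟩⟩
  · rw [labels_rename, hL, hspl.2]
  · have : (LegendrianFront.rename (fun i => N.getD i 0) R).map (fun z => (z.1, z.2.1)) =
        (labels R).map fun i => (N.getD i 0, (rs.map Prod.snd).getD i 0) := by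
      simp only [labels, rename, List.map_map]
      exact List.map_congr_left fun w hw => by simp [hRμ w hw]
    rw [this, hR]
    refine List.ext_getElem (by simp) fun i h₁ h₂ => ?_
    have hi : i < (rs.map Prod.fst).length := by simpa using h₁
    refine Prod.ext ?_ (by simp [h₁])
    simp [N, List.getElem?_append_left hi, h₁]
  · intro n hn n' hn' e
    rw [← idxOf_getD hN (hmem n hn), e, idxOf_getD hN (hmem n' hn')]
  · intro n hn
    rw [idxOf_getD hN (hmem n hn)]

theorem CoreRel.exists_resolution {ls : List ℕ} {rs : List (ℕ × A)} {l y : Stack A}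
    (h : CoreRel P U V (.vertex ls rs) l y) (hb : Balanced U V l) :
    l.length = ls.length ∧ pots y = rs.map Prod.snd ∧
    ∃ φ, IsPerfectMatching (rs.length + ls.length) φ ∧
      IsGradedMatching rs.length (rs.map Prod.snd ++ pots l) φ ∧
      ∀ Q, PRul Q U V (resolveVertex 0 ls.length rs.length φ fun i => (rs.map Prod.snd).getD i 0)
        l y := by
  obtain ⟨L, R, rfl, rfl, rfl, rfl, hV, hbR⟩ := coreRel_vertex.1 h
  have hN : (labels R ++ labels L).Nodup := (List.perm_append_comm.nodup_iff).1 hV.nodup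
  set N := labels R ++ labels L with hNdef
  have hlen : N.length = R.length + L.length := by simp [N]
  have hspl := map_idxOf_split hN
  simp only [length_labels] at hspl
  have hmem : ∀ n ∈ labels L ++ labels R, n ∈ N := fun n hn => by
    simpa [N, or_comm] using hn
  have hφ : IsPerfectMatching (R.length + L.length) fun i => N.idxOf (P (N.getD i 0)) := by
    intro i hi
    rw [← hlen] at hi
    obtain ⟨h₁, h₂, h₃⟩ := hV.invol (N.getD i 0) (by
      rw [List.getD_eq_getElem _ _ hi]
      exact List.mem_append.2 (List.mem_append.1 (List.getElem_mem hi)).symm)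
    refine ⟨hlen ▸ List.idxOf_lt_length_iff.2 (hmem _ h₁), fun e => h₂ ?_, ?_⟩
    · exact (getD_idxOf (hmem _ h₁)).symm.trans (congrArg (fun j => N.getD j 0) e)
    · simp only
      rw [getD_idxOf (hmem _ h₁), h₃, idxOf_getD hN hi]
  have hV' : VertexRel (fun i => N.idxOf (P (N.getD i 0))) U V (rename N.idxOf L)
      (rename N.idxOf R) := by
    refine hV.rename ?_ ?_
    · intro n hn n' hn' e
      rw [← getD_idxOf (hmem n hn), e, getD_idxOf (hmem n' hn')]
    · intro n hn
      rw [getD_idxOf (hmem n hn)]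
  have hR' : labels (rename N.idxOf R) = List.range R.length := by rw [labels_rename, hspl.1]
  have hL' : labels (rename N.idxOf L) = leftEdges R.length L.length := by
    rw [labels_rename, hspl.2]
  have hg := hV'.isGraded hR' hL' (by simpa using hb) (by simpa using hbR)
  simp only [strands_rename] at hg
  have hμ : (R.map fun z => (z.1, z.2.1)).map Prod.snd = pots (strands R) := by
    simp [pots, strands, Function.comp_def]
  refine ⟨by simp, hμ.symm, fun i => N.idxOf (P (N.getD i 0)), by simpa using hφ, ?_, fun Q => ?_⟩
  · rw [hμ]; simpa using hg
  · rw [hμ]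
    simp only [List.length_map, length_labels]
    have hm : (List.range R.length).map (fun i => (pots (strands R)).getD i 0) =
        pots (strands R) :=
      List.ext_getElem (by simp) fun i h₁ h₂ => by simp at h₁; simp [h₁]
    have := (pRul_resolveVertex (P := Q) (μ := fun i => (pots (strands R)).getD i 0)
      (y := strands R) hφ hL' (by simpa using hb) (by rw [hm, strands_rename]; exact hg)).2
      ⟨_, hR', by simp, ?_, hV', by simpa using hbR⟩
    · simpa using this
    · intro w hw
      obtain ⟨i, hi, rfl⟩ := List.getElem_of_mem hw
      have h₁ : (labels (rename N.idxOf R))[i]? = some i := by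
        simp only [rename, List.length_map] at hi
        rw [hR']; simp [hi]
      have h₂ : (rename N.idxOf R)[i].1 = i := by simpa [labels, hi] using h₁
      have hi' : i < R.length := by simpa [rename] using hi
      rw [h₂]
      simp [rename, pots, strands, hi']

theorem pRul_resolveVertex_block {Q φ : ℕ → ℕ} {ℓ r : ℕ} {μ : ℕ → A} {s l t y : Stack A}
    (hl : l.length = ℓ) (hφ : IsPerfectMatching (r + ℓ) φ) :
    PRul Q U V (resolveVertex s.length ℓ r φ μ) (s ++ l ++ t) y ↔
      ∃ m, y = s ++ m ++ t ∧ PRul Q (U ++ pieces s) (pieces t ++ V) (resolveVertex 0 ℓ r φ μ) l m := by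
  subst hl
  rw [shift_resolveVertex, List.append_assoc, pRul_append_left]
  simp only [pRul_append_right (fits_resolveVertex hφ)]
  constructor
  · rintro ⟨_, rfl, m, rfl, h⟩
    exact ⟨m, by simp, h⟩
  · rintro ⟨m, rfl, h⟩
    exact ⟨m ++ t, by simp, m, rfl, h⟩

theorem FullResolution.exists_pRul {s : List A} {W W' : Front A} (h : FullResolution s W W')
    {x y : Stack A} (hx : pots x = s) (hb : Balanced [] [] x) (hy : IsRuling W' x y)
    (hn : W.names.Nodup) : ∃ P, PRul P [] [] W x y := by
  induction h generalizing x with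
  | nil s => exact ⟨id, hy⟩
  | cons e s t W W' he ht h ih =>
    obtain ⟨z, hz, hy⟩ := hy
    have hz' : ∀ P, PStep P [] [] e x z := fun P => (rulingStep_iff he).1 hz
    obtain ⟨P, hP⟩ := ih ((Event.Trans.eq_pots (hx ▸ ht) (hz' id)).symm) ((hz' id).balanced hb) hy (by
      simp only [Front.names, List.flatMap_cons] at hn
      exact hn.of_append_right)
    exact ⟨P, z, hz' P, hP⟩
  | vertex u a v ls rs φ W W' ha hφ hg h ih =>
    obtain ⟨x', xv, rfl, hx', rfl⟩ := List.map_eq_append_iff.1 hx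
    obtain ⟨xu, xa, rfl, rfl, rfl⟩ := List.map_eq_append_iff.1 hx'
    obtain ⟨z, hz, hy⟩ := isRuling_append.1 hy
    rw [isRuling_iff (P := id) (noVertices_resolveVertex _ _ _ _ _)] at hz
    have hxa : xa.length = ls.length := by simpa using ha
    rw [List.length_map] at hz
    obtain ⟨m, rfl, hm⟩ := (pRul_resolveVertex_block hxa hφ).1 hz
    simp only [Front.names, List.flatMap_cons] at hn
    obtain ⟨P₁, hP₁⟩ := exists_coreRel_of_resolution hn.of_append_left hxa hb.mid hφ hg hm
    have hpm : pots m = rs.map Prod.snd := (hP₁.exists_resolution hb.mid).2.1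
    obtain ⟨P₂, hP₂⟩ := ih (x := xu ++ m ++ xv) (by simp [pots] at hpm ⊢; exact hpm)
      (hz.balanced hb) hy hn.of_append_right
    refine ⟨fun n => if n ∈ (Core.vertex ls rs).names then P₁ n else P₂ n, _,
      ⟨xu, xa, m, xv, by simp [vert], rfl, rfl, hP₁.congr_matching fun n hn => ?_⟩,
      hP₂.congr_matching fun n hn' => ?_⟩
    · rw [if_pos hn]
    · exact (if_neg fun h => List.disjoint_of_nodup_append hn h hn').symm

theorem PRul.exists_fullResolution {W : Front A} {x y : Stack A} {t : List A}
    (h : PRul P [] [] W x y) (hW : IsFront W (pots x) t) (hb : Balanced [] [] x) :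
    ∃ W', FullResolution (pots x) W W' ∧ IsRuling W' x y := by
  induction W generalizing x with
  | nil => exact ⟨[], .nil _, h⟩
  | cons e W ih =>
    obtain ⟨z, hz, hy⟩ := h
    obtain ⟨w, ht, hW⟩ := hW
    obtain rfl := ht.eq_pots hz
    obtain ⟨W', hW', hr⟩ := ih hy hW (hz.balanced hb)
    by_cases he : e.core.IsVertex
    · obtain ⟨p, c⟩ := e
      cases c with
      | vertex ls rs =>
        obtain ⟨s, l, r, u, hs, rfl, rfl, h⟩ := hz
        obtain rfl : s.length = p := hs
        obtain ⟨hl, hr', φ, hφ, hg, hQ⟩ := h.exists_resolution hb.mid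
        simp only [List.nil_append, List.append_nil, pots_append, hr'] at hW' hQ ⊢
        have := FullResolution.vertex (pots s) (pots l) (pots u) ls rs φ W W' (by simpa using hl)
          hφ hg hW'
        rw [length_pots] at this
        refine ⟨_, this, isRuling_append.2 ⟨_, (isRuling_iff (P := id)
          (noVertices_resolveVertex _ _ _ _ _)).2 ((pRul_resolveVertex_block hl hφ).2
            ⟨r, rfl, ?_⟩), hr⟩⟩
        simpa using hQ id
      | _ => exact he.elim
    · exact ⟨e :: W', .cons e _ _ W W' he ht hW', z, (rulingStep_iff he).2 hz, hr⟩

/-! ### Changing the ring of potentials -/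

section map

variable {B C : Type} [CommRing B] {g : A → B}

@[simp] theorem map_nil (g : A → B) : Front.map g [] = [] := rfl
@[simp] theorem map_cons (g : A → B) (e : Event A) (W : Front A) :
    Front.map g (e :: W) = ⟨e.pos, e.core.map g⟩ :: Front.map g W := rfl
@[simp] theorem map_append (g : A → B) (W W' : Front A) :
    Front.map g (W ++ W') = Front.map g W ++ Front.map g W' := List.map_append

theorem map_map (g : A → B) (h : B → C) (W : Front A) :
    Front.map h (Front.map g W) = Front.map (h ∘ g) W := by
  simp only [Front.map, List.map_map]
  refine List.map_congr_left fun e _ => ?_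
  obtain ⟨p, c⟩ := e
  cases c <;> simp [Core.map]

@[simp] theorem map_strandUp (g : A → B) (p k : ℕ) : Front.map g (strandUp p k) = strandUp p k := by
  simp [Front.map, strandUp, cross, Core.map, Function.comp_def]

@[simp] theorem map_strandDown (g : A → B) (p k : ℕ) :
    Front.map g (strandDown p k) = strandDown p k := by
  simp [Front.map, strandDown, cross, Core.map, Function.comp_def]

@[simp] theorem ins_map (g : A → B) (c : Core A) : (c.map g).ins = c.ins := by cases c <;> rfl
@[simp] theorem outs_map (g : A → B) (c : Core A) : (c.map g).outs = c.outs := by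
  cases c <;> simp [Core.map, Core.outs]
@[simp] theorem names_core_map (g : A → B) (c : Core A) : (c.map g).names = c.names := by
  cases c <;> simp [Core.map, Core.names, Function.comp_def]
@[simp] theorem isVertex_map (g : A → B) (c : Core A) : (c.map g).IsVertex ↔ c.IsVertex := by
  cases c <;> rfl
@[simp] theorem isMarked_map (g : A → B) (c : Core A) : (c.map g).IsMarked ↔ c.IsMarked := by
  cases c <;> rfl

@[simp] theorem names_map (g : A → B) (W : Front A) : (W.map g).names = W.names := by
  simp [Front.map, Front.names, List.flatMap_map]

theorem noVertices_map (g : A → B) {W : Front A} : (W.map g).NoVertices ↔ W.NoVertices := by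
  simp [Front.map, Front.NoVertices]

theorem noMarkings_map (g : A → B) {W : Front A} : (W.map g).NoMarkings ↔ W.NoMarkings := by
  simp [Front.map, Front.NoMarkings]

theorem coreTrans_map (hg : ∀ a, g (a + 1) = g a + 1) {c : Core A} {l r : List A}
    (h : CoreTrans c l r) : CoreTrans (c.map g) (l.map g) (r.map g) := by
  cases c with
  | leftCusp c =>
    obtain ⟨rfl, rfl⟩ := h
    simp [CoreTrans, Core.map, hg]
  | rightCusp =>
    obtain ⟨c, rfl, rfl⟩ := h
    exact ⟨g c, by simp [hg], rfl⟩
  | crossing k =>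
    obtain ⟨a, b, rfl, rfl⟩ := h
    exact ⟨g a, g b, rfl, rfl⟩
  | vertex ls rs =>
    simp only [CoreTrans] at h
    simp [CoreTrans, Core.map, h, Function.comp_def]

theorem trans_map (hg : ∀ a, g (a + 1) = g a + 1) {e : Event A} {s t : List A}
    (h : e.Trans s t) : Event.Trans ⟨e.pos, e.core.map g⟩ (s.map g) (t.map g) := by
  obtain ⟨u, l, r, v, hu, rfl, rfl, h'⟩ := trans_iff.1 h
  exact trans_iff.2 ⟨u.map g, l.map g, r.map g, v.map g, by simpa using hu, by simp, by simp,
    coreTrans_map hg h'⟩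

theorem IsFront.map (hg : ∀ a, g (a + 1) = g a + 1) {W : Front A} {s t : List A}
    (h : IsFront W s t) : IsFront (W.map g) (s.map g) (t.map g) := by
  induction W generalizing s with
  | nil => exact congrArg _ h
  | cons e W ih =>
    obtain ⟨m, h₁, h₂⟩ := h
    exact ⟨m.map g, trans_map hg h₁, ih h₂⟩

theorem Move.map (hg : ∀ a, g (a + 1) = g a + 1) {W W' : Front A} (h : Move W W') :
    Move (W.map g) (W'.map g) := by
  cases h with
  | zero p d c₁ c₂ => simpa using Move.zero p d (c₁.map g) (c₂.map g)
  | one_below p c => exact Move.one_below p (g c)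
  | one_above p c => exact Move.one_above p (g c)
  | two_left_below p c => exact Move.two_left_below p (g c)
  | two_left_above p c => exact Move.two_left_above p (g c)
  | two_right_below p => exact Move.two_right_below p
  | two_right_above p => exact Move.two_right_above p
  | three p => exact Move.three p
  | four_up p ls rs =>
    simpa [vert, Core.map] using Move.four_up p ls (rs.map fun x => (x.1, g x.2))
  | four_down p ls rs =>
    simpa [vert, Core.map] using Move.four_down p ls (rs.map fun x => (x.1, g x.2))
  | five_right_bottom p ls rs h c =>
    simpa [vert, lcusp, Core.map] using
      Move.five_right_bottom p ls (rs.map fun x => (x.1, g x.2)) h (g c)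
  | five_right_top p ls rs h c =>
    simpa [vert, lcusp, Core.map, hg] using
      Move.five_right_top p ls (rs.map fun x => (x.1, g x.2)) h (g c)
  | five_left_bottom p ls rs h c =>
    simpa [vert, rcusp, Core.map, hg] using
      Move.five_left_bottom p ls (rs.map fun x => (x.1, g x.2)) h (g c)
  | five_left_top p ls rs h c =>
    simpa [vert, rcusp, Core.map] using
      Move.five_left_top p ls (rs.map fun x => (x.1, g x.2)) h (g c)

theorem Equivalent.map (hg : ∀ a, g (a + 1) = g a + 1) {W W' : Front A} (h : Equivalent W W') :
    Equivalent (W.map g) (W'.map g) := by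
  induction h with
  | rel W W' h =>
    obtain ⟨h₁, h₂, U, V, X, X', hm, rfl, rfl⟩ := h
    exact .rel _ _ ⟨h₁.map hg, h₂.map hg, U.map g, V.map g, X.map g, X'.map g, hm.map hg,
      by simp, by simp⟩
  | refl W => exact .refl _
  | symm W W' _ ih => exact .symm _ _ ih
  | trans W W' W'' _ _ ih ih' => exact .trans _ _ _ ih ih'

/-- Apply a map to the potentials of a ruled stack. -/
def mapPots (g : A → B) (x : Stack A) : List (B × ℕ) := x.map fun z => (g z.1, z.2)

@[simp] theorem pieces_mapPots (g : A → B) (x : Stack A) :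
    pieces (mapPots g x) = pieces x := by simp [mapPots, pieces, Function.comp_def]

theorem RulingStep.map (hg : ∀ a, g (a + 1) = g a + 1) {e : Event A} {x y : Stack A}
    (h : RulingStep e x y) : RulingStep ⟨e.pos, e.core.map g⟩ (mapPots g x) (mapPots g y) := by
  have hp : ∀ u : Stack A, (mapPots g u).map Prod.snd = u.map Prod.snd := pieces_mapPots g
  have hl : ∀ u : Stack A, (mapPots g u).length = u.length := fun u => List.length_map _
  cases h with
  | leftCusp u v c d hd =>
    have := RulingStep.leftCusp (mapPots g u) (mapPots g v) (g c) d
      (by rwa [List.map_append, hp, hp, ← List.map_append])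
    simpa [mapPots, hg, lcusp, Core.map] using this
  | rightCusp u v c d =>
    have := RulingStep.rightCusp (mapPots g u) (mapPots g v) (g c) d
    simpa [mapPots, hg, rcusp, Core.map] using this
  | pass u v a b d e k hn =>
    have := RulingStep.pass (mapPots g u) (mapPots g v) (g a) (g b) d e k hn
    simpa [mapPots, Core.map] using this
  | switch u v a b d e hn hab hi =>
    have := RulingStep.switch (mapPots g u) (mapPots g v) (g a) (g b) d e hn
      (by rw [sub_eq_zero.1 hab, sub_self]) (by rwa [hp, hp])
    simpa [mapPots, cross, Core.map] using this

theorem IsRuling.map (hg : ∀ a, g (a + 1) = g a + 1) {W : Front A} {x y : Stack A}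
    (h : IsRuling W x y) : IsRuling (W.map g) (mapPots g x) (mapPots g y) := by
  induction W generalizing x with
  | nil => exact congrArg _ h
  | cons e W ih =>
    obtain ⟨m, h₁, h₂⟩ := h
    exact ⟨mapPots g m, h₁.map hg, ih h₂⟩

end map

/-! ### Vertices at the borders -/

/-- `P` matches the members of each list without fixed points. -/
def PairsBlocks (P : ℕ → ℕ) (bs : List (List ℕ)) : Prop :=
  ∀ b ∈ bs, ∀ n ∈ b, P n ∈ b ∧ P n ≠ n ∧ P (P n) = n

/-- Strands whose names are matched belong to the same piece. -/
def SameOnPairs (P : ℕ → ℕ) (R : Named A) : Prop :=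
  ∀ z ∈ R, ∀ z' ∈ R, P z.1 = z'.1 → z.2.2 = z'.2.2

theorem SameOnPairs.append {R S : Named A} (hR : SameOnPairs P R) (hS : SameOnPairs P S)
    (hn : (labels (R ++ S)).Nodup) (hR' : ∀ n ∈ labels R, P n ∈ labels R)
    (hS' : ∀ n ∈ labels S, P n ∈ labels S) : SameOnPairs P (R ++ S) := by
  rw [labels_append] at hn
  have hd := List.disjoint_of_nodup_append hn
  have hm : ∀ {X : Named A} {z}, z ∈ X → z.1 ∈ labels X := List.mem_map_of_mem
  intro z hz z' hz' e
  rcases List.mem_append.1 hz with hz | hz <;> rcases List.mem_append.1 hz' with hz' | hz'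
  · exact hR z hz z' hz' e
  · exact (hd (hR' _ (hm hz)) (e ▸ hm hz')).elim
  · exact (hd (hm hz') (e ▸ hS' _ (hm hz))).elim
  · exact hS z hz z' hz' e

theorem coreRel_vertex_nil_left {rs : List (ℕ × A)} {r : Stack A} :
    CoreRel P U V (.vertex [] rs) [] r ↔ ∃ R : Named A,
      rs = R.map (fun z => (z.1, z.2.1)) ∧ r = strands R ∧ (labels R).Nodup ∧
      PairsBlocks P [labels R] ∧ SameOnPairs P R ∧ Balanced U V (strands R) := by
  rw [coreRel_vertex]
  constructor
  · rintro ⟨L, R, hL, rfl, -, rfl, h, hb⟩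
    have hl : labels L = [] := hL.symm
    exact ⟨R, rfl, rfl, h.nodup.of_append_right, by simpa [PairsBlocks, hl] using h.invol, h.right, hb⟩
  · rintro ⟨R, rfl, rfl, hn, hp, hs, hb⟩
    refine ⟨[], R, rfl, rfl, rfl, rfl, ⟨⟨by simpa using hn, by simpa [PairsBlocks] using hp,
      by simp, hs⟩, by simp [through, strands], [], ?_, ?_⟩, hb⟩ <;>
    simp [through, Sorts, labels, strands, regular]

theorem coreRel_vertex_nil_right {ls : List ℕ} {l r : Stack A} :
    CoreRel P U V (.vertex ls []) l r ↔ r = [] ∧ ∃ L : Named A,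
      ls = labels L ∧ l = strands L ∧ (labels L).Nodup ∧
      PairsBlocks P [labels L] ∧ SameOnPairs P L := by
  rw [coreRel_vertex]
  constructor
  · rintro ⟨L, R, rfl, hR, rfl, rfl, h, hb⟩
    obtain rfl : R = [] := by simpa using hR.symm
    exact ⟨rfl, L, rfl, rfl, h.nodup.of_append_left, by simpa [PairsBlocks] using h.invol, h.left⟩
  · rintro ⟨rfl, L, rfl, rfl, hn, hp, hs⟩
    refine ⟨L, [], rfl, rfl, rfl, rfl, ⟨⟨by simpa using hn, by simpa [PairsBlocks] using hp,
      hs, by simp⟩, by simp [through, strands], [], ?_, ?_⟩, ⟨by simp, by simp⟩⟩ <;>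
    simp [through, Sorts, labels, strands, regular]

theorem pRul_closeLeft {hs : List (List (ℕ × A))} {s y : Stack A}
    (hn : (hs.flatten.map Prod.fst).Nodup) (h : PRul P U V (closeLeft s.length hs) s y) :
    ∃ R : Named A, R.map (fun z => (z.1, z.2.1)) = hs.flatten ∧ y = s ++ strands R ∧
      PairsBlocks P (hs.map (List.map Prod.fst)) ∧ SameOnPairs P R := by
  induction hs generalizing s with
  | nil => exact ⟨[], rfl, by simpa using Eq.symm h, by simp [PairsBlocks], by simp [SameOnPairs]⟩
  | cons b hs ih =>
    obtain ⟨z, ⟨s', l, r, t, h₁, h₂, rfl, h₃⟩, h₄⟩ := h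
    have hlen := h₃.length_eq.1
    obtain rfl : l = [] := by simpa [vert, Core.ins] using hlen
    obtain ⟨rfl, rfl⟩ : s = s' ∧ t = [] := by
      rw [List.append_assoc] at h₂
      have : s.length = (s' ++ ([] ++ t)).length := congrArg _ h₂
      have ht : t = [] := by
        simp only [vert] at h₁
        simpa [h₁] using this
      subst ht
      simpa using h₂
    obtain ⟨R, rfl, rfl, h₅, h₆, h₇, -⟩ := coreRel_vertex_nil_left.1 h₃
    simp only [List.flatten_cons, List.map_append] at hn
    obtain ⟨S, hS, rfl, h₈, h₉⟩ := ih (s := s ++ strands R) hn.of_append_right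
      (by simpa using h₄)
    have e₁ : (R.map fun z => (z.1, z.2.1)).map Prod.fst = labels R := by simp [labels]
    have e₂ : hs.flatten.map Prod.fst = labels S := by rw [← hS]; simp [labels]
    rw [e₁, e₂] at hn
    refine ⟨R ++ S, by simp [hS], by simp [strands], ?_, h₇.append h₉ (by simpa using hn)
      (fun n hn => (h₆ _ (by simp) n hn).1) fun n hn => ?_⟩
    · intro b' hb'
      rw [List.map_cons, e₁, List.mem_cons] at hb'
      rcases hb' with rfl | hb'
      · exact h₆ _ (by simp)
      · exact h₈ b' hb'
    · rw [← e₂, List.map_flatten, List.mem_flatten] at hn ⊢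
      obtain ⟨b', hb', hn⟩ := hn
      exact ⟨b', hb', (h₈ b' hb' n hn).1⟩

theorem pRul_closeLeft_of_pairs {hs : List (List (ℕ × A))} {s : Stack A}
    {R : Named A} (hn : (hs.flatten.map Prod.fst).Nodup)
    (hR : R.map (fun z => (z.1, z.2.1)) = hs.flatten)
    (hP : PairsBlocks P (hs.map (List.map Prod.fst))) (hS : SameOnPairs P R)
    (hb : Balanced [] [] (s ++ strands R)) :
    PRul P [] [] (closeLeft s.length hs) s (s ++ strands R) := by
  induction hs generalizing s R with
  | nil =>
    obtain rfl : R = [] := by simpa using hR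
    simp [closeLeft, strands]
  | cons b hs ih =>
    obtain ⟨R₁, R₂, rfl, rfl, h₂⟩ := List.map_eq_append_iff.1 hR
    simp only [List.flatten_cons, List.map_append] at hn
    have e₁ : (R₁.map fun z => (z.1, z.2.1)).map Prod.fst = labels R₁ := by simp [labels]
    have hP₁ : PairsBlocks P [labels R₁] := by
      intro b hb
      exact hP b (by rw [List.mem_singleton.1 hb, List.map_cons, e₁]; simp)
    rw [e₁] at hn
    have hbR : Balanced (pieces s) [] (strands R₁) := by
      have hb' : Balanced [] [] (s ++ strands R₁ ++ strands R₂) := by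
        simpa [strands] using hb
      have h₃ := hb'.mid
      refine ⟨fun d hd => ?_, h₃.pot⟩
      have h₄ := h₃.count d hd
      have : d ∉ pieces (strands R₂) := by
        intro hd₂
        obtain ⟨z, hz, rfl⟩ : ∃ z ∈ R₂, z.2.2 = d := by simpa [pieces, strands] using hd₂
        obtain ⟨w, hw, hwd⟩ : ∃ w ∈ R₁, w.2.2 = z.2.2 := by simpa [pieces, strands] using hd
        have hw' := hP₁ (labels R₁) (by simp) w.1 (List.mem_map_of_mem hw)
        obtain ⟨w', hw₁, hw₂⟩ := mem_labels.1 hw'.1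
        have hww := hS w (by simp [hw]) w' (by simp [hw₁]) hw₂.symm
        have hne : w ≠ w' := by
          rintro rfl
          exact hw'.2.1 hw₂.symm
        have h₅ : 2 ≤ (pieces (strands R₁)).count z.2.2 := by
          have : [w, w'].Subperm R₁ := List.subperm_of_subset (by simp [hne])
            (by simp [hw, hw₁])
          obtain ⟨l, hp, hl⟩ := this
          have := (hl.map fun z => z.2.2).count_le z.2.2
          rw [(hp.map fun z => z.2.2).count_eq] at this
          simpa [hwd, hww.symm.trans hwd, pieces, strands, Function.comp_def] using this
        have h₆ : 0 < (pieces (strands R₂)).count z.2.2 := List.count_pos_iff.2 hd₂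
        simp only [List.count_append] at h₄
        omega
      simpa [List.count_eq_zero.2 this] using h₄
    refine ⟨s ++ strands R₁, ⟨s, [], strands R₁, [], rfl, by simp, by simp,
      coreRel_vertex_nil_left.2 ⟨R₁, rfl, rfl, hn.of_append_left, hP₁, ?_, by simpa using hbR⟩⟩, ?_⟩
    · exact fun z hz z' hz' => hS z (by simp [hz]) z' (by simp [hz'])
    · have := ih (s := s ++ strands R₁) (R := R₂) hn.of_append_right h₂
        (fun b hb => hP b (by simp at hb ⊢; exact .inr hb))
        (fun z hz z' hz' => hS z (by simp [hz]) z' (by simp [hz'])) (by simpa [strands] using hb)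
      simpa [strands] using this

theorem pRul_closeRight {bs : List (List ℕ)} {x y : Stack A} (hn : bs.flatten.Nodup)
    (h : PRul P U V (closeRight bs) x y) :
    ∃ L : Named A, labels L = bs.flatten ∧ x = strands L ++ y ∧
      PairsBlocks P bs ∧ SameOnPairs P L := by
  induction bs generalizing x with
  | nil => exact ⟨[], rfl, h, by simp [PairsBlocks], by simp [SameOnPairs]⟩
  | cons b bs ih =>
    obtain ⟨z, ⟨s', l, r, t, h₁, rfl, rfl, h₃⟩, h₄⟩ := h
    obtain rfl : s' = [] := by simpa [vert] using h₁
    obtain ⟨rfl, L, rfl, rfl, h₅, h₆, h₇⟩ := coreRel_vertex_nil_right.1 h₃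
    rw [List.flatten_cons] at hn
    obtain ⟨M, hM, h₈, h₉, h₁₀⟩ := ih hn.of_append_right h₄
    simp only [List.nil_append] at h₈
    subst h₈
    refine ⟨L ++ M, by simp [hM], by simp [strands], ?_, h₇.append h₁₀ (by simpa [hM] using hn)
      (fun n hn => (h₆ _ (by simp) n hn).1) fun n hn => ?_⟩
    · intro b hb
      rcases List.mem_cons.1 hb with rfl | hb
      · exact h₆ _ (by simp)
      · exact h₉ b hb
    · rw [hM, List.mem_flatten] at hn ⊢
      obtain ⟨b, hb, hn⟩ := hn
      exact ⟨b, hb, (h₉ b hb n hn).1⟩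

/-! ### Matchings of the strands at a border -/

theorem count_eq_length_filter (l : List ℕ) (d : ℕ) :
    l.count d = ((List.range l.length).filter fun i => l[i]? = some d).length := by
  conv_lhs => rw [← map_getD_range l]
  rw [List.count_eq_countP, List.countP_map, List.countP_eq_length_filter]
  congr 1
  refine List.filter_congr fun i hi => ?_
  have := List.mem_range.1 hi
  simp [this, beq_eq_decide]

theorem count_eq_two_iff {l : List ℕ} {d i j : ℕ} (hij : i ≠ j) (hi : l[i]? = some d)
    (hj : l[j]? = some d) : l.count d = 2 ↔ ∀ k, l[k]? = some d → k = i ∨ k = j := by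
  rw [count_eq_length_filter]
  have hn : ((List.range l.length).filter fun i => l[i]? = some d).Nodup :=
    List.nodup_range.filter _
  have hm : ∀ k, k ∈ ((List.range l.length).filter fun i => l[i]? = some d) ↔
      l[k]? = some d := by
    intro k
    simp only [List.mem_filter, List.mem_range, decide_eq_true_eq, and_iff_right_iff_imp]
    exact fun h => (List.getElem?_eq_some_iff.1 h).1
  constructor
  · intro h k hk
    have hs : [i, j].Subperm ((List.range l.length).filter fun i => l[i]? = some d) :=
      List.subperm_of_subset (by simp [hij]) (by simp [List.subset_def, hm, hi, hj])
    simpa using (hs.perm_of_length_le (by simp [h])).mem_iff.2 ((hm k).2 hk)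
  · intro h
    have : ((List.range l.length).filter fun i => l[i]? = some d).Perm [i, j] := by
      refine (List.perm_ext_iff_of_nodup hn (by simp [hij])).2 fun k => ?_
      rw [hm]
      constructor
      · intro hk; simpa using h k hk
      · simp only [List.mem_cons, List.not_mem_nil, or_false]
        rintro (rfl | rfl) <;> assumption
    simpa using this.length_eq

theorem pair_sublist_iff {α : Type} {l : List α} {a b : α} :
    [a, b].Sublist l ↔ ∃ i j : ℕ, i < j ∧ l[i]? = some a ∧ l[j]? = some b := by
  constructor
  · intro h
    obtain ⟨is, h₁, h₂⟩ := List.sublist_eq_map_getElem h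
    match is, h₁, h₂ with
    | [i, j], h₁, h₂ =>
      simp only [List.map_cons, List.map_nil, List.cons.injEq, and_true] at h₁
      exact ⟨i, j, by simpa using h₂, by simp [h₁], by simp [h₁]⟩
  · rintro ⟨i, j, hij, hi, hj⟩
    obtain ⟨hi', rfl⟩ := List.getElem?_eq_some_iff.1 hi
    obtain ⟨hj', rfl⟩ := List.getElem?_eq_some_iff.1 hj
    exact List.map_getElem_sublist (l := l) (is := [⟨i, hi'⟩, ⟨j, hj'⟩]) (by simpa using hij)

/-- The matching of the indices of a list that comes from a matching of its members. -/
def indexMatching (N : List ℕ) (P : ℕ → ℕ) (i : ℕ) : ℕ := N.idxOf (P (N.getD i 0))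

/-- The matching of the members of a list that comes from a matching of its indices. -/
def nameMatching (N : List ℕ) (φ : ℕ → ℕ) (n : ℕ) : ℕ := N.getD (φ (N.idxOf n)) 0

theorem block_range {bs : List (List ℕ)} {b : List ℕ} {k : ℕ} (hn : bs.flatten.Nodup)
    (hb : bs[k]? = some b) :
    (∀ n ∈ b, ((bs.map List.length).take k).sum ≤ bs.flatten.idxOf n ∧
      bs.flatten.idxOf n < ((bs.map List.length).take k).sum + b.length) ∧
    ∀ i, ((bs.map List.length).take k).sum ≤ i →
      i < ((bs.map List.length).take k).sum + b.length → bs.flatten.getD i 0 ∈ b := by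
  obtain ⟨hk, rfl⟩ := List.getElem?_eq_some_iff.1 hb
  have hs : ((bs.map List.length).take k).sum = (bs.take k).flatten.length := by
    rw [List.length_flatten, List.map_take]
  have hsplit : bs.flatten = (bs.take k).flatten ++ (bs[k] ++ (bs.drop (k + 1)).flatten) := by
    rw [← List.flatten_cons, ← List.drop_eq_getElem_cons hk, ← List.flatten_append,
      List.take_append_drop]
  rw [hs]
  rw [hsplit] at hn ⊢
  have hd := List.disjoint_of_nodup_append hn
  constructor
  · intro n hnb
    rw [List.idxOf_append_of_notMem fun h => hd h (by simp [hnb]), List.idxOf_append_of_mem hnb]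
    have := List.idxOf_lt_length_iff.2 hnb
    omega
  · intro i h₁ h₂
    rw [List.getD_append_right _ _ _ _ h₁, List.getD_append _ _ _ _ (by omega),
      List.getD_eq_getElem _ _ (by omega)]
    exact List.getElem_mem _

theorem isPerfectMatching_indexMatching {bs : List (List ℕ)} (hn : bs.flatten.Nodup)
    (hP : PairsBlocks P bs) :
    IsPerfectMatching bs.flatten.length (indexMatching bs.flatten P) := by
  intro i hi
  have hm : bs.flatten.getD i 0 ∈ bs.flatten := by
    rw [List.getD_eq_getElem _ _ hi]
    exact List.getElem_mem hi
  obtain ⟨b, hb, hm⟩ := List.mem_flatten.1 hm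
  obtain ⟨h₁, h₂, h₃⟩ := hP b hb _ hm
  have hm' := List.mem_flatten.2 ⟨b, hb, h₁⟩
  refine ⟨List.idxOf_lt_length_iff.2 hm', fun e => h₂ ?_, ?_⟩
  · exact (getD_idxOf hm').symm.trans (congrArg (fun j => bs.flatten.getD j 0) e)
  · rw [indexMatching, indexMatching, getD_idxOf hm', h₃, idxOf_getD hn hi]

theorem preservesBlocks_indexMatching {bs : List (List ℕ)} (hn : bs.flatten.Nodup)
    (hP : PairsBlocks P bs) : PreservesBlocks (bs.map List.length) (indexMatching bs.flatten P) := by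
  intro k n hk i h₁ h₂
  rw [List.getElem?_map, Option.map_eq_some_iff] at hk
  obtain ⟨b, hb, rfl⟩ := hk
  have := block_range hn hb
  exact this.1 _ (hP b (List.mem_of_getElem? hb) _ (this.2 i h₁ h₂)).1

theorem pairsBlocks_nameMatching {bs : List (List ℕ)} {φ : ℕ → ℕ} (hn : bs.flatten.Nodup)
    (hφ : IsPerfectMatching bs.flatten.length φ) (hb : PreservesBlocks (bs.map List.length) φ) :
    PairsBlocks (nameMatching bs.flatten φ) bs := by
  intro b hbs n hnb
  obtain ⟨k, hk⟩ := List.mem_iff_getElem?.1 hbs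
  have hnf := List.mem_flatten.2 ⟨b, hbs, hnb⟩
  have hr := block_range hn hk
  have h₁ := hb k b.length (by simp [hk]) _ (hr.1 n hnb).1 (hr.1 n hnb).2
  obtain ⟨h₂, h₃, h₄⟩ := hφ _ (List.idxOf_lt_length_iff.2 hnf)
  refine ⟨hr.2 _ h₁.1 h₁.2, fun e => h₃ ?_, ?_⟩
  · have := congrArg bs.flatten.idxOf e
    rwa [nameMatching, idxOf_getD hn h₂] at this
  · rw [nameMatching, nameMatching, idxOf_getD hn h₂, h₄, getD_idxOf hnf]

section border

variable {bs : List (List ℕ)} {R : Named A}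

theorem length_of_labels {N : List ℕ} (hR : labels R = N) : R.length = N.length := by
  simpa using congrArg List.length hR

theorem pieces_getElem?_indexMatching (hR : labels R = bs.flatten)
    (hP : PairsBlocks P bs) (hS : SameOnPairs P R) {i d : ℕ}
    (hi : (pieces (strands R))[i]? = some d) :
    (pieces (strands R))[indexMatching bs.flatten P i]? = some d := by
  have hlen := length_of_labels hR
  have hp : ∀ k (hk : k < R.length), bs.flatten.getD k 0 = R[k].1 := fun k hk => by
    simp [← hR, labels, hk]
  obtain ⟨h₁, rfl⟩ := List.getElem?_eq_some_iff.1 hi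
  have hi' : i < R.length := by simpa [pieces, strands] using h₁
  obtain ⟨b, hb, hm⟩ := List.mem_flatten.1
    (hR ▸ mem_labels.2 ⟨_, List.getElem_mem hi', rfl⟩ : R[i].1 ∈ bs.flatten)
  have hm' := List.mem_flatten.2 ⟨b, hb, (hP b hb _ hm).1⟩
  rw [indexMatching, hp i hi']
  have hj : bs.flatten.idxOf (P R[i].1) < R.length := hlen ▸ List.idxOf_lt_length_iff.2 hm'
  have := hS R[i] (by simp) R[bs.flatten.idxOf (P R[i].1)] (by simp) (by
    rw [← hp _ hj, getD_idxOf hm'])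
  simp [pieces, strands, hj, this]

theorem induces_indexMatching (hn : bs.flatten.Nodup) (hR : labels R = bs.flatten)
    (hP : PairsBlocks P bs) (hS : SameOnPairs P R) (hb : Balanced [] [] (strands R)) :
    Induces (strands R) (pots (strands R)) (indexMatching bs.flatten P) := by
  have hlen := length_of_labels hR
  refine ⟨rfl, fun i j hi hj => ?_⟩
  change (pieces (strands R))[i]? = (pieces (strands R))[j]? ↔ _
  have hi' : i < (pieces (strands R)).length := by simpa using hi
  have hi₀ : (pieces (strands R))[i]? = some (pieces (strands R))[i] := by simp
  have hi₁ := pieces_getElem?_indexMatching hR hP hS hi₀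
  constructor
  · intro h
    have hc := hb.count (pieces (strands R))[i] (by simp)
    simp only [List.nil_append, List.append_nil] at hc
    refine (count_eq_two_iff (Ne.symm ?_) hi₀ hi₁).1 hc j (h ▸ hi₀)
    exact (isPerfectMatching_indexMatching hn hP i (by simpa [hlen] using hi)).2.1
  · rintro (rfl | rfl)
    · rfl
    · rw [hi₀, hi₁]

theorem isGraded_indexMatching (hR : labels R = bs.flatten)
    (hP : PairsBlocks P bs) (hS : SameOnPairs P R) (hb : Balanced [] [] (strands R)) :
    IsGradedMatching bs.flatten.length (pots (strands R)) (indexMatching bs.flatten P) := by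
  have hlen := length_of_labels hR
  intro i j a b hij hφ ha hb'
  have hi : i < R.length := by simpa using (List.getElem?_eq_some_iff.1 ha).1
  have hj : j < R.length := by simpa using (List.getElem?_eq_some_iff.1 hb').1
  refine ⟨fun _ => ?_, fun h => by omega⟩
  have h₁ : (strands R)[i]? = some (a, R[i].2.2) := by
    simp only [pots, List.getElem?_map, Option.map_eq_some_iff] at ha
    obtain ⟨z, hz, rfl⟩ := ha
    rw [hz]
    simp [strands, hi] at hz
    simp [← hz]
  have h₂ : (strands R)[j]? = some (b, R[i].2.2) := by
    simp only [pots, List.getElem?_map, Option.map_eq_some_iff] at hb'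
    obtain ⟨z, hz, rfl⟩ := hb'
    have := pieces_getElem?_indexMatching (P := P) hR hP hS (i := i) (d := R[i].2.2)
      (by simp [pieces, strands, hi])
    rw [hφ, pieces, List.getElem?_map, hz] at this
    rw [hz]
    simp at this
    rw [← this]
  exact hb.pot _ _ _ (pair_sublist_iff.2 ⟨i, j, hij, h₁, h₂⟩)

theorem Induces.balanced {x : Stack A} {s : List A} {φ : ℕ → ℕ} (h : Induces x s φ)
    (hφ : IsPerfectMatching s.length φ) (hg : IsGradedMatching s.length s φ) :
    Balanced [] [] x := by
  obtain ⟨rfl, h⟩ := h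
  change ∀ i j, _ → _ → ((pieces x)[i]? = (pieces x)[j]? ↔ _) at h
  simp only [List.length_map] at h hφ hg
  refine ⟨fun d hd => ?_, fun a b d hs => ?_⟩
  · obtain ⟨i, hi⟩ := List.mem_iff_getElem?.1 hd
    have hi' : i < x.length := by simpa using (List.getElem?_eq_some_iff.1 hi).1
    obtain ⟨h₁, h₂, h₃⟩ := hφ i hi'
    rw [List.nil_append, List.append_nil]
    refine (count_eq_two_iff h₂.symm hi (((h i _ hi' h₁).2 (.inr rfl)).symm.trans hi)).2 fun k hk => ?_
    have hk' : k < x.length := by simpa using (List.getElem?_eq_some_iff.1 hk).1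
    exact (h i k hi' hk').1 (hi.trans hk.symm)
  · obtain ⟨i, j, hij, hi, hj⟩ := pair_sublist_iff.1 hs
    have hi' : i < x.length := (List.getElem?_eq_some_iff.1 hi).1
    have hj' : j < x.length := (List.getElem?_eq_some_iff.1 hj).1
    rcases (h i j hi' hj').1 (by simp [pieces, hi, hj]) with rfl | e
    · omega
    · exact (hg i j a b hij e.symm (by simp [hi]) (by simp [hj])).1 (.inl hj')

theorem Induces.sameOnPairs {s : List A} {φ : ℕ → ℕ} (h : Induces (strands R) s φ)
    (hφ : IsPerfectMatching s.length φ) {N : List ℕ} (hR : labels R = N) (hn : N.Nodup) :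
    SameOnPairs (nameMatching N φ) R := by
  obtain ⟨rfl, h⟩ := h
  have hlen := length_of_labels hR
  have hp : ∀ k (hk : k < R.length), N.getD k 0 = R[k].1 := fun k hk => by
    simp [← hR, labels, hk]
  intro z hz z' hz' e
  obtain ⟨i, hi, rfl⟩ := List.getElem_of_mem hz
  obtain ⟨j, hj, rfl⟩ := List.getElem_of_mem hz'
  have hi' : i < ((strands R).map Prod.fst).length := by simpa using hi
  have h₁ := (hφ i hi').1
  have e' : φ i = j := by
    rw [nameMatching, ← hp i hi, idxOf_getD hn (hlen ▸ hi), ← hp j hj] at e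
    rw [← idxOf_getD hn (show φ i < N.length by simpa [← hlen] using h₁), e,
      idxOf_getD hn (hlen ▸ hj)]
  have := (h i j hi' (by simpa using hj)).2 (.inr e'.symm)
  simpa [strands, hi, hj] using this

end border

/-! ### Rulings of the double -/

theorem fullResolution_eq {s : List A} {W W' : Front A} (h : FullResolution s W W')
    (hW : W.NoVertices) : W' = W := by
  induction h with
  | nil => rfl
  | cons e s t W W' _ _ _ ih => rw [ih fun e he => hW e (List.mem_cons_of_mem _ he)]
  | vertex u a v ls rs => exact (hW _ List.mem_cons_self trivial).elim

theorem fullResolution_self {W : Front A} {s t : List A} (h : IsFront W s t) (hW : W.NoVertices) :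
    FullResolution s W W := by
  induction W generalizing s with
  | nil => exact .nil s
  | cons e W ih =>
    obtain ⟨m, h₁, h₂⟩ := h
    exact .cons e s m W W (hW e List.mem_cons_self) h₁
      (ih h₂ fun e he => hW e (List.mem_cons_of_mem _ he))

theorem balanced_nil : Balanced [] [] ([] : Stack A) := ⟨by simp, by simp⟩

theorem hasRulingOfType_nil_iff {W : Front A} (hW : IsFront W [] []) (hn : W.names.Nodup) :
    (∃ φ ψ, HasRulingOfType W [] [] φ ψ) ↔ ∃ P, PRul P [] [] W [] [] := by
  constructor
  · rintro ⟨φ, ψ, -, -, -, -, W', hW', x, y, hx, hy, h⟩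
    obtain rfl : x = [] := by simpa using hx.1
    obtain rfl : y = [] := by simpa using hy.1
    exact hW'.exists_pRul rfl balanced_nil h hn
  · rintro ⟨P, hP⟩
    obtain ⟨W', h₁, h₂⟩ := hP.exists_fullResolution hW balanced_nil
    have h : Induces ([] : Stack A) [] id := ⟨rfl, by simp⟩
    exact ⟨id, id, by simp [IsPerfectMatching], by simp [IsGradedMatching],
      by simp [IsPerfectMatching], by simp [IsGradedMatching], W', h₁, [], [], h, h, h₂⟩

theorem names_of_noVertices {W : Front A} (hW : W.NoVertices) : W.names = [] := by
  rw [Front.names, List.flatMap_eq_nil_iff]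
  intro e he
  have := hW e he
  obtain ⟨p, c⟩ := e
  cases c with
  | vertex => exact (this trivial).elim
  | _ => rfl

theorem names_closeLeft (p : ℕ) (hs : List (List (ℕ × A))) :
    (closeLeft p hs).names = hs.flatten.map Prod.fst := by
  induction hs generalizing p with
  | nil => rfl
  | cons b hs ih =>
    rw [List.flatten_cons, List.map_append, ← ih (p + b.length)]
    simp only [closeLeft, Front.names, List.flatMap_cons, vert, Core.names, List.append_nil]

theorem map_closeLeft {B : Type} (g : A → B) (p : ℕ) (hs : List (List (ℕ × A))) :
    Front.map g (closeLeft p hs) = closeLeft p (hs.map (List.map fun z => (z.1, g z.2))) := by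
  induction hs generalizing p with
  | nil => rfl
  | cons b hs ih => simp [closeLeft, vert, Core.map, ih]

theorem map_closeRight {B : Type} (g : A → B) (bs : List (List ℕ)) :
    Front.map g (closeRight bs : Front A) = closeRight bs := by
  simp [closeRight, Front.map, vert, Core.map, Function.comp_def]

theorem IsRuling.eq_pots {W : Front A} (hW : W.NoVertices) {x y : Stack A} {t : List A}
    (h : IsRuling W x y) (hf : IsFront W (pots x) t) : t = pots y :=
  hf.eq_pots ((isRuling_iff (P := id) hW).1 h)

theorem IsRuling.balanced {W : Front A} (hW : W.NoVertices) {x y : Stack A}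
    (h : IsRuling W x y) (hx : Balanced [] [] x) : Balanced [] [] y :=
  ((isRuling_iff (P := id) hW).1 h).balanced hx

/-- A ruling of the closed front restricts to a matching of the border, which together with a ruling
of a second closed front gives a ruling of the double. -/
theorem hasRulingOfType_double_iff {L Λ₁ Λ₂ Λ₂' : Front A} {hs : List (List (ℕ × A))}
    {g : A → A} (hg : ∀ a, g (a + 1) = g a + 1) {s t : List A} (hL : IsFront L [] [])
    (hn : L.names.Nodup) (hm : L.NoMarkings) (hs' : s = hs.flatten.map Prod.snd)
    (h₁ : IsFront Λ₁ s []) (h₂ : IsFront Λ₂ [] t) (v₁ : Λ₁.NoVertices) (v₂ : Λ₂.NoVertices)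
    (e₁ : Equivalent L (closeLeft 0 hs ++ Λ₁))
    (e₂ : Equivalent L (Λ₂' ++ closeRight (hs.map (List.map Prod.fst))))
    (hΛ : Λ₂'.map g = Λ₂) :
    (∃ φ ψ, HasRulingOfType L [] [] φ ψ) ↔
      ∃ φ, PreservesBlocks (hs.map List.length) φ ∧ HasRulingOfType (Λ₁ ++ Λ₂) s t φ φ := by
  subst hs'
  rw [hasRulingOfType_nil_iff hL hn]
  set bs := hs.map (List.map Prod.fst) with hbs
  have hbl : hs.map List.length = bs.map List.length := by simp [bs, Function.comp_def]
  have hflat : hs.flatten.map Prod.fst = bs.flatten := by rw [List.map_flatten]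
  have hN : bs.flatten.Nodup := by
    have := (e₁.invariant (P := id)).2.1.nodup_iff.1 hn
    rwa [names_append, names_closeLeft, names_of_noVertices v₁, List.append_nil, hflat] at this
  have v₂' : Λ₂'.NoVertices := (noVertices_map g).1 (hΛ ▸ v₂)
  have v : (Λ₁ ++ Λ₂).NoVertices := noVertices_append.2 ⟨v₁, v₂⟩
  have hlenN : (hs.flatten.map Prod.snd).length = bs.flatten.length := by
    rw [← hflat, List.length_map, List.length_map]
  rw [hbl]
  constructor
  · rintro ⟨P, hP⟩
    obtain ⟨x, hx, hx₁⟩ := pRul_append.1 ((e₁.invariant.2.2 hm).1 hP)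
    obtain ⟨y, hy, hy₁⟩ := pRul_append.1 ((e₂.invariant.2.2 hm).1 hP)
    obtain ⟨R, hR, rfl, hB, hS⟩ := pRul_closeLeft (s := []) (hflat ▸ hN) hx
    obtain ⟨M, hM, rfl, -, hT⟩ := pRul_closeRight hN hy₁
    rw [List.nil_append] at hx hx₁
    rw [List.append_nil] at hy
    have hbR := hx.balanced balanced_nil
    have hRl : labels R = bs.flatten := by rw [← hflat, ← hR]; simp [labels]
    have hRp : pots (strands R) = hs.flatten.map Prod.snd := by rw [← hR]; simp [pots, strands]
    have r₁ := (isRuling_iff v₁).2 hx₁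
    have r₂ := ((isRuling_iff v₂').2 hy).map hg
    rw [hΛ] at r₂
    have hM' : mapPots g (strands M) = strands (M.map fun z => (z.1, g z.2.1, z.2.2)) := by
      simp [mapPots, strands]
    rw [hM'] at r₂
    have hbM := r₂.balanced v₂ balanced_nil
    have ht := r₂.eq_pots v₂ h₂
    have hMl : labels (M.map fun z => (z.1, g z.2.1, z.2.2)) = bs.flatten := by
      rw [← hM]; simp [labels]
    have hT' : SameOnPairs P (M.map fun z => (z.1, g z.2.1, z.2.2)) := by
      intro z hz z' hz' e
      obtain ⟨w, hw, rfl⟩ := List.mem_map.1 hz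
      obtain ⟨w', hw', rfl⟩ := List.mem_map.1 hz'
      exact hT w hw w' hw' e
    have hpm := isPerfectMatching_indexMatching hN hB
    have hlent : t.length = bs.flatten.length := by
      rw [ht, length_pots, length_strands, length_of_labels hMl]
    have g₁ := isGraded_indexMatching hRl hB hS hbR
    have g₂ := isGraded_indexMatching hMl hB hT' hbM
    have i₁ := induces_indexMatching hN hRl hB hS hbR
    have i₂ := induces_indexMatching hN hMl hB hT' hbM
    rw [hRp] at g₁ i₁
    rw [← ht] at g₂ i₂
    refine ⟨_, preservesBlocks_indexMatching hN hB, by rwa [hlenN], by rwa [hlenN],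
      by rwa [hlent], by rwa [hlent], Λ₁ ++ Λ₂,
      fullResolution_self (isFront_append.2 ⟨_, h₁, h₂⟩) v, _, _, i₁, i₂,
      isRuling_append.2 ⟨_, r₁, r₂⟩⟩
  · rintro ⟨φ, hB, hφ, hgr, -, -, W', hW', x, y, hx, hy, hr⟩
    rw [fullResolution_eq hW' v] at hr
    obtain ⟨z, hz, -⟩ := isRuling_append.1 hr
    have hxp : pots x = hs.flatten.map Prod.snd := hx.1
    obtain rfl : z = [] := List.map_eq_nil_iff.1 (hz.eq_pots v₁ (hxp.symm ▸ h₁)).symm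
    obtain ⟨R, hR, rfl⟩ := exists_named (ns := bs.flatten) (l := x) (by
      rw [← hlenN, ← hxp, length_pots])
    have hRm : R.map (fun z => (z.1, z.2.1)) = hs.flatten := by
      have a₁ : (R.map fun z => (z.1, z.2.1)).map Prod.fst = hs.flatten.map Prod.fst := by
        rw [hflat, ← hR]; simp [labels]
      have a₂ : (R.map fun z => (z.1, z.2.1)).map Prod.snd = hs.flatten.map Prod.snd := by
        rw [← hxp]; simp [pots, strands]
      rw [← List.zip_unzip (R.map _), ← List.zip_unzip hs.flatten]
      simp only [List.unzip_fst, List.unzip_snd, a₁, a₂]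
    refine ⟨nameMatching bs.flatten φ, (e₁.invariant.2.2 hm).2 (pRul_append.2
      ⟨strands R, ?_, (isRuling_iff v₁).1 hz⟩)⟩
    exact pRul_closeLeft_of_pairs (s := []) (hflat ▸ hN) hRm
      (pairsBlocks_nameMatching hN (hlenN ▸ hφ) hB) (hx.sameOnPairs hφ hR hN) (hx.balanced hφ hgr)

end LegendrianFront

theorem corollary3 (m : ℕ) (ρ : ℤ) (L : LegendrianFront.Front (ZMod m))
    (hL : LegendrianFront.IsLegendrianGraph L)
    (G : LegendrianFront.GompfForm (ZMod m)) (hG : LegendrianFront.IsDouble L G) :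
    LegendrianFront.HasNormalRuling ρ L ↔ LegendrianFront.HasLeversonRuling ρ G := by
  obtain ⟨hs, Λ₁, Λ₂, c, hw, hh, hl, h₁, h₂, e₁, e₂⟩ := hG
  have hf : ∀ a, LegendrianFront.toModRho m ρ (a + 1) = LegendrianFront.toModRho m ρ a + 1 :=
    fun a => by simp [LegendrianFront.toModRho]
  have hv := G.noVertices
  rw [hw, LegendrianFront.noVertices_append] at hv
  have e₁' := e₁.map hf
  have e₂' := e₂.map (g := fun a => LegendrianFront.toModRho m ρ a - LegendrianFront.toModRho m ρ c)
    fun a => by rw [hf]; ring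
  rw [LegendrianFront.map_append, LegendrianFront.map_closeLeft] at e₁'
  rw [LegendrianFront.map_append, LegendrianFront.map_closeRight, LegendrianFront.map_map] at e₂'
  have hc : ((fun a => LegendrianFront.toModRho m ρ a - LegendrianFront.toModRho m ρ c) ∘
      fun a => a + c) = LegendrianFront.toModRho m ρ := by
    funext a
    simp [LegendrianFront.toModRho]
  rw [hc] at e₂'
  have key := LegendrianFront.hasRulingOfType_double_iff
    (g := fun a => a + LegendrianFront.toModRho m ρ c) (fun a => by ring)
    (hL.isFront.map hf) (by simpa using hL.names_nodup)
    ((LegendrianFront.noMarkings_map _).2 hL.noMarkings)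
    (s := G.left.map (LegendrianFront.toModRho m ρ)) (by
      rw [hl, List.map_flatten, List.map_flatten, List.map_flatten]
      simp [Function.comp_def])
    (h₁.map hf) (h₂.map hf) ((LegendrianFront.noVertices_map _).2 hv.1)
    ((LegendrianFront.noVertices_map _).2 hv.2) e₁'
    (by simpa [Function.comp_def] using e₂') (by
      rw [LegendrianFront.map_map]
      congr 1
      funext a
      simp)
  rw [← LegendrianFront.map_append, ← hw] at key
  simpa [LegendrianFront.HasNormalRuling, LegendrianFront.HasLeversonRuling,
    LegendrianFront.HasRhoRulingOfType, hh, Function.comp_def] using key
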